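/- **Setting.** Let $f:\mathbb R^2\to\mathbb R$ be smooth, $2\pi$-periodic in $y$, zero for $|x|>R$, even in $x$ and in $y$, with $\int_\Pi f>0$, where $\Pi=\mathbb R\times(0,2\pi)$. Put $f_j(x)=\int_0^{2\pi}e^{-ijy}f(x,y)\,dy$, $\tilde f_j(\xi)=\int_{\mathbb R} e^{-i\xi x}f_j(x)\,dx$ $(j\in\mathbb Z)$, and $\kappa(\beta)=\sqrt{1-2\beta}$. For $0<\beta<1/2$, $\mu=\varepsilon\nu>0$, $\omega^2=(1-\beta)^2-\mu^2>\beta^2$, $k_0=\sqrt{\omega^2-\beta^2}$, the scattering problem is to find $\Psi$, $\mathcal R$, $\mathcal T$ such that $-\nabla^2\Psi=\omega^2(1+\varepsilon f)\Psi$ in $\Pi$, $\Psi(x,2\pi)=e^{2\pi i\beta}\Psi(x,0)$, $\Psi_y(x,2\pi)=e^{2\pi i\beta}\Psi_y(x,0)$, in the weak sense $\int_\Pi\nabla\Psi\cdot\nabla\overline\Phi=\omega^2\int_\Pi(1+\varepsilon f)\Psi\overline\Phi$ for all smooth $\Phi$ that satisfy the boundary conditions and vanish for large $|x|$, and $$\Psi-\chi(x)\mathcal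 T e^{i\beta y+ik_0x}-\chi(-x)\big(e^{i\beta y+ik_0x}+\mathcal R e^{i\beta y-ik_0x}\big)\in H_1^\beta(\Pi).$$ Here $\chi$ is a smooth cut-off, $0$ for $x<0$ and $1$ for $x>1$, and $H^\beta_1(\Pi)$ is the completion of the above test functions in the norm $\|u\|_{L^2(\Pi)}+\|\nabla u\|_{L^2(\Pi)}$. Let $\gamma(\mu,\beta)=\frac{(1-\beta)^2-\mu^2}{4\pi}$, $k_0=(1-2\beta-\mu^2)^{1/2}$, $k_m=((\beta+m)^2-(1-\beta)^2+\mu^2)^{1/2}$ for $m\ne 0,-1$ (principal branches; $\mu$ may be complex), $H_0(x)=\frac{i}{2k_0}e^{ik_0|x|}$, $H_{-1}(x)=\frac{e^{-\mu|x|}-1}{2\mu}$, $H_m(x)=\frac{1}{2k_m}e^{-k_m|x|}$ otherwise, and let $\hat T$ act on square-summable sequences in $C[-R,R]$ by $(\hat T\mathbf A)_m=2\gamma\sum_n (H_n*A_n)f_{m-n}$. With $\mathbf g^{(2)}=(f_{m+1})_m$ and $\mathbf Y=(1-\varepsilon\hat T)^{-1}\mathbf g^{(2)}$ put $F(\varepsilon,\mu,\beta)=\int_{-R}^{R}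 Y_{-1}\,dx$ and $R^+(\varepsilon,\mu,\beta)=\int_{-R}^{R} Y_0\,e^{ik_0x}\,dx$. **Theorem.** Let $0<\beta_{00}<1/2$ and $\kappa_0=\kappa(\beta_{00})$ satisfy $\tilde f_1(\kappa_0)=0$, $\tilde f_1'(\kappa_0)\neq0$. Put $\gamma_0=\gamma(0,\beta_{00})$, $\nu_{00}=\gamma_0\tilde f_0(0)$, $$\alpha=\frac{\gamma_0^2}{\kappa_0^3}\,|\tilde f_1'(\kappa_0)|^2=\frac{\gamma_0^2}{\kappa_0}\Big|\partial_\beta \tilde f_1(\kappa(\beta))\big|_{\beta=\beta_{00}}\Big|^2,\qquad q=\frac{\gamma_0}{\kappa_0}\tilde f_0(2\kappa_0).$$ There are $\rho_1,\rho_2,\varepsilon_0,C>0$ such that for $0<\varepsilon<\varepsilon_0$: 1. For real $\beta$ with $|\beta-\beta_{00}|<\rho_1$ the equation $\nu-\gamma(\varepsilon\nu,\beta)F(\varepsilon,\varepsilon\nu,\beta)=0$ has a unique complex root $\nu_0(\varepsilon,\beta)$ in $|\nu-\nu_{00}|<\rho_2$. For real $\nu$ with $|\nu-\nu_{00}|<\rho_2$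 the equation $R^+(\varepsilon,\varepsilon\nu,\beta)=0$ has a unique real root $\beta=\beta_0(\varepsilon,\varepsilon\nu)$ in $|\beta-\beta_{00}|<\rho_1$. In this rectangle there is a real point $(\beta_{tr}(\varepsilon),\nu_{tr}(\varepsilon))$ satisfying both equations, and $|\beta_{tr}-\beta_{00}|\le C\varepsilon$, $|\nu_{tr}-\nu_{00}|\le C\varepsilon$. 2. For all real $(\beta,\nu)$ with $|\beta-\beta_{00}|<\rho_1$, $|\nu-\nu_{00}|<\rho_2$ one has $0<\beta<1/2$, $\nu>0$, $\omega^2>\beta^2$. Write $\delta=\nu-\operatorname{Re}\nu_0(\varepsilon,\beta)$ and $\Delta=\beta-\beta_0(\varepsilon,\varepsilon\nu)$. If $(\delta,\Delta)\ne(0,0)$, the scattering problem is solvable, and for each of its solutions $$\mathcal R=\frac{i\varepsilon\big(\delta q+\alpha\Delta^2+(|\delta|+\Delta^2)E_1\big)(1+E_2)}{\delta-i\varepsilon\alpha\Delta^2},\qquad \mathcal T=\frac{\big(\delta+(|\delta|+\Delta^2)E_3\big)(1+E_4)}{\delta-i\varepsilon\alpha\Delta^2},$$ with complex $E_j$ satisfying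 $|E_j|\le C(\varepsilon+|\Delta|)$. The constant $C$ does not depend on $\varepsilon,\beta,\nu$. -/

import Mathlib

open MeasureTheory Filter Topology
open scoped ContDiff ComplexConjugate

noncomputable section

namespace RayleighBloch

/-! ### Fourier data of the perturbation -/

/-- Fourier coefficients in `y`: `f_j(x) = ∫_0^{2π} e^{-ijy} f(x,y) dy`. -/
def fourierY (f : ℝ × ℝ → ℝ) (j : ℤ) (x : ℝ) : ℂ :=
  ∫ y in (0 : ℝ)..(2 * Real.pi), Complex.exp (-(Complex.I * j * y)) * (f (x, y) : ℂ)

/-- Fourier transform in `x` of the Fourier coefficients: `f̃_j(ξ) = ∫ e^{-iξx} f_j(x) dx`. -/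
def fourierXY (f : ℝ × ℝ → ℝ) (j : ℤ) (ξ : ℝ) : ℂ :=
  ∫ x : ℝ, Complex.exp (-(Complex.I * ξ * x)) * fourierY f j x

/-! ### The scattering problem -/

/-- The strip `Π = ℝ × (0, 2π)`. -/
def strip : Set (ℝ × ℝ) := Set.univ ×ˢ Set.Ioo (0 : ℝ) (2 * Real.pi)

/-- Partial derivative in `x`. -/
def dX (u : ℝ × ℝ → ℂ) (p : ℝ × ℝ) : ℂ := fderiv ℝ u p (1, 0)

/-- Partial derivative in `y`. -/
def dY (u : ℝ × ℝ → ℂ) (p : ℝ × ℝ) : ℂ := fderiv ℝ u p (0, 1)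

/-- Smooth functions satisfying the quasiperiodic boundary conditions on the strip and vanishing
for large `|x|`. -/
structure IsTest (β : ℝ) (Φ : ℝ × ℝ → ℂ) : Prop where
  smooth : ContDiff ℝ ∞ Φ
  quasi : ∀ x : ℝ, Φ (x, 2 * Real.pi) = Complex.exp (2 * Real.pi * Complex.I * β) * Φ (x, 0)
  quasi_dY : ∀ x : ℝ,
    dY Φ (x, 2 * Real.pi) = Complex.exp (2 * Real.pi * Complex.I * β) * dY Φ (x, 0)
  vanish : ∃ M : ℝ, ∀ x y : ℝ, M < |x| → Φ (x, y) = 0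

/-- `u` belongs to `H_1^β(Π)`, the completion of the test functions with respect to
`‖u‖_{L²(Π)} + ‖∇u‖_{L²(Π)}`, and `(ux, uy)` is its gradient. -/
structure HasGradH (β : ℝ) (u ux uy : ℝ × ℝ → ℂ) : Prop where
  memLp : MemLp u 2 (volume.restrict strip)
  memLp_x : MemLp ux 2 (volume.restrict strip)
  memLp_y : MemLp uy 2 (volume.restrict strip)
  approx : ∃ φ : ℕ → ℝ × ℝ → ℂ, (∀ n, IsTest β (φ n)) ∧
    Tendsto (fun n => eLpNorm (φ n - u) 2 (volume.restrict strip)) atTop (𝓝 0) ∧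
    Tendsto (fun n => eLpNorm (dX (φ n) - ux) 2 (volume.restrict strip)) atTop (𝓝 0) ∧
    Tendsto (fun n => eLpNorm (dY (φ n) - uy) 2 (volume.restrict strip)) atTop (𝓝 0)

/-- `ω² = ω_1² - μ²` with the threshold `ω_1 = 1 - β`. -/
def omegaSq (μ β : ℝ) : ℝ := (1 - β) ^ 2 - μ ^ 2

/-- Wave number `√(ω² - β²)` of the propagating mode. -/
def waveNumber (μ β : ℝ) : ℝ := Real.sqrt (omegaSq μ β - β ^ 2)

/-- `χ(x) 𝒯 e^{iβy + ikx} + χ(-x) (e^{iβy + ikx} + ℛ e^{iβy - ikx})`, where the smooth cut-off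
`χ = Real.smoothTransition` is `0` for `x ≤ 0` and `1` for `x ≥ 1`. -/
def farField (β k : ℝ) (ℛ 𝒯 : ℂ) (p : ℝ × ℝ) : ℂ :=
  (Real.smoothTransition p.1 : ℂ) * 𝒯 * Complex.exp (Complex.I * (β * p.2 + k * p.1)) +
    (Real.smoothTransition (-p.1) : ℂ) *
      (Complex.exp (Complex.I * (β * p.2 + k * p.1)) +
        ℛ * Complex.exp (Complex.I * (β * p.2 - k * p.1)))

/-- `Ψ` solves the scattering problem for
`-∇²Ψ = ω² (1 + ε f) Ψ` in the strip, with quasiperiodic boundary conditions, a plane wave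
`e^{iβy + ik₀x}` incident from the left, reflection coefficient `ℛ` and transmission
coefficient `𝒯`, where `ω² = (1 - β)² - μ²`: the function `Ψ` minus its far field is in
`H_1^β(Π)`, and the equation holds in the sense of the integral identity. -/
def SolvesScattering (f : ℝ × ℝ → ℝ) (ε μ β : ℝ) (Ψ : ℝ × ℝ → ℂ) (ℛ 𝒯 : ℂ) : Prop :=
  ∃ vx vy : ℝ × ℝ → ℂ,
    HasGradH β (Ψ - farField β (waveNumber μ β) ℛ 𝒯) vx vy ∧
    ∀ Φ : ℝ × ℝ → ℂ, IsTest β Φ →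
      ∫ p in strip,
          ((vx p + dX (farField β (waveNumber μ β) ℛ 𝒯) p) * conj (dX Φ p) +
            (vy p + dY (farField β (waveNumber μ β) ℛ 𝒯) p) * conj (dY Φ p)) =
        (omegaSq μ β : ℂ) * ∫ p in strip, ((1 + ε * f p : ℝ) : ℂ) * Ψ p * conj (Φ p)

/-! ### The infinite system and its dispersion relation -/

/-- `γ(μ, β) = ((1 - β)² - μ²) / (4π)`. -/
def gam (μ : ℂ) (β : ℝ) : ℂ := ((1 - (β : ℂ)) ^ 2 - μ ^ 2) / (4 * Real.pi)

/-- `k_0 = (1 - 2β - μ²)^{1/2}`, principal branch. -/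
def kZero (μ : ℂ) (β : ℝ) : ℂ := (1 - 2 * (β : ℂ) - μ ^ 2) ^ (1 / 2 : ℂ)

/-- `k_m = ((β + m)² - (1 - β)² + μ²)^{1/2}`, principal branch (used for `m ≠ 0, -1`). -/
def kEvan (μ : ℂ) (β : ℝ) (m : ℤ) : ℂ :=
  (((β : ℂ) + m) ^ 2 - (1 - (β : ℂ)) ^ 2 + μ ^ 2) ^ (1 / 2 : ℂ)

/-- The kernels `H_m`: the outgoing Green function for `m = 0`, the regularized Green function
`(e^{-μ|x|} - 1) / (2μ)` (continued by `-|x|/2` to `μ = 0`) for `m = -1`, and the decaying Green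
function otherwise. -/
def kernelH (μ : ℂ) (β : ℝ) (m : ℤ) (x : ℝ) : ℂ :=
  if m = 0 then
    Complex.I / (2 * kZero μ β) * Complex.exp (Complex.I * kZero μ β * (|x| : ℝ))
  else if m = -1 then
    (if μ = 0 then -((|x| : ℝ) : ℂ) / 2 else (Complex.exp (-(μ * (|x| : ℝ))) - 1) / (2 * μ))
  else 1 / (2 * kEvan μ β m) * Complex.exp (-(kEvan μ β m * (|x| : ℝ)))

/-- The Banach space of square-summable sequences in `C[-R, R]`. -/
abbrev SpaceA (R : ℝ) : Type := lp (fun _ : ℤ => C(Set.Icc (-R) R, ℂ)) 2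

/-- Lebesgue measure on `[-R, R]`. -/
def lebIcc (R : ℝ) : Measure (Set.Icc (-R) R) := Measure.comap Subtype.val volume

/-- `(T̂ A)_m = 2γ ∑_n (H_n ∗ A_n) f_{m-n}` on `[-R, R]`. -/
def opT (f : ℝ × ℝ → ℝ) (R : ℝ) (μ : ℂ) (β : ℝ) (A : SpaceA R) (m : ℤ)
    (x : Set.Icc (-R) R) : ℂ :=
  2 * gam μ β *
    ∑' n : ℤ,
      (∫ ξ : Set.Icc (-R) R, kernelH μ β n ((x : ℝ) - (ξ : ℝ)) * A n ξ ∂(lebIcc R)) *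
        fourierY f (m - n) (x : ℝ)

/-- `Y` solves `(1 - ε T̂) Y = g⁽²⁾`, where `(g⁽²⁾)_m = f_{m+1}`. -/
def SolvesSystem (f : ℝ × ℝ → ℝ) (R ε : ℝ) (μ : ℂ) (β : ℝ) (Y : SpaceA R) : Prop :=
  ∀ (m : ℤ) (x : Set.Icc (-R) R),
    Y m x - (ε : ℂ) * opT f R μ β Y m x = fourierY f (m + 1) (x : ℝ)

open Classical in
/-- `Y = (1 - ε T̂)⁻¹ g⁽²⁾` (zero if the system is not uniquely solvable). -/
def vecY (f : ℝ × ℝ → ℝ) (R ε : ℝ) (μ : ℂ) (β : ℝ) : SpaceA R :=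
  if h : ∃! Y : SpaceA R, SolvesSystem f R ε μ β Y then h.choose else 0

/-- `F(ε, μ, β) = ⟨Y_{-1}⟩`. -/
def dispF (f : ℝ × ℝ → ℝ) (R ε : ℝ) (μ : ℂ) (β : ℝ) : ℂ :=
  ∫ x : Set.Icc (-R) R, vecY f R ε μ β (-1) x ∂(lebIcc R)

/-- `R⁺(ε, μ, β) = ⟨Y_0 e^{i k_0 x}⟩` (equal to `R⁻` for even `f`). -/
def orthR (f : ℝ × ℝ → ℝ) (R ε : ℝ) (μ : ℂ) (β : ℝ) : ℂ :=
  ∫ x : Set.Icc (-R) R,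
    vecY f R ε μ β 0 x * Complex.exp (Complex.I * kZero μ β * ((x : ℝ) : ℂ)) ∂(lebIcc R)

/-- `ν - γ(εν, β) F(ε, εν, β) = 0`. -/
def IsResonance (f : ℝ × ℝ → ℝ) (R ε β : ℝ) (ν : ℂ) : Prop :=
  ν - gam (ε * ν) β * dispF f R ε (ε * ν) β = 0

/-! ### The constants in the asymptotics -/

/-- `κ(β) = √(1 - 2β)`. -/
def kap (β : ℝ) : ℝ := Real.sqrt (1 - 2 * β)

/-- `γ(0, β) = (1 - β)² / (4π)`. -/
def gamZero (β : ℝ) : ℝ := (1 - β) ^ 2 / (4 * Real.pi)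

/-- `ν_{00} = γ(0, β_{00}) f̃_0(0)`, where `f̃_0(0) = ∫_Π f`. -/
def nuCenter (f : ℝ × ℝ → ℝ) (β : ℝ) : ℝ := gamZero β * ∫ p in strip, f p

/-- `α = γ₀² |f̃_1'(κ₀)|² / κ₀³`, that is, `(γ₀² / κ₀) |∂_β (f̃_1(κ(β)))|²` at `β = β_{00}`. -/
def alphaC (f : ℝ × ℝ → ℝ) (β : ℝ) : ℝ :=
  gamZero β ^ 2 * ‖deriv (fourierXY f 1) (kap β)‖ ^ 2 / kap β ^ 3

/-- `q = (γ₀ / κ₀) f̃_0(2κ₀)`. -/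
def qC (f : ℝ × ℝ → ℝ) (β : ℝ) : ℂ :=
  ((gamZero β / kap β : ℝ) : ℂ) * fourierXY f 0 (2 * kap β)

end RayleighBloch

end

noncomputable section

namespace RayleighBloch

/-! ### Convolution and multiplication operators on `C[-R, R]` -/

/-! Expanding `Ψ` in the modes `e^{i(β+m)y}` gives `ψ_m'' = ((β+m)² - ω²) ψ_m - 2γε A_m` with `A_m =
∑_n f_{m-n} ψ_n`. Solving each equation by its Green function leaves a closed system for `A` on
`[-R, R]`. Only the mode `m = -1` is near its threshold: its Green function `e^{-μ|x|}/(2μ)` is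
`H_{-1}` plus the constant `1/(2μ)`, and with `μ = εν` this constant contributes at order one. It is
therefore kept as a separate unknown `c`, subject to `νc = γ∫A_{-1}`. What remains is `A - εT̂A =
source`, solved by a Neumann series uniformly in the parameters.

At real parameters the outgoing kernel of the mode `m = 0` is the only one that is not real. It
differs from its real part `-sin(k_0|x|)/(2k_0)` by `(i/2k_0) cos k_0(x - ξ)`, an operator of rank
two (`convOp_kerT_zero`). The reduced system, with the real part in its place, is real and preserves
parity in `x`. Its solutions `Y`, `Z`, `W` for the sources `1`, `cos k_0x`, `sin k_0x` produce four
numbers `sF`, `sr`, `sz`, `sw`, real at real parameters, and the full problem becomes finite linear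
algebra over them. With `a = εγ/k_0`, `F = sF + i a sr² / (1 - i a sz)` and `R⁺ = sr / (1 - i a sz)`
(`Adm.dispF_eq`, `Adm.orthR_eq`); the square comes from reciprocity (`Adm.sr_eq`). So `R⁺ = 0` is
the single real equation `sr = 0`, and on that curve the dispersion relation is real too. This is
why the two curves meet at a real point. The same algebra gives `ℛ` and `𝒯` in closed form, `reflS`
and `transS` (`Adm.exists_system`).

For the asymptotics, `sr = f̃_1(k_0) + O(ε)` has slope close to `c = ∂_β f̃_1(κ(β)) ≠ 0` in `β`.
Contractions with constant `1/2` yield `β_0`, `ν_0` and the common point from Lipschitz bounds alone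
(`ScatData.exists_roots`). The correction to `γF` has size `O(ε sr²)` but real part only `O(ε²
sr²)`, so `d = ν - γ sF` equals `δ` up to `O(ε|δ| + ε²Δ²)`, while `sr` equals `cΔ` up to
`O((ε+|Δ|)|Δ|)`. The common denominator of `ℛ` and `𝒯` is then close to `δ - iεαΔ²`. Since `α > 0`,
the modulus of this number controls both `|δ|` and `εΔ²`, and all errors become relative
(`exists_asymptotic_form`).

The modes built from `A` sum to an actual weak solution with these coefficients
(`solvesScattering_of_modes`, `Adm.exists_solvesScattering`). Every other solution has the same
coefficients: the difference of two solutions is purely outgoing, and conservation of energy flux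
forces its amplitudes to vanish (`HasGradH.outgoing_eq_zero`, `SolvesScattering.unique`). -/

/-- Continuous functions on `[-R, R]`. -/
abbrev CIcc (R : ℝ) : Type := C(Set.Icc (-R) R, ℂ)

lemma lebIcc_univ_lt_top (R : ℝ) : lebIcc R Set.univ < ⊤ := by
  unfold lebIcc
  rw [Measure.comap_apply _ Subtype.val_injective
    (fun s hs => measurableSet_Icc.subtype_image hs) _ MeasurableSet.univ, Set.image_univ,
    Subtype.range_coe]
  exact measure_Icc_lt_top

instance (R : ℝ) : IsFiniteMeasure (lebIcc R) := ⟨lebIcc_univ_lt_top R⟩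

lemma integral_lebIcc (R : ℝ) (g : ℝ → ℂ) :
    ∫ x : Set.Icc (-R) R, g x ∂(lebIcc R) = ∫ x in Set.Icc (-R) R, g x :=
  integral_subtype_comap measurableSet_Icc g

lemma integral_lebIcc_real (R : ℝ) (g : ℝ → ℝ) :
    ∫ x : Set.Icc (-R) R, g x ∂(lebIcc R) = ∫ x in Set.Icc (-R) R, g x :=
  integral_subtype_comap measurableSet_Icc g

lemma integrable_lebIcc {R : ℝ} {F : Type*} [NormedAddCommGroup F] [SecondCountableTopology F]
    {g : Set.Icc (-R) R → F} (hg : Continuous g) : Integrable g (lebIcc R) := by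
  rw [← integrableOn_univ]
  exact ContinuousOn.integrableOn_compact isCompact_univ hg.continuousOn

lemma continuous_conv {R : ℝ} (h : C(ℝ, ℂ)) (A : CIcc R) :
    Continuous fun x : ℝ => ∫ ξ : Set.Icc (-R) R, h (x - (ξ : ℝ)) * A ξ ∂(lebIcc R) := by
  have := continuous_parametric_integral_of_continuous (μ := lebIcc R)
    (f := fun (x : ℝ) (ξ : Set.Icc (-R) R) => h (x - (ξ : ℝ)) * A ξ)
    (by simp only [Function.uncurry_def]; fun_prop) (s := Set.univ) isCompact_univ
  simpa using this

lemma norm_conv_le {R : ℝ} (h : ℝ → ℂ) (hc : Continuous h) (A : CIcc R) (x : ℝ) :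
    ‖∫ ξ : Set.Icc (-R) R, h (x - (ξ : ℝ)) * A ξ ∂(lebIcc R)‖ ≤
      (∫ ξ in Set.Icc (-R) R, ‖h (x - ξ)‖) * ‖A‖ := by
  rw [← integral_lebIcc_real R (fun ξ => ‖h (x - ξ)‖), ← integral_mul_const]
  refine norm_integral_le_of_norm_le (integrable_lebIcc (by fun_prop)) (ae_of_all _ fun ξ => ?_)
  rw [norm_mul]
  gcongr
  exact A.norm_coe_le_norm ξ

/-- For `x` and `ξ` in `[-R, R]` the difference stays in `[-2R, 2R]`, so the `L¹` norm of the kernel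
there bounds the convolution operator in the sup norm. -/
lemma setIntegral_norm_sub_le {R : ℝ} (h : ℝ → ℂ) (hc : Continuous h) {x : ℝ}
    (hx : x ∈ Set.Icc (-R) R) :
    ∫ ξ in Set.Icc (-R) R, ‖h (x - ξ)‖ ≤ ∫ t in Set.Icc (-(2 * R)) (2 * R), ‖h t‖ := by
  have hR : 0 ≤ R := by linarith [hx.1, hx.2]
  rw [integral_Icc_eq_integral_Ioc, integral_Icc_eq_integral_Ioc,
    ← intervalIntegral.integral_of_le (by linarith), ← intervalIntegral.integral_of_le (by linarith),
    intervalIntegral.integral_comp_sub_left (fun t => ‖h t‖)]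
  refine intervalIntegral.integral_mono_interval (by linarith [hx.1]) (by linarith) (by linarith [hx.2])
    (ae_of_all _ fun _ => norm_nonneg _) (Continuous.intervalIntegrable (by fun_prop) _ _)

/-- `L¹` norm of a kernel on `[-2R, 2R]`. -/
def kernelNorm (R : ℝ) (h : C(ℝ, ℂ)) : ℝ := ∫ t in Set.Icc (-(2 * R)) (2 * R), ‖h t‖

lemma kernelNorm_nonneg (R : ℝ) (h : C(ℝ, ℂ)) : 0 ≤ kernelNorm R h :=
  integral_nonneg fun _ => norm_nonneg _

/-- The operator `A ↦ h ∗ A` on `C[-R, R]`. -/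
def convOp (R : ℝ) (h : C(ℝ, ℂ)) : CIcc R →L[ℂ] CIcc R :=
  LinearMap.mkContinuous
    { toFun := fun A => ⟨fun x => ∫ ξ : Set.Icc (-R) R, h ((x : ℝ) - (ξ : ℝ)) * A ξ ∂(lebIcc R),
        (continuous_conv h A).comp continuous_subtype_val⟩
      map_add' := fun A B => by
        ext x
        simp only [ContinuousMap.coe_mk, ContinuousMap.add_apply, mul_add]
        exact integral_add (integrable_lebIcc (by fun_prop)) (integrable_lebIcc (by fun_prop))
      map_smul' := fun c A => by
        ext x
        simp only [ContinuousMap.coe_mk, ContinuousMap.smul_apply, smul_eq_mul, RingHom.id_apply]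
        rw [← integral_const_mul]
        congr 1; ext ξ; ring }
    (kernelNorm R h) (fun A => by
      refine (ContinuousMap.norm_le _
        (mul_nonneg (kernelNorm_nonneg R h) (norm_nonneg _))).2 fun x => ?_
      refine (norm_conv_le h h.continuous A x).trans ?_
      gcongr
      exact setIntegral_norm_sub_le h h.continuous x.2)

@[simp] lemma convOp_apply {R : ℝ} (h : C(ℝ, ℂ)) (A : CIcc R) (x : Set.Icc (-R) R) :
    convOp R h A x = ∫ ξ : Set.Icc (-R) R, h ((x : ℝ) - (ξ : ℝ)) * A ξ ∂(lebIcc R) := rfl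

lemma norm_convOp_le (R : ℝ) (h : C(ℝ, ℂ)) : ‖convOp R h‖ ≤ kernelNorm R h :=
  LinearMap.mkContinuous_norm_le _ (kernelNorm_nonneg R h) _

lemma convOp_sub (R : ℝ) (h h' : C(ℝ, ℂ)) : convOp R h - convOp R h' = convOp R (h - h') := by
  ext A x
  simp only [sub_apply, ContinuousMap.sub_apply, convOp_apply, sub_mul]
  exact (integral_sub (integrable_lebIcc (by fun_prop)) (integrable_lebIcc (by fun_prop))).symm

/-- Multiplication by a continuous function on `C[-R, R]`. -/
def mulOp {R : ℝ} (g : CIcc R) : CIcc R →L[ℂ] CIcc R := ContinuousLinearMap.mul ℂ (CIcc R) g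

lemma norm_mulOp_le {R : ℝ} (g : CIcc R) : ‖mulOp g‖ ≤ ‖g‖ :=
  ContinuousLinearMap.opNorm_mul_apply_le ℂ (CIcc R) g

/-! ### The matrix operator -/

/-- The shear `(m, n) ↦ (m - n, n)` is a bijection of `ℤ × ℤ` and turns the matrix sum into a
product of two series. It is the source of every bound on matrix operators. -/
lemma summable_shift_mul {c b : ℤ → ℝ} (hc : Summable c) (hb : Summable b)
    (hc0 : ∀ n, 0 ≤ c n) (hb0 : ∀ n, 0 ≤ b n) :
    HasSum (fun p : ℤ × ℤ => c (p.1 - p.2) * b p.2) ((∑' n, c n) * ∑' n, b n) := by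
  have h : HasSum (fun p : ℤ × ℤ => c p.1 * b p.2) ((∑' n, c n) * ∑' n, b n) :=
    hc.hasSum.mul hb.hasSum (hc.mul_of_nonneg hb hc0 hb0)
  let e : ℤ × ℤ ≃ ℤ × ℤ :=
    { toFun := fun p => (p.1 - p.2, p.2), invFun := fun p => (p.1 + p.2, p.2),
      left_inv := fun p => by simp, right_inv := fun p => by simp }
  exact (e.hasSum_iff (f := fun p : ℤ × ℤ => c p.1 * b p.2)).2 h

/-- Entry of the matrix operator, as an operator on the sequence space. -/
def sysEntry {R : ℝ} (φ : ℤ → CIcc R) (B : ℤ → CIcc R →L[ℂ] CIcc R) (p : ℤ × ℤ) :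
    SpaceA R →L[ℂ] SpaceA R :=
  (lp.singleContinuousLinearMap ℂ (fun _ : ℤ => CIcc R) 2 p.1) ∘L mulOp (φ (p.1 - p.2)) ∘L
    B p.2 ∘L (lp.evalCLM ℂ (fun _ : ℤ => CIcc R) 2 p.2)

/-- The operator `(T A)_m = ∑_n φ_{m-n} B_n A_n`. -/
def sysOp {R : ℝ} (φ : ℤ → CIcc R) (B : ℤ → CIcc R →L[ℂ] CIcc R) : SpaceA R →L[ℂ] SpaceA R :=
  ∑' p : ℤ × ℤ, sysEntry φ B p

lemma norm_apply_le {R : ℝ} (A : SpaceA R) (n : ℤ) : ‖A n‖ ≤ ‖A‖ :=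
  lp.norm_apply_le_norm (by norm_num) A n

lemma norm_sysEntry_le {R : ℝ} (φ : ℤ → CIcc R) (B : ℤ → CIcc R →L[ℂ] CIcc R) (p : ℤ × ℤ) :
    ‖sysEntry φ B p‖ ≤ ‖φ (p.1 - p.2)‖ * ‖B p.2‖ := by
  refine ContinuousLinearMap.opNorm_le_bound _ (by positivity) fun A => ?_
  have h : ‖sysEntry φ B p A‖ = ‖mulOp (φ (p.1 - p.2)) (B p.2 (A p.2))‖ := by
    unfold sysEntry
    simp only [ContinuousLinearMap.comp_apply, lp.singleContinuousLinearMap_apply]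
    rw [lp.norm_single (by norm_num)]
    rfl
  rw [h]
  calc _ ≤ ‖mulOp (φ (p.1 - p.2))‖ * (‖B p.2‖ * ‖A p.2‖) :=
        (ContinuousLinearMap.le_opNorm _ _).trans (by gcongr; exact ContinuousLinearMap.le_opNorm _ _)
    _ ≤ ‖φ (p.1 - p.2)‖ * (‖B p.2‖ * ‖A‖) := by
        gcongr
        · exact norm_mulOp_le _
        · exact norm_apply_le A _
    _ = _ := by ring

section
variable {R : ℝ} {φ : ℤ → CIcc R} {B B' : ℤ → CIcc R →L[ℂ] CIcc R} {b : ℤ → ℝ}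

lemma summable_sysEntry (hφ : Summable fun n => ‖φ n‖) (hB : Summable fun n => ‖B n‖) :
    Summable (sysEntry φ B) := by
  have h := (summable_shift_mul (c := fun n => ‖φ n‖) (b := fun n => ‖B n‖) hφ hB
    (fun n => norm_nonneg (φ n)) (fun n => norm_nonneg (B n))).summable
  exact Summable.of_norm_bounded (E := SpaceA R →L[ℂ] SpaceA R) (f := sysEntry φ B) (g := fun p : ℤ × ℤ => ‖φ (p.1 - p.2)‖ * ‖B p.2‖) h
    (norm_sysEntry_le φ B)

lemma norm_sysOp_le (hφ : Summable fun n => ‖φ n‖) (hb : Summable b)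
    (hBb : ∀ n, ‖B n‖ ≤ b n) : ‖sysOp φ B‖ ≤ (∑' n, ‖φ n‖) * ∑' n, b n := by
  have h := summable_shift_mul (c := fun n => ‖φ n‖) (b := b) hφ hb (fun n => norm_nonneg (φ n))
    (fun n => (norm_nonneg (B n)).trans (hBb n))
  exact tsum_of_norm_bounded (E := SpaceA R →L[ℂ] SpaceA R) (f := sysEntry φ B) h fun p => (norm_sysEntry_le φ B p).trans
    (mul_le_mul_of_nonneg_left (hBb _) (norm_nonneg _))

lemma sysOp_sub (hφ : Summable fun n => ‖φ n‖) (hB : Summable fun n => ‖B n‖)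
    (hB' : Summable fun n => ‖B' n‖) :
    sysOp φ B - sysOp φ B' = sysOp φ (fun n => B n - B' n) := by
  unfold sysOp
  rw [← (summable_sysEntry hφ hB).tsum_sub (summable_sysEntry hφ hB')]
  congr 1; ext1 p
  unfold sysEntry
  ext1 A
  simp only [sub_apply, ContinuousLinearMap.comp_apply, map_sub]

lemma sysEntry_apply (A : SpaceA R) (m : ℤ) (p : ℤ × ℤ) :
    sysEntry φ B p A m = if p.1 = m then φ (m - p.2) * B p.2 (A p.2) else 0 := by
  unfold sysEntry
  simp only [ContinuousLinearMap.comp_apply, lp.singleContinuousLinearMap_apply]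
  by_cases h : p.1 = m
  · subst h
    rw [if_pos rfl, lp.single_apply_self]
    rfl
  · rw [if_neg h, lp.single_apply_ne _ _ _ (Ne.symm h)]

lemma hasSum_sysOp (hφ : Summable fun n => ‖φ n‖) (hB : Summable fun n => ‖B n‖)
    (A : SpaceA R) : HasSum (fun p => sysEntry φ B p A) (sysOp φ B A) :=
  (summable_sysEntry hφ hB).hasSum.mapL (ContinuousLinearMap.apply ℂ (SpaceA R) A)

lemma hasSum_sysOp_coord (hφ : Summable fun n => ‖φ n‖) (hB : Summable fun n => ‖B n‖)
    (A : SpaceA R) (m : ℤ) : HasSum (fun p => sysEntry φ B p A m) (sysOp φ B A m) :=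
  (hasSum_sysOp hφ hB A).mapL (lp.evalCLM ℂ (fun _ : ℤ => CIcc R) 2 m)

lemma hasSum_sysOp_apply (hφ : Summable fun n => ‖φ n‖) (hB : Summable fun n => ‖B n‖)
    (A : SpaceA R) (m : ℤ) :
    HasSum (fun n => φ (m - n) * B n (A n)) (sysOp φ B A m) := by
  have h1 := hasSum_sysOp_coord hφ hB A m
  have hinj : Function.Injective (fun n : ℤ => ((m, n) : ℤ × ℤ)) := fun a b hab => by simpa using hab
  -- Entries in rows other than `m` do not contribute to the coordinate `m`, so the sum over pairs
  -- collapses to the sum over the column index.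
  have h3 := (hinj.hasSum_iff (f := fun p => sysEntry φ B p A m) (a := sysOp φ B A m) (by
    intro p hp
    rw [sysEntry_apply, if_neg]
    rintro rfl
    exact hp ⟨p.2, rfl⟩)).2 h1
  refine h3.congr_fun ?_
  intro n
  simp only [Function.comp_apply]
  rw [sysEntry_apply, if_pos rfl]
end

section
variable {R : ℝ} {φ : ℤ → CIcc R}

/-- The map `ψ ↦ (φ_{m-k} ψ)_m`. -/
def srcOp (φ : ℤ → CIcc R) (k : ℤ) : CIcc R →L[ℂ] SpaceA R :=
  -- Written as a matrix operator with a single nonzero column, so that boundedness and membership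
  -- in the sequence space are inherited from `sysOp`.
  sysOp φ (fun n => if n = k then ContinuousLinearMap.id ℂ (CIcc R) else 0) ∘L
    lp.singleContinuousLinearMap ℂ (fun _ : ℤ => CIcc R) 2 k

lemma srcOp_apply (hφ : Summable fun n => ‖φ n‖) (k : ℤ) (ψ : CIcc R) (m : ℤ) :
    srcOp φ k ψ m = φ (m - k) * ψ := by
  have hB : Summable fun n : ℤ => ‖(if n = k then ContinuousLinearMap.id ℂ (CIcc R) else 0 :
      CIcc R →L[ℂ] CIcc R)‖ :=
    summable_of_ne_finset_zero (s := {k}) fun n hn => by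
      rw [if_neg (by simpa using hn)]
      exact norm_zero (E := CIcc R →L[ℂ] CIcc R)
  have h := hasSum_sysOp_apply hφ hB (lp.single 2 k ψ) m
  have h' := hasSum_single (f := fun n => φ (m - n) * (if n = k then ContinuousLinearMap.id ℂ (CIcc R)
    else 0 : CIcc R →L[ℂ] CIcc R) ((lp.single 2 k ψ : SpaceA R) n)) k
      (fun n hn => by simp [if_neg hn])
  rw [if_pos rfl, lp.single_apply_self] at h'
  exact h.unique h'
end

/-! ### Fourier coefficients of the perturbation -/

/-- The standing assumptions on the perturbation. -/
structure IsPert (f : ℝ × ℝ → ℝ) (R : ℝ) : Prop where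
  pos : 0 < R
  smooth : ContDiff ℝ ∞ f
  per : ∀ x y : ℝ, f (x, y + 2 * Real.pi) = f (x, y)
  supp : ∀ x y : ℝ, R < |x| → f (x, y) = 0
  even_x : ∀ x y : ℝ, f (-x, y) = f (x, y)
  even_y : ∀ x y : ℝ, f (x, -y) = f (x, y)

variable {f : ℝ × ℝ → ℝ} {R : ℝ}

lemma continuous_fourierY (hf : Continuous f) (j : ℤ) : Continuous (fourierY f j) := by
  unfold fourierY
  exact intervalIntegral.continuous_parametric_intervalIntegral_of_continuous'
    (by simp only [Function.uncurry_def]; fun_prop) _ _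

/-- Continuity extends the vanishing of `f` to the closed set `|x| ≥ R`. The end points matter
later, when functions on `[-R, R]` are extended by zero and have to stay continuous. -/
lemma IsPert.zero (h : IsPert f R) {x : ℝ} (hx : R ≤ |x|) (y : ℝ) : f (x, y) = 0 := by
  have hc : IsClosed {t : ℝ | f (t, y) = 0} :=
    isClosed_eq (h.smooth.continuous.comp (by fun_prop)) continuous_const
  have h1 : Set.Ici R ⊆ {t : ℝ | f (t, y) = 0} := by
    rw [← closure_Ioi]
    exact hc.closure_subset_iff.2 fun t ht => h.supp t y (lt_of_lt_of_le ht (le_abs_self t))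
  rcases abs_cases x with ⟨hx', _⟩ | ⟨hx', _⟩
  · exact h1 (by rw [hx'] at hx; exact hx)
  · rw [← h.even_x]; exact h1 (by rw [hx'] at hx; exact hx)

lemma IsPert.fourierY_zero (h : IsPert f R) (j : ℤ) {x : ℝ} (hx : R ≤ |x|) :
    fourierY f j x = 0 := by
  simp [fourierY, h.zero hx]

lemma IsPert.fourierY_even (h : IsPert f R) (j : ℤ) (x : ℝ) : fourierY f j (-x) = fourierY f j x := by
  simp [fourierY, h.even_x]

lemma exp_int_two_pi (j : ℤ) : Complex.exp (Complex.I * j * (2 * Real.pi)) = 1 := by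
  rw [show Complex.I * j * (2 * Real.pi) = j * (2 * Real.pi * Complex.I) by ring]
  exact Complex.exp_int_mul_two_pi_mul_I j

/-- Substitute `y ↦ 2π - y` and use evenness and periodicity in `y`. Together with the realness of
`f` this makes each `f_j` real, and it makes the coefficient matrix `f_{m-n}` symmetric. -/
lemma IsPert.fourierY_neg (h : IsPert f R) (j : ℤ) (x : ℝ) :
    fourierY f (-j) x = fourierY f j x := by
  unfold fourierY
  have := intervalIntegral.integral_comp_sub_left (a := 0) (b := 2 * Real.pi)
    (fun y : ℝ => Complex.exp (-(Complex.I * j * y)) * (f (x, y) : ℂ)) (2 * Real.pi)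
  rw [sub_self, sub_zero] at this
  rw [← this]
  congr 1; ext y
  have hfy : f (x, 2 * Real.pi - y) = f (x, y) := by
    rw [sub_eq_neg_add, h.per, h.even_y]
  rw [hfy]
  congr 1
  push_cast
  rw [show -(Complex.I * j * (2 * Real.pi - y)) = Complex.I * j * y - Complex.I * j * (2 * Real.pi) by
    ring, Complex.exp_sub, exp_int_two_pi, div_one]
  congr 1; ring

lemma IsPert.conj_fourierY (h : IsPert f R) (j : ℤ) (x : ℝ) :
    conj (fourierY f j x) = fourierY f j x := by
  conv_rhs => rw [← h.fourierY_neg]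
  unfold fourierY
  rw [intervalIntegral.integral_of_le Real.two_pi_pos.le, ← integral_conj,
    intervalIntegral.integral_of_le Real.two_pi_pos.le]
  congr 1; ext y
  rw [map_mul, ← Complex.exp_conj, Complex.conj_ofReal]
  simp

/-- The derivative of the perturbation in `y`. -/
def derivY (g : ℝ × ℝ → ℝ) (p : ℝ × ℝ) : ℝ := fderiv ℝ g p (0, 1)

lemma hasDerivAt_derivY {g : ℝ × ℝ → ℝ} (hg : ContDiff ℝ ∞ g) (x y : ℝ) :
    HasDerivAt (fun t => g (x, t)) (derivY g (x, y)) y := by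
  have h1 : HasFDerivAt g (fderiv ℝ g (x, y)) (x, y) :=
    (hg.differentiable (by simp) _).hasFDerivAt
  have h2 : HasDerivAt (fun t : ℝ => ((x, t) : ℝ × ℝ)) (0, 1) y :=
    (hasDerivAt_const y x).prodMk (hasDerivAt_id y)
  exact h1.comp_hasDerivAt y h2

lemma contDiff_derivY {g : ℝ × ℝ → ℝ} (hg : ContDiff ℝ ∞ g) : ContDiff ℝ ∞ (derivY g) := by
  unfold derivY
  exact (hg.fderiv_right (m := ∞) (by simp)).clm_apply contDiff_const

lemma derivY_per {g : ℝ × ℝ → ℝ} (hg : ContDiff ℝ ∞ g)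
    (hp : ∀ x y : ℝ, g (x, y + 2 * Real.pi) = g (x, y)) (x y : ℝ) :
    derivY g (x, y + 2 * Real.pi) = derivY g (x, y) := by
  have h1 := (hasDerivAt_derivY hg x (y + 2 * Real.pi)).comp_add_const y (2 * Real.pi)
  simp only [hp] at h1
  exact h1.unique (hasDerivAt_derivY hg x y)

lemma derivY_supp {g : ℝ × ℝ → ℝ} (hg : ContDiff ℝ ∞ g)
    (hs : ∀ x y : ℝ, R < |x| → g (x, y) = 0) (x y : ℝ) (hx : R < |x|) : derivY g (x, y) = 0 := by
  have h1 := hasDerivAt_derivY hg x y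
  simp only [hs x _ hx] at h1
  exact h1.unique (hasDerivAt_const y 0)

lemma fourierY_derivY {g : ℝ × ℝ → ℝ} (hg : ContDiff ℝ ∞ g)
    (hp : ∀ x y : ℝ, g (x, y + 2 * Real.pi) = g (x, y)) (j : ℤ) (x : ℝ) :
    fourierY (derivY g) j x = Complex.I * j * fourierY g j x := by
  unfold fourierY
  have hu : ∀ y ∈ Set.uIcc 0 (2 * Real.pi), HasDerivAt (fun y : ℝ => Complex.exp (-(Complex.I * j * y)))
      (-(Complex.I * j) * Complex.exp (-(Complex.I * j * y))) y := by
    intro y _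
    have := (((hasDerivAt_id (y : ℂ)).const_mul (-(Complex.I * j))).cexp).comp_ofReal
    convert this using 1
    · ext y; simp
    · simp [mul_comm]
  have hv : ∀ y ∈ Set.uIcc 0 (2 * Real.pi), HasDerivAt (fun y : ℝ => (g (x, y) : ℂ))
      (derivY g (x, y) : ℂ) y := fun y _ => (hasDerivAt_derivY hg x y).ofReal_comp
  have hgc : Continuous fun y => ((derivY g (x, y) : ℝ) : ℂ) := by
    have := (contDiff_derivY hg).continuous
    fun_prop
  rw [intervalIntegral.integral_mul_deriv_eq_deriv_mul hu hv
    (Continuous.intervalIntegrable (by fun_prop) _ _) (hgc.intervalIntegrable _ _)]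
  have hb : g (x, 2 * Real.pi) = g (x, 0) := by simpa using hp x 0
  have he : Complex.exp (-(Complex.I * j * ((2 * Real.pi : ℝ) : ℂ))) = 1 := by
    have := exp_int_two_pi (-j)
    push_cast at this ⊢
    rw [← this]; congr 1; ring
  rw [hb, he]
  simp only [mul_assoc, intervalIntegral.integral_const_mul, neg_mul, intervalIntegral.integral_neg]
  simp

lemma norm_fourierY_le {g : ℝ × ℝ → ℝ} {M : ℝ} (hM : ∀ p, |g p| ≤ M) (j : ℤ) (x : ℝ) :
    ‖fourierY g j x‖ ≤ 2 * Real.pi * M := by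
  unfold fourierY
  have h := intervalIntegral.norm_integral_le_of_norm_le_const (a := 0) (b := 2 * Real.pi)
    (f := fun y : ℝ => Complex.exp (-(Complex.I * j * y)) * (g (x, y) : ℂ)) (C := M) (by
      intro y _
      rw [norm_mul, show -(Complex.I * j * y) = ((-(j * y) : ℝ) : ℂ) * Complex.I by push_cast; ring,
        Complex.norm_exp_ofReal_mul_I, one_mul, Complex.norm_real]
      exact hM _)
  rw [sub_zero, abs_of_pos Real.two_pi_pos] at h
  linarith

lemma exists_bound_of_per {g : ℝ × ℝ → ℝ} (hg : Continuous g)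
    (hp : ∀ x y : ℝ, g (x, y + 2 * Real.pi) = g (x, y))
    (hs : ∀ x y : ℝ, R < |x| → g (x, y) = 0) : ∃ M, 0 ≤ M ∧ ∀ p, |g p| ≤ M := by
  obtain ⟨M, hM⟩ := (isCompact_Icc.prod isCompact_Icc :
    IsCompact (Set.Icc (-R) R ×ˢ Set.Icc 0 (2 * Real.pi))).exists_bound_of_continuousOn hg.continuousOn
  refine ⟨max M 0, le_max_right _ _, fun p => ?_⟩
  obtain ⟨x, y⟩ := p
  by_cases hx : R < |x|
  · rw [hs x y hx]; simp
  · have hper : Function.Periodic (fun y => g (x, y)) (2 * Real.pi) := fun y => hp x y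
    obtain ⟨y', hy', he⟩ := hper.exists_mem_Ico₀ Real.two_pi_pos y
    rw [show g (x, y) = g (x, y') from he]
    exact (hM (x, y') ⟨abs_le.1 (not_lt.1 hx), Set.Ico_subset_Icc_self hy'⟩).trans (le_max_left _ _)

/-- The summable weight `1 / (1 + n²)`. -/
def wt (n : ℤ) : ℝ := (1 + (n : ℝ) ^ 2)⁻¹

lemma wt_pos (n : ℤ) : 0 < wt n := by unfold wt; positivity

lemma summable_wt : Summable wt := by
  have h := (Real.summable_one_div_int_pow (p := 2)).2 (by norm_num)
  -- The comparison holds off `n = 0` only: there `1 / n²` is `0` by convention while the weight is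
  -- `1`.
  refine Summable.of_norm_bounded_eventually (g := fun n : ℤ => 1 / (n : ℝ) ^ 2) h ?_
  rw [Filter.eventually_cofinite]
  refine Set.Finite.subset (Set.finite_singleton 0) fun n hn => ?_
  by_contra h0
  refine hn ?_
  have h0' : (n : ℝ) ≠ 0 := by exact_mod_cast h0
  rw [Real.norm_of_nonneg (wt_pos n).le, wt, one_div]
  have : 0 < (n : ℝ) ^ 2 := by positivity
  gcongr
  linarith

/-- Two integrations by parts in `y` bound `j² f_j`; adding the trivial bound on `f_j` covers `j =
0`. This decay suffices for all sums over modes. -/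
lemma IsPert.exists_norm_fourierY_le (h : IsPert f R) :
    ∃ C, 0 ≤ C ∧ ∀ j x, ‖fourierY f j x‖ ≤ C * wt j := by
  have hs1 := contDiff_derivY h.smooth
  have hs2 := contDiff_derivY hs1
  have hp1 := derivY_per h.smooth h.per
  have hp2 := derivY_per hs1 hp1
  obtain ⟨M0, hM0, h0⟩ := exists_bound_of_per h.smooth.continuous h.per h.supp
  obtain ⟨M2, hM2, h2⟩ := exists_bound_of_per hs2.continuous hp2
    (derivY_supp hs1 (derivY_supp h.smooth h.supp))
  refine ⟨2 * Real.pi * (M0 + M2), by positivity, fun j x => ?_⟩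
  have e1 := norm_fourierY_le h0 j x
  have e2 := norm_fourierY_le h2 j x
  rw [fourierY_derivY hs1 hp1, fourierY_derivY h.smooth h.per] at e2
  have e3 : ‖Complex.I * j * (Complex.I * j * fourierY f j x)‖ = (j : ℝ) ^ 2 * ‖fourierY f j x‖ := by
    simp only [norm_mul, Complex.norm_I, Complex.norm_intCast]
    rw [← sq_abs]; ring
  rw [e3] at e2
  rw [wt, ← div_eq_mul_inv, le_div_iff₀ (by positivity)]
  nlinarith

open Classical in
/-- The Fourier coefficients as elements of `C[-R, R]`. -/
def coefC (f : ℝ × ℝ → ℝ) (R : ℝ) (j : ℤ) : CIcc R :=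
  if hf : Continuous f then
    ⟨fun x => fourierY f j x, (continuous_fourierY hf j).comp continuous_subtype_val⟩ else 0

lemma IsPert.coefC_apply (h : IsPert f R) (j : ℤ) (x : Set.Icc (-R) R) :
    coefC f R j x = fourierY f j x := by
  unfold coefC
  rw [dif_pos h.smooth.continuous]; rfl

lemma IsPert.summable_coefC (h : IsPert f R) : Summable fun j => ‖coefC f R j‖ := by
  obtain ⟨C, hC, hb⟩ := h.exists_norm_fourierY_le
  refine Summable.of_nonneg_of_le (fun _ => norm_nonneg _) (fun j => ?_) (summable_wt.mul_left C)
  refine (ContinuousMap.norm_le _ (mul_nonneg hC (wt_pos j).le)).2 fun x => ?_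
  rw [h.coefC_apply]
  exact hb j x

/-- The coefficients carry no factor `1/2π`, so the series sums to `2πf`; this is the origin of the
coupling constant `2γ = ω²/2π`. -/
lemma IsPert.hasSum_fourierY (h : IsPert f R) (x y : ℝ) :
    HasSum (fun j : ℤ => fourierY f j x * Complex.exp (Complex.I * j * y))
      (2 * Real.pi * f (x, y)) := by
  have : Fact (0 < 2 * Real.pi) := ⟨Real.two_pi_pos⟩
  have hper : Function.Periodic (fun y => (f (x, y) : ℂ)) (2 * Real.pi) := fun y => by
    simp only [h.per]
  have hcont : Continuous hper.lift := by
    refine continuous_coinduced_dom.2 ?_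
    have := h.smooth.continuous
    change Continuous fun y : ℝ => (f (x, y) : ℂ)
    fun_prop
  let F : C(AddCircle (2 * Real.pi), ℂ) := ⟨hper.lift, hcont⟩
  have hcoef : ∀ j : ℤ, fourierCoeff F j = (1 / (2 * Real.pi) : ℂ) * fourierY f j x := by
    intro j
    rw [fourierCoeff_eq_intervalIntegral F j 0, fourierY, zero_add]
    simp only [Complex.real_smul, one_div, Complex.ofReal_inv, Complex.ofReal_mul, Complex.ofReal_ofNat]
    congr 1
    congr 1; ext y
    rw [smul_eq_mul, fourier_coe_apply]
    congr 1
    have hpi : (Real.pi : ℂ) ≠ 0 := by exact_mod_cast Real.pi_ne_zero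
    congr 1
    push_cast
    field_simp
  obtain ⟨C, hC, hb⟩ := h.exists_norm_fourierY_le
  have hsum : Summable (fourierCoeff F) := by
    refine Summable.of_norm_bounded (g := fun j => ‖(1 / (2 * Real.pi) : ℂ)‖ * (C * wt j))
      ((summable_wt.mul_left C).mul_left _) fun j => ?_
    rw [hcoef, norm_mul]
    gcongr
    exact hb j x
  have hpi : (Real.pi : ℂ) ≠ 0 := by exact_mod_cast Real.pi_ne_zero
  have hs := (has_pointwise_sum_fourier_series_of_summable hsum (y : AddCircle (2 * Real.pi))).mul_left
    (2 * Real.pi : ℂ)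
  refine hs.congr_fun fun j => ?_
  rw [hcoef, smul_eq_mul, fourier_coe_apply]
  have : 2 * (Real.pi : ℂ) * Complex.I * j * y / ((2 * Real.pi : ℝ) : ℂ) = Complex.I * j * y := by
    push_cast; field_simp
  rw [this]
  field_simp

/-! ### Neumann series -/

section
variable {V : Type*} [NormedAddCommGroup V] [NormedSpace ℂ V]

/-- The Neumann series for `(1 - T)⁻¹ g`. -/
def neumann (T : V →L[ℂ] V) (g : V) : V := ∑' n : ℕ, (T ^ n) g

/-- The difference `y - y'` solves the same kind of equation with data `(g - g') + (T - T') y'`, and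
`‖T‖ ≤ 1/2` is absorbed at the cost of a factor `2`. A priori bounds, uniqueness and Lipschitz
dependence on parameters are all instances. -/
lemma norm_le_two_mul_of_fixed {T T' : V →L[ℂ] V} (hT : ‖T‖ ≤ 1 / 2) {y y' g g' : V}
    (hy : y - T y = g) (hy' : y' - T' y' = g') :
    ‖y - y'‖ ≤ 2 * (‖g - g'‖ + ‖T - T'‖ * ‖y'‖) := by
  have h1 : y - y' = (g - g') + T (y - y') + (T - T') y' := by
    rw [← hy, ← hy', map_sub, sub_apply]; abel
  have h2 : ‖y - y'‖ ≤ ‖g - g'‖ + 1 / 2 * ‖y - y'‖ + ‖T - T'‖ * ‖y'‖ := by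
    calc ‖y - y'‖ = ‖(g - g') + T (y - y') + (T - T') y'‖ := congrArg _ h1
      _ ≤ ‖g - g'‖ + ‖T (y - y')‖ + ‖(T - T') y'‖ := norm_add₃_le
      _ ≤ _ := by
        gcongr
        · exact (T.le_opNorm _).trans (by gcongr)
        · exact ContinuousLinearMap.le_opNorm _ _
  linarith

lemma norm_le_of_fixed {T : V →L[ℂ] V} (hT : ‖T‖ ≤ 1 / 2) {y g : V} (hy : y - T y = g) :
    ‖y‖ ≤ 2 * ‖g‖ := by
  have := norm_le_two_mul_of_fixed hT hy (T' := 0) (y' := 0) (g' := 0) (by simp)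
  simpa using this

lemma fixed_unique {T : V →L[ℂ] V} (hT : ‖T‖ ≤ 1 / 2) {y y' g : V} (hy : y - T y = g)
    (hy' : y' - T y' = g) : y = y' := by
  have := norm_le_two_mul_of_fixed hT hy hy'
  rw [sub_self, sub_self, norm_zero, norm_zero] at this
  rw [← sub_eq_zero, ← norm_le_zero_iff]
  linarith

variable [CompleteSpace V]

lemma hasSum_neumann {T : V →L[ℂ] V} (hT : ‖T‖ ≤ 1 / 2) (g : V) :
    HasSum (fun n : ℕ => (T ^ n) g) (neumann T g) := by
  have h : Summable fun n : ℕ => (T ^ n) g := by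
    refine Summable.of_norm_bounded (g := fun n : ℕ => (1 / 2 : ℝ) ^ n * ‖g‖)
      ((summable_geometric_of_lt_one (by norm_num) (by norm_num)).mul_right _) fun n => ?_
    induction n with
    | zero => simp
    | succ n ih =>
      rw [pow_succ', mul_apply_eq_comp]
      calc _ ≤ ‖T‖ * ‖(T ^ n) g‖ := T.le_opNorm _
        _ ≤ 1 / 2 * ((1 / 2) ^ n * ‖g‖) := by gcongr
        _ = _ := by ring
  exact h.hasSum

lemma neumann_spec {T : V →L[ℂ] V} (hT : ‖T‖ ≤ 1 / 2) (g : V) :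
    neumann T g - T (neumann T g) = g := by
  have h := hasSum_neumann hT g
  have h1 := h.mapL T
  have h2 := (hasSum_nat_add_iff' 1).2 h
  simp only [Finset.sum_range_one, pow_zero, one_apply_eq_self] at h2
  have h3 : (fun n : ℕ => (T ^ (n + 1)) g) = fun n => T ((T ^ n) g) := by
    funext n; rw [pow_succ', mul_apply_eq_comp]
  rw [h3] at h2
  rw [h1.unique h2]; abel

/-- All partial sums of the series stay in the closed invariant subspace. The subspace is only
real-linear because it is also applied to real-valued sequences. -/
lemma neumann_mem {T : V →L[ℂ] V} (hT : ‖T‖ ≤ 1 / 2) {g : V} (S : Submodule ℝ V)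
    (hS : IsClosed (S : Set V)) (hTS : ∀ a ∈ S, T a ∈ S) (hg : g ∈ S) : neumann T g ∈ S := by
  refine hS.mem_of_tendsto (hasSum_neumann hT g) (Eventually.of_forall fun s => ?_)
  refine S.sum_mem fun n hn => ?_
  clear hn
  induction n with
  | zero => simpa
  | succ n ih => rw [pow_succ', mul_apply_eq_comp]; exact hTS _ ih
end

/-! ### Invariant classes of sequences -/

section
variable {R : ℝ}

/-- Sequences with all entries in `P`. -/
def seqIn (P : Submodule ℝ (CIcc R)) : Submodule ℝ (SpaceA R) where
  carrier := {A | ∀ m, A m ∈ P}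
  add_mem' := fun ha hb m => P.add_mem (ha m) (hb m)
  zero_mem' := fun _ => P.zero_mem
  smul_mem' := fun c _ ha m => P.smul_mem c (ha m)

lemma continuous_coord (m : ℤ) : Continuous fun A : SpaceA R => A m :=
  (lp.evalCLM ℂ (fun _ : ℤ => CIcc R) 2 m).continuous

lemma isClosed_seqIn {P : Submodule ℝ (CIcc R)} (hP : IsClosed (P : Set (CIcc R))) :
    IsClosed (seqIn P : Set (SpaceA R)) := by
  have : (seqIn P : Set (SpaceA R)) = ⋂ m, (fun A : SpaceA R => A m) ⁻¹' P := by
    ext A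
    simp only [Set.mem_iInter, Set.mem_preimage]
    rfl
  rw [this]
  exact isClosed_iInter fun m => hP.preimage (continuous_coord m)

lemma sysOp_mem_seqIn {φ : ℤ → CIcc R} {B : ℤ → CIcc R →L[ℂ] CIcc R}
    (hφ : Summable fun n => ‖φ n‖) (hB : Summable fun n => ‖B n‖)
    {P : Submodule ℝ (CIcc R)} (hP : IsClosed (P : Set (CIcc R)))
    (hφP : ∀ j, ∀ a ∈ P, φ j * a ∈ P) (hBP : ∀ n, ∀ a ∈ P, B n a ∈ P) {A : SpaceA R}
    (hA : A ∈ seqIn P) : sysOp φ B A ∈ seqIn P := fun m =>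
  hP.mem_of_tendsto (hasSum_sysOp_apply hφ hB A m)
    (Eventually.of_forall fun _ => P.sum_mem fun n _ => hφP _ _ (hBP n _ (hA n)))

/-- Reflection of `[-R, R]`. -/
def negIcc (x : Set.Icc (-R) R) : Set.Icc (-R) R := ⟨-x, by linarith [x.2.2], by linarith [x.2.1]⟩

/-- Functions with `a(-x) = σ a(x)`. -/
def parityC (R σ : ℝ) : Submodule ℝ (CIcc R) where
  carrier := {a | ∀ x, a (negIcc x) = σ * a x}
  add_mem' := fun ha hb x => by simp [ha x, hb x, mul_add]
  zero_mem' := fun _ => by simp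
  smul_mem' := fun c a ha x => by simp [ha x]; ring

/-- Real-valued functions. -/
def realC (R : ℝ) : Submodule ℝ (CIcc R) where
  carrier := {a | ∀ x, conj (a x) = a x}
  add_mem' := fun ha hb x => by simp [ha x, hb x]
  zero_mem' := fun _ => by simp
  smul_mem' := fun c a ha x => by simp [ha x]

lemma isClosed_parityC (σ : ℝ) : IsClosed (parityC R σ : Set (CIcc R)) := by
  have : (parityC R σ : Set (CIcc R)) = ⋂ x, {a : CIcc R | a (negIcc x) = σ * a x} := by
    ext a; simp [parityC]
  rw [this]
  exact isClosed_iInter fun x => isClosed_eq (by fun_prop) (by fun_prop)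

lemma isClosed_realC : IsClosed (realC R : Set (CIcc R)) := by
  have : (realC R : Set (CIcc R)) = ⋂ x, {a : CIcc R | conj (a x) = a x} := by
    ext a; simp [realC]
  rw [this]
  exact isClosed_iInter fun x => isClosed_eq
    (Complex.continuous_conj.comp (by fun_prop)) (by fun_prop)

lemma measurePreserving_negIcc : MeasurePreserving (negIcc (R := R)) (lebIcc R) (lebIcc R) := by
  have hm : Measurable (negIcc (R := R)) := (measurable_subtype_coe.neg).subtype_mk
  refine ⟨hm, ?_⟩
  ext s hs
  rw [Measure.map_apply hm hs]
  unfold lebIcc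
  have hi : ∀ t : Set (Set.Icc (-R) R), MeasurableSet t → MeasurableSet (Subtype.val '' t) :=
    fun t ht => measurableSet_Icc.subtype_image ht
  rw [Measure.comap_apply _ Subtype.val_injective hi _ (hm hs),
    Measure.comap_apply _ Subtype.val_injective hi _ hs]
  have : Subtype.val '' (negIcc ⁻¹' s) = Neg.neg ⁻¹' (Subtype.val '' s) := by
    ext x
    constructor
    · rintro ⟨y, hy, rfl⟩
      exact ⟨_, hy, rfl⟩
    · rintro ⟨y, hy, hxy⟩
      refine ⟨negIcc y, ?_, ?_⟩
      · have : negIcc (negIcc y) = y := Subtype.ext (neg_neg _)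
        simpa [this] using hy
      · simp [negIcc, hxy]
  rw [this, Measure.measure_preimage_neg]

lemma integral_negIcc {a : Set.Icc (-R) R → ℂ} (ha : Continuous a) :
    ∫ x, a (negIcc x) ∂(lebIcc R) = ∫ x, a x ∂(lebIcc R) := by
  conv_rhs => rw [← measurePreserving_negIcc.map_eq]
  rw [integral_map measurePreserving_negIcc.aemeasurable ha.aestronglyMeasurable]

lemma convOp_mem_parityC {h : C(ℝ, ℂ)} (hh : ∀ x, h (-x) = h x) {σ : ℝ} {a : CIcc R}
    (ha : a ∈ parityC R σ) : convOp R h a ∈ parityC R σ := by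
  intro x
  rw [convOp_apply, convOp_apply, ← integral_const_mul, ← integral_negIcc (by fun_prop)]
  congr 1; ext ξ
  rw [show a (negIcc ξ) = σ * a ξ from ha ξ]
  have : ((negIcc x : Set.Icc (-R) R) : ℝ) - (negIcc ξ : Set.Icc (-R) R) = -((x : ℝ) - ξ) := by
    simp [negIcc]; ring
  rw [this, hh]; ring

lemma convOp_mem_realC {h : C(ℝ, ℂ)} (hh : ∀ x, conj (h x) = h x) {a : CIcc R}
    (ha : a ∈ realC R) : convOp R h a ∈ realC R := by
  intro x
  rw [convOp_apply, ← integral_conj]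
  congr 1; ext ξ
  rw [map_mul, hh, show conj (a ξ) = a ξ from ha ξ]

/-! ### Integration functional and symmetry -/

/-- `a ↦ ∫ a` on `C[-R, R]`. -/
def intC (R : ℝ) : CIcc R →L[ℂ] ℂ :=
  LinearMap.mkContinuous
    { toFun := fun a => ∫ x, a x ∂(lebIcc R)
      map_add' := fun a b => integral_add (integrable_lebIcc (by fun_prop)) (integrable_lebIcc (by fun_prop))
      map_smul' := fun c a => integral_const_mul c _ }
    ((lebIcc R).real Set.univ) (fun a => by
      have := norm_integral_le_of_norm_le_const (μ := lebIcc R) (f := a) (C := ‖a‖)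
        (ae_of_all _ fun x => a.norm_coe_le_norm x)
      rw [mul_comm] at this
      exact this)

lemma intC_apply (a : CIcc R) : intC R a = ∫ x, a x ∂(lebIcc R) := rfl

lemma intC_eq_zero_of_odd {a : CIcc R} (ha : a ∈ parityC R (-1)) : intC R a = 0 := by
  have h := integral_negIcc (a := a) (by fun_prop)
  have h2 : (fun x => a (negIcc x)) = fun x => -a x := by
    funext x
    rw [show a (negIcc x) = ((-1 : ℝ) : ℂ) * a x from ha x]; push_cast; ring
  rw [h2, integral_neg] at h
  rw [intC_apply]
  have : (2 : ℂ) * ∫ x, a x ∂(lebIcc R) = 0 := by linear_combination -h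
  simpa using this

lemma intC_conj {a : CIcc R} (ha : a ∈ realC R) : conj (intC R a) = intC R a := by
  rw [intC_apply, ← integral_conj]
  congr 1; ext x; exact ha x

/-- Fubini and evenness of the kernel. The pairing `∫ ab` is bilinear, without conjugation, so the
kernel may be complex. -/
lemma intC_convOp_comm {h : C(ℝ, ℂ)} (hh : ∀ x, h (-x) = h x) (a b : CIcc R) :
    intC R (convOp R h a * b) = intC R (a * convOp R h b) := by
  simp only [intC_apply, ContinuousMap.mul_apply, convOp_apply, ← integral_const_mul,
    ← integral_mul_const]
  rw [integral_integral_swap]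
  · congr 1; ext ξ; congr 1; ext x
    rw [← hh, neg_sub]; ring
  · rw [← integrableOn_univ]
    have : Continuous (Function.uncurry fun (x : Set.Icc (-R) R) (ξ : Set.Icc (-R) R) =>
      h ((x : ℝ) - ξ) * a ξ * b x) := by simp only [Function.uncurry_def]; fun_prop
    exact this.continuousOn.integrableOn_compact isCompact_univ

/-- A reciprocity relation. Let `η` and `ζ` be the full densities, source plus `e B` applied to the
solution. Then `Y_m = ∑ φ_{m-n} η_n` and `Z_m = ∑ φ_{m-n} ζ_n`, so `∑ ∫ Y_m ζ_m = ∑ ∫ Z_m η_m` by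
evenness of `φ` in its index. The parts containing `B` agree by its symmetry, and only the source
terms are left. -/
lemma intC_symm {φ : ℤ → CIcc R} {B : ℤ → CIcc R →L[ℂ] CIcc R}
    (hφ : Summable fun n => ‖φ n‖) (hB : Summable fun n => ‖B n‖) (hφs : ∀ j, φ (-j) = φ j)
    (hBs : ∀ n a b, intC R (B n a * b) = intC R (a * B n b)) {e : ℂ} {k l : ℤ} {ψ χ : CIcc R}
    {Y Z : SpaceA R} (hY : Y - e • sysOp φ B Y = srcOp φ k ψ)
    (hZ : Z - e • sysOp φ B Z = srcOp φ l χ) :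
    intC R (Y l * χ) = intC R (Z k * ψ) := by
  have key : ∀ (k : ℤ) (ψ : CIcc R) (Y : SpaceA R), Y - e • sysOp φ B Y = srcOp φ k ψ →
      ∀ m, HasSum (fun n => φ (m - n) * ((if n = k then ψ else 0) + e • B n (Y n))) (Y m) := by
    intro k ψ Y hY m
    have h1 := (hasSum_sysOp_apply hφ hB Y m).const_smul e
    have h2 : HasSum (fun n => φ (m - n) * (if n = k then ψ else 0)) (srcOp φ k ψ m) := by
      rw [srcOp_apply hφ]
      convert hasSum_single (f := fun n => φ (m - n) * (if n = k then ψ else 0)) k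
        (fun n hn => by simp [if_neg hn]) using 1
      simp
    have h3 := h2.add h1
    have h4 : srcOp φ k ψ m + e • sysOp φ B Y m = Y m := by
      rw [← hY]
      exact sub_add_cancel (Y m) (e • sysOp φ B Y m)
    rw [h4] at h3
    refine h3.congr_fun fun n => ?_
    rw [mul_add, mul_smul_comm]
  have summ : ∀ (k : ℤ) (ψ : CIcc R) (Y : SpaceA R),
      Summable fun n => ‖(if n = k then ψ else 0) + e • B n (Y n)‖ := by
    intro k ψ Y
    have h1 : Summable fun n => ‖(if n = k then ψ else 0 : CIcc R)‖ :=
      summable_of_ne_finset_zero (s := {k}) fun n hn => by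
        rw [if_neg (by simpa using hn), norm_zero]
    refine Summable.of_nonneg_of_le (fun _ => norm_nonneg _) (fun n => ?_)
      (h1.add ((hB.mul_right ‖Y‖).mul_left ‖e‖))
    refine (norm_add_le _ _).trans ?_
    rw [norm_smul]
    gcongr
    exact ((B n).le_opNorm _).trans (by gcongr; exact norm_apply_le Y n)
  set η : ℤ → CIcc R := fun n => (if n = k then ψ else 0) + e • B n (Y n) with hη
  set ζ : ℤ → CIcc R := fun n => (if n = l then χ else 0) + e • B n (Z n) with hζ
  have hYs := key k ψ Y hY
  have hZs := key l χ Z hZ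
  have hsη : Summable fun n => ‖η n‖ := summ k ψ Y
  have hsζ : Summable fun n => ‖ζ n‖ := summ l χ Z
  -- One absolutely convergent double series, summed by rows to pair `Y` with `ζ` and by columns to
  -- pair `Z` with `η`.
  set D : ℤ × ℤ → ℂ := fun p => intC R (φ (p.1 - p.2) * η p.2 * ζ p.1) with hD
  have hDs : Summable D := by
    refine Summable.of_norm_bounded
      (g := fun p : ℤ × ℤ => ‖intC R‖ * (∑' j, ‖φ j‖) * (‖ζ p.1‖ * ‖η p.2‖))
      ((hsζ.mul_of_nonneg hsη (fun _ => norm_nonneg _) (fun _ => norm_nonneg _)).mul_left _)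
      fun p => ?_
    calc ‖D p‖ ≤ ‖intC R‖ * ‖φ (p.1 - p.2) * η p.2 * ζ p.1‖ := (intC R).le_opNorm _
      _ ≤ ‖intC R‖ * (‖φ (p.1 - p.2)‖ * ‖η p.2‖ * ‖ζ p.1‖) := by
        gcongr
        exact (norm_mul_le _ _).trans (by gcongr; exact norm_mul_le _ _)
      _ ≤ ‖intC R‖ * ((∑' j, ‖φ j‖) * ‖η p.2‖ * ‖ζ p.1‖) := by
        gcongr
        exact hφ.le_tsum _ (fun _ _ => norm_nonneg _)
      _ = _ := by ring
  have e1 : HasSum (fun m => intC R (Y m * ζ m)) (∑' p, D p) :=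
    hDs.hasSum.prod_fiberwise fun m =>
      (((hYs m).mul_right (ζ m)).mapL (intC R))
  have e2 : HasSum (fun m => intC R (Z m * η m)) (∑' p, D p) := by
    have hsw : HasSum (fun p : ℤ × ℤ => D p.swap) (∑' p, D p) :=
      ((Equiv.prodComm ℤ ℤ).hasSum_iff (f := D)).2 hDs.hasSum
    refine hsw.prod_fiberwise fun m => ?_
    refine (((hZs m).mul_right (η m)).mapL (intC R)).congr_fun fun n => ?_
    simp only [hD, Prod.swap]
    rw [← hφs (n - m), neg_sub]
    congr 1; ring
  have single : ∀ (l : ℤ) (χ : CIcc R) (Y : SpaceA R),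
      HasSum (fun m => intC R (Y m * (if m = l then χ else 0))) (intC R (Y l * χ)) := by
    intro l χ Y
    convert hasSum_single (f := fun m => intC R (Y m * (if m = l then χ else 0))) l
      (fun m hm => by simp [if_neg hm]) using 1
    simp
  have f1 := e1.sub (single l χ Y)
  have f2 := e2.sub (single k ψ Z)
  -- After the source terms are removed, both sides are `e ∫ Y_m B_m Z_m` termwise, by symmetry of
  -- `B_m`.
  have hfe : (fun m => intC R (Y m * ζ m) - intC R (Y m * (if m = l then χ else 0))) =
      fun m => intC R (Z m * η m) - intC R (Z m * (if m = k then ψ else 0)) := by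
    funext m
    rw [← map_sub, ← map_sub, ← mul_sub, ← mul_sub]
    simp only [hη, hζ, add_sub_cancel_left, mul_smul_comm, map_smul]
    rw [← hBs, mul_comm]
  rw [hfe] at f1
  have := f1.unique f2
  linear_combination -this
end

/-! ### Square roots with positive real part -/

lemma cpow_half_sq (w : ℂ) : (w ^ (1 / 2 : ℂ)) ^ 2 = w := by
  simp

lemma cpow_half_re_nonneg (w : ℂ) : 0 ≤ (w ^ (1 / 2 : ℂ)).re := by
  by_cases hw : w = 0
  · subst hw; simp
  rw [Complex.cpow_def_of_ne_zero hw, Complex.exp_re]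
  refine mul_nonneg (Real.exp_pos _).le (Real.cos_nonneg_of_mem_Icc ?_)
  have him : (Complex.log w * (1 / 2)).im = w.arg / 2 := by
    rw [show Complex.log w * (1 / 2) = ((1 / 2 : ℝ) : ℂ) * Complex.log w by push_cast; ring,
      Complex.im_ofReal_mul, Complex.log_im]; ring
  rw [him]
  constructor <;> linarith [Complex.neg_pi_lt_arg w, Complex.arg_le_pi w]

/-- For `k² = w` one has `Re w = (Re k)² - (Im k)²`, and the principal branch has `Re k ≥ 0`. -/
lemma le_cpow_half_re {w : ℂ} {c : ℝ} (hw : c ^ 2 ≤ w.re) : c ≤ (w ^ (1 / 2 : ℂ)).re := by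
  have h1 := cpow_half_re_nonneg w
  have h2 := congrArg Complex.re (cpow_half_sq w)
  rw [sq, Complex.mul_re] at h2
  by_contra hlt
  push Not at hlt
  nlinarith [mul_self_nonneg (w ^ (1 / 2 : ℂ)).im]

lemma cpow_half_ofReal {s : ℝ} (hs : 0 ≤ s) : (s : ℂ) ^ (1 / 2 : ℂ) = (Real.sqrt s : ℂ) := by
  rw [Real.sqrt_eq_rpow, Complex.ofReal_cpow hs]; norm_num

/-- Factor `k² - k'² = (k - k')(k + k')` and use `‖k + k'‖ ≥ 2c`. Squares of wave numbers are
polynomials in the parameters, so this gives Lipschitz bounds without differentiating a square root.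
-/
lemma norm_sub_le_of_sq {k k' : ℂ} {c D : ℝ} (hc : 0 < c) (hk : c ≤ k.re) (hk' : c ≤ k'.re)
    (h : ‖k ^ 2 - k' ^ 2‖ ≤ D) : ‖k - k'‖ ≤ D / (2 * c) := by
  have h1 : 2 * c ≤ ‖k + k'‖ := by
    refine le_trans ?_ (Complex.re_le_norm _)
    rw [Complex.add_re]; linarith
  rw [le_div_iff₀ (by positivity)]
  calc ‖k - k'‖ * (2 * c) ≤ ‖k - k'‖ * ‖k + k'‖ := by gcongr
    _ = ‖k ^ 2 - k' ^ 2‖ := by rw [← norm_mul]; congr 1; ring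
    _ ≤ D := h

lemma norm_exp_sub_exp_le {u v : ℂ} {M : ℝ} (hu : u.re ≤ M) (hv : v.re ≤ M) :
    ‖Complex.exp u - Complex.exp v‖ ≤ Real.exp M * ‖u - v‖ := by
  refine Convex.norm_image_sub_le_of_norm_hasDerivWithin_le (s := {z : ℂ | z.re ≤ M})
    (f' := Complex.exp) (fun z _ => (Complex.hasDerivAt_exp z).hasDerivWithinAt) (fun z hz => ?_)
    (convex_halfSpace_re_le M) hv hu
  rw [Complex.norm_exp]
  exact Real.exp_le_exp.2 hz

/-! ### Norms of kernels -/

lemma integral_exp_neg_abs {s : ℝ} (hs : 0 < s) :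
    ∫ x : ℝ, Real.exp (-(s * |x|)) = 2 / s := by
  rw [integral_comp_abs (f := fun x => Real.exp (-(s * x)))]
  have := integral_exp_mul_Ioi (a := -s) (by linarith) 0
  simp only [neg_mul] at this
  rw [this]; simp; ring

lemma integrable_exp_neg_abs {s : ℝ} (hs : 0 < s) :
    Integrable fun x : ℝ => Real.exp (-(s * |x|)) := by
  -- The integral of a non-integrable function is `0` by convention, so the positive value already
  -- computed proves integrability.
  by_contra h
  have h1 := integral_exp_neg_abs hs
  rw [integral_undef h] at h1
  have : 0 < 2 / s := by positivity
  linarith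

lemma kernelNorm_le_of_exp {R : ℝ} {h : C(ℝ, ℂ)} {P s : ℝ} (hs : 0 < s)
    (hh : ∀ x, ‖h x‖ ≤ P * Real.exp (-(s * |x|))) : kernelNorm R h ≤ P * (2 / s) := by
  have hP : 0 ≤ P := by
    have := (norm_nonneg _).trans (hh 0)
    simpa using this
  have hi := integrable_exp_neg_abs hs
  have hv := integral_exp_neg_abs hs
  calc kernelNorm R h ≤ ∫ t in Set.Icc (-(2 * R)) (2 * R), P * Real.exp (-(s * |t|)) :=
        integral_mono (Continuous.integrableOn_Icc (by fun_prop))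
          (hi.const_mul P).integrableOn hh
    _ ≤ ∫ t, P * Real.exp (-(s * |t|)) :=
        setIntegral_le_integral (hi.const_mul P) (ae_of_all _ fun _ => by positivity)
    _ = _ := by rw [integral_const_mul, hv]

lemma kernelNorm_le_of_sup {R : ℝ} (hR : 0 ≤ R) {h : C(ℝ, ℂ)} {P : ℝ}
    (hh : ∀ x, |x| ≤ 2 * R → ‖h x‖ ≤ P) : kernelNorm R h ≤ 4 * R * P := by
  unfold kernelNorm
  have h1 : ∀ t ∈ Set.Icc (-(2 * R)) (2 * R), ‖‖h t‖‖ ≤ P := fun t ht => by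
    rw [norm_norm]; exact hh t (abs_le.2 ht)
  have := norm_setIntegral_le_of_norm_le_const (μ := volume) (measure_Icc_lt_top) h1
  rw [Real.volume_real_Icc_of_le (by linarith)] at this
  calc _ ≤ _ := le_trans (le_abs_self _) this
    _ = _ := by ring

/-! ### The evanescent kernels -/

/-- `e^{-k|x|} / (2k)`. -/
def evanKer (k : ℂ) : C(ℝ, ℂ) :=
  ⟨fun x => 1 / (2 * k) * Complex.exp (-(k * (|x| : ℝ))), by fun_prop⟩

lemma norm_exp_neg_mul_le {k : ℂ} {c t : ℝ} (hk : c ≤ k.re) (ht : 0 ≤ t) :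
    ‖Complex.exp (-(k * t))‖ ≤ Real.exp (-(c * t)) := by
  rw [Complex.norm_exp]
  refine Real.exp_le_exp.2 ?_
  rw [Complex.neg_re, Complex.re_mul_ofReal]
  nlinarith

lemma norm_one_div_two_mul_le {k : ℂ} {c : ℝ} (hc : 0 < c) (hk : c ≤ k.re) :
    ‖1 / (2 * k)‖ ≤ 1 / (2 * c) := by
  rw [norm_div, norm_mul, norm_one, Complex.norm_two]
  have := hk.trans (Complex.re_le_norm k)
  gcongr

lemma norm_one_div_sub_le {k k' : ℂ} {c : ℝ} (hc : 0 < c) (hk : c ≤ k.re) (hk' : c ≤ k'.re) :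
    ‖1 / (2 * k) - 1 / (2 * k')‖ ≤ 1 / (2 * c ^ 2) * ‖k - k'‖ := by
  have h1 := hk.trans (Complex.re_le_norm k)
  have h2 := hk'.trans (Complex.re_le_norm k')
  have hk0 : k ≠ 0 := norm_pos_iff.1 (hc.trans_le h1)
  have hk0' : k' ≠ 0 := norm_pos_iff.1 (hc.trans_le h2)
  have : 1 / (2 * k) - 1 / (2 * k') = (k' - k) / (2 * (k * k')) := by field_simp
  have h3 : c ^ 2 ≤ ‖k‖ * ‖k'‖ := by rw [sq]; exact mul_le_mul h1 h2 hc.le (norm_nonneg _)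
  rw [this, norm_div, norm_mul, norm_mul, Complex.norm_two, norm_sub_rev]
  calc ‖k - k'‖ / (2 * (‖k‖ * ‖k'‖)) ≤ ‖k - k'‖ / (2 * c ^ 2) := by gcongr
    _ = _ := by ring

lemma norm_evanKer_le {k : ℂ} {c : ℝ} (hc : 0 < c) (hk : c ≤ k.re) (x : ℝ) :
    ‖evanKer k x‖ ≤ 1 / (2 * c) * Real.exp (-(c * |x|)) := by
  change ‖1 / (2 * k) * Complex.exp (-(k * (|x| : ℝ)))‖ ≤ _
  rw [norm_mul]
  exact mul_le_mul (norm_one_div_two_mul_le hc hk) (norm_exp_neg_mul_le hk (abs_nonneg x))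
    (norm_nonneg _) (by positivity)

/-- Variation of `k` in the exponent brings down a factor `|x|`; half of the decay rate is spent on
absorbing it. -/
lemma norm_evanKer_sub_le {k k' : ℂ} {c : ℝ} (hc : 0 < c) (hk : c ≤ k.re) (hk' : c ≤ k'.re)
    (x : ℝ) : ‖(evanKer k - evanKer k') x‖ ≤
      3 / (2 * c ^ 2) * ‖k - k'‖ * Real.exp (-(c / 2 * |x|)) := by
  set t := |x| with ht
  have ht0 : 0 ≤ t := abs_nonneg x
  have e1 : (evanKer k - evanKer k') x =
      (1 / (2 * k) - 1 / (2 * k')) * Complex.exp (-(k * t)) +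
        1 / (2 * k') * (Complex.exp (-(k * t)) - Complex.exp (-(k' * t))) := by
    change 1 / (2 * k) * Complex.exp (-(k * t)) - 1 / (2 * k') * Complex.exp (-(k' * t)) = _
    ring
  have hre : ∀ z : ℂ, c ≤ z.re → (-(z * t)).re ≤ -(c * t) := fun z hz => by
    rw [Complex.neg_re, Complex.re_mul_ofReal]; nlinarith
  have e2 : ‖Complex.exp (-(k * t)) - Complex.exp (-(k' * t))‖ ≤
      Real.exp (-(c * t)) * (t * ‖k - k'‖) := by
    refine (norm_exp_sub_exp_le (hre k hk) (hre k' hk')).trans (le_of_eq ?_)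
    rw [show -(k * t) - -(k' * t) = (t : ℂ) * (k' - k) by ring, norm_mul, Complex.norm_real,
      Real.norm_of_nonneg ht0, norm_sub_rev]
  have e3 : Real.exp (-(c * t)) ≤ Real.exp (-(c / 2 * t)) := Real.exp_le_exp.2 (by nlinarith)
  have e4 : t * Real.exp (-(c * t)) ≤ 2 / c * Real.exp (-(c / 2 * t)) := by
    have h1 : c / 2 * t ≤ Real.exp (c / 2 * t) := by linarith [Real.add_one_le_exp (c / 2 * t)]
    have h2 : Real.exp (-(c * t)) = Real.exp (-(c / 2 * t)) * Real.exp (-(c / 2 * t)) := by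
      rw [← Real.exp_add]; ring_nf
    have h3 : Real.exp (c / 2 * t) * Real.exp (-(c / 2 * t)) = 1 := by
      rw [← Real.exp_add]; simp
    have h4 : t ≤ 2 / c * Real.exp (c / 2 * t) := by
      rw [div_mul_eq_mul_div, le_div_iff₀ hc]; linarith
    calc t * Real.exp (-(c * t)) ≤ 2 / c * Real.exp (c / 2 * t) * Real.exp (-(c * t)) := by gcongr
      _ = 2 / c * (Real.exp (c / 2 * t) * Real.exp (-(c / 2 * t))) * Real.exp (-(c / 2 * t)) := by
        rw [h2]; ring
      _ = _ := by rw [h3]; ring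
  rw [e1]
  calc _ ≤ ‖1 / (2 * k) - 1 / (2 * k')‖ * ‖Complex.exp (-(k * t))‖ +
        ‖1 / (2 * k')‖ * ‖Complex.exp (-(k * t)) - Complex.exp (-(k' * t))‖ := by
        rw [← norm_mul, ← norm_mul]; exact norm_add_le _ _
    _ ≤ (1 / (2 * c ^ 2) * ‖k - k'‖) * Real.exp (-(c / 2 * t)) +
        1 / (2 * c) * (Real.exp (-(c * t)) * (t * ‖k - k'‖)) := by
        gcongr
        · exact norm_one_div_sub_le hc hk hk'
        · exact (norm_exp_neg_mul_le hk ht0).trans e3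
        · exact norm_one_div_two_mul_le hc hk'
    _ = (1 / (2 * c ^ 2) * ‖k - k'‖) * Real.exp (-(c / 2 * t)) +
        1 / (2 * c) * ‖k - k'‖ * (t * Real.exp (-(c * t))) := by ring
    _ ≤ (1 / (2 * c ^ 2) * ‖k - k'‖) * Real.exp (-(c / 2 * t)) +
        1 / (2 * c) * ‖k - k'‖ * (2 / c * Real.exp (-(c / 2 * t))) := by gcongr
    _ = _ := by field_simp; ring

/-- The powers of `c` are essential: for the evanescent modes `c` is proportional to `|n|`, and both
this bound and the one for differences are then summable in `n`. -/
lemma kernelNorm_evanKer_le {R : ℝ} {k : ℂ} {c : ℝ} (hc : 0 < c) (hk : c ≤ k.re) :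
    kernelNorm R (evanKer k) ≤ 1 / c ^ 2 := by
  refine (kernelNorm_le_of_exp hc (norm_evanKer_le hc hk)).trans (le_of_eq ?_)
  field_simp

lemma kernelNorm_evanKer_sub_le {R : ℝ} {k k' : ℂ} {c : ℝ} (hc : 0 < c) (hk : c ≤ k.re)
    (hk' : c ≤ k'.re) : kernelNorm R (evanKer k - evanKer k') ≤ 6 / c ^ 3 * ‖k - k'‖ := by
  refine (kernelNorm_le_of_exp (half_pos hc) (norm_evanKer_sub_le hc hk hk')).trans (le_of_eq ?_)
  field_simp; ring

/-! ### The propagating kernel -/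

/-- `(i / 2k) e^{ik|x|}`. -/
def propKer (k : ℂ) : C(ℝ, ℂ) :=
  ⟨fun x => Complex.I / (2 * k) * Complex.exp (Complex.I * k * (|x| : ℝ)), by fun_prop⟩

/-- For complex `μ` the wave number `k_0` is complex and `e^{ik_0x}` can grow; on `|x| ≤ 2R` with
`‖k_0‖ ≤ 2` the growth is at most `e^{4R}`. -/
lemma re_I_mul_le {k : ℂ} {t R : ℝ} (hk : ‖k‖ ≤ 2) (ht : |t| ≤ 2 * R) :
    (Complex.I * k * t).re ≤ 4 * R := by
  refine (Complex.re_le_norm _).trans ?_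
  rw [norm_mul, norm_mul, Complex.norm_I, one_mul, Complex.norm_real, Real.norm_eq_abs]
  calc ‖k‖ * |t| ≤ 2 * (2 * R) := by gcongr
    _ = _ := by ring

lemma norm_cexp_sub_le {k k' : ℂ} {t R : ℝ} (hk : ‖k‖ ≤ 2) (hk' : ‖k'‖ ≤ 2) (ht : |t| ≤ 2 * R) :
    ‖Complex.exp (Complex.I * k * t) - Complex.exp (Complex.I * k' * t)‖ ≤
      Real.exp (4 * R) * (2 * R) * ‖k - k'‖ := by
  refine (norm_exp_sub_exp_le (re_I_mul_le hk ht) (re_I_mul_le hk' ht)).trans ?_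
  rw [show Complex.I * k * t - Complex.I * k' * t = Complex.I * (k - k') * t by ring, norm_mul,
    norm_mul, Complex.norm_I, one_mul, Complex.norm_real, Real.norm_eq_abs, mul_assoc]
  refine mul_le_mul_of_nonneg_left ?_ (Real.exp_pos _).le
  rw [mul_comm (2 * R)]
  exact mul_le_mul_of_nonneg_left ht (norm_nonneg _)

lemma norm_cexp_le {k : ℂ} {t R : ℝ} (hk : ‖k‖ ≤ 2) (ht : |t| ≤ 2 * R) :
    ‖Complex.exp (Complex.I * k * t)‖ ≤ Real.exp (4 * R) := by
  rw [Complex.norm_exp]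
  exact Real.exp_le_exp.2 (re_I_mul_le hk ht)

lemma kernelNorm_propKer_le {R : ℝ} (hR : 0 ≤ R) {k : ℂ} {c : ℝ} (hc : 0 < c) (hk : c ≤ ‖k‖)
    (hk2 : ‖k‖ ≤ 2) : kernelNorm R (propKer k) ≤ 4 * R * (1 / (2 * c) * Real.exp (4 * R)) := by
  refine kernelNorm_le_of_sup hR fun x hx => ?_
  change ‖Complex.I / (2 * k) * Complex.exp (Complex.I * k * (|x| : ℝ))‖ ≤ _
  rw [norm_mul, norm_div, norm_mul, Complex.norm_I, Complex.norm_two]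
  have := norm_cexp_le (R := R) (t := |x|) hk2 (by rwa [abs_abs])
  gcongr

lemma kernelNorm_propKer_sub_le {R : ℝ} (hR : 0 ≤ R) {k k' : ℂ} {c : ℝ} (hc : 0 < c)
    (hk : c ≤ ‖k‖) (hk2 : ‖k‖ ≤ 2) (hk' : c ≤ ‖k'‖) (hk2' : ‖k'‖ ≤ 2) :
    kernelNorm R (propKer k - propKer k') ≤
      4 * R * ((1 / (2 * c ^ 2) * Real.exp (4 * R) + 1 / (2 * c) * (Real.exp (4 * R) * (2 * R))) *
        ‖k - k'‖) := by
  refine kernelNorm_le_of_sup hR fun x hx => ?_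
  set t := |x| with ht
  have hx' : |t| ≤ 2 * R := by rwa [ht, abs_abs]
  have hk0 : k ≠ 0 := norm_pos_iff.1 (hc.trans_le hk)
  have hk0' : k' ≠ 0 := norm_pos_iff.1 (hc.trans_le hk')
  have e1 : (propKer k - propKer k') x =
      (Complex.I * (k' - k)) / (2 * (k * k')) * Complex.exp (Complex.I * k * t) +
        Complex.I / (2 * k') * (Complex.exp (Complex.I * k * t) - Complex.exp (Complex.I * k' * t)) := by
    change Complex.I / (2 * k) * Complex.exp (Complex.I * k * t) -
      Complex.I / (2 * k') * Complex.exp (Complex.I * k' * t) = _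
    field_simp; ring
  rw [e1]
  refine (norm_add_le _ _).trans ?_
  rw [norm_mul, norm_mul, norm_div, norm_div, norm_mul, norm_mul, norm_mul, norm_mul, Complex.norm_I,
    Complex.norm_two, one_mul, norm_sub_rev k' k, add_mul]
  have h3 : c ^ 2 ≤ ‖k‖ * ‖k'‖ := by rw [sq]; exact mul_le_mul hk hk' hc.le (norm_nonneg _)
  have h4 := norm_cexp_le hk2 hx'
  have h5 := norm_cexp_sub_le hk2 hk2' hx'
  refine add_le_add ?_ ?_
  · calc _ ≤ ‖k - k'‖ / (2 * c ^ 2) * Real.exp (4 * R) := by gcongr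
      _ = _ := by ring
  · calc _ ≤ 1 / (2 * c) * (Real.exp (4 * R) * (2 * R) * ‖k - k'‖) := by gcongr
      _ = _ := by ring

/-! ### The regularized threshold kernel -/

/-- The integral form covers `μ = 0` and `μ ≠ 0` together. It shows that the regularized kernel is
bounded and Lipschitz in `μ` up to the threshold, although its formula divides by `μ`. -/
lemma thrKer_eq_integral (μ : ℂ) (t : ℝ) :
    (if μ = 0 then -(t : ℂ) / 2 else (Complex.exp (-(μ * t)) - 1) / (2 * μ)) =
      -(1 / 2) * ∫ s in (0 : ℝ)..t, Complex.exp (-(μ * s)) := by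
  split_ifs with h
  · subst h; simp; ring
  · have := integral_exp_mul_complex (a := 0) (b := t) (c := -μ) (neg_ne_zero.2 h)
    simp only [neg_mul] at this
    rw [this]
    simp
    field_simp

/-- `(e^{-μ|x|} - 1) / (2μ)`. -/
def thrKer (μ : ℂ) : C(ℝ, ℂ) :=
  ⟨fun x => if μ = 0 then -((|x| : ℝ) : ℂ) / 2 else (Complex.exp (-(μ * (|x| : ℝ))) - 1) / (2 * μ),
    by split_ifs <;> fun_prop⟩

lemma kernelNorm_thrKer_le {R : ℝ} (hR : 0 ≤ R) {μ : ℂ} (hμ : 0 ≤ μ.re) :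
    kernelNorm R (thrKer μ) ≤ 4 * R * R := by
  refine kernelNorm_le_of_sup hR fun x hx => ?_
  change ‖(if μ = 0 then -((|x| : ℝ) : ℂ) / 2 else _)‖ ≤ _
  rw [thrKer_eq_integral, norm_mul]
  have := intervalIntegral.norm_integral_le_of_norm_le_const (a := 0) (b := |x|)
    (f := fun s : ℝ => Complex.exp (-(μ * s))) (C := 1) (fun s hs => by
      rw [Set.uIoc_of_le (abs_nonneg x)] at hs
      have := norm_exp_neg_mul_le hμ hs.1.le
      simpa using this)
  rw [sub_zero, abs_abs, one_mul] at this
  norm_num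
  linarith

lemma kernelNorm_thrKer_sub_le {R : ℝ} (hR : 0 ≤ R) {μ μ' : ℂ} (hμ : 0 ≤ μ.re) (hμ' : 0 ≤ μ'.re) :
    kernelNorm R (thrKer μ - thrKer μ') ≤ 4 * R * (2 * R * R * ‖μ - μ'‖) := by
  refine kernelNorm_le_of_sup hR fun x hx => ?_
  change ‖(if μ = 0 then -((|x| : ℝ) : ℂ) / 2 else _) - (if μ' = 0 then -((|x| : ℝ) : ℂ) / 2 else _)‖ ≤ _
  rw [thrKer_eq_integral, thrKer_eq_integral, ← mul_sub, norm_mul,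
    ← intervalIntegral.integral_sub (Continuous.intervalIntegrable (by fun_prop) _ _)
      (Continuous.intervalIntegrable (by fun_prop) _ _)]
  have := intervalIntegral.norm_integral_le_of_norm_le_const (a := 0) (b := |x|)
    (f := fun s : ℝ => Complex.exp (-(μ * s)) - Complex.exp (-(μ' * s))) (C := 2 * R * ‖μ - μ'‖)
    (fun s hs => by
      rw [Set.uIoc_of_le (abs_nonneg x)] at hs
      have hre : ∀ z : ℂ, 0 ≤ z.re → (-(z * s)).re ≤ 0 := fun z hz => by
        rw [Complex.neg_re, Complex.re_mul_ofReal]; nlinarith [hs.1]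
      refine (norm_exp_sub_exp_le (hre μ hμ) (hre μ' hμ')).trans ?_
      rw [show -(μ * s) - -(μ' * s) = (s : ℂ) * (μ' - μ) by ring, norm_mul, Complex.norm_real,
        Real.norm_of_nonneg hs.1.le, norm_sub_rev, Real.exp_zero, one_mul]
      gcongr
      exact hs.2.trans hx)
  rw [sub_zero, abs_abs] at this
  have h2 : 2 * R * ‖μ - μ'‖ * |x| ≤ 2 * R * ‖μ - μ'‖ * (2 * R) := by gcongr
  norm_num
  linarith

/-! ### The kernels of the system -/

/-- The parameter domain. -/
structure Dom (b : ℝ) (μ : ℂ) (β : ℝ) : Prop where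
  pos : 0 < b
  le : b ≤ β
  ge : β ≤ 1 / 2 - b
  re : 0 ≤ μ.re
  -- With the bounds on `β` this keeps `Re k_0² ≥ b` and `Re k_n² ≥ b n²` for `n ≠ 0, -1`, so that
  -- only the mode `-1` can approach a threshold.
  small : ‖μ‖ ^ 2 ≤ b / 2

section
variable {b : ℝ} {μ μ' : ℂ} {β β' : ℝ}

lemma Dom.norm_lt (h : Dom b μ β) : ‖μ‖ ≤ 1 := by
  have := h.pos; have := h.le; have := h.ge; have := h.small
  nlinarith [norm_nonneg μ]

lemma Dom.neg_le_re_sq (h : Dom b μ β) : -(b / 2) ≤ (μ ^ 2).re := by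
  have h1 := Complex.abs_re_le_norm (μ ^ 2)
  rw [norm_pow] at h1
  linarith [abs_le.1 h1, h.small]

lemma Dom.re_sq_le (h : Dom b μ β) : (μ ^ 2).re ≤ b / 2 := by
  have h1 := Complex.abs_re_le_norm (μ ^ 2)
  rw [norm_pow] at h1
  linarith [abs_le.1 h1, h.small]

lemma Dom.kZero_re (h : Dom b μ β) : Real.sqrt b ≤ (kZero μ β).re := by
  refine le_cpow_half_re ?_
  rw [Real.sq_sqrt h.pos.le]
  have h1 : (1 - 2 * (β : ℂ) - μ ^ 2).re = 1 - 2 * β - (μ ^ 2).re := by simp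
  rw [h1]
  linarith [h.re_sq_le, h.ge, h.pos]

lemma kZero_sq (μ : ℂ) (β : ℝ) : kZero μ β ^ 2 = 1 - 2 * (β : ℂ) - μ ^ 2 := cpow_half_sq _

lemma kEvan_sq (μ : ℂ) (β : ℝ) (n : ℤ) :
    kEvan μ β n ^ 2 = ((β : ℂ) + n) ^ 2 - (1 - (β : ℂ)) ^ 2 + μ ^ 2 := cpow_half_sq _

lemma one_le_abs_int {n : ℤ} (hn : n ≠ 0) : (1 : ℝ) ≤ |(n : ℝ)| := by
  exact_mod_cast Int.one_le_abs hn

/-- The right side factors with roots `n = -1` and `n = 1 - 2β`. The second lies in `[2b, 1 - 2b]`,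
strictly between two integers. -/
lemma evan_real_le {b β : ℝ} (hb : 0 < b) (h1 : b ≤ β) (h2 : β ≤ 1 / 2 - b) {n : ℤ} (hn : n ≠ 0)
    (hn1 : n ≠ -1) : 2 * b * (n : ℝ) ^ 2 ≤ (β + n) ^ 2 - (1 - β) ^ 2 := by
  rw [show (β + n) ^ 2 - (1 - β) ^ 2 = (n + 1) * (n - 1 + 2 * β) by ring]
  rcases lt_or_gt_of_ne hn with h | h
  · have h3 : (n : ℝ) ≤ -2 := by exact_mod_cast (show n ≤ -2 by omega)
    nlinarith [mul_nonneg hb.le (sq_nonneg (n : ℝ))]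
  · have h3 : (1 : ℝ) ≤ n := by exact_mod_cast h
    have h4 : 2 * b * n ≤ n - 1 + 2 * β := by nlinarith
    nlinarith

lemma Dom.kEvan_re (h : Dom b μ β) {n : ℤ} (hn : n ≠ 0) (hn1 : n ≠ -1) :
    Real.sqrt b * |(n : ℝ)| ≤ (kEvan μ β n).re := by
  refine le_cpow_half_re ?_
  rw [mul_pow, Real.sq_sqrt h.pos.le, sq_abs]
  have h1 : (((β : ℂ) + n) ^ 2 - (1 - (β : ℂ)) ^ 2 + μ ^ 2).re =
      (β + n) ^ 2 - (1 - β) ^ 2 + (μ ^ 2).re := by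
    have : ((β : ℂ) + n) ^ 2 - (1 - (β : ℂ)) ^ 2 + μ ^ 2 =
      (((β + n) ^ 2 - (1 - β) ^ 2 : ℝ) : ℂ) + μ ^ 2 := by push_cast; ring
    rw [this, Complex.add_re, Complex.ofReal_re]
  rw [h1]
  have h2 := evan_real_le h.pos h.le h.ge hn hn1
  have h3 := one_le_abs_int hn
  have h4 : 1 ≤ (n : ℝ) ^ 2 := by rw [← sq_abs]; nlinarith
  nlinarith [h.neg_le_re_sq, h.pos]

lemma Dom.norm_kZero_le (h : Dom b μ β) : ‖kZero μ β‖ ≤ 2 := by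
  have h1 := congrArg norm (kZero_sq μ β)
  rw [norm_pow] at h1
  have h2 : ‖1 - 2 * (β : ℂ) - μ ^ 2‖ ≤ 2 := by
    refine (norm_sub_le _ _).trans ?_
    have : ‖1 - 2 * (β : ℂ)‖ ≤ 1 := by
      rw [show (1 - 2 * (β : ℂ)) = ((1 - 2 * β : ℝ) : ℂ) by push_cast; ring, Complex.norm_real,
        Real.norm_eq_abs, abs_le]
      constructor <;> linarith [h.pos, h.le, h.ge]
    have h3 := h.norm_lt
    rw [norm_pow]
    nlinarith [norm_nonneg μ]
  nlinarith [norm_nonneg (kZero μ β)]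

lemma norm_sq_sub_sq_le (h : Dom b μ β) (h' : Dom b μ' β') : ‖μ ^ 2 - μ' ^ 2‖ ≤ 2 * ‖μ - μ'‖ := by
  rw [show μ ^ 2 - μ' ^ 2 = (μ + μ') * (μ - μ') by ring, norm_mul]
  gcongr
  exact (norm_add_le _ _).trans (by linarith [h.norm_lt, h'.norm_lt])

lemma norm_kZero_sub_le (h : Dom b μ β) (h' : Dom b μ' β') :
    ‖kZero μ β - kZero μ' β'‖ ≤ 1 / Real.sqrt b * (‖μ - μ'‖ + |β - β'|) := by
  have hs := Real.sqrt_pos.2 h.pos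
  have hD : ‖kZero μ β ^ 2 - kZero μ' β' ^ 2‖ ≤ 2 * (‖μ - μ'‖ + |β - β'|) := by
    rw [kZero_sq, kZero_sq, show 1 - 2 * (β : ℂ) - μ ^ 2 - (1 - 2 * (β' : ℂ) - μ' ^ 2) =
      -(2 * ((β - β' : ℝ) : ℂ)) - (μ ^ 2 - μ' ^ 2) by push_cast; ring]
    refine (norm_sub_le _ _).trans ?_
    rw [norm_neg, norm_mul, Complex.norm_two, Complex.norm_real, Real.norm_eq_abs]
    linarith [norm_sq_sub_sq_le h h']
  refine (norm_sub_le_of_sq hs h.kZero_re h'.kZero_re hD).trans (le_of_eq ?_)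
  field_simp

/-- The squares differ by `O(|n|)` and the sum of the roots is at least of order `|n|`, so the
Lipschitz constant is uniform in the mode. -/
lemma norm_kEvan_sub_le (h : Dom b μ β) (h' : Dom b μ' β') {n : ℤ} (hn : n ≠ 0) (hn1 : n ≠ -1) :
    ‖kEvan μ β n - kEvan μ' β' n‖ ≤ 3 / Real.sqrt b * (‖μ - μ'‖ + |β - β'|) := by
  have hs := Real.sqrt_pos.2 h.pos
  have h3 := one_le_abs_int hn
  have hD : ‖kEvan μ β n ^ 2 - kEvan μ' β' n ^ 2‖ ≤
      6 * |(n : ℝ)| * (‖μ - μ'‖ + |β - β'|) := by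
    rw [kEvan_sq, kEvan_sq, show ((β : ℂ) + n) ^ 2 - (1 - (β : ℂ)) ^ 2 + μ ^ 2 -
        (((β' : ℂ) + n) ^ 2 - (1 - (β' : ℂ)) ^ 2 + μ' ^ 2) =
      ((2 * (n + 1) * (β - β') : ℝ) : ℂ) + (μ ^ 2 - μ' ^ 2) by push_cast; ring]
    refine (norm_add_le _ _).trans ?_
    rw [Complex.norm_real, Real.norm_eq_abs, abs_mul, abs_mul, abs_two]
    have h4 : |(n : ℝ) + 1| ≤ 2 * |(n : ℝ)| := (abs_add_le _ _).trans (by rw [abs_one]; linarith)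
    have h5 := norm_sq_sub_sq_le h h'
    nlinarith [norm_nonneg (μ - μ'), abs_nonneg (β - β'),
      mul_le_mul_of_nonneg_right h4 (abs_nonneg (β - β')),
      mul_le_mul_of_nonneg_right h3 (norm_nonneg (μ - μ')),
      mul_nonneg (abs_nonneg (n : ℝ)) (abs_nonneg (β - β'))]
  refine (norm_sub_le_of_sq (by positivity) (h.kEvan_re hn hn1) (h'.kEvan_re hn hn1) hD).trans
    (le_of_eq ?_)
  field_simp; ring
end

/-- The kernels `H_m` as continuous functions. -/
def kerT (μ : ℂ) (β : ℝ) (n : ℤ) : C(ℝ, ℂ) :=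
  if n = 0 then propKer (kZero μ β) else if n = -1 then thrKer μ else evanKer (kEvan μ β n)

lemma kerT_apply (μ : ℂ) (β : ℝ) (n : ℤ) (x : ℝ) : kerT μ β n x = kernelH μ β n x := by
  unfold kerT kernelH
  split_ifs <;> simp_all [propKer, thrKer, evanKer]

/-- The kernels `H_m`, with the outgoing kernel replaced by `-sin(k_0|x|) / (2k_0)`. -/
def kerS (μ : ℂ) (β : ℝ) (n : ℤ) : C(ℝ, ℂ) :=
  -- The average of outgoing and incoming kernels is real at real `k_0`, and in this form it
  -- inherits the bounds proved for `propKer`.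
  if n = 0 then (1 / 2 : ℂ) • (propKer (kZero μ β) + propKer (-kZero μ β)) else kerT μ β n

lemma kernelNorm_smul (R : ℝ) (c : ℂ) (h : C(ℝ, ℂ)) :
    kernelNorm R (c • h) = ‖c‖ * kernelNorm R h := by
  unfold kernelNorm
  rw [← integral_const_mul]
  simp

lemma kernelNorm_add_le (R : ℝ) (h h' : C(ℝ, ℂ)) :
    kernelNorm R (h + h') ≤ kernelNorm R h + kernelNorm R h' := by
  unfold kernelNorm
  rw [← integral_add (Continuous.integrableOn_Icc (by fun_prop))
    (Continuous.integrableOn_Icc (by fun_prop))]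
  exact integral_mono (Continuous.integrableOn_Icc (by fun_prop))
    (Continuous.integrableOn_Icc (by fun_prop)) fun x => norm_add_le _ _

lemma inv_sq_le_wt {n : ℤ} (hn : n ≠ 0) : 1 / |(n : ℝ)| ^ 2 ≤ 2 * wt n := by
  have h := one_le_abs_int hn
  unfold wt
  rw [← sq_abs (n : ℝ), ← div_eq_mul_inv, div_le_div_iff₀ (by positivity) (by positivity)]
  nlinarith

/-- One constant and one summable weight serve all modes: `n = 0` and `n = -1` are two fixed
kernels, and the evanescent ones decay at least like `n⁻²`. -/
lemma exists_kernel_bounds {R b : ℝ} (hR : 0 ≤ R) (hb : 0 < b) :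
    ∃ M, 0 ≤ M ∧ ∀ μ β, Dom b μ β → ∀ n,
      (kernelNorm R (kerT μ β n) ≤ M * wt n ∧ kernelNorm R (kerS μ β n) ≤ M * wt n) ∧
      ∀ μ' β', Dom b μ' β' →
        kernelNorm R (kerT μ β n - kerT μ' β' n) ≤ M * wt n * (‖μ - μ'‖ + |β - β'|) ∧
        kernelNorm R (kerS μ β n - kerS μ' β' n) ≤ M * wt n * (‖μ - μ'‖ + |β - β'|) := by
  set c := Real.sqrt b with hc
  have hc0 : 0 < c := Real.sqrt_pos.2 hb
  set M1 := 4 * R * (1 / (2 * c) * Real.exp (4 * R)) with hM1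
  set M2 := 4 * R * ((1 / (2 * c ^ 2) * Real.exp (4 * R) +
    1 / (2 * c) * (Real.exp (4 * R) * (2 * R)))) * (1 / c) with hM2
  -- `M3` and `M4` are doubled because `wt (-1) = 1/2`. `M5` and `M6` come from `1/n² ≤ 2 wt n`, the
  -- latter as `(12/c³)(3/c)`, kernel variation times variation of `k_n`.
  set M3 := 2 * (4 * R * R) with hM3
  set M4 := 2 * (4 * R * (2 * R * R)) with hM4
  set M5 := 2 / c ^ 2 with hM5
  set M6 := 36 / c ^ 4 with hM6
  have p1 : 0 ≤ M1 := by positivity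
  have p2 : 0 ≤ M2 := by positivity
  have p3 : 0 ≤ M3 := by positivity
  have p4 : 0 ≤ M4 := by positivity
  have p5 : 0 ≤ M5 := by positivity
  have p6 : 0 ≤ M6 := by positivity
  have w0 : wt 0 = 1 := by simp [wt]
  have w1 : wt (-1) = 1 / 2 := by norm_num [wt]
  have hnk : ∀ μ β, Dom b μ β → c ≤ ‖kZero μ β‖ := fun μ β h =>
    h.kZero_re.trans (Complex.re_le_norm _)
  have hP : ∀ μ β, Dom b μ β → kernelNorm R (propKer (kZero μ β)) ≤ M1 ∧
      kernelNorm R (propKer (-kZero μ β)) ≤ M1 := fun μ β h =>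
    ⟨kernelNorm_propKer_le hR hc0 (hnk μ β h) h.norm_kZero_le,
      kernelNorm_propKer_le hR hc0 (by rw [norm_neg]; exact hnk μ β h)
        (by rw [norm_neg]; exact h.norm_kZero_le)⟩
  have hPs : ∀ μ β, Dom b μ β → ∀ μ' β', Dom b μ' β' →
      kernelNorm R (propKer (kZero μ β) - propKer (kZero μ' β')) ≤ M2 * (‖μ - μ'‖ + |β - β'|) ∧
      kernelNorm R (propKer (-kZero μ β) - propKer (-kZero μ' β')) ≤
        M2 * (‖μ - μ'‖ + |β - β'|) := fun μ β h μ' β' h' => by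
    have e := norm_kZero_sub_le h h'
    have e1 := kernelNorm_propKer_sub_le hR hc0 (hnk μ β h) h.norm_kZero_le (hnk μ' β' h')
      h'.norm_kZero_le
    have e2 := kernelNorm_propKer_sub_le (k := -kZero μ β) (k' := -kZero μ' β') hR hc0
      (by rw [norm_neg]; exact hnk μ β h)
      (by rw [norm_neg]; exact h.norm_kZero_le) (by rw [norm_neg]; exact hnk μ' β' h')
      (by rw [norm_neg]; exact h'.norm_kZero_le)
    rw [neg_sub_neg, norm_sub_rev] at e2
    have e3 : 4 * R * ((1 / (2 * c ^ 2) * Real.exp (4 * R) +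
        1 / (2 * c) * (Real.exp (4 * R) * (2 * R))) * ‖kZero μ β - kZero μ' β'‖) ≤
        M2 * (‖μ - μ'‖ + |β - β'|) := by
      calc _ ≤ 4 * R * ((1 / (2 * c ^ 2) * Real.exp (4 * R) +
        1 / (2 * c) * (Real.exp (4 * R) * (2 * R))) * (1 / c * (‖μ - μ'‖ + |β - β'|))) := by gcongr
        _ = _ := by rw [hM2]; ring
    exact ⟨e1.trans e3, e2.trans e3⟩
  have hrest : ∀ μ β, Dom b μ β → ∀ n : ℤ, n ≠ 0 →
      kernelNorm R (kerT μ β n) ≤ (M3 + M5) * wt n ∧ ∀ μ' β', Dom b μ' β' →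
      kernelNorm R (kerT μ β n - kerT μ' β' n) ≤ (M4 + M6) * wt n * (‖μ - μ'‖ + |β - β'|) := by
    intro μ β h n hn
    by_cases hn1 : n = -1
    · subst hn1
      simp only [kerT, if_neg hn, if_true, w1]
      refine ⟨?_, fun μ' β' h' => ?_⟩
      · have := kernelNorm_thrKer_le hR h.re
        rw [hM3]; linarith
      · have := kernelNorm_thrKer_sub_le hR h.re h'.re
        have e : 4 * R * (2 * R * R * ‖μ - μ'‖) ≤ M4 * (1 / 2) * (‖μ - μ'‖ + |β - β'|) := by
          rw [hM4]
          have : 0 ≤ 4 * R * (2 * R * R) * |β - β'| := by positivity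
          linarith
        have e2 : 0 ≤ M6 * (1 / 2) * (‖μ - μ'‖ + |β - β'|) := by positivity
        linarith
    · simp only [kerT, if_neg hn, if_neg hn1]
      have hn' := one_le_abs_int hn
      have hcn : 0 < c * |(n : ℝ)| := by positivity
      have hw := inv_sq_le_wt hn
      refine ⟨?_, fun μ' β' h' => ?_⟩
      · refine (kernelNorm_evanKer_le hcn (h.kEvan_re hn hn1)).trans ?_
        have e : 1 / (c * |(n : ℝ)|) ^ 2 ≤ M5 * wt n := by
          rw [mul_pow, hM5]
          calc 1 / (c ^ 2 * |(n : ℝ)| ^ 2) = 1 / c ^ 2 * (1 / |(n : ℝ)| ^ 2) := by field_simp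
            _ ≤ 1 / c ^ 2 * (2 * wt n) := by gcongr
            _ = _ := by ring
        nlinarith [mul_nonneg p3 (wt_pos n).le]
      · refine (kernelNorm_evanKer_sub_le hcn (h.kEvan_re hn hn1) (h'.kEvan_re hn hn1)).trans ?_
        have e1 := norm_kEvan_sub_le h h' hn hn1
        have e2 : 6 / (c * |(n : ℝ)|) ^ 3 ≤ 12 / c ^ 3 * wt n := by
          calc 6 / (c * |(n : ℝ)|) ^ 3 = 6 / c ^ 3 * (1 / (|(n : ℝ)| ^ 2 * |(n : ℝ)|)) := by field_simp
            _ ≤ 6 / c ^ 3 * (1 / (|(n : ℝ)| ^ 2 * 1)) := by gcongr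
            _ ≤ 6 / c ^ 3 * (2 * wt n) := by rw [mul_one]; gcongr
            _ = _ := by ring
        have hwp := (wt_pos n).le
        calc _ ≤ 12 / c ^ 3 * wt n * (3 / c * (‖μ - μ'‖ + |β - β'|)) := by gcongr
          _ = M6 * wt n * (‖μ - μ'‖ + |β - β'|) := by rw [hM6]; field_simp; ring
          _ ≤ _ := by gcongr; linarith
  refine ⟨M1 + M2 + (M3 + M5) + (M4 + M6), by positivity, fun μ β h n => ?_⟩
  by_cases hn : n = 0
  · subst hn
    simp only [kerT, kerS, if_true, w0, mul_one]
    refine ⟨⟨by linarith [(hP μ β h).1], ?_⟩, fun μ' β' h' => ?_⟩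
    · rw [kernelNorm_smul]
      have := kernelNorm_add_le R (propKer (kZero μ β)) (propKer (-kZero μ β))
      norm_num
      linarith [(hP μ β h).1, (hP μ β h).2]
    · obtain ⟨e1, e2⟩ := hPs μ β h μ' β' h'
      have hd : 0 ≤ ‖μ - μ'‖ + |β - β'| := by positivity
      have e3 : M2 * (‖μ - μ'‖ + |β - β'|) ≤
        (M1 + M2 + (M3 + M5) + (M4 + M6)) * (‖μ - μ'‖ + |β - β'|) := by gcongr; linarith
      refine ⟨e1.trans e3, ?_⟩
      have hsm : (1 / 2 : ℂ) • (propKer (kZero μ β) + propKer (-kZero μ β)) -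
          (1 / 2 : ℂ) • (propKer (kZero μ' β') + propKer (-kZero μ' β')) =
          (1 / 2 : ℂ) • ((propKer (kZero μ β) - propKer (kZero μ' β')) +
            (propKer (-kZero μ β) - propKer (-kZero μ' β'))) := by
        ext x; simp; ring
      rw [hsm, kernelNorm_smul]
      have := kernelNorm_add_le R (propKer (kZero μ β) - propKer (kZero μ' β'))
        (propKer (-kZero μ β) - propKer (-kZero μ' β'))
      norm_num
      linarith
  · obtain ⟨e1, e2⟩ := hrest μ β h n hn
    have hw := (wt_pos n).le
    simp only [kerS, if_neg hn]
    have e3 : (M3 + M5) * wt n ≤ (M1 + M2 + (M3 + M5) + (M4 + M6)) * wt n :=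
      mul_le_mul_of_nonneg_right (by linarith) hw
    refine ⟨⟨e1.trans e3, e1.trans e3⟩, fun μ' β' h' => ?_⟩
    have e4 : (M4 + M6) * wt n * (‖μ - μ'‖ + |β - β'|) ≤
      (M1 + M2 + (M3 + M5) + (M4 + M6)) * wt n * (‖μ - μ'‖ + |β - β'|) :=
      mul_le_mul_of_nonneg_right (mul_le_mul_of_nonneg_right (by linarith) hw) (by positivity)
    exact ⟨(e2 μ' β' h').trans e4, (e2 μ' β' h').trans e4⟩

/-! ### The system operators -/

lemma norm_smul_clm_le {V : Type*} [NormedAddCommGroup V] [NormedSpace ℂ V] (c : ℂ) (T : V →L[ℂ] V) :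
    ‖c • T‖ ≤ ‖c‖ * ‖T‖ := ContinuousLinearMap.opNorm_smul_le c T

lemma norm_smul_sub_smul_le {V : Type*} [NormedAddCommGroup V] [NormedSpace ℂ V] (c c' : ℂ)
    (T T' : V →L[ℂ] V) : ‖c • T - c' • T'‖ ≤ ‖c‖ * ‖T - T'‖ + ‖c - c'‖ * ‖T'‖ := by
  rw [show c • T - c' • T' = c • (T - T') + (c - c') • T' by rw [smul_sub, sub_smul]; abel]
  exact (norm_add_le _ _).trans (add_le_add (norm_smul_clm_le _ _) (norm_smul_clm_le _ _))

/-- `2γ` times the matrix operator with kernels `ker`. -/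
def kerSys (f : ℝ × ℝ → ℝ) (R : ℝ) (ker : ℂ → ℝ → ℤ → C(ℝ, ℂ)) (μ : ℂ) (β : ℝ) :
    SpaceA R →L[ℂ] SpaceA R :=
  (2 * gam μ β) • sysOp (coefC f R) (fun n => convOp R (ker μ β n))

section
variable {f : ℝ × ℝ → ℝ} {R b : ℝ} {μ μ' : ℂ} {β β' : ℝ}

lemma Dom.norm_gam_le (h : Dom b μ β) : ‖gam μ β‖ ≤ 1 := by
  unfold gam
  rw [norm_div, div_le_one (by rw [norm_pos_iff]; simp [Real.pi_ne_zero])]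
  have h1 : ‖((1 - (β : ℂ)) ^ 2 - μ ^ 2)‖ ≤ 2 := by
    refine (norm_sub_le _ _).trans ?_
    rw [norm_pow, norm_pow, show (1 - (β : ℂ)) = ((1 - β : ℝ) : ℂ) by push_cast; ring,
      Complex.norm_real, Real.norm_eq_abs, abs_of_nonneg (by linarith [h.ge, h.pos])]
    have := h.norm_lt
    have := h.le; have := h.pos; have := h.ge
    nlinarith [norm_nonneg μ]
  rw [norm_mul, Complex.norm_real, Real.norm_of_nonneg Real.pi_pos.le]
  norm_num
  linarith [Real.pi_gt_three]

lemma norm_gam_sub_le (h : Dom b μ β) (h' : Dom b μ' β') :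
    ‖gam μ β - gam μ' β'‖ ≤ ‖μ - μ'‖ + |β - β'| := by
  unfold gam
  rw [← sub_div, norm_div, div_le_iff₀ (by rw [norm_pos_iff]; simp [Real.pi_ne_zero])]
  have h1 : ‖((1 - (β : ℂ)) ^ 2 - μ ^ 2) - ((1 - (β' : ℂ)) ^ 2 - μ' ^ 2)‖ ≤
      2 * (‖μ - μ'‖ + |β - β'|) := by
    rw [show ((1 - (β : ℂ)) ^ 2 - μ ^ 2) - ((1 - (β' : ℂ)) ^ 2 - μ' ^ 2) =
      -(((2 - β - β') * (β - β') : ℝ) : ℂ) - (μ ^ 2 - μ' ^ 2) by push_cast; ring]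
    refine (norm_sub_le _ _).trans ?_
    rw [norm_neg, Complex.norm_real, Real.norm_eq_abs, abs_mul,
      abs_of_nonneg (by linarith [h.ge, h.pos, h'.ge] : 0 ≤ 2 - β - β')]
    have h2 := norm_sq_sub_sq_le h h'
    have h3 : (2 - β - β') * |β - β'| ≤ 2 * |β - β'| := by
      gcongr; linarith [h.le, h.pos, h'.le]
    linarith
  rw [norm_mul, Complex.norm_real, Real.norm_of_nonneg Real.pi_pos.le]
  norm_num
  have : 0 ≤ ‖μ - μ'‖ + |β - β'| := by positivity
  nlinarith [Real.pi_gt_three]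

lemma exists_kerSys_bounds (hf : IsPert f R) {ker : ℂ → ℝ → ℤ → C(ℝ, ℂ)} {M : ℝ} (hM : 0 ≤ M)
    (hk : ∀ μ β, Dom b μ β → ∀ n, kernelNorm R (ker μ β n) ≤ M * wt n ∧
      ∀ μ' β', Dom b μ' β' →
        kernelNorm R (ker μ β n - ker μ' β' n) ≤ M * wt n * (‖μ - μ'‖ + |β - β'|)) :
    ∃ K, 0 ≤ K ∧ ∀ μ β, Dom b μ β → ‖kerSys f R ker μ β‖ ≤ K ∧ ∀ μ' β', Dom b μ' β' →
      ‖kerSys f R ker μ β - kerSys f R ker μ' β'‖ ≤ K * (‖μ - μ'‖ + |β - β'|) := by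
  set S := ∑' n, ‖coefC f R n‖ with hS
  set W := ∑' n, M * wt n with hW
  have hφ := hf.summable_coefC
  have hw : Summable fun n => M * wt n := summable_wt.mul_left M
  have hS0 : 0 ≤ S := tsum_nonneg fun _ => norm_nonneg _
  have hW0 : 0 ≤ W := tsum_nonneg fun n => mul_nonneg hM (wt_pos n).le
  have hcb : ∀ μ β, Dom b μ β → ∀ n, ‖convOp R (ker μ β n)‖ ≤ M * wt n := fun μ β h n =>
    (norm_convOp_le R _).trans ((hk μ β h n).1)
  have hsum : ∀ μ β, Dom b μ β → Summable fun n => ‖convOp R (ker μ β n)‖ := fun μ β h =>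
    Summable.of_nonneg_of_le (fun n => norm_nonneg (convOp R (ker μ β n))) (hcb μ β h) hw
  have hn : ∀ μ β, Dom b μ β → ‖sysOp (coefC f R) (fun n => convOp R (ker μ β n))‖ ≤ S * W :=
    fun μ β h => norm_sysOp_le hφ hw (hcb μ β h)
  -- The `4` is `2 + 2` for the Lipschitz bound: one share from varying the kernels and one from
  -- varying `γ`, each with the factor `2` of `2γ`.
  refine ⟨4 * (S * W), by positivity, fun μ β h => ⟨?_, fun μ' β' h' => ?_⟩⟩
  · unfold kerSys
    refine (norm_smul_clm_le _ _).trans ?_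
    rw [norm_mul, Complex.norm_two]
    have := hn μ β h
    have := h.norm_gam_le
    calc 2 * ‖gam μ β‖ * _ ≤ 2 * 1 * (S * W) := by gcongr
      _ ≤ _ := by linarith [mul_nonneg hS0 hW0]
  · set d := ‖μ - μ'‖ + |β - β'| with hd
    have hd0 : 0 ≤ d := by positivity
    have e2 : ‖sysOp (coefC f R) (fun n => convOp R (ker μ β n)) -
          sysOp (coefC f R) (fun n => convOp R (ker μ' β' n))‖ ≤ S * (W * d) := by
      rw [sysOp_sub hφ (hsum μ β h) (hsum μ' β' h'), show W * d = ∑' n, M * wt n * d from tsum_mul_right.symm]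
      refine norm_sysOp_le hφ (hw.mul_right d) fun n => ?_
      rw [convOp_sub]
      exact (norm_convOp_le R _).trans ((hk μ β h n).2 μ' β' h')
    have e3 := h.norm_gam_le
    have e4 := norm_gam_sub_le h h'
    have e5 := hn μ' β' h'
    refine (norm_smul_sub_smul_le _ _ _ _).trans ?_
    rw [← mul_sub, norm_mul, norm_mul, Complex.norm_two]
    calc _ ≤ 2 * 1 * (S * (W * d)) + 2 * d * (S * W) := by gcongr
      _ = _ := by ring

lemma summable_convOp_of_kernelNorm {k : ℤ → C(ℝ, ℂ)} {M : ℝ}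
    (hk : ∀ n, kernelNorm R (k n) ≤ M * wt n) : Summable fun n => ‖convOp R (k n)‖ :=
  Summable.of_nonneg_of_le (fun n => norm_nonneg (convOp R (k n)))
    (fun n => (norm_convOp_le R _).trans (hk n)) (summable_wt.mul_left M)

lemma Dom.summable_kerT (h : Dom b μ β) (hR : 0 ≤ R) :
    Summable fun n => ‖convOp R (kerT μ β n)‖ := by
  obtain ⟨M, _, hM⟩ := exists_kernel_bounds hR h.pos
  exact summable_convOp_of_kernelNorm fun n => (hM μ β h n).1.1

lemma Dom.summable_kerS (h : Dom b μ β) (hR : 0 ≤ R) :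
    Summable fun n => ‖convOp R (kerS μ β n)‖ := by
  obtain ⟨M, _, hM⟩ := exists_kernel_bounds hR h.pos
  exact summable_convOp_of_kernelNorm fun n => (hM μ β h n).1.2

/-- Bound for the system operators on the parameter domain, and their Lipschitz constant. -/
def OpBound (f : ℝ × ℝ → ℝ) (R b K : ℝ) : Prop :=
  0 ≤ K ∧ ∀ μ β, Dom b μ β → (‖kerSys f R kerT μ β‖ ≤ K ∧ ‖kerSys f R kerS μ β‖ ≤ K) ∧
    ∀ μ' β', Dom b μ' β' →
      ‖kerSys f R kerT μ β - kerSys f R kerT μ' β'‖ ≤ K * (‖μ - μ'‖ + |β - β'|) ∧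
      ‖kerSys f R kerS μ β - kerSys f R kerS μ' β'‖ ≤ K * (‖μ - μ'‖ + |β - β'|)

lemma IsPert.exists_opBound (hf : IsPert f R) (hb : 0 < b) : ∃ K, OpBound f R b K := by
  obtain ⟨M, hM, hk⟩ := exists_kernel_bounds hf.pos.le hb
  obtain ⟨K1, h1, hK1⟩ := exists_kerSys_bounds (ker := kerT) hf hM fun μ β h n =>
    ⟨(hk μ β h n).1.1, fun μ' β' h' => ((hk μ β h n).2 μ' β' h').1⟩
  obtain ⟨K2, h2, hK2⟩ := exists_kerSys_bounds (ker := kerS) hf hM fun μ β h n =>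
    ⟨(hk μ β h n).1.2, fun μ' β' h' => ((hk μ β h n).2 μ' β' h').2⟩
  refine ⟨K1 + K2, by positivity, fun μ β h => ⟨⟨?_, ?_⟩, fun μ' β' h' => ⟨?_, ?_⟩⟩⟩
  · linarith [(hK1 μ β h).1]
  · linarith [(hK2 μ β h).1]
  · refine ((hK1 μ β h).2 μ' β' h').trans ?_
    gcongr; linarith
  · refine ((hK2 μ β h).2 μ' β' h').trans ?_
    gcongr; linarith

/-! ### Trigonometric sources -/

/-- `cos(kx)` on `[-R, R]`. -/
def cosC (R : ℝ) (k : ℂ) : CIcc R := ⟨fun x => Complex.cos (k * (x : ℝ)), by fun_prop⟩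

/-- `sin(kx)` on `[-R, R]`. -/
def sinC (R : ℝ) (k : ℂ) : CIcc R := ⟨fun x => Complex.sin (k * (x : ℝ)), by fun_prop⟩

@[simp] lemma cosC_apply (k : ℂ) (x : Set.Icc (-R) R) : cosC R k x = Complex.cos (k * (x : ℝ)) := rfl

@[simp] lemma sinC_apply (k : ℂ) (x : Set.Icc (-R) R) : sinC R k x = Complex.sin (k * (x : ℝ)) := rfl

lemma abs_le_two_mul (x : Set.Icc (-R) R) : |(x : ℝ)| ≤ 2 * R := by
  have h1 := x.2.1; have h2 := x.2.2
  exact abs_le.2 ⟨by linarith, by linarith⟩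

lemma cos_eq_cexp (k : ℂ) (x : ℝ) : Complex.cos (k * x) =
    (Complex.exp (Complex.I * k * x) + Complex.exp (Complex.I * (-k) * x)) / 2 := by
  rw [Complex.cos]; congr 3 <;> ring_nf

lemma sin_eq_cexp (k : ℂ) (x : ℝ) : Complex.sin (k * x) =
    (Complex.exp (Complex.I * (-k) * x) - Complex.exp (Complex.I * k * x)) * Complex.I / 2 := by
  rw [Complex.sin]; congr 4 <;> ring_nf

lemma norm_half_add_le {u v : ℂ} {P : ℝ} (hu : ‖u‖ ≤ P) (hv : ‖v‖ ≤ P) : ‖(u + v) / 2‖ ≤ P := by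
  rw [norm_div, Complex.norm_two]
  linarith [norm_add_le u v]

lemma norm_cosC_le {k : ℂ} (hk : ‖k‖ ≤ 2) : ‖cosC R k‖ ≤ Real.exp (4 * R) := by
  refine (ContinuousMap.norm_le _ (Real.exp_pos _).le).2 fun x => ?_
  rw [cosC_apply, cos_eq_cexp]
  exact norm_half_add_le (norm_cexp_le hk (abs_le_two_mul x))
    (norm_cexp_le (by rwa [norm_neg]) (abs_le_two_mul x))

lemma norm_sinC_le {k : ℂ} (hk : ‖k‖ ≤ 2) : ‖sinC R k‖ ≤ Real.exp (4 * R) := by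
  refine (ContinuousMap.norm_le _ (Real.exp_pos _).le).2 fun x => ?_
  rw [sinC_apply, sin_eq_cexp, sub_eq_add_neg, mul_div_right_comm, norm_mul, Complex.norm_I, mul_one]
  exact norm_half_add_le (norm_cexp_le (by rwa [norm_neg]) (abs_le_two_mul x))
    (by rw [norm_neg]; exact norm_cexp_le hk (abs_le_two_mul x))

lemma norm_cosC_sub_le (hR : 0 ≤ R) {k k' : ℂ} (hk : ‖k‖ ≤ 2) (hk' : ‖k'‖ ≤ 2) :
    ‖cosC R k - cosC R k'‖ ≤ Real.exp (4 * R) * (2 * R) * ‖k - k'‖ := by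
  refine (ContinuousMap.norm_le _ (by positivity)).2 fun x => ?_
  rw [ContinuousMap.sub_apply, cosC_apply, cosC_apply, cos_eq_cexp, cos_eq_cexp, ← sub_div,
    add_sub_add_comm]
  refine norm_half_add_le (norm_cexp_sub_le hk hk' (abs_le_two_mul x)) ?_
  have := norm_cexp_sub_le (k := -k) (k' := -k') (by rwa [norm_neg]) (by rwa [norm_neg])
    (abs_le_two_mul x)
  rwa [neg_sub_neg, norm_sub_rev k' k] at this

lemma cosC_even (k : ℂ) : cosC R k ∈ parityC R 1 := fun x => by
  simp [negIcc]

lemma sinC_odd (k : ℂ) : sinC R k ∈ parityC R (-1) := fun x => by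
  simp [negIcc]

lemma one_even : (1 : CIcc R) ∈ parityC R 1 := fun x => by simp

lemma cosC_real (k : ℝ) : cosC R k ∈ realC R := fun x => by
  simp [← Complex.cos_conj]

lemma sinC_real (k : ℝ) : sinC R k ∈ realC R := fun x => by
  simp [← Complex.sin_conj]

lemma one_real : (1 : CIcc R) ∈ realC R := fun x => by simp

lemma mul_mem_parityC {σ τ : ℝ} {a c : CIcc R} (ha : a ∈ parityC R σ) (hc : c ∈ parityC R τ) :
    a * c ∈ parityC R (σ * τ) := fun x => by
  rw [ContinuousMap.mul_apply, ContinuousMap.mul_apply, ha x, hc x]; push_cast; ring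

lemma mul_mem_realC {a c : CIcc R} (ha : a ∈ realC R) (hc : c ∈ realC R) :
    a * c ∈ realC R := fun x => by
  rw [ContinuousMap.mul_apply, map_mul, ha x, hc x]

lemma IsPert.coefC_even (hf : IsPert f R) (j : ℤ) : coefC f R j ∈ parityC R 1 := fun x => by
  rw [hf.coefC_apply, hf.coefC_apply]
  simp [negIcc, hf.fourierY_even]

lemma IsPert.coefC_real (hf : IsPert f R) (j : ℤ) : coefC f R j ∈ realC R := fun x => by
  rw [hf.coefC_apply, hf.conj_fourierY]

lemma IsPert.coefC_neg (hf : IsPert f R) (j : ℤ) : coefC f R (-j) = coefC f R j := by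
  ext x
  rw [hf.coefC_apply, hf.coefC_apply, hf.fourierY_neg]

/-! ### Symmetries of the kernels -/

lemma kerT_neg (n : ℤ) (x : ℝ) : kerT μ β n (-x) = kerT μ β n x := by
  rw [kerT_apply, kerT_apply]; simp [kernelH]

lemma kerS_neg (n : ℤ) (x : ℝ) : kerS μ β n (-x) = kerS μ β n x := by
  unfold kerS
  split_ifs
  · simp [propKer]
  · exact kerT_neg n x

lemma conj_cpow_half {w : ℂ} (hw : 0 ≤ w.re) (hi : w.im = 0) :
    conj (w ^ (1 / 2 : ℂ)) = w ^ (1 / 2 : ℂ) := by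
  have : w = (w.re : ℂ) := Complex.ext rfl (by simp [hi])
  rw [this, cpow_half_ofReal hw, Complex.conj_ofReal]

lemma Dom.conj_kZero {m : ℝ} (h : Dom b (m : ℂ) β) : conj (kZero m β) = kZero m β := by
  refine conj_cpow_half ?_ ?_
  · have h1 : (1 - 2 * (β : ℂ) - (m : ℂ) ^ 2).re = 1 - 2 * β - ((m : ℂ) ^ 2).re := by simp
    rw [h1]; linarith [h.re_sq_le, h.ge, h.pos]
  · simp [sq]

lemma Dom.conj_kEvan {m : ℝ} (h : Dom b (m : ℂ) β) {n : ℤ} (hn : n ≠ 0) (hn1 : n ≠ -1) :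
    conj (kEvan m β n) = kEvan m β n := by
  have he : ((β : ℂ) + n) ^ 2 - (1 - (β : ℂ)) ^ 2 + (m : ℂ) ^ 2 =
      (((β + n) ^ 2 - (1 - β) ^ 2 + m ^ 2 : ℝ) : ℂ) := by push_cast; ring
  unfold kEvan
  rw [he]
  refine conj_cpow_half ?_ (Complex.ofReal_im _)
  rw [Complex.ofReal_re]
  have h2 := evan_real_le h.pos h.le h.ge hn hn1
  have := h.pos
  have : 0 ≤ 2 * b * (n : ℝ) ^ 2 := by positivity
  nlinarith [sq_nonneg m]

/-- For real `k_0` the averaged kernel of the mode `0` is `-sin(k_0|x|)/(2k_0)`, and the other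
kernels involve only real exponentials. This realness is the purpose of the reduced system. -/
lemma Dom.conj_kerS {m : ℝ} (h : Dom b (m : ℂ) β) (n : ℤ) (x : ℝ) :
    conj (kerS m β n x) = kerS m β n x := by
  have h0 := h.conj_kZero
  unfold kerS kerT
  split_ifs with h1 h2
  · change conj ((1 / 2 : ℂ) * (Complex.I / (2 * kZero m β) *
        Complex.exp (Complex.I * kZero m β * (|x| : ℝ)) + Complex.I / (2 * -kZero m β) *
        Complex.exp (Complex.I * -kZero m β * (|x| : ℝ)))) = _
    simp only [map_mul, map_add, map_div₀, ← Complex.exp_conj, map_neg, Complex.conj_I,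
      Complex.conj_ofReal, h0, map_one, map_ofNat]
    change _ = ((1 / 2 : ℂ) * (Complex.I / (2 * kZero m β) *
        Complex.exp (Complex.I * kZero m β * (|x| : ℝ)) + Complex.I / (2 * -kZero m β) *
        Complex.exp (Complex.I * -kZero m β * (|x| : ℝ))))
    simp only [mul_neg, neg_mul, div_neg, neg_div, neg_neg]
    ring
  · change conj (if (m : ℂ) = 0 then -((|x| : ℝ) : ℂ) / 2 else
      (Complex.exp (-((m : ℂ) * (|x| : ℝ))) - 1) / (2 * (m : ℂ))) = (if (m : ℂ) = 0 then
        -((|x| : ℝ) : ℂ) / 2 else (Complex.exp (-((m : ℂ) * (|x| : ℝ))) - 1) / (2 * (m : ℂ)))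
    split_ifs <;> simp [← Complex.exp_conj, map_ofNat]
  · change conj (1 / (2 * kEvan m β n) * Complex.exp (-(kEvan m β n * (|x| : ℝ)))) =
      1 / (2 * kEvan m β n) * Complex.exp (-(kEvan m β n * (|x| : ℝ)))
    simp only [map_mul, map_div₀, ← Complex.exp_conj, map_neg, Complex.conj_ofReal,
      h.conj_kEvan h1 h2, map_one, map_ofNat]

lemma smul_kerSys_apply (e : ℂ) (ker : ℂ → ℝ → ℤ → C(ℝ, ℂ)) (A : SpaceA R) (m : ℤ)
    (x : Set.Icc (-R) R) : (e • kerSys f R ker μ β) A m x =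
      e * (2 * gam μ β * sysOp (coefC f R) (fun n => convOp R (ker μ β n)) A m x) := rfl

lemma kerSys_kerS_mem_parity (hf : IsPert f R) (h : Dom b μ β) {σ : ℝ} {A : SpaceA R}
    (hA : A ∈ seqIn (parityC R σ)) (e : ℂ) : (e • kerSys f R kerS μ β) A ∈ seqIn (parityC R σ) := by
  have h1 := sysOp_mem_seqIn hf.summable_coefC (h.summable_kerS hf.pos.le) (isClosed_parityC σ)
    (fun j a ha => by simpa using mul_mem_parityC (hf.coefC_even j) ha)
    (fun n a ha => convOp_mem_parityC (kerS_neg n) ha) hA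
  intro m x
  rw [smul_kerSys_apply, smul_kerSys_apply, h1 m x]; ring

lemma Dom.conj_gam {m : ℝ} : conj (gam m β) = gam m β := by
  unfold gam; simp [map_ofNat]

lemma kerSys_kerS_mem_real (hf : IsPert f R) {m : ℝ} (h : Dom b (m : ℂ) β) {A : SpaceA R}
    (hA : A ∈ seqIn (realC R)) (e : ℝ) : ((e : ℂ) • kerSys f R kerS m β) A ∈ seqIn (realC R) := by
  have h1 := sysOp_mem_seqIn hf.summable_coefC (h.summable_kerS hf.pos.le) isClosed_realC
    (fun j a ha => mul_mem_realC (hf.coefC_real j) ha)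
    (fun n a ha => convOp_mem_realC (h.conj_kerS n) ha) hA
  intro k x
  rw [smul_kerSys_apply, map_mul, map_mul, map_mul, h1 k x, Dom.conj_gam, Complex.conj_ofReal,
    map_ofNat]
end

/-! ### Solutions of the reduced system -/

/-- `(1 - εT)⁻¹` applied to `(f_{m-k} ψ)_m`, where `T` has the kernels `kerS`. -/
def redSol (f : ℝ × ℝ → ℝ) (R ε : ℝ) (μ : ℂ) (β : ℝ) (k : ℤ) (ψ : CIcc R) : SpaceA R :=
  neumann ((ε : ℂ) • kerSys f R kerS μ β) (srcOp (coefC f R) k ψ)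

/-- `⟨Y_{-1}⟩` for the reduced system. -/
def sF (f : ℝ × ℝ → ℝ) (R ε : ℝ) (μ : ℂ) (β : ℝ) : ℂ := intC R (redSol f R ε μ β (-1) 1 (-1))

/-- `⟨Y_0 cos k_0x⟩` for the reduced system. -/
def sr (f : ℝ × ℝ → ℝ) (R ε : ℝ) (μ : ℂ) (β : ℝ) : ℂ :=
  intC R (redSol f R ε μ β (-1) 1 0 * cosC R (kZero μ β))

/-- `⟨Z_0 cos k_0x⟩` for the reduced system, where `Z` has the source `cos k_0x`. -/
def sz (f : ℝ × ℝ → ℝ) (R ε : ℝ) (μ : ℂ) (β : ℝ) : ℂ :=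
  intC R (redSol f R ε μ β 0 (cosC R (kZero μ β)) 0 * cosC R (kZero μ β))

/-- `⟨W_0 sin k_0x⟩` for the reduced system, where `W` has the source `sin k_0x`. -/
def sw (f : ℝ × ℝ → ℝ) (R ε : ℝ) (μ : ℂ) (β : ℝ) : ℂ :=
  intC R (redSol f R ε μ β 0 (sinC R (kZero μ β)) 0 * sinC R (kZero μ β))

/-- `εγ/k_0`. -/
def sa (ε : ℝ) (μ : ℂ) (β : ℝ) : ℂ := ε * gam μ β / kZero μ β

section
variable {f : ℝ × ℝ → ℝ} {R b K ε : ℝ} {μ μ' : ℂ} {β β' : ℝ}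

/-- The parameters for which the Neumann series is used. -/
structure Adm (f : ℝ × ℝ → ℝ) (R b K ε : ℝ) (μ : ℂ) (β : ℝ) : Prop where
  pert : IsPert f R
  bound : OpBound f R b K
  eps : 0 ≤ ε
  small : ε * K ≤ 1 / 2
  dom : Dom b μ β

lemma Adm.norm_kerS_le (h : Adm f R b K ε μ β) : ‖(ε : ℂ) • kerSys f R kerS μ β‖ ≤ ε * K := by
  refine (norm_smul_clm_le _ _).trans ?_
  rw [Complex.norm_real, Real.norm_of_nonneg h.eps]
  exact mul_le_mul_of_nonneg_left (h.bound.2 μ β h.dom).1.2 h.eps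

lemma Adm.norm_kerT_le (h : Adm f R b K ε μ β) : ‖(ε : ℂ) • kerSys f R kerT μ β‖ ≤ ε * K := by
  refine (norm_smul_clm_le _ _).trans ?_
  rw [Complex.norm_real, Real.norm_of_nonneg h.eps]
  exact mul_le_mul_of_nonneg_left (h.bound.2 μ β h.dom).1.1 h.eps

lemma Adm.norm_kerS_sub_le (h : Adm f R b K ε μ β) (h' : Dom b μ' β') :
    ‖(ε : ℂ) • kerSys f R kerS μ β - (ε : ℂ) • kerSys f R kerS μ' β'‖ ≤
      ε * K * (‖μ - μ'‖ + |β - β'|) := by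
  refine (norm_smul_sub_smul_le _ _ _ _).trans ?_
  rw [sub_self, norm_zero, zero_mul, add_zero, Complex.norm_real, Real.norm_of_nonneg h.eps, mul_assoc]
  exact mul_le_mul_of_nonneg_left ((h.bound.2 μ β h.dom).2 μ' β' h').2 h.eps

lemma Adm.norm_kerT_sub_le (h : Adm f R b K ε μ β) (h' : Dom b μ' β') :
    ‖(ε : ℂ) • kerSys f R kerT μ β - (ε : ℂ) • kerSys f R kerT μ' β'‖ ≤
      ε * K * (‖μ - μ'‖ + |β - β'|) := by
  refine (norm_smul_sub_smul_le _ _ _ _).trans ?_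
  rw [sub_self, norm_zero, zero_mul, add_zero, Complex.norm_real, Real.norm_of_nonneg h.eps, mul_assoc]
  exact mul_le_mul_of_nonneg_left ((h.bound.2 μ β h.dom).2 μ' β' h').1 h.eps

lemma Adm.redSol_spec (h : Adm f R b K ε μ β) (k : ℤ) (ψ : CIcc R) :
    redSol f R ε μ β k ψ - ((ε : ℂ) • kerSys f R kerS μ β) (redSol f R ε μ β k ψ) =
      srcOp (coefC f R) k ψ :=
  neumann_spec (h.norm_kerS_le.trans h.small) _

lemma Adm.src_apply (h : Adm f R b K ε μ β) (k : ℤ) (ψ : CIcc R) (m : ℤ) :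
    srcOp (coefC f R) k ψ m = coefC f R (m - k) * ψ := srcOp_apply h.pert.summable_coefC k ψ m

lemma Adm.redSol_parity (h : Adm f R b K ε μ β) (k : ℤ) {ψ : CIcc R} {σ : ℝ}
    (hψ : ψ ∈ parityC R σ) : redSol f R ε μ β k ψ ∈ seqIn (parityC R σ) := by
  refine neumann_mem (h.norm_kerS_le.trans h.small) _ (isClosed_seqIn (isClosed_parityC σ))
    (fun A hA => kerSys_kerS_mem_parity h.pert h.dom hA _) fun m => ?_
  rw [h.src_apply]
  simpa using mul_mem_parityC (h.pert.coefC_even _) hψ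

/-- Coefficients, kernels and `ε` are real, so the Neumann series stays among real-valued sequences.
Hence the four scalars of the reduced system are real at real parameters. -/
lemma Adm.redSol_real {m : ℝ} (h : Adm f R b K ε m β) (k : ℤ) {ψ : CIcc R}
    (hψ : ψ ∈ realC R) : redSol f R ε m β k ψ ∈ seqIn (realC R) := by
  refine neumann_mem (h.norm_kerS_le.trans h.small) _ (isClosed_seqIn isClosed_realC)
    (fun A hA => kerSys_kerS_mem_real h.pert h.dom hA _) fun m => ?_
  rw [h.src_apply]
  exact mul_mem_realC (h.pert.coefC_real _) hψ

lemma Adm.kZero_ofReal {m : ℝ} (h : Adm f R b K ε m β) : (((kZero m β).re : ℝ) : ℂ) = kZero m β :=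
  Complex.conj_eq_iff_re.1 h.dom.conj_kZero

lemma Adm.cosC_real {m : ℝ} (h : Adm f R b K ε m β) : cosC R (kZero m β) ∈ realC R := by
  rw [← h.kZero_ofReal]; exact RayleighBloch.cosC_real _

lemma Adm.sinC_real {m : ℝ} (h : Adm f R b K ε m β) : sinC R (kZero m β) ∈ realC R := by
  rw [← h.kZero_ofReal]; exact RayleighBloch.sinC_real _

lemma Adm.sF_ofReal {m : ℝ} (h : Adm f R b K ε m β) :
    (((sF f R ε m β).re : ℝ) : ℂ) = sF f R ε m β :=
  Complex.conj_eq_iff_re.1 (intC_conj (h.redSol_real (-1) one_real (-1)))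

lemma Adm.sr_ofReal {m : ℝ} (h : Adm f R b K ε m β) :
    (((sr f R ε m β).re : ℝ) : ℂ) = sr f R ε m β :=
  Complex.conj_eq_iff_re.1 (intC_conj (mul_mem_realC (h.redSol_real (-1) one_real 0) h.cosC_real))

lemma Adm.sz_ofReal {m : ℝ} (h : Adm f R b K ε m β) :
    (((sz f R ε m β).re : ℝ) : ℂ) = sz f R ε m β :=
  Complex.conj_eq_iff_re.1 (intC_conj (mul_mem_realC (h.redSol_real 0 h.cosC_real 0) h.cosC_real))

lemma Adm.sw_ofReal {m : ℝ} (h : Adm f R b K ε m β) :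
    (((sw f R ε m β).re : ℝ) : ℂ) = sw f R ε m β :=
  Complex.conj_eq_iff_re.1 (intC_conj (mul_mem_realC (h.redSol_real 0 h.sinC_real 0) h.sinC_real))

/-- Coefficients and kernels are even in `x`, hence parity is preserved. The sine problem therefore
decouples from the cosine and threshold problems, and all cross terms vanish. -/
lemma Adm.intC_even_mul_sin (h : Adm f R b K ε μ β) (k : ℤ) {ψ : CIcc R} (hψ : ψ ∈ parityC R 1)
    (κ : ℂ) : intC R (redSol f R ε μ β k ψ 0 * sinC R κ) = 0 :=
  intC_eq_zero_of_odd (by simpa using mul_mem_parityC (h.redSol_parity k hψ 0) (sinC_odd κ))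

lemma Adm.intC_odd_mul_even (h : Adm f R b K ε μ β) (k m : ℤ) {ψ χ : CIcc R}
    (hψ : ψ ∈ parityC R (-1)) (hχ : χ ∈ parityC R 1) :
    intC R (redSol f R ε μ β k ψ m * χ) = 0 :=
  intC_eq_zero_of_odd (by simpa using mul_mem_parityC (h.redSol_parity k hψ m) hχ)

/-- Reciprocity between the source `1` in the threshold slot and the source `cos k_0x` in the
propagating slot. It makes the correction to `F` a perfect square in `sr`. -/
lemma Adm.sr_eq (h : Adm f R b K ε μ β) :
    intC R (redSol f R ε μ β 0 (cosC R (kZero μ β)) (-1)) = sr f R ε μ β := by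
  have key := fun k ψ => h.redSol_spec k ψ
  have e : ∀ A : SpaceA R, ((ε : ℂ) • kerSys f R kerS μ β) A =
      ((ε : ℂ) * (2 * gam μ β)) • sysOp (coefC f R) (fun n => convOp R (kerS μ β n)) A := fun A => by
    rw [mul_smul]; rfl
  simp only [e] at key
  have := intC_symm h.pert.summable_coefC (h.dom.summable_kerS h.pert.pos.le) h.pert.coefC_neg
    (fun n a c => intC_convOp_comm (kerS_neg n) a c) (key (-1) 1) (key 0 (cosC R (kZero μ β)))
  rw [mul_one] at this
  exact this.symm

/-! ### The full system -/

lemma Dom.kZero_ne (h : Dom b μ β) : kZero μ β ≠ 0 := by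
  intro h0
  have := h.kZero_re
  rw [h0] at this
  have h2 := Real.sqrt_pos.2 h.pos
  simp at this; linarith

/-- The two kernels of the mode `0` differ by `(i/2k_0) cos k_0(x - ξ)`, since the absolute value
disappears under the cosine; the addition theorem splits this into an even and an odd rank-one part.
-/
lemma convOp_kerT_zero (a : CIcc R) : convOp R (kerT μ β 0) a = convOp R (kerS μ β 0) a +
    (Complex.I / (2 * kZero μ β)) • (intC R (a * cosC R (kZero μ β)) • cosC R (kZero μ β) +
      intC R (a * sinC R (kZero μ β)) • sinC R (kZero μ β)) := by
  set k := kZero μ β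
  have hk : kerT μ β 0 - kerS μ β 0 = (Complex.I / (2 * k)) •
      (⟨fun x => Complex.cos (k * (x : ℝ)), by fun_prop⟩ : C(ℝ, ℂ)) := by
    ext x
    simp only [kerT, kerS, if_true]
    change Complex.I / (2 * k) * Complex.exp (Complex.I * k * (|x| : ℝ)) -
      1 / 2 * (Complex.I / (2 * k) * Complex.exp (Complex.I * k * (|x| : ℝ)) +
        Complex.I / (2 * -k) * Complex.exp (Complex.I * -k * (|x| : ℝ))) =
      Complex.I / (2 * k) * Complex.cos (k * x)
    have hc : Complex.cos (k * x) = Complex.cos (k * (|x| : ℝ)) := by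
      rcases abs_choice x with h | h <;> rw [h] ; simp
    rw [hc, cos_eq_cexp, mul_neg 2 k, div_neg]
    ring
  have hs : convOp R (kerT μ β 0) a - convOp R (kerS μ β 0) a =
      convOp R (kerT μ β 0 - kerS μ β 0) a := by rw [← convOp_sub]; rfl
  rw [← sub_eq_iff_eq_add', hs, hk]
  ext x
  simp only [convOp_apply, ContinuousMap.smul_apply, ContinuousMap.add_apply, ContinuousMap.coe_mk,
    smul_eq_mul, intC_apply, ContinuousMap.mul_apply, cosC_apply, sinC_apply]
  rw [← integral_mul_const, ← integral_mul_const, ← integral_add (integrable_lebIcc (by fun_prop))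
    (integrable_lebIcc (by fun_prop)), ← integral_const_mul]
  congr 1; ext ξ
  push_cast
  rw [mul_sub k, Complex.cos_sub]; ring

/-- Only the column `n = 0` of the matrix changes, so the full operator is a rank-two perturbation
of the reduced one. Its strength is `ε · 2γ · i/(2k_0) = i a`. -/
lemma Adm.kerT_apply (h : Adm f R b K ε μ β) (A : SpaceA R) :
    ((ε : ℂ) • kerSys f R kerT μ β) A = ((ε : ℂ) • kerSys f R kerS μ β) A +
      (Complex.I * sa ε μ β) • (intC R (A 0 * cosC R (kZero μ β)) •
          srcOp (coefC f R) 0 (cosC R (kZero μ β)) +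
        intC R (A 0 * sinC R (kZero μ β)) • srcOp (coefC f R) 0 (sinC R (kZero μ β))) := by
  set k := kZero μ β with hk
  have hφ := h.pert.summable_coefC
  have hd : sysOp (coefC f R) (fun n => convOp R (kerT μ β n)) A =
      sysOp (coefC f R) (fun n => convOp R (kerS μ β n)) A +
      (Complex.I / (2 * k)) • (intC R (A 0 * cosC R k) • srcOp (coefC f R) 0 (cosC R k) +
        intC R (A 0 * sinC R k) • srcOp (coefC f R) 0 (sinC R k)) := by
    refine lp.ext (funext fun m => ?_)
    have h1 := hasSum_sysOp_apply hφ (h.dom.summable_kerT h.pert.pos.le) A m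
    have h2 := hasSum_sysOp_apply hφ (h.dom.summable_kerS h.pert.pos.le) A m
    have h3 := hasSum_single (f := fun n : ℤ => if n = 0 then coefC f R m *
      ((Complex.I / (2 * k)) • (intC R (A 0 * cosC R k) • cosC R k +
        intC R (A 0 * sinC R k) • sinC R k)) else 0) 0 (fun n hn => if_neg hn)
    rw [if_pos rfl] at h3
    have h4 := h2.add h3
    have h5 := h1.unique (h4.congr_fun fun n => by
      by_cases hn : n = 0
      · subst hn
        rw [if_pos rfl, convOp_kerT_zero, mul_add, sub_zero]
      · simp only [if_neg hn, add_zero, kerS])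
    rw [h5]
    change _ = sysOp (coefC f R) (fun n => convOp R (kerS μ β n)) A m +
      (Complex.I / (2 * k)) • (intC R (A 0 * cosC R k) • srcOp (coefC f R) 0 (cosC R k) m +
        intC R (A 0 * sinC R k) • srcOp (coefC f R) 0 (sinC R k) m)
    rw [h.src_apply, h.src_apply, sub_zero, mul_smul_comm, mul_add, mul_smul_comm, mul_smul_comm]
  have e : ∀ ker : ℂ → ℝ → ℤ → C(ℝ, ℂ), ((ε : ℂ) • kerSys f R ker μ β) A =
      ((ε : ℂ) * (2 * gam μ β)) • sysOp (coefC f R) (fun n => convOp R (ker μ β n)) A := fun ker => by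
    rw [mul_smul]; rfl
  rw [e, e, hd, smul_add, smul_smul _ (Complex.I / (2 * k))]
  congr 2
  have := h.dom.kZero_ne
  rw [← hk] at this
  unfold sa
  rw [← hk]
  field_simp

lemma Adm.opT_eq (h : Adm f R b K ε μ β) (A : SpaceA R) (m : ℤ) (x : Set.Icc (-R) R) :
    opT f R μ β A m x = kerSys f R kerT μ β A m x := by
  have h1 := (hasSum_sysOp_apply h.pert.summable_coefC (h.dom.summable_kerT h.pert.pos.le) A m).mapL
    (ContinuousMap.evalCLM ℂ x)
  unfold opT
  change _ = 2 * gam μ β * sysOp (coefC f R) (fun n => convOp R (kerT μ β n)) A m x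
  congr 1
  rw [← show ∑' n, _ = sysOp (coefC f R) (fun n => convOp R (kerT μ β n)) A m x from h1.tsum_eq]
  congr 1; ext n
  change _ = coefC f R (m - n) x * convOp R (kerT μ β n) (A n) x
  rw [h.pert.coefC_apply, convOp_apply, mul_comm]
  simp only [RayleighBloch.kerT_apply]

lemma Adm.solvesSystem_iff (h : Adm f R b K ε μ β) (A : SpaceA R) :
    SolvesSystem f R ε μ β A ↔
      A - ((ε : ℂ) • kerSys f R kerT μ β) A = srcOp (coefC f R) (-1) 1 := by
  have e : ∀ m x, (A - ((ε : ℂ) • kerSys f R kerT μ β) A) m x = A m x - ε * opT f R μ β A m x :=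
    fun m x => by rw [h.opT_eq]; rfl
  have e2 : ∀ m (x : Set.Icc (-R) R), srcOp (coefC f R) (-1) 1 m x = fourierY f (m + 1) x := by
    intro m x
    rw [h.src_apply, mul_one, h.pert.coefC_apply, sub_neg_eq_add]
  constructor
  · intro hA
    refine lp.ext (funext fun m => ?_)
    ext x
    rw [e, e2]; exact hA m x
  · intro hA m x
    rw [← e, ← e2, hA]

lemma Adm.vecY_spec (h : Adm f R b K ε μ β) :
    vecY f R ε μ β - ((ε : ℂ) • kerSys f R kerT μ β) (vecY f R ε μ β) =
      srcOp (coefC f R) (-1) 1 := by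
  have hT := h.norm_kerT_le.trans h.small
  -- Uniqueness is part of what is needed here: without it `vecY` would take its default value `0`.
  have hex : ∃! Y : SpaceA R, SolvesSystem f R ε μ β Y := by
    refine ⟨neumann ((ε : ℂ) • kerSys f R kerT μ β) (srcOp (coefC f R) (-1) 1), ?_, fun Y hY => ?_⟩
    · exact (h.solvesSystem_iff _).2 (neumann_spec hT _)
    · exact fixed_unique hT ((h.solvesSystem_iff _).1 hY) (neumann_spec hT _)
  have : vecY f R ε μ β = hex.choose := by unfold vecY; rw [dif_pos hex]
  rw [this]
  exact (h.solvesSystem_iff _).1 hex.choose_spec.1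

/-- The source is even, so only the cosine part of the rank-two perturbation acts. The solution is
`Y + iaρZ`, where `ρ` is its own pairing with `cos k_0x`. -/
lemma Adm.vecY_eq (h : Adm f R b K ε μ β)
    (hne : 1 - Complex.I * sa ε μ β * sz f R ε μ β ≠ 0) :
    vecY f R ε μ β = redSol f R ε μ β (-1) 1 +
      (Complex.I * sa ε μ β * (sr f R ε μ β / (1 - Complex.I * sa ε μ β * sz f R ε μ β))) •
        redSol f R ε μ β 0 (cosC R (kZero μ β)) := by
  refine fixed_unique (h.norm_kerT_le.trans h.small) h.vecY_spec ?_
  set k := kZero μ β with hk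
  set a := sa ε μ β
  set Y := redSol f R ε μ β (-1) 1 with hY
  set Z := redSol f R ε μ β 0 (cosC R k) with hZ
  -- This solves the consistency condition `ρ = sr + i a ρ sz`.
  set ρ := sr f R ε μ β / (1 - Complex.I * a * sz f R ε μ β) with hρ
  set A := Y + (Complex.I * a * ρ) • Z with hA
  have h1 : intC R (A 0 * cosC R k) = ρ := by
    have : A 0 * cosC R k = Y 0 * cosC R k + (Complex.I * a * ρ) • (Z 0 * cosC R k) := by
      rw [← smul_mul_assoc, ← add_mul]; rfl
    rw [this, map_add, map_smul, smul_eq_mul]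
    change sr f R ε μ β + Complex.I * a * ρ * sz f R ε μ β = ρ
    rw [hρ]; field_simp; ring
  have h2 : intC R (A 0 * sinC R k) = 0 := by
    have : A 0 * sinC R k = Y 0 * sinC R k + (Complex.I * a * ρ) • (Z 0 * sinC R k) := by
      rw [← smul_mul_assoc, ← add_mul]; rfl
    rw [this, map_add, map_smul, hY, hZ, h.intC_even_mul_sin _ one_even,
      h.intC_even_mul_sin _ (cosC_even k), smul_zero, add_zero]
  have e1 := h.redSol_spec (-1) 1
  have e2 := h.redSol_spec 0 (cosC R k)
  rw [h.kerT_apply, h1, h2, hA, map_add, map_smul, ← e1, zero_smul, add_zero, ← e2]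
  simp only [← hY, ← hZ, smul_sub, smul_smul]
  abel

lemma Adm.dispF_eq (h : Adm f R b K ε μ β)
    (hne : 1 - Complex.I * sa ε μ β * sz f R ε μ β ≠ 0) :
    dispF f R ε μ β = sF f R ε μ β + Complex.I * sa ε μ β * sr f R ε μ β ^ 2 /
      (1 - Complex.I * sa ε μ β * sz f R ε μ β) := by
  change intC R (vecY f R ε μ β (-1)) = _
  rw [h.vecY_eq hne]
  change intC R (redSol f R ε μ β (-1) 1 (-1) +
    (_ : ℂ) • redSol f R ε μ β 0 (cosC R (kZero μ β)) (-1)) = _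
  rw [map_add, map_smul, h.sr_eq, smul_eq_mul]
  unfold sF; ring

/-- In `e^{ik_0x} = cos k_0x + i sin k_0x` the sine part pairs to zero with the even solution, and
the rest is the number `ρ` of the rank-one correction. -/
lemma Adm.orthR_eq (h : Adm f R b K ε μ β)
    (hne : 1 - Complex.I * sa ε μ β * sz f R ε μ β ≠ 0) :
    orthR f R ε μ β = sr f R ε μ β / (1 - Complex.I * sa ε μ β * sz f R ε μ β) := by
  set k := kZero μ β with hk
  have h0 : orthR f R ε μ β = intC R (vecY f R ε μ β 0 * (cosC R k + Complex.I • sinC R k)) := by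
    rw [intC_apply]; unfold orthR
    congr 1; ext x
    change _ = vecY f R ε μ β 0 x * (Complex.cos (k * (x : ℝ)) + Complex.I * Complex.sin (k * (x : ℝ)))
    rw [show Complex.I * kZero μ β * ((x : ℝ) : ℂ) = (k * (x : ℝ)) * Complex.I by rw [hk]; ring,
      Complex.exp_mul_I]
    ring
  rw [h0, h.vecY_eq hne]
  set a := sa ε μ β
  set c := Complex.I * a * (sr f R ε μ β / (1 - Complex.I * a * sz f R ε μ β)) with hc
  change intC R ((redSol f R ε μ β (-1) 1 0 + c • redSol f R ε μ β 0 (cosC R k) 0) *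
    (cosC R k + Complex.I • sinC R k)) = _
  rw [mul_add, mul_smul_comm, add_mul, add_mul, smul_mul_assoc, smul_mul_assoc]
  simp only [map_add, map_smul]
  rw [h.intC_even_mul_sin _ one_even, h.intC_even_mul_sin _ (cosC_even k), smul_zero, add_zero,
    smul_zero, add_zero, smul_eq_mul]
  change sr f R ε μ β + c * sz f R ε μ β = _
  rw [hc]; field_simp; ring
end

section
variable {f : ℝ × ℝ → ℝ} {R b K ε : ℝ} {μ μ' : ℂ} {β β' : ℝ}

/-! ### Estimates for the reduced quantities -/

/-- The source is the same for both operators, so parameters enter only through `T`; this is why the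
Lipschitz bound carries the small factor `e`. -/
lemma neumann_bounds {V : Type*} [NormedAddCommGroup V] [NormedSpace ℂ V] {T T' : V →L[ℂ] V}
    {e d : ℝ} (hT : ‖T‖ ≤ e) (hT' : ‖T'‖ ≤ e) (he : e ≤ 1 / 2) (hTT : ‖T - T'‖ ≤ e * d) {y y' g : V}
    (hy : y - T y = g) (hy' : y' - T' y' = g) :
    ‖y‖ ≤ 2 * ‖g‖ ∧ ‖y - g‖ ≤ 2 * e * ‖g‖ ∧ ‖y - y'‖ ≤ 4 * e * d * ‖g‖ := by
  have he0 : 0 ≤ e := (norm_nonneg _).trans hT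
  have h1 := norm_le_of_fixed (hT.trans he) hy
  have h1' := norm_le_of_fixed (hT'.trans he) hy'
  refine ⟨h1, ?_, ?_⟩
  · rw [show y - g = T y by rw [← hy]; abel]
    calc ‖T y‖ ≤ ‖T‖ * ‖y‖ := T.le_opNorm y
      _ ≤ e * (2 * ‖g‖) := by gcongr
      _ = _ := by ring
  · have := norm_le_two_mul_of_fixed (hT.trans he) hy hy'
    rw [sub_self, norm_zero, zero_add] at this
    calc _ ≤ 2 * (‖T - T'‖ * ‖y'‖) := this
      _ ≤ 2 * (e * d * (2 * ‖g‖)) := by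
        have := (norm_nonneg _).trans hTT
        gcongr
      _ = _ := by ring

lemma norm_intC_coord_mul_le (A : SpaceA R) (m : ℤ) (χ : CIcc R) :
    ‖intC R (A m * χ)‖ ≤ ‖intC R‖ * (‖A‖ * ‖χ‖) :=
  ((intC R).le_opNorm _).trans (mul_le_mul_of_nonneg_left
    ((norm_mul_le _ _).trans (mul_le_mul_of_nonneg_right (norm_apply_le A m) (norm_nonneg _)))
    (norm_nonneg _))

lemma norm_src_le (φ : ℤ → CIcc R) (k : ℤ) (ψ : CIcc R) {P : ℝ} (hψ : ‖ψ‖ ≤ P) :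
    ‖srcOp φ k ψ‖ ≤ ‖srcOp φ k‖ * P :=
  ((srcOp φ k).le_opNorm _).trans (mul_le_mul_of_nonneg_left hψ (norm_nonneg _))

lemma Adm.of_dom (h : Adm f R b K ε μ β) (h' : Dom b μ' β') : Adm f R b K ε μ' β' :=
  ⟨h.pert, h.bound, h.eps, h.small, h'⟩

/-- Bounds on the reduced quantities. -/
structure RedBounds (f : ℝ × ℝ → ℝ) (R b K C : ℝ) : Prop where
  nonneg : 0 ≤ C
  disp : ∀ ε μ β, Adm f R b K ε μ β → ‖dispF f R ε μ β - intC R (coefC f R 0)‖ ≤ C * ε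
  disp_lip : ∀ ε μ β, Adm f R b K ε μ β → ∀ μ' β', Dom b μ' β' →
    ‖dispF f R ε μ β - dispF f R ε μ' β'‖ ≤ C * ε * (‖μ - μ'‖ + |β - β'|)
  sF : ∀ ε μ β, Adm f R b K ε μ β → ‖sF f R ε μ β - intC R (coefC f R 0)‖ ≤ C * ε
  sF_lip : ∀ ε μ β, Adm f R b K ε μ β → ∀ μ' β', Dom b μ' β' →
    ‖RayleighBloch.sF f R ε μ β - RayleighBloch.sF f R ε μ' β'‖ ≤ C * ε * (‖μ - μ'‖ + |β - β'|)
  sr : ∀ ε μ β, Adm f R b K ε μ β →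
    ‖sr f R ε μ β - intC R (coefC f R 1 * cosC R (kZero μ β))‖ ≤ C * ε
  -- Only the deviation of `sr` from its leading term varies at order `ε`; the leading term itself
  -- varies at order one in `β`.
  sr_lip : ∀ ε μ β, Adm f R b K ε μ β → ∀ μ' β', Dom b μ' β' →
    ‖(RayleighBloch.sr f R ε μ β - intC R (coefC f R 1 * cosC R (kZero μ β))) -
      (RayleighBloch.sr f R ε μ' β' - intC R (coefC f R 1 * cosC R (kZero μ' β')))‖ ≤
        C * ε * (‖μ - μ'‖ + |β - β'|)
  sz : ∀ ε μ β, Adm f R b K ε μ β → ‖sz f R ε μ β‖ ≤ C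
  sw : ∀ ε μ β, Adm f R b K ε μ β → ‖sw f R ε μ β‖ ≤ C
  -- To leading order `sz - sw` is `∫ f_0 (cos² - sin²)(k_0x) dx`, which is the origin of
  -- `f̃_0(2κ₀)` in `q`.
  diff : ∀ ε μ β, Adm f R b K ε μ β → ‖RayleighBloch.sz f R ε μ β - RayleighBloch.sw f R ε μ β -
    intC R (coefC f R 0 * cosC R (2 * kZero μ β))‖ ≤ C * ε

lemma exists_redBounds (hf : IsPert f R) (hb : 0 < b) (hK : OpBound f R b K) :
    ∃ C, RedBounds f R b K C := by
  set φ := coefC f R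
  set N := ‖intC R‖ with hN
  set g := srcOp φ (-1) 1 with hg
  set G := ‖g‖ with hG
  set x := Real.exp (4 * R) with hx
  set S := ‖srcOp φ 0‖ with hS
  set s := 1 / Real.sqrt b with hs
  have hs0 : 0 ≤ s := by positivity
  have hx0 : 0 ≤ x := (Real.exp_pos _).le
  have hN0 : 0 ≤ N := norm_nonneg (intC R)
  have hG0 : 0 ≤ G := norm_nonneg g
  have hS0 : 0 ≤ S := norm_nonneg (srcOp φ 0)
  have hK0 := hK.1
  have hR := hf.pos.le
  -- The source is shifted by one index: its entries `-1` and `0` are `f_0` and `f_1`. Hence the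
  -- leading terms `f̃_0(0)` of `sF` and `f̃_1(k_0)` of `sr`.
  have hgm : ∀ m, g m = φ (m + 1) := fun m => by
    rw [hg, srcOp_apply hf.summable_coefC, mul_one, sub_neg_eq_add]

  have hc : ∀ μ β, Dom b μ β → ‖cosC R (kZero μ β)‖ ≤ x := fun μ β h =>
    norm_cosC_le h.norm_kZero_le
  have hsn : ∀ μ β, Dom b μ β → ‖sinC R (kZero μ β)‖ ≤ x := fun μ β h =>
    norm_sinC_le h.norm_kZero_le
  have bT : ∀ ε μ β, Adm f R b K ε μ β → ∀ μ' β', Dom b μ' β' →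
      ‖vecY f R ε μ β - g‖ ≤ 2 * (ε * K) * G ∧
      ‖vecY f R ε μ β - vecY f R ε μ' β'‖ ≤ 4 * (ε * K) * (‖μ - μ'‖ + |β - β'|) * G :=
    fun ε μ β h μ' β' h' => (neumann_bounds h.norm_kerT_le (h.of_dom h').norm_kerT_le h.small
      (h.norm_kerT_sub_le h') h.vecY_spec (h.of_dom h').vecY_spec).2
  have bS : ∀ ε μ β, Adm f R b K ε μ β → ∀ μ' β', Dom b μ' β' →
      ‖redSol f R ε μ β (-1) 1 - g‖ ≤ 2 * (ε * K) * G ∧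
      ‖redSol f R ε μ β (-1) 1 - redSol f R ε μ' β' (-1) 1‖ ≤
        4 * (ε * K) * (‖μ - μ'‖ + |β - β'|) * G :=
    fun ε μ β h μ' β' h' => (neumann_bounds h.norm_kerS_le (h.of_dom h').norm_kerS_le h.small
      (h.norm_kerS_sub_le h') (h.redSol_spec _ _) ((h.of_dom h').redSol_spec _ _)).2
  have bP : ∀ ε μ β, Adm f R b K ε μ β → ∀ ψ : CIcc R, ‖ψ‖ ≤ x →
      ‖redSol f R ε μ β 0 ψ‖ ≤ 2 * (S * x) ∧
      ‖redSol f R ε μ β 0 ψ - srcOp φ 0 ψ‖ ≤ 2 * (ε * K) * (S * x) := by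
    intro ε μ β h ψ hψ
    have h1 := neumann_bounds (d := 0) h.norm_kerS_le h.norm_kerS_le h.small (by simp)
      (h.redSol_spec 0 ψ) (h.redSol_spec 0 ψ)
    have h2 := norm_src_le φ 0 ψ hψ
    refine ⟨h1.1.trans (by gcongr), h1.2.1.trans ?_⟩
    have := h.eps
    gcongr
  have bI : ∀ (A : SpaceA R) m, ‖intC R (A m)‖ ≤ N * ‖A‖ := fun A m =>
    ((intC R).le_opNorm _).trans (mul_le_mul_of_nonneg_left (norm_apply_le A m) hN0)
  have lin : ∀ (A B : SpaceA R) m, intC R (A m) - intC R (B m) = intC R ((A - B) m) := fun A B m => by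
    rw [← map_sub]; rfl
  have linm : ∀ (A B : SpaceA R) m χ, intC R (A m * χ) - intC R (B m * χ) = intC R ((A - B) m * χ) :=
    fun A B m χ => by rw [← map_sub, ← sub_mul]; rfl
  -- `C1` serves `F` and `sF`, `C2` serves `sr`, with a last term from the variation of `cos k_0x`,
  -- and `C3` serves `sz`, `sw` and their difference.
  set C1 := N * (2 * K * G) + N * (4 * K * G) with hC1
  set C2 := N * (2 * K * G * x) + N * (4 * K * G * x) + N * (2 * K * G * (x * (2 * R) * s)) with hC2
  set C3 := N * (2 * (S * x) * x) + 2 * (N * (2 * K * (S * x) * x)) with hC3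
  have hC10 : 0 ≤ C1 := by positivity
  have hC20 : 0 ≤ C2 := by positivity
  have hC30 : 0 ≤ C3 := by positivity
  have mono1 : ∀ {u e d : ℝ}, 0 ≤ e → 0 ≤ d → u ≤ C1 * e * d → u ≤ (C1 + C2 + C3) * e * d :=
    fun he hd h => h.trans (by gcongr; linarith)
  have mono2 : ∀ {u e d : ℝ}, 0 ≤ e → 0 ≤ d → u ≤ C2 * e * d → u ≤ (C1 + C2 + C3) * e * d :=
    fun he hd h => h.trans (by gcongr; linarith)
  refine ⟨C1 + C2 + C3, by positivity, ?_, ?_, ?_, ?_, ?_, ?_, ?_, ?_, ?_⟩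
  · intro ε μ β h
    have := h.eps
    rw [← mul_one ((C1 + C2 + C3) * ε)]
    refine mono1 h.eps zero_le_one ?_
    change ‖intC R (vecY f R ε μ β (-1)) - _‖ ≤ _
    have e : coefC f R 0 = g (-1) := by rw [hgm]; rfl
    rw [e, lin]
    refine (bI _ _).trans ?_
    calc N * _ ≤ N * (2 * (ε * K) * G) := by gcongr; exact (bT ε μ β h μ β h.dom).1
      _ ≤ _ := by rw [hC1]; have : 0 ≤ N * (4 * K * G) * ε := by positivity
                  linarith
  · intro ε μ β h μ' β' h'
    have := h.eps
    refine mono1 h.eps (by positivity) ?_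
    change ‖intC R (vecY f R ε μ β (-1)) - intC R (vecY f R ε μ' β' (-1))‖ ≤ _
    rw [lin]
    refine (bI _ _).trans ?_
    calc N * _ ≤ N * (4 * (ε * K) * (‖μ - μ'‖ + |β - β'|) * G) := by
          gcongr; exact (bT ε μ β h μ' β' h').2
      _ ≤ _ := by
        rw [hC1]
        have : 0 ≤ N * (2 * K * G) * ε * (‖μ - μ'‖ + |β - β'|) := by positivity
        linarith
  · intro ε μ β h
    have := h.eps
    rw [← mul_one ((C1 + C2 + C3) * ε)]
    refine mono1 h.eps zero_le_one ?_
    change ‖intC R (redSol f R ε μ β (-1) 1 (-1)) - _‖ ≤ _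
    have e : coefC f R 0 = g (-1) := by rw [hgm]; rfl
    rw [e, lin]
    refine (bI _ _).trans ?_
    calc N * _ ≤ N * (2 * (ε * K) * G) := by gcongr; exact (bS ε μ β h μ β h.dom).1
      _ ≤ _ := by rw [hC1]; have : 0 ≤ N * (4 * K * G) * ε := by positivity
                  linarith
  · intro ε μ β h μ' β' h'
    have := h.eps
    refine mono1 h.eps (by positivity) ?_
    change ‖intC R (redSol f R ε μ β (-1) 1 (-1)) - intC R (redSol f R ε μ' β' (-1) 1 (-1))‖ ≤ _
    rw [lin]
    refine (bI _ _).trans ?_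
    calc N * _ ≤ N * (4 * (ε * K) * (‖μ - μ'‖ + |β - β'|) * G) := by
          gcongr; exact (bS ε μ β h μ' β' h').2
      _ ≤ _ := by
        rw [hC1]
        have : 0 ≤ N * (2 * K * G) * ε * (‖μ - μ'‖ + |β - β'|) := by positivity
        linarith
  · intro ε μ β h
    have := h.eps
    rw [← mul_one ((C1 + C2 + C3) * ε)]
    refine mono2 h.eps zero_le_one ?_
    change ‖intC R (redSol f R ε μ β (-1) 1 0 * cosC R (kZero μ β)) - _‖ ≤ _
    have e : coefC f R 1 = g 0 := by rw [hgm]; rfl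
    rw [e, linm]
    refine (norm_intC_coord_mul_le _ _ _).trans ?_
    calc N * (_ * _) ≤ N * ((2 * (ε * K) * G) * x) := by
          gcongr
          · exact (bS ε μ β h μ β h.dom).1
          · exact hc μ β h.dom
      _ ≤ _ := by
        rw [hC2]
        have : 0 ≤ (N * (4 * K * G * x) + N * (2 * K * G * (x * (2 * R) * s))) * ε := by positivity
        linarith
  · intro ε μ β h μ' β' h'
    have := h.eps
    refine mono2 h.eps (by positivity) ?_
    change ‖(intC R (redSol f R ε μ β (-1) 1 0 * cosC R (kZero μ β)) - _) -
      (intC R (redSol f R ε μ' β' (-1) 1 0 * cosC R (kZero μ' β')) - _)‖ ≤ _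
    have e : coefC f R 1 = g 0 := by rw [hgm]; rfl
    rw [e, linm, linm]
    set U := redSol f R ε μ β (-1) 1
    set U' := redSol f R ε μ' β' (-1) 1
    set d := ‖μ - μ'‖ + |β - β'| with hd
    have hd0 : 0 ≤ d := by positivity
    -- Separate the change of the solution from the change of the cosine; the latter multiplies `U'
    -- - g`, which is already `O(ε)`.
    have e2 : intC R ((U - g) 0 * cosC R (kZero μ β)) - intC R ((U' - g) 0 * cosC R (kZero μ' β')) =
        intC R ((U - U') 0 * cosC R (kZero μ β)) +
          intC R ((U' - g) 0 * (cosC R (kZero μ β) - cosC R (kZero μ' β'))) := by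
      rw [mul_sub, map_sub]
      have : intC R ((U - g) 0 * cosC R (kZero μ β)) - intC R ((U' - g) 0 * cosC R (kZero μ β)) =
          intC R ((U - U') 0 * cosC R (kZero μ β)) := by
        rw [linm, sub_sub_sub_cancel_right]
      rw [← this]; ring
    rw [e2]
    have e3 : ‖cosC R (kZero μ β) - cosC R (kZero μ' β')‖ ≤ x * (2 * R) * (s * d) := by
      refine (norm_cosC_sub_le hR h.dom.norm_kZero_le h'.norm_kZero_le).trans ?_
      gcongr
      exact norm_kZero_sub_le h.dom h'
    refine (norm_add_le _ _).trans ?_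
    calc _ ≤ N * (‖U - U'‖ * ‖cosC R (kZero μ β)‖) +
          N * (‖U' - g‖ * ‖cosC R (kZero μ β) - cosC R (kZero μ' β')‖) :=
          add_le_add (norm_intC_coord_mul_le _ _ _) (norm_intC_coord_mul_le _ _ _)
      _ ≤ N * ((4 * (ε * K) * d * G) * x) + N * ((2 * (ε * K) * G) * (x * (2 * R) * (s * d))) := by
          gcongr
          · exact (bS ε μ β h μ' β' h').2
          · exact hc μ β h.dom
          · exact (bS ε μ' β' (h.of_dom h') μ β h.dom).1
      _ ≤ _ := by
        rw [hC2]
        have : 0 ≤ N * (2 * K * G * x) * ε * d := by positivity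
        linarith
  · intro ε μ β h
    refine (norm_intC_coord_mul_le _ _ _).trans ?_
    calc N * (_ * _) ≤ N * (2 * (S * x) * x) := by
          gcongr
          · exact (bP ε μ β h _ (hc μ β h.dom)).1
          · exact hc μ β h.dom
      _ ≤ _ := by
        have : 0 ≤ 2 * (N * (2 * K * (S * x) * x)) := by positivity
        linarith
  · intro ε μ β h
    refine (norm_intC_coord_mul_le _ _ _).trans ?_
    calc N * (_ * _) ≤ N * (2 * (S * x) * x) := by
          gcongr
          · exact (bP ε μ β h _ (hsn μ β h.dom)).1
          · exact hsn μ β h.dom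
      _ ≤ _ := by
        have : 0 ≤ 2 * (N * (2 * K * (S * x) * x)) := by positivity
        linarith
  · intro ε μ β h
    have hε := h.eps
    set k := kZero μ β with hk
    have e0 : φ 0 * cosC R (2 * k) =
        srcOp φ 0 (cosC R k) 0 * cosC R k - srcOp φ 0 (sinC R k) 0 * sinC R k := by
      rw [srcOp_apply hf.summable_coefC, srcOp_apply hf.summable_coefC, sub_self, mul_assoc, mul_assoc,
        ← mul_sub]
      congr 1
      ext y
      simp only [cosC_apply, ContinuousMap.sub_apply, ContinuousMap.mul_apply, sinC_apply]
      rw [mul_assoc, two_mul, Complex.cos_add]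
    have e1 : RayleighBloch.sz f R ε μ β - RayleighBloch.sw f R ε μ β - intC R (φ 0 * cosC R (2 * k)) =
        intC R ((redSol f R ε μ β 0 (cosC R k) - srcOp φ 0 (cosC R k)) 0 * cosC R k) -
        intC R ((redSol f R ε μ β 0 (sinC R k) - srcOp φ 0 (sinC R k)) 0 * sinC R k) := by
      rw [e0, map_sub, ← linm, ← linm]
      change intC R (redSol f R ε μ β 0 (cosC R k) 0 * cosC R k) -
        intC R (redSol f R ε μ β 0 (sinC R k) 0 * sinC R k) - _ = _
      ring
    rw [e1]
    refine (norm_sub_le _ _).trans ?_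
    calc _ ≤ N * ((2 * (ε * K) * (S * x)) * x) + N * ((2 * (ε * K) * (S * x)) * x) := by
          refine add_le_add ((norm_intC_coord_mul_le _ _ _).trans ?_)
            ((norm_intC_coord_mul_le _ _ _).trans ?_)
          · gcongr
            · exact (bP ε μ β h _ (hc μ β h.dom)).2
            · exact hc μ β h.dom
          · gcongr
            · exact (bP ε μ β h _ (hsn μ β h.dom)).2
            · exact hsn μ β h.dom
      _ ≤ _ := by
        rw [hC3]
        have : 0 ≤ (C1 + C2 + N * (2 * (S * x) * x)) * ε := by positivity
        linarith
end

/-! ### Fixed points -/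

/-- Banach's fixed point theorem on a closed ball: the centre moves by at most half the radius and
distances are halved, so the ball is mapped to itself. It replaces the implicit function theorem and
needs no differentiability. -/
lemma exists_fixed_of_lipschitz_half {E : Type*} [NormedAddCommGroup E] [CompleteSpace E] (T : E → E)
    (x₀ : E) {ρ : ℝ} (hρ : 0 ≤ ρ) (h0 : ‖T x₀ - x₀‖ ≤ ρ / 2)
    (hT : ∀ x y, ‖x - x₀‖ ≤ ρ → ‖y - x₀‖ ≤ ρ → ‖T x - T y‖ ≤ 1 / 2 * ‖x - y‖) :
    ∃ x, ‖x - x₀‖ ≤ ρ ∧ T x = x := by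
  have hmaps : Set.MapsTo T (Metric.closedBall x₀ ρ) (Metric.closedBall x₀ ρ) := by
    intro x hx
    rw [mem_closedBall_iff_norm] at hx ⊢
    have h1 := hT x x₀ hx (by simpa using hρ)
    calc ‖T x - x₀‖ = ‖(T x - T x₀) + (T x₀ - x₀)‖ := by rw [sub_add_sub_cancel]
      _ ≤ ‖T x - T x₀‖ + ‖T x₀ - x₀‖ := norm_add_le _ _
      _ ≤ ρ := by linarith
  have hc : ContractingWith (1 / 2) (hmaps.restrict T _ _) := by
    refine ⟨by rw [← NNReal.coe_lt_coe]; norm_num, LipschitzWith.of_dist_le_mul fun x y => ?_⟩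
    have := hT x y (mem_closedBall_iff_norm.1 x.2) (mem_closedBall_iff_norm.1 y.2)
    rw [Subtype.dist_eq, dist_eq_norm, Subtype.dist_eq, dist_eq_norm]
    simpa using this
  obtain ⟨y, hy, hfix, -⟩ := hc.exists_fixedPoint' (x := x₀) Metric.isClosed_closedBall.isComplete hmaps
    (Metric.mem_closedBall_self hρ) (edist_ne_top _ _)
  exact ⟨y, mem_closedBall_iff_norm.1 hy, hfix⟩

/-! ### The abstract two-parameter problem -/

/-- Uniform estimates for the reduced quantities at a fixed `ε`. -/
structure ScatData (L m₀ b β₀ ν₀ c α₀ q ε : ℝ) (Q : ℂ → ℝ → ℂ) (Qr r z w A₁ A₂ : ℝ → ℝ → ℝ) :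
    Prop where
  -- In the application `Q = γF` for complex `μ`, while `Qr = γ sF` and `r`, `z`, `w` are `sr`,
  -- `sz`, `sw` at real parameters; `A₁ = γ²/k_0` and `A₂ = γ/k_0`.
  Q_lip : ∀ μ μ' β, 0 ≤ μ.re → 0 ≤ μ'.re → ‖μ‖ ≤ m₀ → ‖μ'‖ ≤ m₀ → |β - β₀| ≤ b →
    ‖Q μ β - Q μ' β‖ ≤ L * ‖μ - μ'‖
  Q_center : ∀ μ β, 0 ≤ μ.re → ‖μ‖ ≤ m₀ → |β - β₀| ≤ b → ‖Q μ β - ν₀‖ ≤ L * (ε + ‖μ‖ + |β - β₀|)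
  Qr_lip : ∀ m m' β β', 0 ≤ m → 0 ≤ m' → m ≤ m₀ → m' ≤ m₀ → |β - β₀| ≤ b → |β' - β₀| ≤ b →
    |Qr m β - Qr m' β'| ≤ L * (|m - m'| + |β - β'|)
  Qr_center : ∀ m β, 0 ≤ m → m ≤ m₀ → |β - β₀| ≤ b → |Qr m β - ν₀| ≤ L * (ε + m + |β - β₀|)
  Q_eq : ∀ m β, 0 ≤ m → m ≤ m₀ → |β - β₀| ≤ b → Q m β =
    Qr m β + Complex.I * ε * A₁ m β * r m β ^ 2 / (1 - Complex.I * ε * A₂ m β * z m β)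
  A₁_center : ∀ m β, 0 ≤ m → m ≤ m₀ → |β - β₀| ≤ b → |A₁ m β - α₀| ≤ L * (m + |β - β₀|)
  A₁_le : ∀ m β, 0 ≤ m → m ≤ m₀ → |β - β₀| ≤ b → |A₁ m β| ≤ L
  A₂_le : ∀ m β, 0 ≤ m → m ≤ m₀ → |β - β₀| ≤ b → |A₂ m β| ≤ L
  z_le : ∀ m β, 0 ≤ m → m ≤ m₀ → |β - β₀| ≤ b → |z m β| ≤ L
  w_le : ∀ m β, 0 ≤ m → m ≤ m₀ → |β - β₀| ≤ b → |w m β| ≤ L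
  q_center : ∀ m β, 0 ≤ m → m ≤ m₀ → |β - β₀| ≤ b →
    |A₂ m β * (z m β - w m β) - q| ≤ L * (ε + m + |β - β₀|)
  r_lip : ∀ m m' β, 0 ≤ m → 0 ≤ m' → m ≤ m₀ → m' ≤ m₀ → |β - β₀| ≤ b →
    |r m β - r m' β| ≤ L * |m - m'|
  -- Strict differentiability at the base point in quantitative form: between any two nearby points
  -- the slope is `c` up to a small error.
  r_slope : ∀ m β β', 0 ≤ m → m ≤ m₀ → |β - β₀| ≤ b → |β' - β₀| ≤ b →
    |r m β - r m β' - c * (β - β')| ≤ L * (ε + m + |β - β₀| + |β' - β₀|) * |β - β'|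
  r_center : ∀ m, 0 ≤ m → m ≤ m₀ → |r m β₀| ≤ L * (ε + m)

/-- With the real numbers `s = εA₁r²` and `t = εA₂z` the fraction is `is/(1 - it) = (-st + is)/(1 +
t²)`. Its real part has the additional factor `t = O(ε)`. -/
lemma norm_I_frac_le {ε A₁ A₂ r z L : ℝ} (hε : 0 ≤ ε) (h1 : |A₁| ≤ L) (h2 : |A₂| ≤ L)
    (h3 : |z| ≤ L) :
    ‖(Complex.I * ε * A₁ * r ^ 2 / (1 - Complex.I * ε * A₂ * z) : ℂ)‖ ≤ ε * L * r ^ 2 ∧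
    |(Complex.I * ε * A₁ * r ^ 2 / (1 - Complex.I * ε * A₂ * z) : ℂ).re| ≤ ε ^ 2 * L ^ 3 * r ^ 2 := by
  have hL0 : 0 ≤ L := (abs_nonneg _).trans h1
  set t := ε * A₂ * z with ht
  set s := ε * A₁ * r ^ 2 with hs
  have e1 : (Complex.I * ε * A₁ * r ^ 2 / (1 - Complex.I * ε * A₂ * z) : ℂ) =
      (((-(s * t) / (1 + t ^ 2) : ℝ) : ℂ) + ((s / (1 + t ^ 2) : ℝ) : ℂ) * Complex.I) := by
    have hne : (1 : ℂ) + (t : ℂ) ^ 2 ≠ 0 := by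
      have : (1 : ℝ) + t ^ 2 ≠ 0 := by positivity
      exact_mod_cast this
    have hne2 : (1 : ℂ) - Complex.I * t ≠ 0 := by
      intro h
      have := congrArg Complex.re h
      simp at this
    have e : (1 : ℂ) - Complex.I * ε * A₂ * z = 1 - Complex.I * t := by rw [ht]; push_cast; ring
    have e' : (Complex.I * ε * A₁ * r ^ 2 : ℂ) = Complex.I * s := by rw [hs]; push_cast; ring
    rw [e, e']
    push_cast
    rw [div_eq_iff hne2]
    field_simp
    linear_combination ((s : ℂ) * t) * Complex.I_sq
  have hs' : |s| ≤ ε * L * r ^ 2 := by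
    rw [hs, abs_mul, abs_mul, abs_of_nonneg hε, abs_of_nonneg (sq_nonneg r)]; gcongr
  have ht' : |t| ≤ ε * L ^ 2 := by
    rw [ht, abs_mul, abs_mul, abs_of_nonneg hε, mul_assoc, sq]; gcongr
  have hden : 1 ≤ 1 + t ^ 2 := by nlinarith [sq_nonneg t]
  have hden2 : 1 + t ^ 2 > 0 := by positivity
  constructor
  · have hn : ‖(1 - Complex.I * ε * A₂ * z : ℂ)‖ ≥ 1 := by
      have h : (1 - Complex.I * ε * A₂ * z : ℂ).re = 1 := by simp
      calc (1 : ℝ) = |(1 - Complex.I * ε * A₂ * z : ℂ).re| := by rw [h]; simp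
        _ ≤ _ := Complex.abs_re_le_norm _
    rw [norm_div]
    refine (div_le_self (norm_nonneg _) hn).trans ?_
    rw [show (Complex.I * ε * A₁ * r ^ 2 : ℂ) = Complex.I * s by rw [hs]; push_cast; ring, norm_mul,
      Complex.norm_I, one_mul, Complex.norm_real]
    exact hs'
  · rw [e1]
    simp only [Complex.add_re, Complex.ofReal_re, Complex.mul_re, Complex.I_re, mul_zero,
      Complex.ofReal_im, Complex.I_im, mul_one, sub_zero, add_zero]
    rw [abs_div, abs_neg, abs_mul, abs_of_pos hden2]
    refine (div_le_self (by positivity) hden).trans ?_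
    calc |s| * |t| ≤ (ε * L * r ^ 2) * (ε * L ^ 2) := by gcongr
      _ = _ := by ring

/-- The relations between the constants under which both curves are found. -/
structure Rect (L m₀ b ν₀ c M ρ₂ H B1 B2 P ρ₁ ε : ℝ) : Prop where
  hL0 : 0 < L
  hν₀ : 0 < ν₀
  hc0 : 0 < |c|
  -- `Mε` bounds `εν` on the disc of radius `ρ₂`, `Hε` the displacement of the zero of `r`, and `2
  -- B1 ε` the displacement of the tracking point in `ν`. `B2` and `P` bound `r - cΔ` and `r` in
  -- terms of `Δ`.
  hM : M = 2 * ν₀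
  hρ₂ : ρ₂ = ν₀ / 2
  hH : H = 4 * L * (1 + M) / |c|
  hB1 : B1 = L * (1 + M + H)
  hB2 : B2 = L * (2 + M + 2 * H)
  hP : P = |c| + L * (4 + M + 2 * b + 2 * H)
  hb : 0 < b
  hρ₁ : 0 < ρ₁
  hρb : ρ₁ ≤ b
  hρL : L * ρ₁ ≤ ρ₂ / 8
  hρc : L * ρ₁ ≤ |c| / 16
  hε : 0 < ε
  s1 : ε ≤ 1
  s2 : ε * M ≤ m₀
  s3 : L * ε ≤ 1 / 2
  s4 : L * (1 + M) * ε ≤ ρ₂ / 8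
  s5 : L * (1 + M) * ε ≤ |c| / 8
  s6 : H * ε ≤ ρ₁ / 2
  s7 : L * (ε + 2 * L / |c| * ε) ≤ 1 / 2
  s8 : B1 * ε ≤ ρ₂ / 4
  s9 : ε * (2 * L ^ 2) ≤ 1

section
variable {L m₀ b β₀ ν₀ c α₀ q M ρ₂ H B1 B2 P ρ₁ ε : ℝ} {Q : ℂ → ℝ → ℂ}
  {Qr r z w A₁ A₂ : ℝ → ℝ → ℝ}

lemma Rect.pos (Y : Rect L m₀ b ν₀ c M ρ₂ H B1 B2 P ρ₁ ε) :
    0 < M ∧ 0 < ρ₂ ∧ 0 < H ∧ 0 < B1 ∧ 0 < B2 ∧ 0 < P := by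
  obtain ⟨hL0, hν₀, hc0, hM, hρ₂, hH, hB1, hB2, hP, hb, -⟩ := Y
  have hM0 : 0 < M := by rw [hM]; positivity
  have hH0 : 0 < H := by rw [hH]; positivity
  refine ⟨hM0, by rw [hρ₂]; positivity, hH0, by rw [hB1]; positivity, by rw [hB2]; positivity,
    by rw [hP]; positivity⟩

lemma Rect.real (Y : Rect L m₀ b ν₀ c M ρ₂ H B1 B2 P ρ₁ ε) :
    ∀ ν : ℝ, |ν - ν₀| ≤ ρ₂ → 0 ≤ ε * ν ∧ ε * ν ≤ M * ε ∧ ε * ν ≤ m₀ := by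
  obtain ⟨hM0, hρ₂0, hH0, hB10, hB20, hP0⟩ := Y.pos
  obtain ⟨hL0, hν₀, hc0, hM, hρ₂, hH, hB1, hB2, hP, hb, hρ₁, hρb, hρL, hρc, hε, s1, s2, s3, s4, s5, s6,
    s7, s8, s9⟩ := Y
  intro ν hν
  rw [abs_le] at hν
  have h1 : 0 ≤ ν := by linarith [hν.1]
  have h2 : ν ≤ M := by linarith [hν.2]
  refine ⟨by positivity, by nlinarith, le_trans (by gcongr) s2⟩

lemma Rect.cplx (Y : Rect L m₀ b ν₀ c M ρ₂ H B1 B2 P ρ₁ ε) :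
    ∀ ν : ℂ, ‖ν - ν₀‖ ≤ ρ₂ → 0 ≤ ((ε : ℂ) * ν).re ∧ ‖(ε : ℂ) * ν‖ ≤ M * ε ∧
      ‖(ε : ℂ) * ν‖ ≤ m₀ ∧ |ν.re - ν₀| ≤ ρ₂ := by
  have hreal := Y.real
  obtain ⟨hM0, hρ₂0, hH0, hB10, hB20, hP0⟩ := Y.pos
  obtain ⟨hL0, hν₀, hc0, hM, hρ₂, hH, hB1, hB2, hP, hb, hρ₁, hρb, hρL, hρc, hε, s1, s2, s3, s4, s5, s6,
    s7, s8, s9⟩ := Y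
  intro ν hν
  have h0 : |ν.re - ν₀| ≤ ρ₂ := by
    have := Complex.abs_re_le_norm (ν - ν₀)
    simp only [Complex.sub_re, Complex.ofReal_re] at this
    linarith
  have h1 : ‖ν‖ ≤ M := by
    calc ‖ν‖ = ‖(ν - ν₀) + ν₀‖ := by rw [sub_add_cancel]
      _ ≤ ‖ν - ν₀‖ + ‖(ν₀ : ℂ)‖ := norm_add_le _ _
      _ ≤ ρ₂ + ν₀ := by rw [Complex.norm_real, Real.norm_of_nonneg hν₀.le]; linarith
      _ ≤ M := by linarith
  have h2 : ‖(ε : ℂ) * ν‖ = ε * ‖ν‖ := by rw [norm_mul, Complex.norm_real, Real.norm_of_nonneg hε.le]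
  refine ⟨?_, ?_, ?_, h0⟩
  · rw [Complex.re_ofReal_mul]; exact (hreal ν.re h0).1
  · rw [h2]; nlinarith
  · rw [h2]; exact le_trans (by gcongr) s2

lemma Rect.contr (Y : Rect L m₀ b ν₀ c M ρ₂ H B1 B2 P ρ₁ ε)
    (S : ScatData L m₀ b β₀ ν₀ c α₀ q ε Q Qr r z w A₁ A₂) :
    ∀ β, |β - β₀| ≤ b → ∀ ν ν' : ℂ, ‖ν - ν₀‖ ≤ ρ₂ → ‖ν' - ν₀‖ ≤ ρ₂ →
      ‖Q (ε * ν) β - Q (ε * ν') β‖ ≤ L * ε * ‖ν - ν'‖ := by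
  have hcplx := Y.cplx
  obtain ⟨hM0, hρ₂0, hH0, hB10, hB20, hP0⟩ := Y.pos
  obtain ⟨hL0, hν₀, hc0, hM, hρ₂, hH, hB1, hB2, hP, hb, hρ₁, hρb, hρL, hρc, hε, s1, s2, s3, s4, s5, s6,
    s7, s8, s9⟩ := Y
  intro β hβ ν ν' hν hν'
  have h1 := hcplx ν hν
  have h2 := hcplx ν' hν'
  refine (S.Q_lip _ _ β h1.1 h2.1 h1.2.2.1 h2.2.2.1 hβ).trans (le_of_eq ?_)
  rw [← mul_sub, norm_mul, Complex.norm_real, Real.norm_of_nonneg hε.le]; ring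

/-- The unknown enters the right side only through `μ = εν`, so the map has Lipschitz constant `Lε ≤
1/2`. Existence is obtained in the half disc, uniqueness in the whole one. -/
lemma Rect.root (Y : Rect L m₀ b ν₀ c M ρ₂ H B1 B2 P ρ₁ ε)
    (S : ScatData L m₀ b β₀ ν₀ c α₀ q ε Q Qr r z w A₁ A₂) :
    ∀ β, |β - β₀| < ρ₁ → ∃ ν : ℂ, ‖ν - ν₀‖ < ρ₂ ∧ ν - Q (ε * ν) β = 0 ∧
      ∀ ν' : ℂ, ‖ν' - ν₀‖ < ρ₂ → ν' - Q (ε * ν') β = 0 → ν' = ν := by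
  have hcplx := Y.cplx
  have hcontr := Y.contr S
  obtain ⟨hM0, hρ₂0, hH0, hB10, hB20, hP0⟩ := Y.pos
  obtain ⟨hL0, hν₀, hc0, hM, hρ₂, hH, hB1, hB2, hP, hb, hρ₁, hρb, hρL, hρc, hε, s1, s2, s3, s4, s5, s6,
    s7, s8, s9⟩ := Y
  intro β hβ
  have hβb : |β - β₀| ≤ b := hβ.le.trans hρb
  have h0 := hcplx (ν₀ : ℂ) (by simpa using hρ₂0.le)
  obtain ⟨ν, hν, hfix⟩ := exists_fixed_of_lipschitz_half (fun ν : ℂ => Q (ε * ν) β) (ν₀ : ℂ)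
    (ρ := ρ₂ / 2) (by positivity) (by
      have h1 := S.Q_center _ β h0.1 h0.2.2.1 hβb
      refine h1.trans ?_
      have h2 : L * |β - β₀| ≤ L * ρ₁ := by gcongr
      have h3 : L * ‖(ε : ℂ) * ν₀‖ ≤ L * (M * ε) := by gcongr; exact h0.2.1
      linarith) (fun x y hx hy => by
      refine (hcontr β hβb x y (by linarith) (by linarith)).trans ?_
      gcongr)
  refine ⟨ν, by linarith, by rw [sub_eq_zero]; exact hfix.symm, fun ν' hν' h' => ?_⟩
  have h1 := hcontr β hβb ν' ν hν'.le (by linarith)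
  rw [show Q (ε * ν) β = ν from hfix, ← sub_eq_zero.1 h'] at h1
  have h2 : ‖ν' - ν‖ ≤ 1 / 2 * ‖ν' - ν‖ := h1.trans (by gcongr)
  rw [← sub_eq_zero, ← norm_le_zero_iff]
  linarith

lemma Rect.slope (Y : Rect L m₀ b ν₀ c M ρ₂ H B1 B2 P ρ₁ ε)
    (S : ScatData L m₀ b β₀ ν₀ c α₀ q ε Q Qr r z w A₁ A₂) :
    ∀ m, 0 ≤ m → m ≤ M * ε → m ≤ m₀ → ∀ β β', |β - β₀| ≤ ρ₁ → |β' - β₀| ≤ ρ₁ →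
      |r m β - r m β' - c * (β - β')| ≤ |c| / 2 * |β - β'| := by
  obtain ⟨hM0, hρ₂0, hH0, hB10, hB20, hP0⟩ := Y.pos
  obtain ⟨hL0, hν₀, hc0, hM, hρ₂, hH, hB1, hB2, hP, hb, hρ₁, hρb, hρL, hρc, hε, s1, s2, s3, s4, s5, s6,
    s7, s8, s9⟩ := Y
  intro m h0 h1 h2 β β' hβ hβ'
  refine (S.r_slope m β β' h0 h2 (hβ.trans hρb) (hβ'.trans hρb)).trans ?_
  refine mul_le_mul_of_nonneg_right ?_ (abs_nonneg _)
  have e1 : L * |β - β₀| ≤ L * ρ₁ := by gcongr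
  have e2 : L * |β' - β₀| ≤ L * ρ₁ := by gcongr
  have e3 : L * m ≤ L * (M * ε) := by gcongr
  linarith

/-- The slope of `r` is within `|c|/2` of `c`, so `r` cannot vanish twice. This gives both
uniqueness of its zero and, later, Lipschitz dependence of the zero on `m`. -/
lemma Rect.low (Y : Rect L m₀ b ν₀ c M ρ₂ H B1 B2 P ρ₁ ε)
    (S : ScatData L m₀ b β₀ ν₀ c α₀ q ε Q Qr r z w A₁ A₂) :
    ∀ m, 0 ≤ m → m ≤ M * ε → m ≤ m₀ → ∀ β β', |β - β₀| ≤ ρ₁ → |β' - β₀| ≤ ρ₁ →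
      |c| / 2 * |β - β'| ≤ |r m β - r m β'| := by
  have hslope := Y.slope S
  obtain ⟨hM0, hρ₂0, hH0, hB10, hB20, hP0⟩ := Y.pos
  obtain ⟨hL0, hν₀, hc0, hM, hρ₂, hH, hB1, hB2, hP, hb, hρ₁, hρb, hρL, hρc, hε, s1, s2, s3, s4, s5, s6,
    s7, s8, s9⟩ := Y
  intro m h0 h1 h2 β β' hβ hβ'
  have e1 := hslope m h0 h1 h2 β β' hβ hβ'
  have e2 : |c * (β - β')| ≤ |r m β - r m β'| + |r m β - r m β' - c * (β - β')| := by
    have := abs_sub_abs_le_abs_sub (c * (β - β')) (r m β - r m β')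
    rw [abs_sub_comm (c * (β - β'))] at this
    linarith
  rw [abs_mul] at e2
  linarith

/-- Newton's iteration with frozen slope, `β ↦ β - r/c`, halves distances by `Rect.slope`. Its first
step is `O(ε)` because `r` is `O(ε + m)` at the base point. -/
lemma Rect.orth (Y : Rect L m₀ b ν₀ c M ρ₂ H B1 B2 P ρ₁ ε)
    (S : ScatData L m₀ b β₀ ν₀ c α₀ q ε Q Qr r z w A₁ A₂) :
    ∀ m, 0 ≤ m → m ≤ M * ε → m ≤ m₀ → ∃ β, |β - β₀| ≤ H * ε ∧ r m β = 0 := by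
  have hslope := Y.slope S
  have hc : c ≠ 0 := abs_pos.1 Y.hc0
  obtain ⟨hM0, hρ₂0, hH0, hB10, hB20, hP0⟩ := Y.pos
  obtain ⟨hL0, hν₀, hc0, hM, hρ₂, hH, hB1, hB2, hP, hb, hρ₁, hρb, hρL, hρc, hε, s1, s2, s3, s4, s5, s6,
    s7, s8, s9⟩ := Y
  intro m h0 h1 h2
  obtain ⟨β, hβ, hfix⟩ := exists_fixed_of_lipschitz_half (fun β : ℝ => β - r m β / c) β₀
    (ρ := H * ε) (by positivity) (by
      have := S.r_center m h0 h2
      rw [show β₀ - r m β₀ / c - β₀ = -(r m β₀ / c) by ring, norm_neg, Real.norm_eq_abs, abs_div,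
        div_le_iff₀ hc0]
      refine this.trans ?_
      rw [hH]
      have e3 : L * m ≤ L * (M * ε) := by gcongr
      have : 4 * L * (1 + M) / |c| * ε / 2 * |c| = 2 * (L * (1 + M) * ε) := by field_simp; ring
      rw [this]
      nlinarith [mul_pos hL0 hε, mul_pos (mul_pos hL0 hM0) hε]) (fun x y hx hy => by
      rw [Real.norm_eq_abs] at hx hy
      have e1 := hslope m h0 h1 h2 x y (by linarith) (by linarith)
      have e2 : (x - r m x / c) - (y - r m y / c) = -(r m x - r m y - c * (x - y)) / c := by
        field_simp; ring
      rw [Real.norm_eq_abs, Real.norm_eq_abs, e2, abs_div, abs_neg, div_le_iff₀ hc0]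
      linarith)
  refine ⟨β, hβ, ?_⟩
  have : r m β / c = 0 := by
    have : β - r m β / c = β := hfix
    linarith
  rcases div_eq_zero_iff.1 this with h | h
  · exact h
  · exact absurd h hc

/-- At the zero for `m'` the value of `r m` is at most `L|m - m'|`; `Rect.low` converts this value
into a distance between zeros. -/
lemma Rect.orth_lip (Y : Rect L m₀ b ν₀ c M ρ₂ H B1 B2 P ρ₁ ε)
    (S : ScatData L m₀ b β₀ ν₀ c α₀ q ε Q Qr r z w A₁ A₂)
    {βs : ℝ → ℝ} (hβs1 : ∀ m, 0 ≤ m → m ≤ M * ε → m ≤ m₀ → |βs m - β₀| ≤ H * ε ∧ r m (βs m) = 0) :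
    ∀ m m', 0 ≤ m → m ≤ M * ε → m ≤ m₀ → 0 ≤ m' → m' ≤ M * ε → m' ≤ m₀ →
      |βs m - βs m'| ≤ 2 * L / |c| * |m - m'| := by
  have hlow := Y.low S
  obtain ⟨hM0, hρ₂0, hH0, hB10, hB20, hP0⟩ := Y.pos
  obtain ⟨hL0, hν₀, hc0, hM, hρ₂, hH, hB1, hB2, hP, hb, hρ₁, hρb, hρL, hρc, hε, s1, s2, s3, s4, s5, s6,
    s7, s8, s9⟩ := Y
  intro m m' a0 a1 a2 b0 b1 b2
  have e1 := hβs1 m a0 a1 a2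
  have e2 := hβs1 m' b0 b1 b2
  have e3 := hlow m a0 a1 a2 (βs m) (βs m') (by linarith [e1.1]) (by linarith [e2.1])
  have e4 := S.r_lip m m' (βs m') a0 b0 a2 b2 (by linarith [e2.1])
  rw [e1.2, zero_sub, abs_neg] at e3
  rw [e2.2, sub_zero] at e4
  rw [div_mul_eq_mul_div, le_div_iff₀ hc0]
  linarith

/-- On the curve `r = 0` the dispersion relation loses its imaginary correction and becomes a real
fixed point equation. The unknown enters only through `εν`, directly and through the curve, so the
map contracts. -/
lemma Rect.tracking (Y : Rect L m₀ b ν₀ c M ρ₂ H B1 B2 P ρ₁ ε)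
    (S : ScatData L m₀ b β₀ ν₀ c α₀ q ε Q Qr r z w A₁ A₂)
    {βs : ℝ → ℝ} (hβs1 : ∀ m, 0 ≤ m → m ≤ M * ε → m ≤ m₀ → |βs m - β₀| ≤ H * ε ∧ r m (βs m) = 0) :
    ∃ νt, |νt - ν₀| ≤ 2 * (B1 * ε) ∧ Qr (ε * νt) (βs (ε * νt)) = νt := by
  have hreal := Y.real
  have hβlip := Y.orth_lip S hβs1
  obtain ⟨hM0, hρ₂0, hH0, hB10, hB20, hP0⟩ := Y.pos
  obtain ⟨hL0, hν₀, hc0, hM, hρ₂, hH, hB1, hB2, hP, hb, hρ₁, hρb, hρL, hρc, hε, s1, s2, s3, s4, s5, s6,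
    s7, s8, s9⟩ := Y
  obtain ⟨νt, hνt, hνfix⟩ := exists_fixed_of_lipschitz_half
    (fun ν : ℝ => Qr (ε * ν) (βs (ε * ν))) ν₀ (ρ := 2 * (B1 * ε)) (by positivity) (by
      have h := hreal ν₀ (by simpa using hρ₂0.le)
      have e1 := hβs1 _ h.1 h.2.1 h.2.2
      have := S.Qr_center _ (βs (ε * ν₀)) h.1 h.2.2 (by linarith [e1.1])
      refine this.trans ?_
      rw [hB1]
      have e3 : L * (ε * ν₀) ≤ L * (M * ε) := mul_le_mul_of_nonneg_left h.2.1 hL0.le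
      have e4 : L * |βs (ε * ν₀) - β₀| ≤ L * (H * ε) := by gcongr; exact e1.1
      linarith) (fun x y hx hy => by
      rw [Real.norm_eq_abs] at hx hy
      have h := hreal x (by linarith)
      have h' := hreal y (by linarith)
      have e1 := hβs1 _ h.1 h.2.1 h.2.2
      have e2 := hβs1 _ h'.1 h'.2.1 h'.2.2
      refine (S.Qr_lip _ _ _ _ h.1 h'.1 h.2.2 h'.2.2 (by linarith [e1.1]) (by linarith [e2.1])).trans ?_
      have e3 := hβlip _ _ h.1 h.2.1 h.2.2 h'.1 h'.2.1 h'.2.2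
      have e4 : |ε * x - ε * y| = ε * |x - y| := by rw [← mul_sub, abs_mul, abs_of_pos hε]
      rw [e4] at e3 ⊢
      calc _ ≤ L * (ε * |x - y| + 2 * L / |c| * (ε * |x - y|)) := by gcongr
        _ = L * (ε + 2 * L / |c| * ε) * |x - y| := by ring
        _ ≤ _ := by rw [Real.norm_eq_abs]; gcongr)
  exact ⟨νt, hνt, hνfix⟩

/-- Since `r` vanishes at `βs m`, the slope estimate between `β` and `βs m` expresses `r` through
`Δ`. -/
lemma Rect.compare_r (Y : Rect L m₀ b ν₀ c M ρ₂ H B1 B2 P ρ₁ ε)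
    (S : ScatData L m₀ b β₀ ν₀ c α₀ q ε Q Qr r z w A₁ A₂)
    {βs : ℝ → ℝ} (hβs1 : ∀ m, 0 ≤ m → m ≤ M * ε → m ≤ m₀ → |βs m - β₀| ≤ H * ε ∧ r m (βs m) = 0)
    {m β Δ : ℝ} (h : 0 ≤ m ∧ m ≤ M * ε ∧ m ≤ m₀) (hβ : |β - β₀| < ρ₁) (hΔ : Δ = β - βs m) :
    |β - β₀| ≤ |Δ| + H * ε ∧ |r m β - c * Δ| ≤ B2 * (ε + |Δ|) * |Δ| ∧ |r m β| ≤ P * |Δ| := by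
  have e1 := hβs1 _ h.1 h.2.1 h.2.2
  obtain ⟨hM0, hρ₂0, hH0, hB10, hB20, hP0⟩ := Y.pos
  obtain ⟨hL0, hν₀, hc0, hM, hρ₂, hH, hB1, hB2, hP, hb, hρ₁, hρb, hρL, hρc, hε, s1, s2, s3, s4, s5, s6,
    s7, s8, s9⟩ := Y
  have hβb : |β - β₀| ≤ b := hβ.le.trans hρb
  have hβΔ : |β - β₀| ≤ |Δ| + H * ε := by
    calc |β - β₀| = |Δ + (βs m - β₀)| := by rw [hΔ]; congr 1; ring
      _ ≤ |Δ| + |βs m - β₀| := abs_add_le _ _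
      _ ≤ _ := by linarith [e1.1]
  have hrΔ : |r m β - c * Δ| ≤ B2 * (ε + |Δ|) * |Δ| := by
    have := S.r_slope m β (βs m) h.1 h.2.2 hβb (by linarith [e1.1])
    rw [e1.2, sub_zero, ← hΔ] at this
    refine this.trans (mul_le_mul_of_nonneg_right ?_ (abs_nonneg _))
    rw [hB2]
    have e3 : ε + m + |β - β₀| + |βs m - β₀| ≤ (1 + M + 2 * H) * ε + |Δ| := by linarith [e1.1, h.2.1]
    calc L * (ε + m + |β - β₀| + |βs m - β₀|) ≤ L * ((1 + M + 2 * H) * ε + |Δ|) := by gcongr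
      _ ≤ _ := by
        have p1 : 0 ≤ L * ε := by positivity
        have p2 : 0 ≤ L * |Δ| * (1 + M + 2 * H) := by positivity
        linarith
  have hrP : |r m β| ≤ P * |Δ| := by
    have hΔb : |Δ| ≤ 2 * b := by
      rw [hΔ]
      calc |β - βs m| = |(β - β₀) - (βs m - β₀)| := by congr 1; ring
        _ ≤ |β - β₀| + |βs m - β₀| := abs_sub _ _
        _ ≤ _ := by linarith [e1.1]
    have := S.r_slope m β (βs m) h.1 h.2.2 hβb (by linarith [e1.1])
    rw [e1.2, sub_zero, ← hΔ] at this
    have e3 : ε + m + |β - β₀| + |βs m - β₀| ≤ 4 + M + 2 * b + 2 * H := by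
      have : M * ε ≤ M * 1 := by gcongr
      have : H * ε ≤ H * 1 := by gcongr
      linarith [e1.1, h.2.1]
    have e4 : |r m β| ≤ |r m β - c * Δ| + |c * Δ| := by
      have := abs_sub_abs_le_abs_sub (r m β) (c * Δ)
      linarith
    calc |r m β| ≤ |r m β - c * Δ| + |c * Δ| := e4
      _ ≤ L * (4 + M + 2 * b + 2 * H) * |Δ| + |c| * |Δ| := by
        rw [abs_mul]
        gcongr
        exact this.trans (by gcongr)
      _ = P * |Δ| := by rw [hP]; ring
  exact ⟨hβΔ, hrΔ, hrP⟩

/-- Compare the complex root `n` with its real part `x`. The correction to `Q` at the real point has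
norm `O(εr²)`, so `Im n = O(εr²)`; moving from `n` to `x` then costs `Lε |Im n| = O(ε²r²)`, and the
real part of the correction is also `O(ε²r²)`. -/
lemma Rect.compare_im (Y : Rect L m₀ b ν₀ c M ρ₂ H B1 B2 P ρ₁ ε)
    (S : ScatData L m₀ b β₀ ν₀ c α₀ q ε Q Qr r z w A₁ A₂)
    {β : ℝ} (hβ : |β - β₀| < ρ₁) {n : ℂ} (hn1 : ‖n - ν₀‖ < ρ₂) (hn2 : n = Q (ε * n) β) :
    |n.re - Qr (ε * n.re) β| ≤ (L ^ 2 * 2 + L ^ 3) * ε ^ 2 * r (ε * n.re) β ^ 2 := by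
  have hreal := Y.real
  have hcplx := Y.cplx
  have hcontr := Y.contr S
  obtain ⟨hM0, hρ₂0, hH0, hB10, hB20, hP0⟩ := Y.pos
  obtain ⟨hL0, hν₀, hc0, hM, hρ₂, hH, hB1, hB2, hP, hb, hρ₁, hρb, hρL, hρc, hε, s1, s2, s3, s4, s5, s6,
    s7, s8, s9⟩ := Y
  have hβb : |β - β₀| ≤ b := hβ.le.trans hρb
  obtain ⟨c1, c2, c3, c4⟩ := hcplx n hn1.le
  have hx := hreal n.re c4
  obtain ⟨x, hx'⟩ : ∃ x, x = n.re := ⟨_, rfl⟩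
  rw [← hx'] at hx c4 ⊢
  obtain ⟨rx, hrx⟩ : ∃ rx, rx = r (ε * x) β := ⟨_, rfl⟩
  rw [← hrx]
  have hQx := S.Q_eq (ε * x) β hx.1 hx.2.2 hβb
  have hfr := norm_I_frac_le (r := rx) hε.le (S.A₁_le _ β hx.1 hx.2.2 hβb)
    (S.A₂_le _ β hx.1 hx.2.2 hβb) (S.z_le _ β hx.1 hx.2.2 hβb)
  rw [← hrx] at hQx
  generalize (Complex.I * ε * A₁ (ε * x) β * rx ^ 2 /
    (1 - Complex.I * ε * A₂ (ε * x) β * z (ε * x) β) : ℂ) = fr at hfr hQx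
  have hxc : ‖((x : ℝ) : ℂ) - ν₀‖ ≤ ρ₂ := by
    rw [← Complex.ofReal_sub, Complex.norm_real]; exact c4
  have hdiff := hcontr β hβb n x hn1.le hxc
  have hnx : ‖n - x‖ = |n.im| := by
    have : n - x = n.im * Complex.I := by
      apply Complex.ext <;> simp [hx']
    rw [this, norm_mul, Complex.norm_I, mul_one, Complex.norm_real, Real.norm_eq_abs]
  rw [← hn2, hnx] at hdiff
  have hQx' : Q (ε * (x : ℂ)) β = Qr (ε * x) β + fr := by
    rw [← hQx]; push_cast; rfl
  rw [hQx'] at hdiff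
  -- The imaginary part appears on both sides with factor `Lε ≤ 1/2` on the right, and is absorbed.
  have him : |n.im| ≤ 2 * (ε * L * rx ^ 2) := by
    have e3 := Complex.abs_im_le_norm (n - (Qr (ε * x) β + fr))
    have e4 := Complex.abs_im_le_norm fr
    simp only [Complex.sub_im, Complex.add_im, Complex.ofReal_im, zero_add] at e3
    have e5 : |n.im| ≤ |n.im - fr.im| + |fr.im| := by
      have := abs_sub_abs_le_abs_sub n.im fr.im
      linarith
    have e6 : L * ε * |n.im| ≤ 1 / 2 * |n.im| := by gcongr
    linarith [hfr.1]
  have hre : |x - Qr (ε * x) β| ≤ (L ^ 2 * 2 + L ^ 3) * ε ^ 2 * rx ^ 2 := by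
    have e3 := Complex.abs_re_le_norm (n - (Qr (ε * x) β + fr))
    simp only [Complex.sub_re, Complex.add_re, Complex.ofReal_re] at e3
    rw [← hx'] at e3
    have e5 : |x - Qr (ε * x) β| ≤ |x - (Qr (ε * x) β + fr.re)| + |fr.re| := by
      have := abs_add_le (x - (Qr (ε * x) β + fr.re)) fr.re
      rw [show x - (Qr (ε * x) β + fr.re) + fr.re = x - Qr (ε * x) β by ring] at this
      exact this
    have e6 : L * ε * |n.im| ≤ L * ε * (2 * (ε * L * rx ^ 2)) := by gcongr
    linarith [hfr.2]
  exact hre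

/-- With `x = Re n`, `ν - Qr(εν) - δ` is the sum of `x - Qr(εx)`, handled by `Rect.compare_im`, and
`Qr(εx) - Qr(εν) = O(ε|δ|)`. -/
lemma Rect.compare_δ (Y : Rect L m₀ b ν₀ c M ρ₂ H B1 B2 P ρ₁ ε)
    (S : ScatData L m₀ b β₀ ν₀ c α₀ q ε Q Qr r z w A₁ A₂)
    {β ν Δ δ : ℝ} (hβ : |β - β₀| < ρ₁) (hν : |ν - ν₀| < ρ₂) {n : ℂ} (hn1 : ‖n - ν₀‖ < ρ₂)
    (hn2 : n = Q (ε * n) β) (hδ : δ = ν - n.re) (hrP : |r (ε * ν) β| ≤ P * |Δ|) :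
    |ν - Qr (ε * ν) β - δ| ≤
      (L + (L ^ 2 * 2 + L ^ 3) * (2 * P ^ 2 + 2 * L ^ 2 * ν₀)) * (ε * |δ| + ε ^ 2 * Δ ^ 2) := by
  have hre := Y.compare_im S hβ hn1 hn2
  have c4 := (Y.cplx n hn1.le).2.2.2
  have hx := Y.real _ c4
  have h := Y.real ν hν.le
  obtain ⟨x, hx'⟩ : ∃ x, x = n.re := ⟨_, rfl⟩
  rw [← hx'] at hx c4 hre hδ
  obtain ⟨m, hm⟩ : ∃ m, m = ε * ν := ⟨_, rfl⟩
  rw [← hm] at h hrP ⊢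
  obtain ⟨rx, hrx⟩ : ∃ rx, rx = r (ε * x) β := ⟨_, rfl⟩
  rw [← hrx] at hre
  obtain ⟨hM0, hρ₂0, hH0, hB10, hB20, hP0⟩ := Y.pos
  obtain ⟨hL0, hν₀, hc0, hM, hρ₂, hH, hB1, hB2, hP, hb, hρ₁, hρb, hρL, hρc, hε, s1, s2, s3, s4, s5, s6,
    s7, s8, s9⟩ := Y
  have hβb : |β - β₀| ≤ b := hβ.le.trans hρb
  have hδx : |ν - x| = |δ| := by rw [hδ]
  -- `Rect.compare_im` involves `r` at `εx` instead of `εν`; changing the argument costs `Lε|δ|`,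
  -- hence the term with `δ²`.
  have hrx' : rx ^ 2 ≤ 2 * P ^ 2 * Δ ^ 2 + 2 * L ^ 2 * δ ^ 2 := by
    have e3 := S.r_lip (ε * x) m β hx.1 h.1 hx.2.2 h.2.2 hβb
    have e4 : |ε * x - m| = ε * |δ| := by
      rw [hm, ← mul_sub, abs_mul, abs_of_pos hε, abs_sub_comm, hδx]
    rw [e4, ← hrx] at e3
    have e5 : |rx| ≤ P * |Δ| + L * |δ| := by
      have e6 : |rx| ≤ |r m β| + |rx - r m β| := by
        have := abs_sub_abs_le_abs_sub rx (r m β); linarith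
      have e7 : L * (ε * |δ|) ≤ L * (1 * |δ|) := by gcongr
      linarith
    have e6 : rx ^ 2 ≤ (P * |Δ| + L * |δ|) ^ 2 := by
      rw [← sq_abs rx]; gcongr
    have e7 : (P * |Δ| + L * |δ|) ^ 2 ≤ 2 * (P * |Δ|) ^ 2 + 2 * (L * |δ|) ^ 2 := by
      nlinarith [sq_nonneg (P * |Δ| - L * |δ|)]
    rw [mul_pow, mul_pow, sq_abs, sq_abs] at e7
    linarith
  have e3 := S.Qr_lip (ε * x) m β β hx.1 h.1 hx.2.2 h.2.2 hβb hβb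
  have e4 : |ε * x - m| = ε * |δ| := by
    rw [hm, ← mul_sub, abs_mul, abs_of_pos hε, abs_sub_comm, hδx]
  rw [e4, sub_self, abs_zero, add_zero] at e3
  have e5 : |ν - Qr m β - δ| ≤ |x - Qr (ε * x) β| + |Qr (ε * x) β - Qr m β| := by
    have := abs_add_le (x - Qr (ε * x) β) (Qr (ε * x) β - Qr m β)
    rw [show x - Qr (ε * x) β + (Qr (ε * x) β - Qr m β) = ν - Qr m β - δ by rw [hδ]; ring] at this
    exact this
  have hδ1 : |δ| ≤ ν₀ := by
    rw [← hδx]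
    calc |ν - x| = |(ν - ν₀) - (x - ν₀)| := by congr 1; ring
      _ ≤ |ν - ν₀| + |x - ν₀| := abs_sub _ _
      _ ≤ ν₀ := by linarith
  -- Both `ν` and `Re n` lie within `ρ₂ = ν₀/2` of `ν₀`, so `|δ| ≤ ν₀` and the quadratic term is
  -- absorbed into `ε|δ|`.
  have k1 : ε ^ 2 * δ ^ 2 ≤ ε * |δ| * ν₀ := by
    calc ε ^ 2 * δ ^ 2 = (ε * |δ|) * (ε * |δ|) := by rw [← sq_abs δ]; ring
      _ ≤ (ε * |δ|) * (1 * ν₀) := by gcongr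
      _ = _ := by ring
  obtain ⟨J, hJ⟩ : ∃ J, J = L ^ 2 * 2 + L ^ 3 := ⟨_, rfl⟩
  have hJ0 : 0 ≤ J := by rw [hJ]; positivity
  rw [← hJ] at hre ⊢
  have k2 : J * ε ^ 2 * rx ^ 2 ≤ J * (2 * P ^ 2 * (ε ^ 2 * Δ ^ 2) + 2 * L ^ 2 * (ε * |δ| * ν₀)) := by
    calc J * ε ^ 2 * rx ^ 2 ≤ J * ε ^ 2 * (2 * P ^ 2 * Δ ^ 2 + 2 * L ^ 2 * δ ^ 2) := by gcongr
      _ = J * (2 * P ^ 2 * (ε ^ 2 * Δ ^ 2) + 2 * L ^ 2 * (ε ^ 2 * δ ^ 2)) := by ring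
      _ ≤ _ := by gcongr
  have k3 : 0 ≤ L * (ε ^ 2 * Δ ^ 2) := by positivity
  have k4 : 0 ≤ J * (2 * P ^ 2 * (ε * |δ|)) := by positivity
  have k5 : 0 ≤ J * (2 * L ^ 2 * ν₀ * (ε ^ 2 * Δ ^ 2)) := by positivity
  linarith

end

/-- Roots of the dispersion relation and of the orthogonality condition, with the comparison of
`δ`, `Δ` to the reduced quantities. -/
lemma ScatData.exists_roots {L m₀ b β₀ ν₀ c α₀ q : ℝ} (hL : 1 ≤ L) (hm₀ : 0 < m₀) (hb : 0 < b)
    (hν₀ : 0 < ν₀) (hc : c ≠ 0) :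
    ∃ ρmax ρ₂ B : ℝ, 0 < ρmax ∧ ρmax ≤ b ∧ 0 < ρ₂ ∧ ρ₂ = ν₀ / 2 ∧ 0 < B ∧
    -- `ρ₁` remains free below `ρmax`, and `B` does not depend on it: the rectangle has to be shrunk
    -- once more when the asymptotic constants are known.
    ∀ ρ₁, 0 < ρ₁ → ρ₁ ≤ ρmax → ∃ ε₀, 0 < ε₀ ∧ ε₀ ≤ 1 ∧ ∀ ε, 0 < ε → ε < ε₀ →
    (ε * (2 * ν₀) ≤ m₀) ∧
    ∀ (Q : ℂ → ℝ → ℂ) (Qr r z w A₁ A₂ : ℝ → ℝ → ℝ),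
    ScatData L m₀ b β₀ ν₀ c α₀ q ε Q Qr r z w A₁ A₂ →
    ∃ (νs : ℝ → ℂ) (βs : ℝ → ℝ) (νt βt : ℝ),
      (∀ β, |β - β₀| < ρ₁ → ‖νs β - ν₀‖ < ρ₂ ∧ νs β - Q (ε * νs β) β = 0 ∧
        ∀ ν : ℂ, ‖ν - ν₀‖ < ρ₂ → ν - Q (ε * ν) β = 0 → ν = νs β) ∧
      (∀ ν : ℝ, |ν - ν₀| < ρ₂ → |βs (ε * ν) - β₀| < ρ₁ ∧ r (ε * ν) (βs (ε * ν)) = 0 ∧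
        ∀ β, |β - β₀| < ρ₁ → r (ε * ν) β = 0 → β = βs (ε * ν)) ∧
      (|βt - β₀| < ρ₁ ∧ |βt - β₀| ≤ B * ε ∧ |νt - ν₀| < ρ₂ ∧ |νt - ν₀| ≤ B * ε ∧
        βt = βs (ε * νt) ∧ (νt : ℂ) - Q (ε * νt) βt = 0) ∧
      ∀ β ν : ℝ, |β - β₀| < ρ₁ → |ν - ν₀| < ρ₂ → ∀ δ Δ : ℝ, δ = ν - (νs β).re →
        Δ = β - βs (ε * ν) →
        |ν - Qr (ε * ν) β - δ| ≤ B * (ε * |δ| + ε ^ 2 * Δ ^ 2) ∧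
        |r (ε * ν) β - c * Δ| ≤ B * (ε + |Δ|) * |Δ| ∧ |β - β₀| ≤ |Δ| + B * ε ∧ ε * ν ≤ B * ε := by
  have hc0 : 0 < |c| := abs_pos.2 hc
  have hL0 : 0 < L := by linarith
  obtain ⟨M, hM⟩ : ∃ M, M = 2 * ν₀ := ⟨_, rfl⟩
  have hM0 : 0 < M := by rw [hM]; positivity
  obtain ⟨ρ₂, hρ₂⟩ : ∃ ρ₂, ρ₂ = ν₀ / 2 := ⟨_, rfl⟩
  have hρ₂0 : 0 < ρ₂ := by rw [hρ₂]; positivity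
  obtain ⟨H, hH⟩ : ∃ H, H = 4 * L * (1 + M) / |c| := ⟨_, rfl⟩
  have hH0 : 0 < H := by rw [hH]; positivity
  obtain ⟨B1, hB1⟩ : ∃ B1, B1 = L * (1 + M + H) := ⟨_, rfl⟩
  have hB10 : 0 < B1 := by rw [hB1]; positivity
  obtain ⟨B2, hB2⟩ : ∃ B2, B2 = L * (2 + M + 2 * H) := ⟨_, rfl⟩
  have hB20 : 0 < B2 := by rw [hB2]; positivity
  obtain ⟨P, hP⟩ : ∃ P, P = |c| + L * (4 + M + 2 * b + 2 * H) := ⟨_, rfl⟩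
  obtain ⟨B3, hB3⟩ : ∃ B3, B3 = L + (L ^ 2 * 2 + L ^ 3) * (2 * P ^ 2 + 2 * L ^ 2 * ν₀) := ⟨_, rfl⟩
  have hB30 : 0 < B3 := by rw [hB3]; positivity
  -- The second bound limits the motion of the centre of the disc under `Q`, the third the change of
  -- slope of `r` across the interval.
  refine ⟨min b (min (ρ₂ / (8 * L)) (|c| / (16 * L))), ρ₂, H + 2 * B1 + B2 + B3 + M, by positivity,
    min_le_left _ _, hρ₂0, hρ₂, by positivity, fun ρ₁ hρ₁ hρ₁m => ?_⟩
  have hρb : ρ₁ ≤ b := hρ₁m.trans (min_le_left _ _)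
  have hρL : L * ρ₁ ≤ ρ₂ / 8 := by
    have := hρ₁m.trans ((min_le_right _ _).trans (min_le_left _ _))
    rw [le_div_iff₀ (by positivity)] at this; linarith
  have hρc : L * ρ₁ ≤ |c| / 16 := by
    have := hρ₁m.trans ((min_le_right _ _).trans (min_le_right _ _))
    rw [le_div_iff₀ (by positivity)] at this; linarith
  -- `X` is the sum of the reciprocals of all thresholds for `ε`, so `ε < 1/X` yields every
  -- smallness condition at once.
  obtain ⟨X, hX⟩ : ∃ X, X = 1 + M / m₀ + 2 * L + 8 * L * (1 + M) / ρ₂ + 8 * L * (1 + M) / |c| + 2 * H / ρ₁ +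
    2 * L * (1 + 2 * L / |c|) + 4 * B1 / ρ₂ + 2 * L ^ 2 := ⟨_, rfl⟩
  have hX0 : 0 < X := by rw [hX]; positivity
  have q1 : 0 ≤ M / m₀ := by positivity
  have q2 : 0 ≤ 8 * L * (1 + M) / ρ₂ := by positivity
  have q3 : 0 ≤ 8 * L * (1 + M) / |c| := by positivity
  have q4 : 0 ≤ 2 * H / ρ₁ := by positivity
  have q5 : 0 ≤ 2 * L * (1 + 2 * L / |c|) := by positivity
  have q6 : 0 ≤ 4 * B1 / ρ₂ := by positivity
  have q7 : 0 ≤ 2 * L ^ 2 := by positivity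
  refine ⟨1 / X, by positivity, by rw [div_le_one hX0]; linarith, fun ε hε hεX => ?_⟩
  have hεX' : ε * X ≤ 1 := by
    rw [lt_div_iff₀ hX0] at hεX; exact hεX.le
  have small : ∀ Y, Y ≤ X → ε * Y ≤ 1 := fun Y hY =>
    (mul_le_mul_of_nonneg_left hY hε.le).trans hεX'
  have s1 : ε ≤ 1 := by have := small 1 (by linarith); linarith
  have s2 : ε * M ≤ m₀ := by
    have := small (M / m₀) (by linarith)
    rw [← mul_div_assoc, div_le_one hm₀] at this; exact this
  have s3 : L * ε ≤ 1 / 2 := by have := small (2 * L) (by linarith); linarith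
  have s4 : L * (1 + M) * ε ≤ ρ₂ / 8 := by
    have := small (8 * L * (1 + M) / ρ₂) (by linarith)
    rw [← mul_div_assoc, div_le_one hρ₂0] at this; linarith
  have s5 : L * (1 + M) * ε ≤ |c| / 8 := by
    have := small (8 * L * (1 + M) / |c|) (by linarith)
    rw [← mul_div_assoc, div_le_one hc0] at this; linarith
  have s6 : H * ε ≤ ρ₁ / 2 := by
    have := small (2 * H / ρ₁) (by linarith)
    rw [← mul_div_assoc, div_le_one hρ₁] at this; linarith
  have s7 : L * (ε + 2 * L / |c| * ε) ≤ 1 / 2 := by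
    have := small (2 * L * (1 + 2 * L / |c|)) (by linarith)
    linarith
  have s8 : B1 * ε ≤ ρ₂ / 4 := by
    have := small (4 * B1 / ρ₂) (by linarith)
    rw [← mul_div_assoc, div_le_one hρ₂0] at this; linarith
  have s9 : ε * (2 * L ^ 2) ≤ 1 := small _ (by linarith)
  have Y : Rect L m₀ b ν₀ c M ρ₂ H B1 B2 P ρ₁ ε := ⟨hL0, hν₀, hc0, hM, hρ₂, hH, hB1, hB2, hP, hb, hρ₁,
    hρb, hρL, hρc, hε, s1, s2, s3, s4, s5, s6, s7, s8, s9⟩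
  refine ⟨by rw [← hM]; exact s2, fun Q Qr r z w A₁ A₂ S => ?_⟩
  have hreal := Y.real
  have hroot := Y.root S
  have horth := Y.orth S
  choose! νs hνs1 hνs2 hνs3 using hroot
  choose! βs hβs0 using horth
  obtain ⟨νt, hνt, hfixt⟩ := Y.tracking S hβs0
  have hmt := hreal νt (by linarith)
  have hβt := hβs0 _ hmt.1 hmt.2.1 hmt.2.2
  refine ⟨νs, βs, νt, βs (ε * νt), fun β hβ => ⟨hνs1 β hβ, hνs2 β hβ, fun ν hν h =>
    hνs3 β hβ ν hν h⟩, fun ν hν => ?_, ⟨by linarith [hβt.1], ?_, by linarith, ?_, rfl, ?_⟩,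
    fun β ν hβ hν δ Δ hδ hΔ => ?_⟩
  · have h := hreal ν hν.le
    have e1 := hβs0 _ h.1 h.2.1 h.2.2
    refine ⟨by linarith [e1.1], e1.2, fun β hβ hr => ?_⟩
    have := Y.low S _ h.1 h.2.1 h.2.2 β (βs (ε * ν)) hβ.le (by linarith [e1.1])
    rw [hr, e1.2, sub_zero, abs_zero] at this
    have h2 : |β - βs (ε * ν)| ≤ 0 := by
      by_contra hh
      push Not at hh
      have := mul_pos (half_pos hc0) hh
      linarith
    exact sub_eq_zero.1 (abs_nonpos_iff.1 h2)
  · have : 0 ≤ (2 * B1 + B2 + B3 + M) * ε := by positivity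
    linarith [hβt.1]
  · have : 0 ≤ (H + B2 + B3 + M) * ε := by positivity
    linarith
  -- At this point `r = 0`, so `Q` reduces to the real `Qr` and the real fixed point solves the
  -- complex relation.
  · have := S.Q_eq _ (βs (ε * νt)) hmt.1 hmt.2.2 (by linarith [hβt.1])
    rw [hβt.2, hfixt] at this
    push_cast at this
    rw [this]; simp
  · have h := hreal ν hν.le
    obtain ⟨t1, t2, t3⟩ := Y.compare_r S hβs0 h hβ hΔ
    have t4 := Y.compare_δ S hβ hν (hνs1 β hβ) (sub_eq_zero.1 (hνs2 β hβ)) hδ t3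
    rw [← hB3] at t4
    refine ⟨t4.trans ?_, t2.trans ?_, ?_, ?_⟩
    · gcongr
      linarith
    · gcongr
      linarith
    · have : 0 ≤ (2 * B1 + B2 + B3 + M) * ε := by positivity
      linarith
    · have : 0 ≤ (H + 2 * B1 + B2 + B3) * ε := by positivity
      linarith [h.2.1]

/-! ### Asymptotics of the scattering coefficients -/

/-- The relative error of the denominator becomes the factor `1 + E₂` with `E₂ = (D₀ - D₁)/D₁`; the
error of the numerator, measured against `S`, is `E₁ = X/S`. -/
lemma exists_factor {D₀ D₁ N X : ℂ} {S C₁ C₂ η : ℝ} (hS : 0 < S) (hD₀ : D₀ ≠ 0)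
    (hD : ‖D₁ - D₀‖ ≤ C₁ * η * ‖D₀‖) (hC : C₁ * η ≤ 1 / 2) (hX : ‖X‖ ≤ C₂ * η * S) :
    D₁ ≠ 0 ∧ ∃ E₁ E₂ : ℂ, ‖E₁‖ ≤ C₂ * η ∧ ‖E₂‖ ≤ 2 * C₁ * η ∧
      (N + X) / D₁ = (N + (S : ℝ) * E₁) * (1 + E₂) / D₀ := by
  have h0 : 0 < ‖D₀‖ := norm_pos_iff.2 hD₀
  have h1 : ‖D₀‖ / 2 ≤ ‖D₁‖ := by
    have h2 : ‖D₀‖ ≤ ‖D₁‖ + ‖D₁ - D₀‖ := by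
      have := norm_sub_le D₁ (D₁ - D₀)
      rwa [sub_sub_cancel] at this
    have h3 : C₁ * η * ‖D₀‖ ≤ 1 / 2 * ‖D₀‖ := by gcongr
    linarith
  have hD₁ : D₁ ≠ 0 := norm_pos_iff.1 (by linarith)
  have hSc : ((S : ℝ) : ℂ) ≠ 0 := by exact_mod_cast hS.ne'
  refine ⟨hD₁, X / S, (D₀ - D₁) / D₁, ?_, ?_, ?_⟩
  · rw [norm_div, Complex.norm_real, Real.norm_of_nonneg hS.le, div_le_iff₀ hS]; exact hX
  · rw [norm_div, div_le_iff₀ (by linarith), norm_sub_rev]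
    have h4 : 0 ≤ C₁ * η := by
      by_contra h
      push Not at h
      have := mul_neg_of_neg_of_pos h h0
      linarith [norm_nonneg (D₁ - D₀)]
    calc _ ≤ C₁ * η * ‖D₀‖ := hD
      _ ≤ C₁ * η * (2 * ‖D₁‖) := by gcongr; linarith
      _ = _ := by ring
  · field_simp
    ring

/-- The denominator common to the scattering coefficients. -/
def denS (ε d r z A₁ A₂ : ℝ) : ℂ :=
  d * (1 - Complex.I * (ε * A₂ : ℝ) * z) - Complex.I * ε * A₁ * r ^ 2

/-- Reflection coefficient in terms of the reduced quantities. -/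
def reflS (ε d r z w A₁ A₂ : ℝ) : ℂ :=
  Complex.I * ε * (A₂ * (z - w) * d + A₁ * r ^ 2) /
    (denS ε d r z A₁ A₂ * (1 - Complex.I * (ε * A₂ : ℝ) * w))

/-- Transmission coefficient in terms of the reduced quantities. -/
def transS (ε d r z w A₁ A₂ : ℝ) : ℂ :=
  (d + (ε * A₂ : ℝ) ^ 2 * w * z * d + (ε * A₂ : ℝ) * w * ε * A₁ * r ^ 2) /
    (denS ε d r z A₁ A₂ * (1 - Complex.I * (ε * A₂ : ℝ) * w))

/-- Insert `d ≈ δ`, `r ≈ cΔ`, `A₁ ≈ α₀`. The denominator is wrong by `O(η(|δ| + εΔ²))` with `η = ε +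
|Δ|`, and this is a relative error: `δ` and `-εαΔ²` are the real and imaginary parts of the model
denominator and `α > 0`. The numerators are compared on the larger scale `|δ| + Δ²`. -/
lemma exists_asymptotic_form {L α₀ c q : ℝ} (hL : 1 ≤ L) (hα : 0 < α₀ * c ^ 2) (hα₀ : |α₀| ≤ L)
    (hc : |c| ≤ L) (hq : |q| ≤ L) : ∃ C, 1 ≤ C ∧ ∀ ε δ Δ d r z w A₁ A₂ : ℝ, 0 < ε →
    C * (ε + |Δ|) ≤ 1 → (δ ≠ 0 ∨ Δ ≠ 0) →
    |A₁ - α₀| ≤ L * (ε + |Δ|) → |A₁| ≤ L → |A₂| ≤ L → |z| ≤ L → |w| ≤ L →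
    |A₂ * (z - w) - q| ≤ L * (ε + |Δ|) → |d - δ| ≤ L * (ε * |δ| + ε ^ 2 * Δ ^ 2) →
    |r - c * Δ| ≤ L * (ε + |Δ|) * |Δ| →
    denS ε d r z A₁ A₂ ≠ 0 ∧
    (∃ E₁ E₂ : ℂ, ‖E₁‖ ≤ C * (ε + |Δ|) ∧ ‖E₂‖ ≤ C * (ε + |Δ|) ∧
      reflS ε d r z w A₁ A₂ = Complex.I * ε * (δ * q + (α₀ * c ^ 2 : ℝ) * Δ ^ 2 +
        (|δ| + Δ ^ 2 : ℝ) * E₁) * (1 + E₂) / (δ - Complex.I * ε * (α₀ * c ^ 2 : ℝ) * Δ ^ 2)) ∧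
    (∃ E₁ E₂ : ℂ, ‖E₁‖ ≤ C * (ε + |Δ|) ∧ ‖E₂‖ ≤ C * (ε + |Δ|) ∧
      transS ε d r z w A₁ A₂ = (δ + (|δ| + Δ ^ 2 : ℝ) * E₁) * (1 + E₂) /
        (δ - Complex.I * ε * (α₀ * c ^ 2 : ℝ) * Δ ^ 2)) := by
  obtain ⟨α, hαd⟩ : ∃ α, α = α₀ * c ^ 2 := ⟨_, rfl⟩
  rw [← hαd] at hα ⊢
  have hL0 : 0 < L := by linarith
  have hαL : α ≤ L ^ 3 := by
    calc α ≤ |α₀ * c ^ 2| := by rw [hαd]; exact le_abs_self _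
      _ = |α₀| * |c| ^ 2 := by rw [abs_mul, abs_pow]
      _ ≤ L * L ^ 2 := by gcongr
      _ = _ := by ring
  -- `K₁` bounds the error of `denS`, `K₂` includes the factor `1 - iεA₂w`, and `C₁` makes it
  -- relative to the model denominator. `C₂` and `C₃` belong to the numerators of `ℛ` and `𝒯`.
  obtain ⟨K₁, hK₁⟩ : ∃ K₁, K₁ = L + L ^ 2 * (1 + L) + 4 * L ^ 3 := ⟨_, rfl⟩
  have hK₁0 : 0 < K₁ := by rw [hK₁]; positivity
  obtain ⟨K₂, hK₂⟩ : ∃ K₂, K₂ = K₁ + L ^ 2 * (K₁ + 1 + L ^ 3) := ⟨_, rfl⟩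
  have hK₂0 : 0 < K₂ := by rw [hK₂]; positivity
  obtain ⟨C₁, hC₁⟩ : ∃ C₁, C₁ = K₂ * (1 + 1 / α) := ⟨_, rfl⟩
  have hC₁0 : 0 < C₁ := by rw [hC₁]; positivity
  obtain ⟨C₂, hC₂⟩ : ∃ C₂, C₂ = 2 * L ^ 2 + L + 4 * L ^ 3 := ⟨_, rfl⟩
  have hC₂0 : 0 < C₂ := by rw [hC₂]; positivity
  obtain ⟨C₃, hC₃⟩ : ∃ C₃, C₃ = L + L ^ 4 * (1 + L) + 4 * L ^ 5 := ⟨_, rfl⟩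
  have hC₃0 : 0 < C₃ := by rw [hC₃]; positivity
  refine ⟨1 + 2 * C₁ + C₂ + C₃, by linarith, ?_⟩
  intro ε δ Δ d r z w A₁ A₂ hε hsm hne hA₁ hA₁L hA₂ hz hw hqc hd hr
  obtain ⟨η, hη⟩ : ∃ η, η = ε + |Δ| := ⟨_, rfl⟩
  rw [← hη] at hsm hA₁ hqc hr ⊢
  have hεη : ε ≤ η := by rw [hη]; linarith [abs_nonneg Δ]
  have hη0 : 0 < η := hε.trans_le hεη
  have p1 : 0 ≤ C₁ * η := by positivity
  have p2 : 0 ≤ C₂ * η := by positivity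
  have p3 : 0 ≤ C₃ * η := by positivity
  have hη1 : η ≤ 1 := by linarith
  have hε1 : ε ≤ 1 := hεη.trans hη1
  have hCη : C₁ * η ≤ 1 / 2 := by linarith
  -- `T` is the natural scale of the denominator and `S ≥ T` that of the numerators.
  obtain ⟨T, hT⟩ : ∃ T, T = |δ| + ε * Δ ^ 2 := ⟨_, rfl⟩
  obtain ⟨S, hS⟩ : ∃ S, S = |δ| + Δ ^ 2 := ⟨_, rfl⟩
  have hT0 : 0 ≤ T := by rw [hT]; positivity
  have hTS : T ≤ S := by
    rw [hT, hS]; have : ε * Δ ^ 2 ≤ 1 * Δ ^ 2 := by gcongr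
    linarith
  have hS0 : 0 < S := by
    rw [hS]
    rcases hne with h | h
    · have := abs_pos.2 h; positivity
    · positivity
  have hΔS : Δ ^ 2 ≤ S := by rw [hS]; linarith [abs_nonneg δ]
  have hΔT : ε * Δ ^ 2 ≤ T := by rw [hT]; linarith [abs_nonneg δ]
  have hδT : |δ| ≤ T := by rw [hT]; linarith [show 0 ≤ ε * Δ ^ 2 by positivity]
  have hdT : |d - δ| ≤ L * ε * T := by
    refine hd.trans (le_of_eq ?_); rw [hT]; ring
  have hdT' : |d| ≤ (1 + L) * T := by
    have h1 : |d| ≤ |δ| + |d - δ| := by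
      have := abs_sub_abs_le_abs_sub d δ; linarith
    have h2 : L * ε * T ≤ L * 1 * T := by gcongr
    linarith
  have hrL : |r + c * Δ| ≤ 3 * L * |Δ| := by
    calc |r + c * Δ| = |(r - c * Δ) + 2 * (c * Δ)| := by congr 1; ring
      _ ≤ |r - c * Δ| + |2 * (c * Δ)| := abs_add_le _ _
      _ ≤ L * η * |Δ| + 2 * (L * |Δ|) := by
        rw [abs_mul 2, abs_mul c, abs_of_pos (zero_lt_two' ℝ)]; gcongr
      _ ≤ L * 1 * |Δ| + 2 * (L * |Δ|) := by gcongr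
      _ = _ := by ring
  have hr2 : |r ^ 2 - c ^ 2 * Δ ^ 2| ≤ 3 * L ^ 2 * η * Δ ^ 2 := by
    calc |r ^ 2 - c ^ 2 * Δ ^ 2| = |r - c * Δ| * |r + c * Δ| := by rw [← abs_mul]; congr 1; ring
      _ ≤ (L * η * |Δ|) * (3 * L * |Δ|) := by gcongr
      _ = 3 * L ^ 2 * η * (|Δ| * |Δ|) := by ring
      _ = _ := by rw [abs_mul_abs_self]; ring
  have hAr : |A₁ * r ^ 2 - α * Δ ^ 2| ≤ 4 * L ^ 3 * η * Δ ^ 2 := by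
    calc |A₁ * r ^ 2 - α * Δ ^ 2| = |A₁ * (r ^ 2 - c ^ 2 * Δ ^ 2) + (A₁ - α₀) * (c ^ 2 * Δ ^ 2)| := by
          congr 1; rw [hαd]; ring
      _ ≤ |A₁ * (r ^ 2 - c ^ 2 * Δ ^ 2)| + |(A₁ - α₀) * (c ^ 2 * Δ ^ 2)| := abs_add_le _ _
      _ = |A₁| * |r ^ 2 - c ^ 2 * Δ ^ 2| + |A₁ - α₀| * (|c| ^ 2 * Δ ^ 2) := by
        rw [abs_mul, abs_mul, abs_of_nonneg (by positivity : 0 ≤ c ^ 2 * Δ ^ 2), sq_abs]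
      _ ≤ L * (3 * L ^ 2 * η * Δ ^ 2) + L * η * (L ^ 2 * Δ ^ 2) := by gcongr
      _ = _ := by ring
  have hArL : |A₁ * r ^ 2| ≤ 4 * L ^ 3 * Δ ^ 2 := by
    have h1 : |r| ≤ 2 * L * |Δ| := by
      calc |r| = |(r - c * Δ) + c * Δ| := by rw [sub_add_cancel]
        _ ≤ |r - c * Δ| + |c * Δ| := abs_add_le _ _
        _ ≤ L * η * |Δ| + L * |Δ| := by rw [abs_mul c]; gcongr
        _ ≤ L * 1 * |Δ| + L * |Δ| := by gcongr
        _ = _ := by ring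
    calc |A₁ * r ^ 2| = |A₁| * |r| ^ 2 := by rw [abs_mul, abs_pow]
      _ ≤ L * (2 * L * |Δ|) ^ 2 := by gcongr
      _ = 4 * L ^ 3 * |Δ| ^ 2 := by ring
      _ = _ := by rw [sq_abs]
  obtain ⟨D₀, hD₀⟩ : ∃ D₀ : ℂ, D₀ = δ - Complex.I * ε * (α : ℝ) * Δ ^ 2 := ⟨_, rfl⟩
  have hre : D₀.re = δ := by
    rw [hD₀, show (δ - Complex.I * ε * (α : ℝ) * Δ ^ 2 : ℂ) =
      (δ : ℝ) - ((ε * α * Δ ^ 2 : ℝ) : ℂ) * Complex.I by push_cast; ring]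
    simp [-Complex.ofReal_mul, -Complex.ofReal_pow]
  have him : D₀.im = -(ε * α * Δ ^ 2) := by
    rw [hD₀, show (δ - Complex.I * ε * (α : ℝ) * Δ ^ 2 : ℂ) =
      (δ : ℝ) - ((ε * α * Δ ^ 2 : ℝ) : ℂ) * Complex.I by push_cast; ring]
    simp [-Complex.ofReal_mul, -Complex.ofReal_pow]
  -- Positivity of `α` is used here: no cancellation is possible between a real and an imaginary
  -- part.
  have hTD : T ≤ (1 + 1 / α) * ‖D₀‖ := by
    have h1 := Complex.abs_re_le_norm D₀
    have h2 := Complex.abs_im_le_norm D₀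
    rw [hre] at h1
    rw [him, abs_neg, abs_of_nonneg (by positivity)] at h2
    have h3 : ε * Δ ^ 2 ≤ 1 / α * ‖D₀‖ := by
      rw [one_div, inv_mul_eq_div, le_div_iff₀ hα]; linarith
    rw [hT]; linarith
  have hD₀0 : D₀ ≠ 0 := by
    intro h
    rw [h, norm_zero, mul_zero, hT] at hTD
    rcases hne with h | h
    · have := abs_pos.2 h
      have : 0 ≤ ε * Δ ^ 2 := by positivity
      linarith
    · have : 0 < ε * Δ ^ 2 := by positivity
      linarith [abs_nonneg δ]
  have hD₀T : ‖D₀‖ ≤ (1 + L ^ 3) * T := by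
    calc ‖D₀‖ ≤ |D₀.re| + |D₀.im| := Complex.norm_le_abs_re_add_abs_im _
      _ = |δ| + α * (ε * Δ ^ 2) := by
        rw [hre, him, abs_neg, abs_of_nonneg (by positivity : 0 ≤ ε * α * Δ ^ 2)]; ring
      _ ≤ T + L ^ 3 * T := by gcongr
      _ = _ := by ring
  have nr : ∀ x : ℝ, ‖(x : ℂ)‖ = |x| := fun x => by rw [Complex.norm_real, Real.norm_eq_abs]
  have hDD : ‖denS ε d r z A₁ A₂ - D₀‖ ≤ K₁ * η * T := by
    have e : denS ε d r z A₁ A₂ - D₀ = ((d - δ : ℝ) : ℂ) -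
        Complex.I * ((ε * A₂ * z * d : ℝ) : ℂ) - Complex.I * ((ε * (A₁ * r ^ 2 - α * Δ ^ 2) : ℝ) : ℂ) := by
      rw [hD₀, denS]; push_cast; ring
    rw [e]
    calc _ ≤ ‖((d - δ : ℝ) : ℂ)‖ + ‖Complex.I * ((ε * A₂ * z * d : ℝ) : ℂ)‖ +
        ‖Complex.I * ((ε * (A₁ * r ^ 2 - α * Δ ^ 2) : ℝ) : ℂ)‖ :=
          (norm_sub_le _ _).trans (add_le_add_left (norm_sub_le _ _) _)
      _ = |d - δ| + ε * |A₂| * |z| * |d| + ε * |A₁ * r ^ 2 - α * Δ ^ 2| := by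
        rw [norm_mul, norm_mul, Complex.norm_I, nr, nr, nr, abs_mul, abs_mul, abs_mul, abs_mul ε (_ - _),
          abs_of_pos hε]; ring
      _ ≤ L * ε * T + ε * L * L * ((1 + L) * T) + ε * (4 * L ^ 3 * η * Δ ^ 2) := by gcongr
      _ = L * ε * T + L ^ 2 * (1 + L) * ε * T + 4 * L ^ 3 * η * (ε * Δ ^ 2) := by ring
      _ ≤ L * η * T + L ^ 2 * (1 + L) * η * T + 4 * L ^ 3 * η * T := by gcongr
      _ = _ := by rw [hK₁]; ring
  have hD1 : ‖denS ε d r z A₁ A₂ * (1 - Complex.I * (ε * A₂ : ℝ) * w) - D₀‖ ≤ C₁ * η * ‖D₀‖ := by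
    have e : denS ε d r z A₁ A₂ * (1 - Complex.I * (ε * A₂ : ℝ) * w) - D₀ =
        (denS ε d r z A₁ A₂ - D₀) - Complex.I * ((ε * A₂ * w : ℝ) : ℂ) *
          ((denS ε d r z A₁ A₂ - D₀) + D₀) := by push_cast; ring
    rw [e]
    calc _ ≤ ‖denS ε d r z A₁ A₂ - D₀‖ + ‖Complex.I * ((ε * A₂ * w : ℝ) : ℂ) *
          ((denS ε d r z A₁ A₂ - D₀) + D₀)‖ := norm_sub_le _ _
      _ = ‖denS ε d r z A₁ A₂ - D₀‖ + ε * |A₂| * |w| * ‖(denS ε d r z A₁ A₂ - D₀) + D₀‖ := by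
        rw [norm_mul, norm_mul, Complex.norm_I, nr, abs_mul, abs_mul, abs_of_pos hε, one_mul]
      _ ≤ K₁ * η * T + ε * L * L * (K₁ * η * T + (1 + L ^ 3) * T) := by
        gcongr
        exact (norm_add_le _ _).trans (add_le_add hDD hD₀T)
      _ ≤ K₁ * η * T + η * L * L * (K₁ * 1 * T + (1 + L ^ 3) * T) := by gcongr
      _ = K₂ * η * T := by rw [hK₂]; ring
      _ ≤ K₂ * η * ((1 + 1 / α) * ‖D₀‖) := by gcongr
      _ = _ := by rw [hC₁]; ring
  have hX₁ : ‖((A₂ * (z - w) * d + A₁ * r ^ 2 - (δ * q + α * Δ ^ 2) : ℝ) : ℂ)‖ ≤ C₂ * η * S := by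
    rw [nr]
    calc _ = |A₂ * (z - w) * (d - δ) + (A₂ * (z - w) - q) * δ + (A₁ * r ^ 2 - α * Δ ^ 2)| := by
          congr 1; ring
      _ ≤ |A₂ * (z - w) * (d - δ)| + |(A₂ * (z - w) - q) * δ| + |A₁ * r ^ 2 - α * Δ ^ 2| :=
        (abs_add_le _ _).trans (add_le_add_left (abs_add_le _ _) _)
      _ = |A₂ * (z - w) - q + q| * |d - δ| + |A₂ * (z - w) - q| * |δ| + |A₁ * r ^ 2 - α * Δ ^ 2| := by
        rw [sub_add_cancel, abs_mul _ (d - δ), abs_mul _ δ]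
      _ ≤ (L * η + L) * (L * ε * T) + L * η * T + 4 * L ^ 3 * η * Δ ^ 2 := by
        gcongr
        exact (abs_add_le _ _).trans (add_le_add hqc hq)
      _ ≤ (L * 1 + L) * (L * η * S) + L * η * S + 4 * L ^ 3 * η * S := by gcongr
      _ = _ := by rw [hC₂]; ring
  have hX₂ : ‖(((d - δ) + (ε * A₂) ^ 2 * w * z * d + (ε * A₂) * w * ε * A₁ * r ^ 2 : ℝ) : ℂ)‖ ≤
      C₃ * η * S := by
    rw [nr]
    calc _ ≤ |d - δ| + |(ε * A₂) ^ 2 * w * z * d| + |(ε * A₂) * w * ε * A₁ * r ^ 2| :=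
        (abs_add_le _ _).trans (add_le_add_left (abs_add_le _ _) _)
      _ = |d - δ| + (ε * |A₂|) ^ 2 * |w| * |z| * |d| + ε * |A₂| * |w| * ε * |A₁ * r ^ 2| := by
        rw [abs_mul _ d, abs_mul _ z, abs_mul _ w, abs_pow, abs_mul ε, abs_of_pos hε,
          show ε * A₂ * w * ε * A₁ * r ^ 2 = ε * A₂ * w * ε * (A₁ * r ^ 2) by ring,
          abs_mul _ (A₁ * r ^ 2), abs_mul _ ε, abs_mul _ w, abs_mul ε, abs_of_pos hε]
      _ ≤ L * ε * T + (ε * L) ^ 2 * L * L * ((1 + L) * T) + ε * L * L * ε * (4 * L ^ 3 * Δ ^ 2) := by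
        gcongr
      _ = L * ε * T + L ^ 4 * (1 + L) * (ε * ε) * T + 4 * L ^ 5 * (ε * ε) * Δ ^ 2 := by ring
      _ ≤ L * η * S + L ^ 4 * (1 + L) * (η * 1) * S + 4 * L ^ 5 * (η * 1) * S := by gcongr
      _ = _ := by rw [hC₃]; ring
  obtain ⟨n1, E₁, E₂, b1, b2, h1⟩ := exists_factor (N := (δ * q + (α : ℝ) * Δ ^ 2)) hS0 hD₀0 hD1
    hCη hX₁
  obtain ⟨-, E₃, E₄, b3, b4, h2⟩ := exists_factor (N := (δ : ℂ)) hS0 hD₀0 hD1 hCη hX₂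
  refine ⟨left_ne_zero_of_mul n1, ⟨E₁, E₂, by linarith, by linarith, ?_⟩,
    ⟨E₃, E₄, by linarith, by linarith, ?_⟩⟩
  · rw [← hD₀, ← hS, reflS, mul_assoc (Complex.I * ε), mul_div_assoc, mul_div_assoc, ← h1]
    congr 2
    push_cast; ring
  · rw [← hD₀, ← hS, ← h2, transS]
    congr 1
    push_cast; ring

/-! ### Cosine transforms of the Fourier coefficients -/

/-- `∫ cos(kx) f_j(x) dx`. -/
def cosT (f : ℝ × ℝ → ℝ) (j : ℤ) (k : ℝ) : ℝ := ∫ x, Real.cos (k * x) * (fourierY f j x).re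

/-- Derivative of `cosT`. -/
def cosT' (f : ℝ × ℝ → ℝ) (j : ℤ) (k : ℝ) : ℝ := ∫ x, -(x * Real.sin (k * x)) * (fourierY f j x).re

section
variable {f : ℝ × ℝ → ℝ} {R : ℝ}

lemma IsPert.fourierY_re (h : IsPert f R) (j : ℤ) (x : ℝ) : ((fourierY f j x).re : ℂ) = fourierY f j x :=
  Complex.conj_eq_iff_re.1 (h.conj_fourierY j x)

lemma IsPert.hasCompactSupport_fourierY (h : IsPert f R) (j : ℤ) : HasCompactSupport (fourierY f j) :=
  HasCompactSupport.intro (isCompact_Icc (a := -R) (b := R)) fun x hx => h.fourierY_zero j (by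
    by_contra hc
    push Not at hc
    exact hx ⟨(abs_lt.1 hc).1.le, (abs_lt.1 hc).2.le⟩)

lemma IsPert.integrable_mul_re (h : IsPert f R) (j : ℤ) {g : ℝ → ℝ} (hg : Continuous g) :
    Integrable fun x => g x * (fourierY f j x).re := by
  have hc := continuous_fourierY h.smooth.continuous j
  refine Continuous.integrable_of_hasCompactSupport (by fun_prop) ?_
  exact ((h.hasCompactSupport_fourierY j).comp_left (g := Complex.re) rfl).mul_left

lemma IsPert.integrable_mul_fourierY (h : IsPert f R) (j : ℤ) {g : ℝ → ℂ} (hg : Continuous g) :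
    Integrable fun x => g x * fourierY f j x := by
  have hc := continuous_fourierY h.smooth.continuous j
  exact Continuous.integrable_of_hasCompactSupport (by fun_prop)
    (h.hasCompactSupport_fourierY j).mul_left

lemma IsPert.ofReal_cosT (h : IsPert f R) (j : ℤ) (k : ℝ) :
    (cosT f j k : ℂ) = ∫ x : ℝ, Complex.cos (k * x) * fourierY f j x := by
  unfold cosT
  rw [← integral_complex_ofReal]
  refine integral_congr_ae (ae_of_all _ fun x => ?_)
  simp only
  push_cast
  rw [h.fourierY_re]

/-- Since `f_j` is even, the transform equals its mean with the reflected integral, which is the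
cosine transform and hence real. -/
lemma IsPert.fourierXY_eq (h : IsPert f R) (j : ℤ) (k : ℝ) : fourierXY f j k = cosT f j k := by
  have h1 : fourierXY f j k = ∫ x : ℝ, Complex.exp (Complex.I * k * x) * fourierY f j x := by
    unfold fourierXY
    rw [← integral_neg_eq_self]
    refine integral_congr_ae (ae_of_all _ fun x => ?_)
    simp only
    rw [h.fourierY_even]
    push_cast
    congr 2; ring
  have h2 : fourierXY f j k + fourierXY f j k = (cosT f j k : ℂ) + cosT f j k := by
    nth_rewrite 1 [h1]
    unfold fourierXY
    rw [h.ofReal_cosT, ← integral_add (h.integrable_mul_fourierY j (by fun_prop))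
      (h.integrable_mul_fourierY j (by fun_prop)), ← integral_add
      (h.integrable_mul_fourierY j (by fun_prop)) (h.integrable_mul_fourierY j (by fun_prop))]
    refine integral_congr_ae (ae_of_all _ fun x => ?_)
    simp only
    rw [Complex.cos, ← add_mul, ← add_mul]
    congr 1
    rw [show (k : ℂ) * x * Complex.I = Complex.I * k * x by ring,
      show -((k : ℂ) * x) * Complex.I = -(Complex.I * k * x) by ring]
    ring
  rw [← two_mul, ← two_mul] at h2
  exact mul_left_cancel₀ two_ne_zero h2

lemma IsPert.intC_coefC_mul_cosC (h : IsPert f R) (j : ℤ) (k : ℝ) :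
    intC R (coefC f R j * cosC R k) = cosT f j k := by
  rw [h.ofReal_cosT, intC_apply]
  have e : ∀ x : Set.Icc (-R) R, (coefC f R j * cosC R k) x =
      (fun x : ℝ => Complex.cos (k * x) * fourierY f j x) x := fun x => by
    rw [ContinuousMap.mul_apply, h.coefC_apply, cosC_apply, mul_comm]
  rw [integral_congr_ae (ae_of_all _ e),
    integral_lebIcc R (fun x : ℝ => Complex.cos (k * x) * fourierY f j x), setIntegral_eq_integral_of_forall_compl_eq_zero]
  intro x hx
  have : R ≤ |x| := by
    by_contra hc
    push Not at hc
    exact hx ⟨(abs_lt.1 hc).1.le, (abs_lt.1 hc).2.le⟩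
  rw [h.fourierY_zero j this, mul_zero]

lemma IsPert.intC_coefC (h : IsPert f R) : intC R (coefC f R 0) = cosT f 0 0 := by
  rw [← h.intC_coefC_mul_cosC]
  congr 1
  ext x
  simp

lemma IsPert.integrable_strip (h : IsPert f R) : IntegrableOn f strip := by
  have h1 : IntegrableOn f (Set.Icc (-R) R ×ˢ Set.Icc 0 (2 * Real.pi)) :=
    h.smooth.continuous.continuousOn.integrableOn_compact (isCompact_Icc.prod isCompact_Icc)
  refine h1.of_forall_sdiff_eq_zero (MeasurableSet.univ.prod measurableSet_Ioo) fun p hp => ?_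
  have hR : R ≤ |p.1| := by
    by_contra hc
    push Not at hc
    exact hp.2 ⟨⟨(abs_lt.1 hc).1.le, (abs_lt.1 hc).2.le⟩, Set.Ioo_subset_Icc_self hp.1.2⟩
  exact h.zero hR p.2

lemma IsPert.integral_strip (h : IsPert f R) : ∫ p in strip, f p = cosT f 0 0 := by
  have hi := h.integrable_strip
  unfold strip at *
  rw [Measure.volume_eq_prod] at *
  rw [setIntegral_prod _ hi, setIntegral_univ]
  unfold cosT
  refine integral_congr_ae (ae_of_all _ fun x => ?_)
  have : fourierY f 0 x = ((∫ y in Set.Ioo 0 (2 * Real.pi), f (x, y) : ℝ) : ℂ) := by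
    unfold fourierY
    rw [intervalIntegral.integral_of_le Real.two_pi_pos.le, ← integral_Ioc_eq_integral_Ioo,
      ← integral_complex_ofReal]
    simp
  simp [this]

/-- Mean value inequality for `t ↦ cos t + t sin c`, whose derivative `sin c - sin t` is small near
`c`. The expansion is centred at `c`, while both end points are free. -/
lemma abs_cos_sub_cos_add_le (a b c : ℝ) :
    |Real.cos a - Real.cos b + Real.sin c * (a - b)| ≤ (|a - c| + |b - c|) * |a - b| := by
  have hd : ∀ t ∈ Set.uIcc b a, HasDerivWithinAt (fun t => Real.cos t + Real.sin c * t)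
      (-Real.sin t + Real.sin c * 1) (Set.uIcc b a) t := fun t _ =>
    ((Real.hasDerivAt_cos t).add ((hasDerivAt_id t).const_mul _)).hasDerivWithinAt
  have hb : ∀ t ∈ Set.uIcc b a, ‖-Real.sin t + Real.sin c * 1‖ ≤ |a - c| + |b - c| := by
    intro t ht
    have h1 : |Real.sin c - Real.sin t| ≤ |c - t| := Real.abs_sin_sub_sin_le c t
    rw [show -Real.sin t + Real.sin c * 1 = Real.sin c - Real.sin t by ring, Real.norm_eq_abs]
    refine h1.trans ?_
    rw [Set.mem_uIcc] at ht
    rcases ht with ht | ht <;>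
    · rcases abs_cases (a - c) with h2 | h2 <;> rcases abs_cases (b - c) with h3 | h3 <;>
        rcases abs_cases (c - t) with h4 | h4 <;> linarith
  have := (convex_uIcc b a).norm_image_sub_le_of_norm_hasDerivWithin_le hd hb Set.left_mem_uIcc
    Set.right_mem_uIcc
  rw [Real.norm_eq_abs, Real.norm_eq_abs] at this
  refine le_trans (le_of_eq ?_) this
  congr 1; ring

lemma IsPert.abs_integral_mul_re_le (h : IsPert f R) (j : ℤ) {u v : ℝ → ℝ} {C : ℝ} (hu : Continuous u)
    (hv : Continuous v) (huv : ∀ x, |u x| ≤ C * v x) :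
    |∫ x, u x * (fourierY f j x).re| ≤ C * ∫ x, v x * |(fourierY f j x).re| := by
  have hint : Integrable fun x => v x * |(fourierY f j x).re| := by
    have hc := continuous_fourierY h.smooth.continuous j
    refine Continuous.integrable_of_hasCompactSupport (by fun_prop) ?_
    exact HasCompactSupport.intro (isCompact_Icc (a := -R) (b := R)) fun x hx => by
      rw [h.fourierY_zero j (by
        by_contra hc
        push Not at hc
        exact hx ⟨(abs_lt.1 hc).1.le, (abs_lt.1 hc).2.le⟩), Complex.zero_re, abs_zero, mul_zero]
  rw [← integral_const_mul]
  refine (abs_integral_le_integral_abs).trans (integral_mono (h.integrable_mul_re j hu).abs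
    (hint.const_mul C) fun x => ?_)
  change |u x * (fourierY f j x).re| ≤ C * (v x * |(fourierY f j x).re|)
  rw [abs_mul, ← mul_assoc]
  exact mul_le_mul_of_nonneg_right (huv x) (abs_nonneg _)

/-- First order Taylor estimate for the cosine transforms. -/
lemma IsPert.exists_cosT_bound (h : IsPert f R) (j : ℤ) : ∃ M, 0 ≤ M ∧
    (∀ k, |cosT f j k| ≤ M) ∧ (∀ k k', |cosT f j k - cosT f j k'| ≤ M * |k - k'|) ∧
    ∀ k₀ k k', |cosT f j k - cosT f j k' - cosT' f j k₀ * (k - k')| ≤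
      M * (|k - k₀| + |k' - k₀|) * |k - k'| := by
  obtain ⟨N, hN⟩ : ∃ N : (ℝ → ℝ) → ℝ, ∀ g, N g = ∫ x, g x * |(fourierY f j x).re| := ⟨_, fun _ => rfl⟩
  have hpos : ∀ {g : ℝ → ℝ}, (∀ x, 0 ≤ g x) → 0 ≤ N g := fun hg => by
    rw [hN]; exact integral_nonneg fun x => mul_nonneg (hg x) (abs_nonneg _)
  have key : ∀ {u v : ℝ → ℝ} {C : ℝ}, Continuous u → Continuous v → (∀ x, |u x| ≤ C * v x) →
      |∫ x, u x * (fourierY f j x).re| ≤ C * N v := fun hu hv huv => by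
    rw [hN]; exact h.abs_integral_mul_re_le j hu hv huv
  have n1 := hpos (g := fun _ => 1) (by simp)
  have n2 := hpos (g := fun x => |x|) (by simp)
  have n3 := hpos (g := fun x => x ^ 2) (fun x => sq_nonneg x)
  -- The moments of `|f_j|` with weights `1`, `|x|` and `x²` control the value, the Lipschitz
  -- constant and the second order remainder.
  refine ⟨N (fun _ => 1) + N (fun x => |x|) + N (fun x => x ^ 2), by positivity, fun k => ?_,
    fun k k' => ?_, fun k₀ k k' => ?_⟩
  · have := key (u := fun x => Real.cos (k * x)) (v := fun _ => 1) (C := 1) (by fun_prop) (by fun_prop)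
      (fun x => by simpa using Real.abs_cos_le_one _)
    unfold cosT; linarith
  · have := key (u := fun x => Real.cos (k * x) - Real.cos (k' * x)) (v := fun x => |x|)
      (C := |k - k'|) (by fun_prop) (by fun_prop) (fun x => by
        refine (Real.abs_cos_sub_cos_le _ _).trans (le_of_eq ?_)
        rw [← sub_mul, abs_mul])
    have e : cosT f j k - cosT f j k' =
        ∫ x, (Real.cos (k * x) - Real.cos (k' * x)) * (fourierY f j x).re := by
      unfold cosT
      rw [← integral_sub (h.integrable_mul_re j (by fun_prop)) (h.integrable_mul_re j (by fun_prop))]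
      simp only [sub_mul]
    rw [e]
    refine this.trans ?_
    rw [mul_comm]
    gcongr
    linarith
  · have := key (u := fun x => Real.cos (k * x) - Real.cos (k' * x) + Real.sin (k₀ * x) * (k * x - k' * x))
      (v := fun x => x ^ 2) (C := (|k - k₀| + |k' - k₀|) * |k - k'|) (by fun_prop) (by fun_prop)
      (fun x => by
        refine (abs_cos_sub_cos_add_le _ _ _).trans (le_of_eq ?_)
        rw [← sub_mul, ← sub_mul, ← sub_mul, abs_mul, abs_mul, abs_mul, ← sq_abs x]; ring)
    have e : cosT f j k - cosT f j k' - cosT' f j k₀ * (k - k') =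
        ∫ x, (Real.cos (k * x) - Real.cos (k' * x) + Real.sin (k₀ * x) * (k * x - k' * x)) *
          (fourierY f j x).re := by
      unfold cosT cosT'
      rw [← integral_mul_const, ← integral_sub (h.integrable_mul_re j (by fun_prop))
        (h.integrable_mul_re j (by fun_prop))]
      refine (integral_sub
        ((h.integrable_mul_re j (g := fun x => Real.cos (k * x)) (by fun_prop)).sub
        (h.integrable_mul_re j (g := fun x => Real.cos (k' * x)) (by fun_prop)))
        ((h.integrable_mul_re j (g := fun x => -(x * Real.sin (k₀ * x))) (by fun_prop)).mul_const
          _)).symm.trans ?_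
      refine integral_congr_ae (ae_of_all _ fun x => ?_)
      simp only [Pi.sub_apply]
      ring
    rw [e]
    refine this.trans ?_
    rw [mul_comm, ← mul_assoc]
    gcongr
    linarith

lemma IsPert.hasDerivAt_fourierXY (h : IsPert f R) (j : ℤ) (k : ℝ) :
    HasDerivAt (fourierXY f j) (cosT' f j k : ℂ) k := by
  obtain ⟨M, hM, -, -, h3⟩ := h.exists_cosT_bound j
  have h1 : HasDerivAt (cosT f j) (cosT' f j k) k := by
    rw [hasDerivAt_iff_isLittleO]
    refine Asymptotics.IsBigO.trans_isLittleO (g := fun x => ‖x - k‖ ^ 2) ?_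
      (Asymptotics.isLittleO_pow_sub_sub k one_lt_two)
    · refine Asymptotics.IsBigO.of_bound M (Eventually.of_forall fun x => ?_)
      have := h3 k x k
      rw [sub_self, abs_zero, add_zero] at this
      rw [Real.norm_eq_abs, norm_pow, norm_norm, Real.norm_eq_abs, smul_eq_mul, mul_comm (x - k)]
      exact this.trans (le_of_eq (by ring))
  have e : fourierXY f j = fun k => (cosT f j k : ℂ) := funext fun k => h.fourierXY_eq j k
  rw [e]
  exact h1.ofReal_comp

end

section
variable {f : ℝ × ℝ → ℝ} {R b K C ε : ℝ}

/-! ### The reduced quantities for real parameters -/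

/-- `γ(m, β)` for real `m`. -/
def gamR (m β : ℝ) : ℝ := ((1 - β) ^ 2 - m ^ 2) / (4 * Real.pi)

lemma ofReal_gamR (m β : ℝ) : (gamR m β : ℂ) = gam m β := by unfold gamR gam; push_cast; ring

lemma gamR_zero (β : ℝ) : gamR 0 β = gamZero β := by unfold gamR gamZero; ring

lemma waveNumber_zero (β : ℝ) : waveNumber 0 β = kap β := by
  unfold waveNumber kap omegaSq; congr 1; ring

lemma Dom.waveNumber_arg {m β : ℝ} (h : Dom b (m : ℂ) β) : 0 < omegaSq m β - β ^ 2 := by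
  have h1 : m ^ 2 ≤ b / 2 := by
    have := h.small
    rwa [Complex.norm_real, Real.norm_eq_abs, sq_abs] at this
  unfold omegaSq
  nlinarith [h.ge, h.pos]

lemma Dom.kZero_eq {m β : ℝ} (h : Dom b (m : ℂ) β) : kZero m β = waveNumber m β := by
  unfold kZero waveNumber
  rw [← cpow_half_ofReal h.waveNumber_arg.le]
  congr 1
  unfold omegaSq; push_cast; ring

lemma Dom.le_waveNumber {m β : ℝ} (h : Dom b (m : ℂ) β) : Real.sqrt b ≤ waveNumber m β := by
  have := h.kZero_re
  rwa [h.kZero_eq, Complex.ofReal_re] at this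

lemma Dom.waveNumber_sq {m β : ℝ} (h : Dom b (m : ℂ) β) : waveNumber m β ^ 2 = 1 - 2 * β - m ^ 2 := by
  unfold waveNumber
  rw [Real.sq_sqrt h.waveNumber_arg.le]
  unfold omegaSq; ring

lemma abs_waveNumber_sub_le {m m' β β' : ℝ} (h : Dom b (m : ℂ) β) (h' : Dom b (m' : ℂ) β') :
    |waveNumber m β - waveNumber m' β'| ≤ 1 / Real.sqrt b * (|m - m'| + |β - β'|) := by
  have := norm_kZero_sub_le h h'
  rwa [h.kZero_eq, h'.kZero_eq, ← Complex.ofReal_sub, ← Complex.ofReal_sub, Complex.norm_real,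
    Complex.norm_real, Real.norm_eq_abs, Real.norm_eq_abs] at this

lemma Dom.abs_gamR_le {m β : ℝ} (h : Dom b (m : ℂ) β) : |gamR m β| ≤ 1 := by
  have := h.norm_gam_le
  rwa [← ofReal_gamR, Complex.norm_real] at this

lemma abs_gamR_sub_le {m m' β β' : ℝ} (h : Dom b (m : ℂ) β) (h' : Dom b (m' : ℂ) β') :
    |gamR m β - gamR m' β'| ≤ |m - m'| + |β - β'| := by
  have := norm_gam_sub_le h h'
  rwa [← ofReal_gamR, ← ofReal_gamR, ← Complex.ofReal_sub, ← Complex.ofReal_sub, Complex.norm_real,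
    Complex.norm_real] at this

lemma abs_inv_sub_inv_le {k k' t : ℝ} (ht : 0 < t) (hk : t ≤ k) (hk' : t ≤ k') :
    |k⁻¹ - k'⁻¹| ≤ 1 / t ^ 2 * |k - k'| := by
  have h0 := ht.trans_le hk
  have h0' := ht.trans_le hk'
  rw [inv_sub_inv h0.ne' h0'.ne', abs_div, abs_of_pos (mul_pos h0 h0'), abs_sub_comm, one_div,
    inv_mul_eq_div]
  gcongr
  nlinarith

lemma abs_inv_le {k t : ℝ} (ht : 0 < t) (hk : t ≤ k) : |k⁻¹| ≤ 1 / t := by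
  rw [abs_of_pos (inv_pos.2 (ht.trans_le hk)), one_div]
  exact inv_anti₀ ht hk

lemma abs_mul_sub_mul_le {a a' c c' A C d e : ℝ} (ha : |a| ≤ A) (hc : |c'| ≤ C) (hd : |a - a'| ≤ d)
    (he : |c - c'| ≤ e) : |a * c - a' * c'| ≤ A * e + C * d := by
  calc |a * c - a' * c'| = |a * (c - c') + (a - a') * c'| := by congr 1; ring
    _ ≤ |a * (c - c')| + |(a - a') * c'| := abs_add_le _ _
    _ = |a| * |c - c'| + |c'| * |a - a'| := by rw [abs_mul, abs_mul, mul_comm |a - a'|]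
    _ ≤ _ := by
      have := (abs_nonneg _).trans ha
      have := (abs_nonneg _).trans hc
      gcongr

lemma norm_mul_sub_mul_le {a a' c c' : ℂ} {A C d e : ℝ} (ha : ‖a‖ ≤ A) (hc : ‖c'‖ ≤ C)
    (hd : ‖a - a'‖ ≤ d) (he : ‖c - c'‖ ≤ e) : ‖a * c - a' * c'‖ ≤ A * e + C * d := by
  calc ‖a * c - a' * c'‖ = ‖a * (c - c') + (a - a') * c'‖ := by congr 1; ring
    _ ≤ ‖a * (c - c')‖ + ‖(a - a') * c'‖ := norm_add_le _ _
    _ = ‖a‖ * ‖c - c'‖ + ‖c'‖ * ‖a - a'‖ := by rw [norm_mul, norm_mul, mul_comm ‖a - a'‖]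
    _ ≤ _ := by
      have := (norm_nonneg _).trans ha
      have := (norm_nonneg _).trans hc
      gcongr

/-- At real parameters `a` and `z` are real, so the real part of `1 - iaz` is `1`. -/
lemma Adm.one_sub_ne {m β : ℝ} (h : Adm f R b K ε (m : ℂ) β) {z : ℂ} (hz : ((z.re : ℝ) : ℂ) = z) :
    1 - Complex.I * sa ε m β * z ≠ 0 := by
  intro h0
  have e : Complex.I * sa ε m β * z =
      Complex.I * ((ε * gamR m β / waveNumber m β * z.re : ℝ) : ℂ) := by
    unfold sa
    rw [h.dom.kZero_eq, ← ofReal_gamR]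
    nth_rewrite 1 [← hz]
    push_cast; ring
  rw [e] at h0
  have := congrArg Complex.re h0
  simp [-Complex.ofReal_mul, -Complex.ofReal_div] at this

/-- The interval of `β` and the domain of the spectral parameter. -/
lemma dom_of_le {β₀₀ β : ℝ} {μ : ℂ} (h0 : 0 < β₀₀) (h1 : β₀₀ < 1 / 2) (hb : b = min β₀₀ (1 / 2 - β₀₀) / 2)
    (hre : 0 ≤ μ.re) (hμ : ‖μ‖ ≤ b) (hβ : |β - β₀₀| ≤ b) : Dom b μ β := by
  have h2 : b ≤ β₀₀ / 2 := by rw [hb]; linarith [min_le_left β₀₀ (1 / 2 - β₀₀)]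
  have h3 : b ≤ (1 / 2 - β₀₀) / 2 := by rw [hb]; linarith [min_le_right β₀₀ (1 / 2 - β₀₀)]
  have hpos : 0 < b := by
    rw [hb]; exact half_pos (lt_min h0 (by linarith))
  rw [abs_le] at hβ
  refine ⟨hpos, by linarith [hβ.1], by linarith [hβ.2], hre, ?_⟩
  have : ‖μ‖ ^ 2 ≤ b ^ 2 := by gcongr
  nlinarith

/-- Linearization of the cosine transform along the wave number. -/
lemma abs_cosT_waveNumber_slope_le {M : ℝ} {j : ℤ} (hM : 0 ≤ M)
    (h3 : ∀ k₀ k k', |cosT f j k - cosT f j k' - cosT' f j k₀ * (k - k')| ≤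
      M * (|k - k₀| + |k' - k₀|) * |k - k'|) {β₀ m β β' : ℝ} (hm : 0 ≤ m) (d0 : Dom b ((0 : ℝ) : ℂ) β₀)
    (d1 : Dom b (m : ℂ) β) (d2 : Dom b (m : ℂ) β') :
    |cosT f j (waveNumber m β) - cosT f j (waveNumber m β') -
      -cosT' f j (waveNumber 0 β₀) / waveNumber 0 β₀ * (β - β')| ≤
    (2 * M / Real.sqrt b ^ 2 + 2 * |cosT' f j (waveNumber 0 β₀)| / Real.sqrt b ^ 3) *
      (m + |β - β₀| + |β' - β₀|) * |β - β'| := by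
  obtain ⟨t, ht⟩ : ∃ t, t = Real.sqrt b := ⟨_, rfl⟩
  have ht0 : 0 < t := by rw [ht]; exact Real.sqrt_pos.2 d0.pos
  have k0 := d0.le_waveNumber
  have k1 := d1.le_waveNumber
  have k2 := d2.le_waveNumber
  have e1 := abs_waveNumber_sub_le d1 d0
  have e2 := abs_waveNumber_sub_le d2 d0
  have e3 := abs_waveNumber_sub_le d1 d2
  -- The square of the wave number is affine in `β`, so `k - k' = -2(β - β')/(k + k')` exactly.
  have hsq : waveNumber m β ^ 2 - waveNumber m β' ^ 2 = -2 * (β - β') := by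
    rw [d1.waveNumber_sq, d2.waveNumber_sq]; ring
  have h := h3 (waveNumber 0 β₀) (waveNumber m β) (waveNumber m β')
  rw [← ht] at k0 k1 k2 e1 e2 e3 ⊢
  rw [sub_zero, abs_of_nonneg hm] at e1 e2
  rw [sub_self, abs_zero, zero_add] at e3
  generalize waveNumber 0 β₀ = κ at *
  generalize waveNumber m β = k at *
  generalize waveNumber m β' = k' at *
  generalize cosT' f j κ = D at *
  obtain ⟨s, hs⟩ : ∃ s, s = 1 / t := ⟨_, rfl⟩
  have hs0 : 0 < s := by rw [hs]; positivity
  have hts : t * s = 1 := by rw [hs]; field_simp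
  obtain ⟨E, hE⟩ : ∃ E, E = m + |β - β₀| + |β' - β₀| := ⟨_, rfl⟩
  have hE0 : 0 ≤ E := by rw [hE]; positivity
  rw [← hs] at e1 e2 e3
  have hκ : 0 < κ := ht0.trans_le k0
  have hkk : 0 < k + k' := by linarith
  have hsum : |k - κ| + |k' - κ| ≤ 2 * s * E := by
    have : s * (m + |β - β₀|) + s * (m + |β' - β₀|) ≤ 2 * s * E := by
      rw [hE]
      have p1 : 0 ≤ s * |β - β₀| := by positivity
      have p2 : 0 ≤ s * |β' - β₀| := by positivity
      linarith
    linarith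
  -- The slope `-2/(k + k')` differs from `-1/κ` by `(k + k' - 2κ)/(κ(k + k'))`, which is controlled
  -- by the distances of `k` and `k'` to `κ`.
  have hlin : |k - k' + (β - β') / κ| ≤ 2 * s ^ 3 * E * |β - β'| := by
    have e : k - k' + (β - β') / κ = (k - κ + (k' - κ)) * ((β - β') / (κ * (k + k'))) := by
      have : β - β' = -(k - k') * (k + k') / 2 := by linarith
      rw [this]; field_simp; ring
    rw [e, abs_mul, abs_div, abs_of_pos (mul_pos hκ hkk)]
    have h5 : |β - β'| / (κ * (k + k')) ≤ |β - β'| * s ^ 2 := by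
      rw [div_le_iff₀ (mul_pos hκ hkk)]
      have h6 : 1 ≤ s ^ 2 * (κ * (k + k')) := by
        calc (1 : ℝ) = s ^ 2 * (t * t) := by rw [show s ^ 2 * (t * t) = (t * s) ^ 2 by ring, hts]; norm_num
          _ ≤ _ := by gcongr; linarith
      calc |β - β'| = |β - β'| * 1 := by ring
        _ ≤ |β - β'| * (s ^ 2 * (κ * (k + k'))) := by gcongr
        _ = _ := by ring
    calc _ ≤ (2 * s * E) * (|β - β'| * s ^ 2) := by
          gcongr
          exact (abs_add_le _ _).trans hsum
      _ = _ := by ring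
  have e : cosT f j k - cosT f j k' - -D / κ * (β - β') =
      (cosT f j k - cosT f j k' - D * (k - k')) + D * (k - k' + (β - β') / κ) := by ring
  rw [e]
  calc _ ≤ |cosT f j k - cosT f j k' - D * (k - k')| + |D| * |k - k' + (β - β') / κ| := by
        rw [← abs_mul]; exact abs_add_le _ _
    _ ≤ M * (2 * s * E) * (s * |β - β'|) + |D| * (2 * s ^ 3 * E * |β - β'|) := by
      gcongr
      exact h.trans (by gcongr)
    _ = (2 * M / t ^ 2 + 2 * |D| / t ^ 3) * E * |β - β'| := by rw [hs]; field_simp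
    _ = _ := by rw [hE]

end

section
variable {f : ℝ × ℝ → ℝ} {R b K C ε : ℝ}

/-! ### Verification of the uniform estimates -/

/-- `γ F`, the right-hand side of the dispersion relation. -/
def qQ (f : ℝ × ℝ → ℝ) (R ε : ℝ) (μ : ℂ) (β : ℝ) : ℂ := gam μ β * dispF f R ε μ β

/-- `γ F` for the reduced system. -/
def qR (f : ℝ × ℝ → ℝ) (R ε m β : ℝ) : ℝ := gamR m β * (sF f R ε m β).re

/-- `γ / k_0`. -/
def cA₂ (m β : ℝ) : ℝ := gamR m β * (waveNumber m β)⁻¹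

/-- `γ² / k_0`. -/
def cA₁ (m β : ℝ) : ℝ := gamR m β * cA₂ m β

lemma Adm.sa_eq {m β : ℝ} (h : Adm f R b K ε (m : ℂ) β) : sa ε m β = ε * cA₂ m β := by
  unfold sa cA₂
  rw [h.dom.kZero_eq, ← ofReal_gamR]
  push_cast; field_simp

lemma Adm.qQ_eq {m β : ℝ} (h : Adm f R b K ε (m : ℂ) β) : qQ f R ε m β =
    qR f R ε m β + Complex.I * ε * cA₁ m β * ((sr f R ε m β).re : ℝ) ^ 2 /
      (1 - Complex.I * ε * cA₂ m β * ((sz f R ε m β).re : ℝ)) := by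
  unfold qQ qR cA₁
  rw [h.dispF_eq (h.one_sub_ne h.sz_ofReal), h.sa_eq, h.sr_ofReal, h.sz_ofReal]
  push_cast
  rw [h.sF_ofReal, ofReal_gamR, ← mul_assoc Complex.I (ε : ℂ)]
  ring

variable {β₀ : ℝ}

lemma Dom.abs_cA₂_le {m β : ℝ} (h : Dom b (m : ℂ) β) : |cA₂ m β| ≤ 1 / Real.sqrt b := by
  unfold cA₂
  rw [abs_mul]
  calc _ ≤ 1 * (1 / Real.sqrt b) :=
        mul_le_mul h.abs_gamR_le (abs_inv_le (Real.sqrt_pos.2 h.pos) h.le_waveNumber) (abs_nonneg _)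
          zero_le_one
    _ = _ := one_mul _

lemma abs_cA₂_sub_le {m m' β β' : ℝ} (h : Dom b (m : ℂ) β) (h' : Dom b (m' : ℂ) β') :
    |cA₂ m β - cA₂ m' β'| ≤ (1 / Real.sqrt b ^ 3 + 1 / Real.sqrt b) * (|m - m'| + |β - β'|) := by
  have ht := Real.sqrt_pos.2 h.pos
  have h1 := abs_inv_sub_inv_le ht h.le_waveNumber h'.le_waveNumber
  have h2 := abs_waveNumber_sub_le h h'
  have h3 : |(waveNumber m β)⁻¹ - (waveNumber m' β')⁻¹| ≤
      1 / Real.sqrt b ^ 3 * (|m - m'| + |β - β'|) := by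
    refine h1.trans ?_
    calc _ ≤ 1 / Real.sqrt b ^ 2 * (1 / Real.sqrt b * (|m - m'| + |β - β'|)) := by gcongr
      _ = _ := by field_simp
  refine (abs_mul_sub_mul_le h.abs_gamR_le (abs_inv_le ht h'.le_waveNumber) (abs_gamR_sub_le h h')
    h3).trans (le_of_eq (by ring))

lemma Dom.abs_cA₁_le {m β : ℝ} (h : Dom b (m : ℂ) β) : |cA₁ m β| ≤ 1 / Real.sqrt b := by
  unfold cA₁
  rw [abs_mul]
  calc _ ≤ 1 * (1 / Real.sqrt b) := mul_le_mul h.abs_gamR_le h.abs_cA₂_le (abs_nonneg _) zero_le_one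
    _ = _ := one_mul _

lemma abs_cA₁_sub_le {m m' β β' : ℝ} (h : Dom b (m : ℂ) β) (h' : Dom b (m' : ℂ) β') :
    |cA₁ m β - cA₁ m' β'| ≤ (1 / Real.sqrt b ^ 3 + 2 / Real.sqrt b) * (|m - m'| + |β - β'|) := by
  refine (abs_mul_sub_mul_le h.abs_gamR_le h'.abs_cA₂_le (abs_gamR_sub_le h h')
    (abs_cA₂_sub_le h h')).trans (le_of_eq (by ring))

lemma IsPert.norm_intC_le (hf : IsPert f R) {M₀ : ℝ} (hM : ∀ k, |cosT f 0 k| ≤ M₀) :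
    ‖intC R (coefC f R 0)‖ ≤ M₀ := by
  rw [hf.intC_coefC, Complex.norm_real]; exact hM 0

lemma RedBounds.norm_dispF_le (H : RedBounds f R b K C) (hf : IsPert f R) {M₀ : ℝ}
    (hM : ∀ k, |cosT f 0 k| ≤ M₀) {μ : ℂ} {β : ℝ} (h : Adm f R b K ε μ β) (hε : ε ≤ 1) :
    ‖dispF f R ε μ β‖ ≤ M₀ + C := by
  have h1 := H.disp ε μ β h
  have h2 := hf.norm_intC_le hM
  have h3 := norm_sub_norm_le (dispF f R ε μ β) (intC R (coefC f R 0))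
  have h4 : C * ε ≤ C * 1 := mul_le_mul_of_nonneg_left hε H.nonneg
  linarith

lemma RedBounds.norm_sF_le (H : RedBounds f R b K C) (hf : IsPert f R) {M₀ : ℝ}
    (hM : ∀ k, |cosT f 0 k| ≤ M₀) {μ : ℂ} {β : ℝ} (h : Adm f R b K ε μ β) (hε : ε ≤ 1) :
    ‖RayleighBloch.sF f R ε μ β‖ ≤ M₀ + C := by
  have h1 := H.sF ε μ β h
  have h2 := hf.norm_intC_le hM
  have h3 := norm_sub_norm_le (RayleighBloch.sF f R ε μ β) (intC R (coefC f R 0))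
  have h4 : C * ε ≤ C * 1 := mul_le_mul_of_nonneg_left hε H.nonneg
  linarith

lemma RedBounds.qQ_lip (H : RedBounds f R b K C) (hf : IsPert f R) {M₀ : ℝ}
    (hM : ∀ k, |cosT f 0 k| ≤ M₀) {μ μ' : ℂ} {β β' : ℝ} (h : Adm f R b K ε μ β)
    (h' : Dom b μ' β') (hε : ε ≤ 1) :
    ‖qQ f R ε μ β - qQ f R ε μ' β'‖ ≤ (M₀ + 2 * C) * (‖μ - μ'‖ + |β - β'|) := by
  refine (norm_mul_sub_mul_le h.dom.norm_gam_le (H.norm_dispF_le hf hM (h.of_dom h') hε)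
    (norm_gam_sub_le h.dom h') (H.disp_lip ε μ β h μ' β' h')).trans ?_
  have : C * ε * (‖μ - μ'‖ + |β - β'|) ≤ C * 1 * (‖μ - μ'‖ + |β - β'|) := by
    have := H.nonneg
    gcongr
  linarith

lemma Adm.ofReal_qR {m β : ℝ} (h : Adm f R b K ε (m : ℂ) β) :
    (qR f R ε m β : ℂ) = gam m β * RayleighBloch.sF f R ε m β := by
  unfold qR; push_cast; rw [h.sF_ofReal, ofReal_gamR]

lemma RedBounds.qR_lip (H : RedBounds f R b K C) (hf : IsPert f R) {M₀ : ℝ}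
    (hM : ∀ k, |cosT f 0 k| ≤ M₀) {m m' β β' : ℝ} (h : Adm f R b K ε (m : ℂ) β)
    (h' : Dom b (m' : ℂ) β') (hε : ε ≤ 1) :
    |qR f R ε m β - qR f R ε m' β'| ≤ (M₀ + 2 * C) * (|m - m'| + |β - β'|) := by
  have h1 := (norm_mul_sub_mul_le h.dom.norm_gam_le (H.norm_sF_le hf hM (h.of_dom h') hε)
    (norm_gam_sub_le h.dom h') (H.sF_lip ε m β h m' β' h'))
  rw [← h.ofReal_qR, ← (h.of_dom h').ofReal_qR, ← Complex.ofReal_sub, ← Complex.ofReal_sub,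
    Complex.norm_real, Complex.norm_real, Real.norm_eq_abs, Real.norm_eq_abs] at h1
  have : C * ε * (|m - m'| + |β - β'|) ≤ C * 1 * (|m - m'| + |β - β'|) := by
    have := H.nonneg
    gcongr
  linarith

lemma norm_gam_mul_center_le (hf : IsPert f R) {M₀ e : ℝ} (hM : ∀ k, |cosT f 0 k| ≤ M₀) {μ : ℂ} {β : ℝ}
    (h : Dom b μ β) (h0 : Dom b ((0 : ℝ) : ℂ) β₀) {z : ℂ} (hz : ‖z - intC R (coefC f R 0)‖ ≤ e) :
    ‖gam μ β * z - nuCenter f β₀‖ ≤ e + M₀ * (‖μ‖ + |β - β₀|) := by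
  have e1 : (nuCenter f β₀ : ℂ) = gam ((0 : ℝ) : ℂ) β₀ * intC R (coefC f R 0) := by
    unfold nuCenter
    rw [hf.integral_strip, hf.intC_coefC, ← ofReal_gamR, gamR_zero]; push_cast; rfl
  rw [e1]
  have := norm_mul_sub_mul_le h.norm_gam_le (hf.norm_intC_le hM) (norm_gam_sub_le h h0) hz
  rwa [one_mul, Complex.ofReal_zero, sub_zero] at this

lemma RedBounds.sr_re (H : RedBounds f R b K C) {m β : ℝ} (h : Adm f R b K ε (m : ℂ) β) :
    |(RayleighBloch.sr f R ε m β).re - cosT f 1 (waveNumber m β)| ≤ C * ε := by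
  have := H.sr ε m β h
  rwa [← h.sr_ofReal, h.dom.kZero_eq, h.pert.intC_coefC_mul_cosC, ← Complex.ofReal_sub,
    Complex.norm_real] at this

lemma RedBounds.sr_re_lip (H : RedBounds f R b K C) {m m' β β' : ℝ} (h : Adm f R b K ε (m : ℂ) β)
    (h' : Dom b (m' : ℂ) β') :
    |((RayleighBloch.sr f R ε m β).re - cosT f 1 (waveNumber m β)) -
      ((RayleighBloch.sr f R ε m' β').re - cosT f 1 (waveNumber m' β'))| ≤
      C * ε * (|m - m'| + |β - β'|) := by
  have := H.sr_lip ε m β h m' β' h'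
  rwa [← h.sr_ofReal, ← (h.of_dom h').sr_ofReal, h.dom.kZero_eq, h'.kZero_eq,
    h.pert.intC_coefC_mul_cosC, h.pert.intC_coefC_mul_cosC, ← Complex.ofReal_sub, ← Complex.ofReal_sub,
    ← Complex.ofReal_sub, ← Complex.ofReal_sub, Complex.norm_real, Complex.norm_real] at this

lemma RedBounds.diff_re (H : RedBounds f R b K C) {m β : ℝ} (h : Adm f R b K ε (m : ℂ) β) :
    |((RayleighBloch.sz f R ε m β).re - (RayleighBloch.sw f R ε m β).re) -
      cosT f 0 (2 * waveNumber m β)| ≤ C * ε := by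
  have := H.diff ε m β h
  rwa [← h.sz_ofReal, ← h.sw_ofReal, h.dom.kZero_eq,
    show (2 : ℂ) * (waveNumber m β : ℂ) = ((2 * waveNumber m β : ℝ) : ℂ) by push_cast; ring,
    h.pert.intC_coefC_mul_cosC, ← Complex.ofReal_sub, ← Complex.ofReal_sub, Complex.norm_real] at this

lemma abs_re_le_of_norm {z : ℂ} {C : ℝ} (h : ‖z‖ ≤ C) : |z.re| ≤ C := (Complex.abs_re_le_norm z).trans h

/-- The reduced quantities satisfy the uniform estimates. -/
lemma RedBounds.exists_scatData (H : RedBounds f R b K C) (hf : IsPert f R) (hK : OpBound f R b K)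
    (h0 : 0 < β₀) (h1 : β₀ < 1 / 2) (hb : b = min β₀ (1 / 2 - β₀) / 2)
    (hz : cosT f 1 (waveNumber 0 β₀) = 0) :
    ∃ L, 1 ≤ L ∧ ∀ ε, 0 ≤ ε → ε ≤ 1 → ε * K ≤ 1 / 2 →
      ScatData L b b β₀ (nuCenter f β₀) (-cosT' f 1 (waveNumber 0 β₀) / waveNumber 0 β₀)
        (gamR 0 β₀ * cA₂ 0 β₀) (cA₂ 0 β₀ * cosT f 0 (2 * waveNumber 0 β₀)) ε (qQ f R ε) (qR f R ε)
        (fun m β => (RayleighBloch.sr f R ε m β).re) (fun m β => (RayleighBloch.sz f R ε m β).re)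
        (fun m β => (RayleighBloch.sw f R ε m β).re) cA₁ cA₂ := by
  obtain ⟨M₀, hM₀, g1, g2, -⟩ := hf.exists_cosT_bound 0
  obtain ⟨M₁, hM₁, p1, p2, p3⟩ := hf.exists_cosT_bound 1
  have hC := H.nonneg
  have hbpos : 0 < b := by rw [hb]; exact half_pos (lt_min h0 (by linarith))
  have ht : 0 < Real.sqrt b := Real.sqrt_pos.2 hbpos
  obtain ⟨t, htd⟩ : ∃ t, t = Real.sqrt b := ⟨_, rfl⟩
  rw [← htd] at ht
  have d0 : Dom b ((0 : ℝ) : ℂ) β₀ := dom_of_le h0 h1 hb (by simp) (by simpa using hbpos.le)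
    (by simpa using hbpos.le)
  obtain ⟨J, hJ⟩ : ∃ J, J = 2 * M₁ / t ^ 2 + 2 * |cosT' f 1 (waveNumber 0 β₀)| / t ^ 3 := ⟨_, rfl⟩
  have hJ0 : 0 ≤ J := by rw [hJ]; positivity
  obtain ⟨A, hA⟩ : ∃ A, A = 1 / t ^ 3 + 2 / t := ⟨_, rfl⟩
  have hA0 : 0 ≤ A := by rw [hA]; positivity
  have hA1 : 1 / t ^ 3 + 1 / t ≤ A := by
    rw [hA]; gcongr; norm_num
  obtain ⟨N, hN⟩ : ∃ N, N = 1 / t * (C + M₀ * (2 * (1 / t))) + M₀ * A := ⟨_, rfl⟩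
  have hN0 : 0 ≤ N := by rw [hN]; positivity
  -- `L` dominates every constant required below; it does not depend on `ε`.
  obtain ⟨L, hL⟩ : ∃ L, L = 1 + (M₀ + 2 * C) + A + 1 / t + N + J + M₁ / t := ⟨_, rfl⟩
  have ht1 : 0 ≤ 1 / t := by positivity
  have hMt : 0 ≤ M₁ / t := by positivity
  have l1 : M₀ + 2 * C ≤ L := by rw [hL]; linarith
  have l2 : A ≤ L := by rw [hL]; linarith
  have l3 : 1 / t ≤ L := by rw [hL]; linarith
  have l4 : N ≤ L := by rw [hL]; linarith
  have l5 : C + J ≤ L := by rw [hL]; linarith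
  have l6 : C + M₁ / t ≤ L := by rw [hL]; linarith
  have l7 : C ≤ L := by rw [hL]; linarith
  have hLpos : 0 ≤ L := by rw [hL]; linarith
  refine ⟨L, by rw [hL]; linarith, fun ε hε hε1 hεK => ?_⟩
  have dm : ∀ {μ : ℂ} {β}, 0 ≤ μ.re → ‖μ‖ ≤ b → |β - β₀| ≤ b → Dom b μ β := fun a c d =>
    dom_of_le h0 h1 hb a c d
  have dr : ∀ {m β : ℝ}, 0 ≤ m → m ≤ b → |β - β₀| ≤ b → Dom b (m : ℂ) β := fun a c d =>
    dm (by simpa using a) (by rwa [Complex.norm_real, Real.norm_of_nonneg a]) d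
  have am : ∀ {μ : ℂ} {β}, Dom b μ β → Adm f R b K ε μ β := fun h => ⟨hf, hK, hε, hεK, h⟩
  have nm : ∀ {m : ℝ}, 0 ≤ m → ‖(m : ℂ)‖ = m := fun h => by
    rw [Complex.norm_real, Real.norm_of_nonneg h]
  refine ⟨?_, ?_, ?_, ?_, ?_, ?_, ?_, ?_, ?_, ?_, ?_, ?_, ?_, ?_⟩
  · intro μ μ' β a a' c c' d
    have := H.qQ_lip hf g1 (am (dm a c d)) (dm a' c' d) hε1
    rw [sub_self, abs_zero, add_zero] at this
    exact this.trans (by gcongr)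
  · intro μ β a c d
    have := norm_gam_mul_center_le hf g1 (dm a c d) d0 (H.disp ε μ β (am (dm a c d)))
    refine this.trans ?_
    calc _ ≤ L * ε + L * (‖μ‖ + |β - β₀|) := by gcongr; linarith
      _ = _ := by ring
  · intro m m' β β' a a' c c' d d'
    exact (H.qR_lip hf g1 (am (dr a c d)) (dr a' c' d') hε1).trans (by gcongr)
  · intro m β a c d
    have := norm_gam_mul_center_le hf g1 (dr a c d) d0 (H.sF ε m β (am (dr a c d)))
    rw [← (am (dr a c d)).ofReal_qR, ← Complex.ofReal_sub, Complex.norm_real, nm a] at this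
    refine this.trans ?_
    calc _ ≤ L * ε + L * (m + |β - β₀|) := by gcongr; linarith
      _ = _ := by ring
  · intro m β a c d
    exact (am (dr a c d)).qQ_eq
  · intro m β a c d
    have := abs_cA₁_sub_le (dr a c d) d0
    rw [sub_zero, abs_of_nonneg a, ← htd, ← hA] at this
    exact this.trans (by gcongr)
  · intro m β a c d
    have := (dr a c d).abs_cA₁_le
    rw [← htd] at this; linarith
  · intro m β a c d
    have := (dr a c d).abs_cA₂_le
    rw [← htd] at this; linarith
  · intro m β a c d
    exact (abs_re_le_of_norm (H.sz ε m β (am (dr a c d)))).trans l7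
  · intro m β a c d
    exact (abs_re_le_of_norm (H.sw ε m β (am (dr a c d)))).trans l7
  · intro m β a c d
    have e1 := (dr a c d).abs_cA₂_le
    have e2 := abs_cA₂_sub_le (dr a c d) d0
    have e3 := abs_waveNumber_sub_le (dr a c d) d0
    have e4 := H.diff_re (am (dr a c d))
    have e5 := g2 (2 * waveNumber m β) (2 * waveNumber 0 β₀)
    rw [← mul_sub, abs_mul, abs_of_pos (zero_lt_two' ℝ)] at e5
    rw [sub_zero, abs_of_nonneg a, ← htd] at e2 e3
    rw [← htd] at e1
    have e6 : |((RayleighBloch.sz f R ε m β).re - (RayleighBloch.sw f R ε m β).re) -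
        cosT f 0 (2 * waveNumber 0 β₀)| ≤ (C + M₀ * (2 * (1 / t))) * (ε + m + |β - β₀|) := by
      refine (abs_sub_le _ (cosT f 0 (2 * waveNumber m β)) _).trans ?_
      have : M₀ * (2 * |waveNumber m β - waveNumber 0 β₀|) ≤ M₀ * (2 * (1 / t * (m + |β - β₀|))) := by
        gcongr
      have q1 : 0 ≤ C * (m + |β - β₀|) := by positivity
      have q2 : 0 ≤ M₀ * (2 * (1 / t)) * ε := by positivity
      linarith
    refine (abs_mul_sub_mul_le e1 (g1 (2 * waveNumber 0 β₀)) e2 e6).trans ?_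
    calc _ ≤ 1 / t * ((C + M₀ * (2 * (1 / t))) * (ε + m + |β - β₀|)) +
          M₀ * (A * (ε + m + |β - β₀|)) := by
            gcongr
            linarith
      _ = N * (ε + m + |β - β₀|) := by rw [hN]; ring
      _ ≤ _ := by gcongr
  · intro m m' β a a' c c' d
    have e1 := H.sr_re_lip (am (dr a c d)) (dr a' c' d)
    have e2 := p2 (waveNumber m β) (waveNumber m' β)
    have e3 := abs_waveNumber_sub_le (dr a c d) (dr a' c' d)
    rw [sub_self, abs_zero, add_zero] at e1 e3
    rw [← htd] at e3
    generalize (RayleighBloch.sr f R ε m β).re = x at *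
    generalize (RayleighBloch.sr f R ε m' β).re = y at *
    change |x - y| ≤ _
    have e4 : x - y = ((x - cosT f 1 (waveNumber m β)) - (y - cosT f 1 (waveNumber m' β))) +
      (cosT f 1 (waveNumber m β) - cosT f 1 (waveNumber m' β)) := by ring
    rw [e4]
    refine (abs_add_le _ _).trans ?_
    calc _ ≤ C * 1 * |m - m'| + M₁ * (1 / t * |m - m'|) := by
          gcongr
          · exact e1.trans (by gcongr)
          · exact e2.trans (by gcongr)
      _ = (C + M₁ / t) * |m - m'| := by ring
      _ ≤ _ := by gcongr
  · intro m β β' a c d d'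
    have e1 := H.sr_re_lip (am (dr a c d)) (dr a c d')
    have e2 := abs_cosT_waveNumber_slope_le hM₁ p3 a d0 (dr a c d) (dr a c d')
    rw [← htd, ← hJ] at e2
    rw [sub_self, abs_zero, zero_add] at e1
    generalize (RayleighBloch.sr f R ε m β).re = x at *
    generalize (RayleighBloch.sr f R ε m β').re = y at *
    change |x - y - _| ≤ _
    generalize -cosT' f 1 (waveNumber 0 β₀) / waveNumber 0 β₀ = c at *
    have e4 : x - y - c * (β - β') = ((x - cosT f 1 (waveNumber m β)) -
      (y - cosT f 1 (waveNumber m β'))) +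
      (cosT f 1 (waveNumber m β) - cosT f 1 (waveNumber m β') - c * (β - β')) := by ring
    rw [e4]
    refine (abs_add_le _ _).trans ?_
    calc _ ≤ C * (ε + m + |β - β₀| + |β' - β₀|) * |β - β'| +
          J * (ε + m + |β - β₀| + |β' - β₀|) * |β - β'| := by
          gcongr
          · exact e1.trans (by gcongr; linarith [abs_nonneg (β - β₀), abs_nonneg (β' - β₀)])
          · exact e2.trans (by gcongr; linarith)
      _ = (C + J) * (ε + m + |β - β₀| + |β' - β₀|) * |β - β'| := by ring
      _ ≤ _ := by gcongr
  · intro m a c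
    have d : |β₀ - β₀| ≤ b := by simpa using hbpos.le
    have e1 := H.sr_re (am (dr a c d))
    have e2 := p2 (waveNumber m β₀) (waveNumber 0 β₀)
    have e3 := abs_waveNumber_sub_le (dr a c d) d0
    rw [sub_self, abs_zero, add_zero, sub_zero, abs_of_nonneg a, ← htd] at e3
    -- The vanishing of `f̃_1` at `κ₀` enters here: `r` is small at the base point.
    rw [hz, sub_zero] at e2
    generalize (RayleighBloch.sr f R ε m β₀).re = x at *
    change |x| ≤ _
    rw [← sub_add_cancel x (cosT f 1 (waveNumber m β₀))]
    refine (abs_add_le _ _).trans ?_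
    calc _ ≤ C * ε + M₁ * (1 / t * m) := by
          gcongr
          exact e2.trans (by gcongr)
      _ = C * ε + (M₁ / t) * m := by ring
      _ ≤ L * ε + L * m := by gcongr; linarith
      _ = _ := by ring

end

/-! ### Quasiperiodic functions on the strip -/

/-- `u(x) e^{i(β+m)y}`. -/
def modal (β : ℝ) (m : ℤ) (u : ℝ → ℂ) (p : ℝ × ℝ) : ℂ :=
  u p.1 * Complex.exp (Complex.I * (β + m) * p.2)

section
variable {β : ℝ} {m : ℤ} {u : ℝ → ℂ} {p : ℝ × ℝ}

lemma norm_exp_modal (β : ℝ) (m : ℤ) (y : ℝ) : ‖Complex.exp (Complex.I * (β + m) * y)‖ = 1 := by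
  rw [show Complex.I * (β + m) * y = (((β + m) * y : ℝ) : ℂ) * Complex.I by push_cast; ring]
  exact Complex.norm_exp_ofReal_mul_I _

lemma norm_modal (β : ℝ) (m : ℤ) (u : ℝ → ℂ) (p : ℝ × ℝ) : ‖modal β m u p‖ = ‖u p.1‖ := by
  rw [modal, norm_mul, norm_exp_modal, mul_one]

lemma hasFDerivAt_exp_modal (β : ℝ) (m : ℤ) (p : ℝ × ℝ) :
    HasFDerivAt (fun p : ℝ × ℝ => Complex.exp (Complex.I * (β + m) * p.2))
      ((ContinuousLinearMap.snd ℝ ℝ ℝ).smulRight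
        (Complex.I * (β + m) * Complex.exp (Complex.I * (β + m) * p.2))) p := by
  have h1 : HasDerivAt (fun y : ℝ => Complex.exp (Complex.I * (β + m) * y))
      (Complex.exp (Complex.I * (β + m) * p.2) * (Complex.I * (β + m))) p.2 := by
    have h2 : HasDerivAt (fun y : ℝ => Complex.I * (β + m) * (y : ℂ)) (Complex.I * (β + m)) p.2 := by
      simpa using (Complex.ofRealCLM.hasDerivAt (x := p.2)).const_mul (Complex.I * (β + m))
    exact h2.cexp
  have h3 := h1.hasFDerivAt.comp p (hasFDerivAt_snd (𝕜 := ℝ) (p := p))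
  refine h3.congr_fderiv ?_
  ext <;> simp [mul_comm]

lemma hasFDerivAt_fst_comp {u : ℝ → ℂ} {u' : ℂ} (h : HasDerivAt u u' p.1) :
    HasFDerivAt (fun p : ℝ × ℝ => u p.1) ((ContinuousLinearMap.fst ℝ ℝ ℝ).smulRight u') p := by
  refine (h.hasFDerivAt.comp p (hasFDerivAt_fst (𝕜 := ℝ) (p := p))).congr_fderiv ?_
  ext <;> simp

/-- Product with a function of `x`. -/
lemma dX_fst_mul {P : ℝ × ℝ → ℂ} {u' : ℂ} (h : HasDerivAt u u' p.1) (hP : DifferentiableAt ℝ P p) :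
    dX (fun p => u p.1 * P p) p = u p.1 * dX P p + u' * P p := by
  unfold dX
  rw [show (fun p => u p.1 * P p) = (fun p : ℝ × ℝ => u p.1) * P from rfl,
    ((hasFDerivAt_fst_comp h).mul hP.hasFDerivAt).fderiv]
  simp [mul_comm]

lemma dY_fst_mul {P : ℝ × ℝ → ℂ} {u' : ℂ} (h : HasDerivAt u u' p.1) (hP : DifferentiableAt ℝ P p) :
    dY (fun p => u p.1 * P p) p = u p.1 * dY P p := by
  unfold dY
  rw [show (fun p => u p.1 * P p) = (fun p : ℝ × ℝ => u p.1) * P from rfl,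
    ((hasFDerivAt_fst_comp h).mul hP.hasFDerivAt).fderiv]
  simp

lemma dX_modal {u' : ℂ} (h : HasDerivAt u u' p.1) :
    dX (modal β m u) p = u' * Complex.exp (Complex.I * (β + m) * p.2) := by
  have h1 := hasFDerivAt_exp_modal β m p
  have := dX_fst_mul h h1.differentiableAt
  unfold modal
  rw [this, dX, h1.fderiv]
  simp

lemma dY_modal {u' : ℂ} (h : HasDerivAt u u' p.1) :
    dY (modal β m u) p = Complex.I * (β + m) * modal β m u p := by
  have h1 := hasFDerivAt_exp_modal β m p
  have := dY_fst_mul h h1.differentiableAt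
  unfold modal
  rw [this, dY, h1.fderiv]
  simp
  ring

/-- Smooth functions with the quasiperiodicity conditions. -/
structure IsQuasi (β : ℝ) (Φ : ℝ × ℝ → ℂ) : Prop where
  smooth : ContDiff ℝ ∞ Φ
  quasi : ∀ x : ℝ, Φ (x, 2 * Real.pi) = Complex.exp (2 * Real.pi * Complex.I * β) * Φ (x, 0)
  quasi_dY : ∀ x : ℝ,
    dY Φ (x, 2 * Real.pi) = Complex.exp (2 * Real.pi * Complex.I * β) * dY Φ (x, 0)

lemma IsTest.isQuasi {Φ : ℝ × ℝ → ℂ} (h : IsTest β Φ) : IsQuasi β Φ := ⟨h.smooth, h.quasi, h.quasi_dY⟩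

lemma IsQuasi.add {Φ Φ' : ℝ × ℝ → ℂ} (h : IsQuasi β Φ) (h' : IsQuasi β Φ') : IsQuasi β (Φ + Φ') := by
  have hd := h.smooth.differentiable (by simp)
  have hd' := h'.smooth.differentiable (by simp)
  refine ⟨h.smooth.add h'.smooth, fun x => ?_, fun x => ?_⟩
  · simp only [Pi.add_apply]; rw [h.quasi, h'.quasi]; ring
  · have e : ∀ p, dY (Φ + Φ') p = dY Φ p + dY Φ' p := fun p => by
      unfold dY; rw [fderiv_add (hd p) (hd' p)]; rfl
    rw [e, e, h.quasi_dY, h'.quasi_dY]; ring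

lemma IsQuasi.zero : IsQuasi β 0 :=
  ⟨contDiff_const, fun _ => by simp, fun _ => by simp [dY]⟩

lemma isQuasi_modal (hu : ContDiff ℝ ∞ u) : IsQuasi β (modal β m u) := by
  have hd : ∀ x, HasDerivAt u (deriv u x) x := fun x => (hu.differentiable (by simp) x).hasDerivAt
  have hq : ∀ x : ℝ, modal β m u (x, 2 * Real.pi) =
      Complex.exp (2 * Real.pi * Complex.I * β) * modal β m u (x, 0) := by
    intro x
    have e : Complex.exp (Complex.I * (β + m) * ((2 * Real.pi : ℝ) : ℂ)) =
        Complex.exp (2 * Real.pi * Complex.I * β) := by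
      rw [show Complex.I * (β + m) * ((2 * Real.pi : ℝ) : ℂ) =
        2 * Real.pi * Complex.I * β + Complex.I * m * (2 * Real.pi) by push_cast; ring,
        Complex.exp_add, exp_int_two_pi, mul_one]
    simp only [modal, e]
    simp [mul_comm]
  refine ⟨?_, hq, fun x => ?_⟩
  · have h1 : ContDiff ℝ ∞ fun p : ℝ × ℝ => (p.2 : ℂ) := Complex.ofRealCLM.contDiff.comp contDiff_snd
    unfold modal; fun_prop
  · rw [dY_modal (hd x), dY_modal (hd x), hq]; ring

lemma IsQuasi.cutoff {Φ : ℝ × ℝ → ℂ} (h : IsQuasi β Φ) (hu : ContDiff ℝ ∞ u) {M : ℝ}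
    (hM : ∀ x, M < |x| → u x = 0) : IsTest β (fun p => u p.1 * Φ p) := by
  have hs := h.smooth
  have hd : ∀ x, HasDerivAt u (deriv u x) x := fun x => (hu.differentiable (by simp) x).hasDerivAt
  refine ⟨by fun_prop, fun x => ?_, fun x => ?_, M, fun x y hx => ?_⟩
  · simp only; rw [h.quasi]; ring
  · rw [dY_fst_mul (hd x) (hs.differentiable (by simp) _), dY_fst_mul (hd x)
      (hs.differentiable (by simp) _), h.quasi_dY]; ring
  · simp only; rw [hM x hx, zero_mul]

lemma IsQuasi.isTest_of_vanish {Φ : ℝ × ℝ → ℂ} (h : IsQuasi β Φ)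
    (hM : ∃ M : ℝ, ∀ x y : ℝ, M < |x| → Φ (x, y) = 0) : IsTest β Φ := ⟨h.smooth, h.quasi, h.quasi_dY, hM⟩

lemma continuous_dX {Φ : ℝ × ℝ → ℂ} (h : ContDiff ℝ ∞ Φ) : Continuous (dX Φ) := by
  have := h.continuous_fderiv (by simp)
  unfold dX; fun_prop

lemma continuous_dY {Φ : ℝ × ℝ → ℂ} (h : ContDiff ℝ ∞ Φ) : Continuous (dY Φ) := by
  have := h.continuous_fderiv (by simp)
  unfold dY; fun_prop

lemma fderiv_eq_zero_of_vanish {Φ : ℝ × ℝ → ℂ} {M : ℝ} (h : ∀ x y : ℝ, M < |x| → Φ (x, y) = 0)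
    {x y : ℝ} (hx : M < |x|) : fderiv ℝ Φ (x, y) = 0 := by
  have : Φ =ᶠ[𝓝 (x, y)] fun _ => 0 := by
    have ho : IsOpen {p : ℝ × ℝ | M < |p.1|} := isOpen_lt continuous_const (by fun_prop)
    filter_upwards [ho.mem_nhds (show (x, y) ∈ {p : ℝ × ℝ | M < |p.1|} from hx)] with p hp
    exact h p.1 p.2 hp
  rw [this.fderiv_eq, fderiv_fun_const]; rfl

lemma dX_eq_zero_of_vanish {Φ : ℝ × ℝ → ℂ} {M : ℝ} (h : ∀ x y : ℝ, M < |x| → Φ (x, y) = 0)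
    {x y : ℝ} (hx : M < |x|) : dX Φ (x, y) = 0 := by
  unfold dX; rw [fderiv_eq_zero_of_vanish h hx]; rfl

lemma dY_eq_zero_of_vanish {Φ : ℝ × ℝ → ℂ} {M : ℝ} (h : ∀ x y : ℝ, M < |x| → Φ (x, y) = 0)
    {x y : ℝ} (hx : M < |x|) : dY Φ (x, y) = 0 := by
  unfold dY; rw [fderiv_eq_zero_of_vanish h hx]; rfl

end

/-! ### Integration on the strip -/

/-- Continuous functions restricted to a bounded part of the strip are in every `L^p`. -/
lemma memLp_indicator_of_continuous {u : ℝ × ℝ → ℂ} (hu : Continuous u) (M : ℝ) (r : ENNReal) :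
    MemLp ({p : ℝ × ℝ | |p.1| ≤ M}.indicator u) r (volume.restrict strip) := by
  have hm : MeasurableSet {p : ℝ × ℝ | |p.1| ≤ M} := measurableSet_le (by fun_prop) measurable_const
  rw [memLp_indicator_iff_restrict hm, Measure.restrict_restrict hm]
  have hsub : {p : ℝ × ℝ | |p.1| ≤ M} ∩ strip ⊆ Set.Icc (-M) M ×ˢ Set.Icc 0 (2 * Real.pi) :=
    fun p hp => ⟨abs_le.1 hp.1, Set.Ioo_subset_Icc_self hp.2.2⟩
  have hc : IsCompact (Set.Icc (-M) M ×ˢ Set.Icc 0 (2 * Real.pi)) := isCompact_Icc.prod isCompact_Icc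
  have : IsFiniteMeasure (volume.restrict (Set.Icc (-M) M ×ˢ Set.Icc 0 (2 * Real.pi)) :
    Measure (ℝ × ℝ)) := ⟨by rw [Measure.restrict_apply_univ]; exact hc.measure_lt_top⟩
  obtain ⟨C, hC⟩ := hc.exists_bound_of_continuousOn hu.continuousOn
  refine (MemLp.of_bound (hu.aestronglyMeasurable) C ?_).mono_measure (Measure.restrict_mono hsub le_rfl)
  exact (ae_restrict_iff' (measurableSet_Icc.prod measurableSet_Icc)).2 (ae_of_all _ hC)

lemma memLp_of_vanish {u : ℝ × ℝ → ℂ} (hu : Continuous u) {M : ℝ}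
    (hM : ∀ x y : ℝ, M < |x| → u (x, y) = 0) (r : ENNReal) : MemLp u r (volume.restrict strip) := by
  have e : {p : ℝ × ℝ | |p.1| ≤ M}.indicator u = u := by
    rw [Set.indicator_eq_self]
    intro p hp
    by_contra hc
    simp only [Set.mem_ofPred_eq, not_le] at hc
    exact hp (hM p.1 p.2 hc)
  rw [← e]; exact memLp_indicator_of_continuous hu M r

lemma integrable_of_vanish {u : ℝ × ℝ → ℂ} (hu : Continuous u) {M : ℝ}
    (hM : ∀ x y : ℝ, M < |x| → u (x, y) = 0) : IntegrableOn u strip :=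
  memLp_one_iff_integrable.1 (memLp_of_vanish hu hM 1)

section
variable {α : Type*} {mα : MeasurableSpace α} {ν : Measure α}

lemma integrable_mul_conj {a c : α → ℂ} (ha : MemLp a 2 ν) (hc : MemLp c 2 ν) :
    Integrable (fun p => a p * conj (c p)) ν := ha.integrable_mul hc.star

lemma tendsto_integral_mul_conj {a c : α → ℂ} {φ : ℕ → α → ℂ} (ha : MemLp a 2 ν) (hc : MemLp c 2 ν)
    (hφ : ∀ n, MemLp (φ n) 2 ν) (h : Tendsto (fun n => eLpNorm (φ n - c) 2 ν) atTop (𝓝 0)) :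
    Tendsto (fun n => ∫ p, a p * conj (φ n p) ∂ν) atTop (𝓝 (∫ p, a p * conj (c p) ∂ν)) := by
  refine tendsto_integral_of_L1' _ (integrable_mul_conj ha hc).aestronglyMeasurable
    (Eventually.of_forall fun n => integrable_mul_conj ha (hφ n)) ?_
  have h1 : ∀ n, eLpNorm ((fun p => a p * conj (φ n p)) - fun p => a p * conj (c p)) 1 ν ≤
      eLpNorm a 2 ν * eLpNorm (φ n - c) 2 ν := by
    intro n
    have e : ((fun p => a p * conj (φ n p)) - fun p => a p * conj (c p)) = a • star (φ n - c) := by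
      ext p
      simp [mul_sub]
    have e2 : eLpNorm (φ n - c) 2 ν = eLpNorm (star (φ n - c)) 2 ν :=
      eLpNorm_congr_norm_ae (ae_of_all _ fun p => (norm_star _).symm)
    rw [e, e2]
    exact eLpNorm_smul_le_mul_eLpNorm ((hφ n).sub hc).star.aestronglyMeasurable ha.aestronglyMeasurable
  refine tendsto_of_tendsto_of_tendsto_of_le_of_le tendsto_const_nhds ?_ (fun _ => zero_le) h1
  rw [← mul_zero (eLpNorm a 2 ν)]
  exact ENNReal.Tendsto.const_mul h (Or.inr ha.eLpNorm_ne_top)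

lemma memLp_bdd_mul {a w : α → ℂ} {C : ℝ} (ha : MemLp a 2 ν) (hw : AEStronglyMeasurable w ν)
    (hC : ∀ p, ‖w p‖ ≤ C) : MemLp (fun p => w p * a p) 2 ν :=
  ha.of_le_mul (hw.mul ha.aestronglyMeasurable) (c := C) (ae_of_all _ fun p => by
    rw [norm_mul]; gcongr; exact hC p)

end

/-! ### The energy identity -/

lemma deriv_eq_zero_of_vanish {E : Type*} [NormedAddCommGroup E] [NormedSpace ℝ E] {u : ℝ → E} {M : ℝ}
    (h : ∀ x, M < |x| → u x = 0) {x : ℝ} (hx : M < |x|) : deriv u x = 0 := by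
  have : u =ᶠ[𝓝 x] fun _ => 0 := by
    have ho : IsOpen {x : ℝ | M < |x|} := isOpen_lt continuous_const (by fun_prop)
    filter_upwards [ho.mem_nhds hx] with t ht
    exact h t ht
  rw [this.deriv_eq, deriv_const]

lemma exists_bound_of_vanish {u : ℝ → ℝ} (hu : Continuous u) {M : ℝ} (h : ∀ x, M < |x| → u x = 0) :
    ∃ C, 0 ≤ C ∧ ∀ x, |u x| ≤ C := by
  obtain ⟨C, hC⟩ := (isCompact_Icc (a := -M) (b := M)).exists_bound_of_continuousOn hu.continuousOn
  refine ⟨max C 0, le_max_right _ _, fun x => ?_⟩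
  by_cases hx : |x| ≤ M
  · exact (hC x (abs_le.1 hx)).trans (le_max_left _ _)
  · rw [h x (not_le.1 hx), abs_zero]; exact le_max_right _ _

section
variable {f : ℝ × ℝ → ℝ} {R ε β c : ℝ} {v vx vy g : ℝ × ℝ → ℂ}

/-- Formally, test the equation for `u = v + g` with `ηu`. The terms `η|∇u|²` and `(1 + εf)η|u|²`
integrate to real numbers, so the imaginary part of the remaining term `η' u_x ū` vanishes. Since
`v` is only a limit of test functions, one tests with `η(φ_n + g)` and passes to the limit. -/
lemma HasGradH.im_flux_eq_zero (hf : IsPert f R) (hv : HasGradH β v vx vy) (hg : IsQuasi β g)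
    (hweak : ∀ Φ, IsTest β Φ →
      ∫ p in strip, ((vx p + dX g p) * conj (dX Φ p) + (vy p + dY g p) * conj (dY Φ p)) =
        (c : ℂ) * ∫ p in strip, ((1 + ε * f p : ℝ) : ℂ) * (v p + g p) * conj (Φ p))
    {η : ℝ → ℝ} (hη : ContDiff ℝ ∞ η) {M : ℝ} (hM : ∀ x, M < |x| → η x = 0) :
    (∫ p in strip, ((deriv η p.1 : ℝ) : ℂ) * (vx p + dX g p) * conj (v p + g p)).im = 0 := by
  obtain ⟨φ, hφ, l0, lx, ly⟩ := hv.approx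
  obtain ⟨Cf, hCf, hbf⟩ := exists_bound_of_per hf.smooth.continuous hf.per hf.supp
  obtain ⟨C0, hC0, hb0⟩ := exists_bound_of_vanish hη.continuous hM
  have hM' : ∀ x, M < |x| → deriv η x = 0 := fun x hx => deriv_eq_zero_of_vanish hM hx
  obtain ⟨C1, hC1, hb1⟩ := exists_bound_of_vanish (hη.continuous_deriv (by simp)) hM'
  have cη : Continuous fun p : ℝ × ℝ => (η p.1 : ℂ) :=
    Complex.continuous_ofReal.comp (hη.continuous.comp continuous_fst)
  have cη' : Continuous fun p : ℝ × ℝ => ((deriv η p.1 : ℝ) : ℂ) :=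
    Complex.continuous_ofReal.comp ((hη.continuous_deriv (by simp)).comp continuous_fst)
  have cf : Continuous fun p : ℝ × ℝ => ((1 + ε * f p : ℝ) : ℂ) :=
    Complex.continuous_ofReal.comp (by have := hf.smooth.continuous; fun_prop)
  have nη : ∀ p : ℝ × ℝ, ‖(η p.1 : ℂ)‖ ≤ C0 := fun p => by
    rw [Complex.norm_real]; exact hb0 _
  have nη' : ∀ p : ℝ × ℝ, ‖((deriv η p.1 : ℝ) : ℂ)‖ ≤ C1 := fun p => by
    rw [Complex.norm_real]; exact hb1 _
  have nf : ∀ p : ℝ × ℝ, ‖((1 + ε * f p : ℝ) : ℂ) * (η p.1 : ℂ)‖ ≤ (1 + |ε| * Cf) * C0 := fun p => by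
    rw [norm_mul, Complex.norm_real, Real.norm_eq_abs]
    refine mul_le_mul ?_ (nη p) (norm_nonneg _) (by positivity)
    calc |1 + ε * f p| ≤ |1| + |ε * f p| := abs_add_le _ _
      _ = 1 + |ε| * |f p| := by rw [abs_one, abs_mul]
      _ ≤ _ := by gcongr; exact hbf p
  have ind : ∀ (w : ℝ × ℝ → ℂ) (p : ℝ × ℝ), |p.1| ≤ M →
      {p : ℝ × ℝ | |p.1| ≤ M}.indicator w p = w p := fun w p hp =>
    Set.indicator_of_mem (show p ∈ {p : ℝ × ℝ | |p.1| ≤ M} from hp) w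
  -- `g` need not be square integrable on the strip; it is truncated to `|x| ≤ M`, outside which `η`
  -- vanishes.
  obtain ⟨U, hU⟩ : ∃ U, U = v + {p : ℝ × ℝ | |p.1| ≤ M}.indicator g := ⟨_, rfl⟩
  obtain ⟨Ux, hUx⟩ : ∃ Ux, Ux = vx + {p : ℝ × ℝ | |p.1| ≤ M}.indicator (dX g) := ⟨_, rfl⟩
  obtain ⟨Uy, hUy⟩ : ∃ Uy, Uy = vy + {p : ℝ × ℝ | |p.1| ≤ M}.indicator (dY g) := ⟨_, rfl⟩
  obtain ⟨B, hB⟩ : ∃ B : ℕ → ℝ × ℝ → ℂ, ∀ n, B n = φ n + {p : ℝ × ℝ | |p.1| ≤ M}.indicator g :=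
    ⟨_, fun _ => rfl⟩
  obtain ⟨X, hX⟩ : ∃ X : ℕ → ℝ × ℝ → ℂ, ∀ n,
    X n = dX (φ n) + {p : ℝ × ℝ | |p.1| ≤ M}.indicator (dX g) := ⟨_, fun _ => rfl⟩
  obtain ⟨Y, hY⟩ : ∃ Y : ℕ → ℝ × ℝ → ℂ, ∀ n,
    Y n = dY (φ n) + {p : ℝ × ℝ | |p.1| ≤ M}.indicator (dY g) := ⟨_, fun _ => rfl⟩
  have mG := memLp_indicator_of_continuous hg.smooth.continuous M 2
  have mGx := memLp_indicator_of_continuous (continuous_dX hg.smooth) M 2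
  have mGy := memLp_indicator_of_continuous (continuous_dY hg.smooth) M 2
  have mU : MemLp U 2 (volume.restrict strip) := by rw [hU]; exact hv.memLp.add mG
  have mUx : MemLp Ux 2 (volume.restrict strip) := by rw [hUx]; exact hv.memLp_x.add mGx
  have mUy : MemLp Uy 2 (volume.restrict strip) := by rw [hUy]; exact hv.memLp_y.add mGy
  have mB : ∀ n, MemLp (B n) 2 (volume.restrict strip) := fun n => by
    obtain ⟨N, hN⟩ := (hφ n).vanish
    rw [hB]; exact (memLp_of_vanish (hφ n).smooth.continuous hN 2).add mG
  have mX : ∀ n, MemLp (X n) 2 (volume.restrict strip) := fun n => by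
    obtain ⟨N, hN⟩ := (hφ n).vanish
    rw [hX]
    exact (memLp_of_vanish (continuous_dX (hφ n).smooth) (fun x y => dX_eq_zero_of_vanish hN) 2).add mGx
  have mY : ∀ n, MemLp (Y n) 2 (volume.restrict strip) := fun n => by
    obtain ⟨N, hN⟩ := (hφ n).vanish
    rw [hY]
    exact (memLp_of_vanish (continuous_dY (hφ n).smooth) (fun x y => dY_eq_zero_of_vanish hN) 2).add mGy
  have a1 : MemLp (fun p => (η p.1 : ℂ) * Ux p) 2 (volume.restrict strip) :=
    memLp_bdd_mul mUx cη.aestronglyMeasurable nη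
  have a2 : MemLp (fun p => ((deriv η p.1 : ℝ) : ℂ) * Ux p) 2 (volume.restrict strip) :=
    memLp_bdd_mul mUx cη'.aestronglyMeasurable nη'
  have a3 : MemLp (fun p => (η p.1 : ℂ) * Uy p) 2 (volume.restrict strip) :=
    memLp_bdd_mul mUy cη.aestronglyMeasurable nη
  have a4 : MemLp (fun p => ((1 + ε * f p : ℝ) : ℂ) * (η p.1 : ℂ) * U p) 2 (volume.restrict strip) :=
    memLp_bdd_mul mU (cf.mul cη).aestronglyMeasurable nf
  have t0 : Tendsto (fun n => eLpNorm (B n - U) 2 (volume.restrict strip)) atTop (𝓝 0) := by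
    refine l0.congr fun n => ?_
    rw [hB, hU, add_sub_add_right_eq_sub]
  have tx : Tendsto (fun n => eLpNorm (X n - Ux) 2 (volume.restrict strip)) atTop (𝓝 0) := by
    refine lx.congr fun n => ?_
    rw [hX, hUx, add_sub_add_right_eq_sub]
  have ty : Tendsto (fun n => eLpNorm (Y n - Uy) 2 (volume.restrict strip)) atTop (𝓝 0) := by
    refine ly.congr fun n => ?_
    rw [hY, hUy, add_sub_add_right_eq_sub]
  have key : ∀ n, (∫ p in strip, (η p.1 : ℂ) * Ux p * conj (X n p)) +
      (∫ p in strip, ((deriv η p.1 : ℝ) : ℂ) * Ux p * conj (B n p)) +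
      (∫ p in strip, (η p.1 : ℂ) * Uy p * conj (Y n p)) =
      (c : ℂ) * ∫ p in strip, ((1 + ε * f p : ℝ) : ℂ) * (η p.1 : ℂ) * U p * conj (B n p) := by
    intro n
    have hq := (hφ n).isQuasi.add hg
    have hηc : ContDiff ℝ ∞ fun x => (η x : ℂ) := Complex.ofRealCLM.contDiff.comp hη
    have hd : ∀ x, HasDerivAt (fun x => (η x : ℂ)) ((deriv η x : ℝ) : ℂ) x := fun x =>
      ((hη.differentiable (by simp) x).hasDerivAt).ofReal_comp
    have ht := hq.cutoff hηc (M := M) (fun x hx => by rw [hM x hx, Complex.ofReal_zero])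
    have hdq := hq.smooth.differentiable (by simp)
    have hw := hweak _ ht
    have ex : ∀ p, dX (φ n + g) p = dX (φ n) p + dX g p := fun p => by
      unfold dX
      rw [fderiv_add ((hφ n).smooth.differentiable (by simp) p) (hg.smooth.differentiable (by simp) p)]
      rfl
    have ey : ∀ p, dY (φ n + g) p = dY (φ n) p + dY g p := fun p => by
      unfold dY
      rw [fderiv_add ((hφ n).smooth.differentiable (by simp) p) (hg.smooth.differentiable (by simp) p)]
      rfl
    have s1 := integral_add (integrable_mul_conj a1 (mX n)) (integrable_mul_conj a2 (mB n))
    have s2 := integral_add ((integrable_mul_conj a1 (mX n)).add (integrable_mul_conj a2 (mB n)))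
        (integrable_mul_conj a3 (mY n))
    simp only [Pi.add_apply] at s2
    rw [← s1, ← s2]
    refine Eq.trans (integral_congr_ae (ae_of_all _ fun p => ?_)) (hw.trans ?_)
    · beta_reduce
      rw [dX_fst_mul (hd p.1) (hdq p), dY_fst_mul (hd p.1) (hdq p), ex, ey]
      by_cases hp : |p.1| ≤ M
      · rw [hUx, hUy, hX, hY, hB]
        simp only [Pi.add_apply, ind _ p hp, map_add, map_mul, Complex.conj_ofReal]
        ring
      · rw [hM _ (not_le.1 hp), hM' _ (not_le.1 hp)]; simp
    · congr 1
      refine integral_congr_ae (ae_of_all _ fun p => ?_)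
      beta_reduce
      by_cases hp : |p.1| ≤ M
      · rw [hU, hB]
        simp only [Pi.add_apply, ind _ p hp, map_add, map_mul, Complex.conj_ofReal]
        ring
      · rw [hM _ (not_le.1 hp)]; simp
  have L1 := tendsto_integral_mul_conj a1 mUx mX tx
  have L2 := tendsto_integral_mul_conj a2 mU mB t0
  have L3 := tendsto_integral_mul_conj a3 mUy mY ty
  have L4 := (tendsto_integral_mul_conj a4 mU mB t0).const_mul (c : ℂ)
  have lim := tendsto_nhds_unique (((L1.add L2).add L3).congr key) L4
  -- These integrals are real because their integrands are real multiples of squared moduli.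
  have r1 : (∫ p in strip, (η p.1 : ℂ) * Ux p * conj (Ux p)).im = 0 := by
    have : ∀ p : ℝ × ℝ, (η p.1 : ℂ) * Ux p * conj (Ux p) = ((η p.1 * Complex.normSq (Ux p) : ℝ) : ℂ) :=
      fun p => by rw [mul_assoc, Complex.mul_conj]; push_cast; rfl
    simp only [this]
    rw [integral_complex_ofReal, Complex.ofReal_im]
  have r3 : (∫ p in strip, (η p.1 : ℂ) * Uy p * conj (Uy p)).im = 0 := by
    have : ∀ p : ℝ × ℝ, (η p.1 : ℂ) * Uy p * conj (Uy p) = ((η p.1 * Complex.normSq (Uy p) : ℝ) : ℂ) :=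
      fun p => by rw [mul_assoc, Complex.mul_conj]; push_cast; rfl
    simp only [this]
    rw [integral_complex_ofReal, Complex.ofReal_im]
  have r4 : ((c : ℂ) * ∫ p in strip, ((1 + ε * f p : ℝ) : ℂ) * (η p.1 : ℂ) * U p * conj (U p)).im = 0 := by
    have : ∀ p : ℝ × ℝ, ((1 + ε * f p : ℝ) : ℂ) * (η p.1 : ℂ) * U p * conj (U p) =
        (((1 + ε * f p) * η p.1 * Complex.normSq (U p) : ℝ) : ℂ) :=
      fun p => by rw [mul_assoc, Complex.mul_conj]; push_cast; rfl
    simp only [this]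
    rw [integral_complex_ofReal, ← Complex.ofReal_mul, Complex.ofReal_im]
  have e2 : ∫ p in strip, ((deriv η p.1 : ℝ) : ℂ) * (vx p + dX g p) * conj (v p + g p) =
      ∫ p in strip, ((deriv η p.1 : ℝ) : ℂ) * Ux p * conj (U p) := by
    refine integral_congr_ae (ae_of_all _ fun p => ?_)
    beta_reduce
    by_cases hp : |p.1| ≤ M
    · rw [hU, hUx]; simp only [Pi.add_apply, ind _ p hp]
    · rw [hM' _ (not_le.1 hp)]; simp
  have := congrArg Complex.im lim
  rw [Complex.add_im, Complex.add_im, r1, r3, r4, zero_add, add_zero] at this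
  rw [e2]; exact this

end

/-! ### Uniqueness of the scattering coefficients -/

/-- Profile of the outgoing waves `t e^{ikx}` on the right and `ρ e^{-ikx}` on the left. -/
def outU (k : ℝ) (ρ t : ℂ) (x : ℝ) : ℂ :=
  (Real.smoothTransition x : ℂ) * t * Complex.exp (Complex.I * (k * x)) +
    (Real.smoothTransition (-x) : ℂ) * (ρ * Complex.exp (-(Complex.I * (k * x))))

/-- Profile of the far field. -/
def farU (k : ℝ) (ρ t : ℂ) (x : ℝ) : ℂ :=
  outU k ρ t x + (Real.smoothTransition (-x) : ℂ) * Complex.exp (Complex.I * (k * x))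

lemma farField_eq (β k : ℝ) (ρ t : ℂ) : farField β k ρ t = modal β 0 (farU k ρ t) := by
  ext p
  unfold farField modal farU outU
  rw [show Complex.I * (β * p.2 + k * p.1) = Complex.I * (k * p.1) + Complex.I * (β + (0 : ℤ)) * p.2 by
      push_cast; ring,
    show Complex.I * (β * p.2 - k * p.1) = -(Complex.I * (k * p.1)) + Complex.I * (β + (0 : ℤ)) * p.2 by
      push_cast; ring, Complex.exp_add, Complex.exp_add]
  ring

lemma contDiff_ofReal_comp {E : Type*} [NormedAddCommGroup E] [NormedSpace ℝ E] {g : E → ℝ}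
    (hg : ContDiff ℝ ∞ g) : ContDiff ℝ ∞ fun x => (g x : ℂ) := Complex.ofRealCLM.contDiff.comp hg

lemma contDiff_outU (k : ℝ) (ρ t : ℂ) : ContDiff ℝ ∞ (outU k ρ t) := by
  have h1 := contDiff_ofReal_comp (Real.smoothTransition.contDiff (n := ⊤))
  have h2 := contDiff_ofReal_comp ((Real.smoothTransition.contDiff (n := ⊤)).comp
    (contDiff_neg (𝕜 := ℝ) (F := ℝ)))
  have h3 := contDiff_ofReal_comp (contDiff_id (𝕜 := ℝ) (E := ℝ))
  simp only [id, Function.comp_def] at h2 h3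
  unfold outU
  fun_prop

lemma contDiff_farU (k : ℝ) (ρ t : ℂ) : ContDiff ℝ ∞ (farU k ρ t) := by
  have h2 := contDiff_ofReal_comp ((Real.smoothTransition.contDiff (n := ⊤)).comp
    (contDiff_neg (𝕜 := ℝ) (F := ℝ)))
  have h3 := contDiff_ofReal_comp (contDiff_id (𝕜 := ℝ) (E := ℝ))
  simp only [id, Function.comp_def] at h2 h3
  have := contDiff_outU k ρ t
  unfold farU
  fun_prop

lemma isQuasi_farField (β k : ℝ) (ρ t : ℂ) : IsQuasi β (farField β k ρ t) := by
  rw [farField_eq]; exact isQuasi_modal (contDiff_farU k ρ t)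

lemma farField_sub (β k : ℝ) (ρ t ρ' t' : ℂ) :
    farField β k ρ t - farField β k ρ' t' = modal β 0 (outU k (ρ - ρ') (t - t')) := by
  rw [farField_eq, farField_eq]
  ext p
  simp only [Pi.sub_apply, modal, farU, outU]
  ring

lemma outU_of_one_le {k : ℝ} {ρ t : ℂ} {x : ℝ} (hx : 1 ≤ x) :
    outU k ρ t x = t * Complex.exp (Complex.I * (k * x)) := by
  unfold outU
  rw [Real.smoothTransition.one_of_one_le hx, Real.smoothTransition.zero_of_nonpos (by linarith)]
  simp

lemma outU_of_le_neg_one {k : ℝ} {ρ t : ℂ} {x : ℝ} (hx : x ≤ -1) :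
    outU k ρ t x = ρ * Complex.exp (-(Complex.I * (k * x))) := by
  unfold outU
  rw [Real.smoothTransition.one_of_one_le (x := -x) (by linarith), Real.smoothTransition.zero_of_nonpos (by linarith)]
  simp

lemma hasDerivAt_exp_linear (c : ℂ) (x : ℝ) :
    HasDerivAt (fun x : ℝ => Complex.exp (c * x)) (c * Complex.exp (c * x)) x := by
  have h2 : HasDerivAt (fun y : ℝ => c * (y : ℂ)) c x := by
    simpa using (Complex.ofRealCLM.hasDerivAt (x := x)).const_mul c
  simpa [mul_comm] using h2.cexp

lemma deriv_outU_of_one_lt {k : ℝ} {ρ t : ℂ} {x : ℝ} (hx : 1 < x) :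
    deriv (outU k ρ t) x = Complex.I * k * outU k ρ t x := by
  have e : outU k ρ t =ᶠ[𝓝 x] fun x : ℝ => t * Complex.exp (Complex.I * k * x) := by
    filter_upwards [Ioi_mem_nhds hx] with z hz
    rw [outU_of_one_le (le_of_lt hz), mul_assoc]
  rw [e.deriv_eq, ((hasDerivAt_exp_linear _ x).const_mul t).deriv, outU_of_one_le hx.le, mul_assoc]
  ring_nf

lemma deriv_outU_of_lt_neg_one {k : ℝ} {ρ t : ℂ} {x : ℝ} (hx : x < -1) :
    deriv (outU k ρ t) x = -(Complex.I * k) * outU k ρ t x := by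
  have e : outU k ρ t =ᶠ[𝓝 x] fun x : ℝ => ρ * Complex.exp (-(Complex.I * k) * x) := by
    filter_upwards [Iio_mem_nhds hx] with z hz
    rw [outU_of_le_neg_one (le_of_lt hz)]; congr 2; ring
  rw [e.deriv_eq, ((hasDerivAt_exp_linear _ x).const_mul ρ).deriv, outU_of_le_neg_one hx.le]
  ring_nf

lemma norm_exp_I_mul (k x : ℝ) : ‖Complex.exp (Complex.I * (k * x))‖ = 1 := by
  rw [show Complex.I * (k * x) = ((k * x : ℝ) : ℂ) * Complex.I by push_cast; ring]
  exact Complex.norm_exp_ofReal_mul_I _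

lemma norm_exp_neg_I_mul (k x : ℝ) : ‖Complex.exp (-(Complex.I * (k * x)))‖ = 1 := by
  rw [show -(Complex.I * (k * x)) = ((-(k * x) : ℝ) : ℂ) * Complex.I by push_cast; ring]
  exact Complex.norm_exp_ofReal_mul_I _

lemma norm_outU_of_one_le {k : ℝ} {ρ t : ℂ} {x : ℝ} (hx : 1 ≤ x) : ‖outU k ρ t x‖ = ‖t‖ := by
  rw [outU_of_one_le hx, norm_mul, norm_exp_I_mul, mul_one]

lemma norm_outU_of_le_neg_one {k : ℝ} {ρ t : ℂ} {x : ℝ} (hx : x ≤ -1) : ‖outU k ρ t x‖ = ‖ρ‖ := by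
  rw [outU_of_le_neg_one hx, norm_mul, norm_exp_neg_I_mul, mul_one]

lemma volume_strip : volume.restrict strip =
    (volume : Measure ℝ).prod (volume.restrict (Set.Ioo 0 (2 * Real.pi))) := by
  unfold strip
  rw [Measure.volume_eq_prod, ← Measure.prod_restrict, Measure.restrict_univ]

lemma integral_strip_fst (h : ℝ → ℂ) : ∫ p in strip, h p.1 = 2 * Real.pi * ∫ x, h x := by
  have := integral_prod_mul (μ := (volume : Measure ℝ))
    (ν := volume.restrict (Set.Ioo 0 (2 * Real.pi))) h (fun _ : ℝ => (1 : ℂ))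
  simp only [mul_one] at this
  rw [volume_strip, this]
  rw [integral_const]
  have : max (Real.pi * 2) 0 = Real.pi * 2 := max_eq_left (by positivity)
  simp [mul_comm, this]

/-- Cut-off equal to one on `[-s, s]` and vanishing outside `[-2s, 2s]`. -/
def cutS (s x : ℝ) : ℝ := Real.smoothTransition (2 - x / s) * Real.smoothTransition (2 + x / s)

lemma contDiff_cutS (s : ℝ) : ContDiff ℝ ∞ (cutS s) := by
  have h := Real.smoothTransition.contDiff (n := ⊤)
  have h1 : ContDiff ℝ ∞ fun x : ℝ => Real.smoothTransition (2 - x / s) :=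
    h.comp (contDiff_const.sub (contDiff_id.div_const s))
  have h2 : ContDiff ℝ ∞ fun x : ℝ => Real.smoothTransition (2 + x / s) :=
    h.comp (contDiff_const.add (contDiff_id.div_const s))
  exact h1.mul h2

lemma cutS_eq_one {s x : ℝ} (hs : 0 < s) (hx : |x| ≤ s) : cutS s x = 1 := by
  rw [abs_le] at hx
  have h1 : x / s ≤ 1 := by rw [div_le_one hs]; exact hx.2
  have h2 : -1 ≤ x / s := by rw [le_div_iff₀ hs]; linarith [hx.1]
  unfold cutS
  rw [Real.smoothTransition.one_of_one_le (by linarith), Real.smoothTransition.one_of_one_le (by linarith),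
    mul_one]

lemma cutS_eq_zero {s x : ℝ} (hs : 0 < s) (hx : 2 * s ≤ |x|) : cutS s x = 0 := by
  unfold cutS
  rcases le_abs.1 hx with h | h
  · rw [Real.smoothTransition.zero_of_nonpos (by
      have : 2 ≤ x / s := by rw [le_div_iff₀ hs]; exact h
      linarith), zero_mul]
  · rw [Real.smoothTransition.zero_of_nonpos (x := 2 + x / s) (by
      have : x / s ≤ -2 := by rw [div_le_iff₀ hs]; linarith
      linarith), mul_zero]

lemma cutS_mem (s x : ℝ) : |cutS s x| ≤ 1 := by
  unfold cutS
  rw [abs_mul, abs_of_nonneg (Real.smoothTransition.nonneg _), abs_of_nonneg (Real.smoothTransition.nonneg _)]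
  exact mul_le_one₀ (Real.smoothTransition.le_one _) (Real.smoothTransition.nonneg _)
    (Real.smoothTransition.le_one _)

/-- By scaling, `cutS s x = cutS 1 (x / s)`. -/
lemma exists_deriv_cutS_bound : ∃ D, 0 ≤ D ∧ ∀ s, 0 < s → ∀ x, |deriv (cutS s) x| ≤ D / s := by
  have h0 : ∀ x, 2 < |x| → cutS 1 x = 0 := fun x hx => cutS_eq_zero one_pos (by linarith)
  obtain ⟨D, hD, hb⟩ := exists_bound_of_vanish ((contDiff_cutS 1).continuous_deriv (by simp))
    (fun x => deriv_eq_zero_of_vanish h0)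
  refine ⟨D, hD, fun s hs x => ?_⟩
  have e : cutS s = fun x => cutS 1 (x / s) := by ext x; simp [cutS]
  have h1 : HasDerivAt (cutS s) (deriv (cutS 1) (x / s) * (1 / s)) x := by
    rw [e]
    exact (((contDiff_cutS 1).differentiable (by simp) (x / s)).hasDerivAt).comp x
      ((hasDerivAt_id x).div_const s)
  rw [h1.deriv, abs_mul, abs_of_pos (by positivity : 0 < 1 / s), mul_one_div]
  gcongr
  exact hb _

lemma deriv_cutS_eq_zero {s x : ℝ} (hs : 0 < s) (hx : |x| < s ∨ 2 * s < |x|) : deriv (cutS s) x = 0 := by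
  rcases hx with hx | hx
  · have : cutS s =ᶠ[𝓝 x] fun _ => 1 := by
      have ho : IsOpen {x : ℝ | |x| < s} := isOpen_lt (by fun_prop) continuous_const
      filter_upwards [ho.mem_nhds hx] with t ht
      exact cutS_eq_one hs (le_of_lt ht)
    rw [this.deriv_eq, deriv_const]
  · exact deriv_eq_zero_of_vanish (fun x hx => cutS_eq_zero hs (le_of_lt hx)) hx

lemma integrable_deriv_cutS {s : ℝ} (hs : 0 < s) : Integrable (deriv (cutS s)) := by
  refine Continuous.integrable_of_hasCompactSupport ((contDiff_cutS s).continuous_deriv (by simp))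
    (HasCompactSupport.intro (isCompact_Icc (a := -(2 * s)) (b := 2 * s)) fun x hx => ?_)
  refine deriv_cutS_eq_zero hs (Or.inr ?_)
  by_contra hc
  exact hx (abs_le.1 (not_lt.1 hc))

lemma integral_deriv_cutS {s : ℝ} (hs : 0 < s) :
    ∫ x in Set.Ioi 0, deriv (cutS s) x = -1 ∧ ∫ x in Set.Iic 0, deriv (cutS s) x = 1 := by
  have hd : ∀ x, HasDerivAt (cutS s) (deriv (cutS s) x) x := fun x =>
    ((contDiff_cutS s).differentiable (by simp) x).hasDerivAt
  have h0 : cutS s 0 = 1 := cutS_eq_one hs (by simpa using hs.le)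
  constructor
  · rw [integral_Ioi_of_hasDerivAt_of_tendsto' (fun x _ => hd x) (integrable_deriv_cutS hs).integrableOn
      (m := 0), h0, zero_sub]
    refine tendsto_const_nhds.congr' ?_
    filter_upwards [eventually_ge_atTop (2 * s)] with x hx
    rw [cutS_eq_zero hs (hx.trans (le_abs_self x))]
  · rw [integral_Iic_of_hasDerivAt_of_tendsto' (fun x _ => hd x) (integrable_deriv_cutS hs).integrableOn
      (m := 0), h0, sub_zero]
    refine tendsto_const_nhds.congr' ?_
    filter_upwards [eventually_le_atBot (-(2 * s))] with x hx
    rw [cutS_eq_zero hs (by rw [le_abs]; right; linarith)]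

section
variable {f : ℝ × ℝ → ℝ} {R ε β c k : ℝ} {v vx vy : ℝ × ℝ → ℂ} {ρ t : ℂ}

/-- The derivative of the cut-off lives on `|x| ≥ s > 1`, where the profile is a pure exponential
and its derivative is `±ik` times itself. The integrals of the cut-off's derivative over the two
half-lines are `-1` and `1`. -/
lemma flux_outU {s : ℝ} (hs : 1 < s) :
    (∫ p in strip, ((deriv (cutS s) p.1 : ℝ) : ℂ) * dX (modal β 0 (outU k ρ t)) p *
      conj (modal β 0 (outU k ρ t) p)) =
    -(2 * Real.pi * (Complex.I * k * (‖t‖ ^ 2 + ‖ρ‖ ^ 2 : ℝ))) := by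
  have hs0 : 0 < s := by linarith
  have hd : ∀ x, HasDerivAt (outU k ρ t) (deriv (outU k ρ t) x) x := fun x =>
    ((contDiff_outU k ρ t).differentiable (by simp) x).hasDerivAt
  have e : ∀ p : ℝ × ℝ, ((deriv (cutS s) p.1 : ℝ) : ℂ) * dX (modal β 0 (outU k ρ t)) p *
      conj (modal β 0 (outU k ρ t) p) = (fun x => ((deriv (cutS s) x : ℝ) : ℂ) *
        (deriv (outU k ρ t) x * conj (outU k ρ t x))) p.1 := by
    intro p
    rw [dX_modal (hd p.1), modal, map_mul]
    have : Complex.exp (Complex.I * (β + (0 : ℤ)) * p.2) *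
        conj (Complex.exp (Complex.I * (β + (0 : ℤ)) * p.2)) = 1 := by
      rw [Complex.mul_conj, Complex.normSq_eq_norm_sq, norm_exp_modal]; simp
    linear_combination ((deriv (cutS s) p.1 : ℝ) : ℂ) * deriv (outU k ρ t) p.1 *
      conj (outU k ρ t p.1) * this
  rw [integral_congr_ae (ae_of_all _ e), integral_strip_fst (fun x => ((deriv (cutS s) x : ℝ) : ℂ) *
        (deriv (outU k ρ t) x * conj (outU k ρ t x)))]
  have hR : ∀ x, 0 < x → ((deriv (cutS s) x : ℝ) : ℂ) * (deriv (outU k ρ t) x * conj (outU k ρ t x)) =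
      (Complex.I * k * (‖t‖ ^ 2 : ℝ)) * ((deriv (cutS s) x : ℝ) : ℂ) := by
    intro x hx
    rcases le_or_gt x 1 with h | h
    · rw [deriv_cutS_eq_zero hs0 (Or.inl (by rw [abs_of_pos hx]; linarith))]; simp
    · rw [deriv_outU_of_one_lt h, mul_assoc _ (outU k ρ t x), Complex.mul_conj,
        Complex.normSq_eq_norm_sq, norm_outU_of_one_le h.le]; ring
  have hL : ∀ x, x ≤ 0 → ((deriv (cutS s) x : ℝ) : ℂ) * (deriv (outU k ρ t) x * conj (outU k ρ t x)) =
      (-(Complex.I * k) * (‖ρ‖ ^ 2 : ℝ)) * ((deriv (cutS s) x : ℝ) : ℂ) := by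
    intro x hx
    rcases le_or_gt (-1) x with h | h
    · rw [deriv_cutS_eq_zero hs0 (Or.inl (by rw [abs_of_nonpos hx]; linarith))]; simp
    · rw [deriv_outU_of_lt_neg_one h, mul_assoc _ (outU k ρ t x), Complex.mul_conj,
        Complex.normSq_eq_norm_sq, norm_outU_of_le_neg_one h.le]; ring
  have hi : Integrable fun x => ((deriv (cutS s) x : ℝ) : ℂ) := (integrable_deriv_cutS hs0).ofReal
  have iR : IntegrableOn (fun x => ((deriv (cutS s) x : ℝ) : ℂ) *
      (deriv (outU k ρ t) x * conj (outU k ρ t x))) (Set.Ioi 0) :=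
    ((hi.const_mul _).integrableOn).congr_fun (fun x hx => (hR x hx).symm) measurableSet_Ioi
  have iL : IntegrableOn (fun x => ((deriv (cutS s) x : ℝ) : ℂ) *
      (deriv (outU k ρ t) x * conj (outU k ρ t x))) (Set.Iic 0) :=
    ((hi.const_mul _).integrableOn).congr_fun (fun x hx => (hL x hx).symm) measurableSet_Iic
  rw [← intervalIntegral.integral_Iic_add_Ioi iL iR, setIntegral_congr_fun measurableSet_Ioi
    (fun x hx => hR x hx), setIntegral_congr_fun measurableSet_Iic (fun x hx => hL x hx),
    integral_const_mul, integral_const_mul, integral_complex_ofReal, integral_complex_ofReal,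
    (integral_deriv_cutS hs0).1, (integral_deriv_cutS hs0).2]
  push_cast; ring

lemma integral_indicator_strip (C : ℝ) {s : ℝ} (hs : 0 < s) :
    IntegrableOn ({p : ℝ × ℝ | |p.1| ≤ s}.indicator fun _ => C) strip ∧
    ∫ p in strip, {p : ℝ × ℝ | |p.1| ≤ s}.indicator (fun _ => C) p = C * (4 * Real.pi * s) := by
  have hm : MeasurableSet {p : ℝ × ℝ | |p.1| ≤ s} := measurableSet_le (by fun_prop) measurable_const
  have e : {p : ℝ × ℝ | |p.1| ≤ s} ∩ strip = Set.Icc (-s) s ×ˢ Set.Ioo 0 (2 * Real.pi) := by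
    ext p
    simp [strip, abs_le]
  have hv : volume ({p : ℝ × ℝ | |p.1| ≤ s} ∩ strip) = ENNReal.ofReal (4 * Real.pi * s) := by
    rw [e, Measure.volume_eq_prod, Measure.prod_prod, Real.volume_Icc, Real.volume_Ioo,
      ← ENNReal.ofReal_mul (by linarith)]
    congr 1; ring
  constructor
  · refine (integrable_indicator_iff hm).2 ?_
    refine integrableOn_const (hs := ?_)
    rw [Measure.restrict_apply hm, hv]; exact ENNReal.ofReal_ne_top
  · rw [integral_indicator hm, setIntegral_const, Measure.real, Measure.restrict_apply hm, hv,
      ENNReal.toReal_ofReal (by have := Real.pi_pos; positivity), smul_eq_mul, mul_comm]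

/-- A solution whose incoming waves vanish has no outgoing waves. -/
lemma HasGradH.outgoing_eq_zero (hf : IsPert f R) (hv : HasGradH β v vx vy) (hk : 0 < k)
    (hweak : ∀ Φ, IsTest β Φ →
      ∫ p in strip, ((vx p + dX (modal β 0 (outU k ρ t)) p) * conj (dX Φ p) +
        (vy p + dY (modal β 0 (outU k ρ t)) p) * conj (dY Φ p)) =
        (c : ℂ) * ∫ p in strip, ((1 + ε * f p : ℝ) : ℂ) * (v p + modal β 0 (outU k ρ t) p) *
          conj (Φ p)) : ρ = 0 ∧ t = 0 := by
  obtain ⟨D, hD, hbD⟩ := exists_deriv_cutS_bound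
  obtain ⟨g, hgd⟩ : ∃ g, g = modal β 0 (outU k ρ t) := ⟨_, rfl⟩
  have hg : IsQuasi β g := by rw [hgd]; exact isQuasi_modal (contDiff_outU k ρ t)
  have hd : ∀ x, HasDerivAt (outU k ρ t) (deriv (outU k ρ t) x) x := fun x =>
    ((contDiff_outU k ρ t).differentiable (by simp) x).hasDerivAt
  obtain ⟨a, ha⟩ : ∃ a, a = (1 + k) * (‖t‖ + ‖ρ‖) := ⟨_, rfl⟩
  have ha0 : 0 ≤ a := by rw [ha]; positivity
  have hU : ∀ x, 1 < |x| → ‖outU k ρ t x‖ ≤ a ∧ ‖deriv (outU k ρ t) x‖ ≤ a := by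
    intro x hx
    have h1 : 0 ≤ k * ‖t‖ := by positivity
    have h2 : 0 ≤ k * ‖ρ‖ := by positivity
    have h3 := norm_nonneg t
    have h4 := norm_nonneg ρ
    rcases lt_abs.1 hx with h | h
    · rw [deriv_outU_of_one_lt h, norm_mul, norm_mul, Complex.norm_I, one_mul, Complex.norm_real,
        norm_outU_of_one_le h.le, Real.norm_of_nonneg hk.le, ha]
      constructor <;> linarith
    · rw [deriv_outU_of_lt_neg_one (by linarith), norm_mul, norm_neg, norm_mul, Complex.norm_I, one_mul,
        Complex.norm_real, norm_outU_of_le_neg_one (by linarith), Real.norm_of_nonneg hk.le, ha]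
      constructor <;> linarith
  have hgb : ∀ p : ℝ × ℝ, 1 < |p.1| → ‖g p‖ ≤ a ∧ ‖dX g p‖ ≤ a := by
    intro p hp
    rw [hgd, norm_modal, dX_modal (hd p.1), norm_mul, norm_exp_modal, mul_one]
    exact hU _ hp
  have i1 : Integrable (fun p => ‖vx p‖ ^ 2) (volume.restrict strip) := hv.memLp_x.integrable_norm_pow (by simp)
  have i2 : Integrable (fun p => ‖v p‖ ^ 2) (volume.restrict strip) := hv.memLp.integrable_norm_pow (by simp)
  obtain ⟨A, hA⟩ : ∃ A, A = ∫ p in strip, (‖vx p‖ ^ 2 + ‖v p‖ ^ 2) := ⟨_, rfl⟩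
  -- The cut-off has length scale `s²`, so its slope is at most `D/s²` on a set of area `O(s²)`.
  -- Splitting the cross terms with weight `s` leaves `(D/s)` times the energy of `v`, plus `a²/s³`
  -- times the area, and both are `O(1/s)`.
  have main : ∀ s : ℝ, 2 ≤ s →
      2 * Real.pi * (k * (‖t‖ ^ 2 + ‖ρ‖ ^ 2)) ≤ (D * A + 8 * Real.pi * D * a ^ 2) / s := by
    intro s hs
    have hs2 : 1 < s ^ 2 := by nlinarith
    have hs0 : 0 < s ^ 2 := by linarith
    have hflux := hv.im_flux_eq_zero hf hg (by rw [hgd]; exact hweak) (contDiff_cutS (s ^ 2))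
      (M := 2 * s ^ 2) (fun x hx => cutS_eq_zero hs0 hx.le)
    have hgf := flux_outU (β := β) (k := k) (ρ := ρ) (t := t) hs2
    rw [← hgd] at hgf
    have cη' : Continuous fun p : ℝ × ℝ => ((deriv (cutS (s ^ 2)) p.1 : ℝ) : ℂ) :=
      Complex.continuous_ofReal.comp (((contDiff_cutS _).continuous_deriv (by simp)).comp continuous_fst)
    have cdg := continuous_dX hg.smooth
    have cg := hg.smooth.continuous
    have ig : Integrable (fun p : ℝ × ℝ => ((deriv (cutS (s ^ 2)) p.1 : ℝ) : ℂ) * dX g p * conj (g p))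
        (volume.restrict strip) := by
      refine integrable_of_vanish (M := 2 * s ^ 2) (by fun_prop) fun x y hx => ?_
      simp only
      rw [deriv_cutS_eq_zero hs0 (Or.inr hx)]; simp
    obtain ⟨X, hX⟩ : ∃ X : ℝ × ℝ → ℂ, ∀ p, X p = ((deriv (cutS (s ^ 2)) p.1 : ℝ) : ℂ) *
      (vx p * conj (v p) + vx p * conj (g p) + dX g p * conj (v p)) := ⟨_, fun _ => rfl⟩
    have ind := integral_indicator_strip (D / s ^ 2 * (a ^ 2 / s)) (s := 2 * s ^ 2) (by positivity)
    obtain ⟨Bd, hBd⟩ : ∃ Bd : ℝ × ℝ → ℝ, ∀ p, Bd p = D / s * (‖vx p‖ ^ 2 + ‖v p‖ ^ 2) +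
      {p : ℝ × ℝ | |p.1| ≤ 2 * s ^ 2}.indicator (fun _ => D / s ^ 2 * (a ^ 2 / s)) p := ⟨_, fun _ => rfl⟩
    have iB : Integrable Bd (volume.restrict strip) := by
      rw [funext hBd]; exact ((i1.add i2).const_mul _).add ind.1
    have hXB : ∀ p, ‖X p‖ ≤ Bd p := by
      intro p
      rw [hX, hBd]
      by_cases hp : 1 < |p.1| ∧ |p.1| ≤ 2 * s ^ 2
      · rw [Set.indicator_of_mem (show p ∈ {p : ℝ × ℝ | |p.1| ≤ 2 * s ^ 2} from hp.2), norm_mul]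
        obtain ⟨g1, g2⟩ := hgb p hp.1
        have h1 : ‖vx p * conj (v p) + vx p * conj (g p) + dX g p * conj (v p)‖ ≤
            ‖vx p‖ * ‖v p‖ + ‖vx p‖ * a + a * ‖v p‖ := by
          refine (norm_add₃_le).trans ?_
          rw [norm_mul, norm_mul, norm_mul, RCLike.norm_conj, RCLike.norm_conj]
          gcongr
        have h2 : ‖((deriv (cutS (s ^ 2)) p.1 : ℝ) : ℂ)‖ ≤ D / s ^ 2 := by
          rw [Complex.norm_real]; exact hbD _ hs0 _
        -- Young's inequality with weight `s`; the constant amplitude `a` is not square integrable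
        -- and must carry the small factor.
        have h3 : ‖vx p‖ * ‖v p‖ + ‖vx p‖ * a + a * ‖v p‖ ≤ s * (‖vx p‖ ^ 2 + ‖v p‖ ^ 2) + a ^ 2 / s := by
          have hs' : 0 < s := by linarith
          rw [← mul_le_mul_iff_left₀ hs', add_mul, add_mul, add_mul, div_mul_cancel₀ _ hs'.ne']
          nlinarith [sq_nonneg (s * ‖vx p‖ - a), sq_nonneg (s * ‖v p‖ - a), sq_nonneg (‖vx p‖ - ‖v p‖),
            mul_nonneg (mul_nonneg hs'.le (by linarith : 0 ≤ s - 1)) (add_nonneg (sq_nonneg ‖vx p‖) (sq_nonneg ‖v p‖)),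
            sq_nonneg ‖vx p‖, sq_nonneg ‖v p‖]
        calc _ ≤ D / s ^ 2 * (s * (‖vx p‖ ^ 2 + ‖v p‖ ^ 2) + a ^ 2 / s) :=
              mul_le_mul h2 (h1.trans h3) (norm_nonneg _) (by positivity)
          _ = _ := by
            have hs' : s ≠ 0 := by linarith
            field_simp
      · have h0 : deriv (cutS (s ^ 2)) p.1 = 0 := by
          refine deriv_cutS_eq_zero hs0 ?_
          by_cases h : 1 < |p.1|
          · exact Or.inr (not_le.1 fun h' => hp ⟨h, h'⟩)
          · exact Or.inl (lt_of_le_of_lt (not_lt.1 h) hs2)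
        rw [h0]
        simp only [Complex.ofReal_zero, zero_mul, norm_zero]
        have : 0 ≤ {p : ℝ × ℝ | |p.1| ≤ 2 * s ^ 2}.indicator (fun _ => D / s ^ 2 * (a ^ 2 / s)) p :=
          Set.indicator_nonneg (fun _ _ => by positivity) p
        positivity
    have iX : Integrable X (volume.restrict strip) := by
      refine iB.mono' ?_ (ae_of_all _ hXB)
      have m1 := hv.memLp.aestronglyMeasurable
      have m2 := hv.memLp_x.aestronglyMeasurable
      have m3 : ∀ {w : ℝ × ℝ → ℂ}, AEStronglyMeasurable w (volume.restrict strip) →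
          AEStronglyMeasurable (fun p => conj (w p)) (volume.restrict strip) := fun hw => hw.star
      rw [funext hX]
      exact cη'.aestronglyMeasurable.mul (((m2.mul (m3 m1)).add (m2.mul (m3 cg.aestronglyMeasurable))).add
        (cdg.aestronglyMeasurable.mul (m3 m1)))
    have hsum : ∫ p in strip, ((deriv (cutS (s ^ 2)) p.1 : ℝ) : ℂ) * (vx p + dX g p) * conj (v p + g p) =
        (∫ p in strip, X p) + ∫ p in strip, ((deriv (cutS (s ^ 2)) p.1 : ℝ) : ℂ) * dX g p * conj (g p) := by
      rw [← integral_add iX ig]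
      refine integral_congr_ae (ae_of_all _ fun p => ?_)
      simp only [hX, map_add]
      ring
    have hXn : ‖∫ p in strip, X p‖ ≤ (D * A + 8 * Real.pi * D * a ^ 2) / s := by
      refine (norm_integral_le_of_norm_le iB (ae_of_all _ hXB)).trans (le_of_eq ?_)
      have i3 : Integrable (fun p => D / s * (‖vx p‖ ^ 2 + ‖v p‖ ^ 2)) (volume.restrict strip) :=
        (i1.add i2).const_mul _
      rw [integral_congr_ae (ae_of_all _ hBd), integral_add i3 ind.1, ind.2,
        integral_const_mul]
      change D / s * (∫ p in strip, (‖vx p‖ ^ 2 + ‖v p‖ ^ 2)) + _ = _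
      rw [← hA]
      have hs' : s ≠ 0 := by linarith
      field_simp
      ring
    rw [hsum, hgf] at hflux
    have him : (-(2 * Real.pi * (Complex.I * k * (‖t‖ ^ 2 + ‖ρ‖ ^ 2 : ℝ))) : ℂ).im =
        -(2 * Real.pi * (k * (‖t‖ ^ 2 + ‖ρ‖ ^ 2))) := by
      rw [show (-(2 * Real.pi * (Complex.I * k * (‖t‖ ^ 2 + ‖ρ‖ ^ 2 : ℝ))) : ℂ) =
        ((-(2 * Real.pi * (k * (‖t‖ ^ 2 + ‖ρ‖ ^ 2))) : ℝ) : ℂ) * Complex.I by push_cast; ring]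
      rw [Complex.im_ofReal_mul, Complex.I_im, mul_one]
    rw [Complex.add_im, him] at hflux
    calc 2 * Real.pi * (k * (‖t‖ ^ 2 + ‖ρ‖ ^ 2)) = (∫ p in strip, X p).im := by linarith
      _ ≤ |(∫ p in strip, X p).im| := le_abs_self _
      _ ≤ _ := (Complex.abs_im_le_norm _).trans hXn
  have hlim : 2 * Real.pi * (k * (‖t‖ ^ 2 + ‖ρ‖ ^ 2)) ≤ 0 :=
    ge_of_tendsto (tendsto_const_nhds.div_atTop tendsto_id)
      ((eventually_ge_atTop 2).mono fun s hs => main s hs)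
  have h1 : ‖t‖ ^ 2 + ‖ρ‖ ^ 2 ≤ 0 := by
    by_contra h
    push Not at h
    have : 0 < 2 * Real.pi * (k * (‖t‖ ^ 2 + ‖ρ‖ ^ 2)) := by have := Real.pi_pos; positivity
    linarith
  have h2 := sq_nonneg ‖t‖
  have h3 := sq_nonneg ‖ρ‖
  exact ⟨norm_eq_zero.1 (pow_eq_zero_iff two_ne_zero |>.1 (by linarith)),
    norm_eq_zero.1 (pow_eq_zero_iff two_ne_zero |>.1 (by linarith))⟩

lemma IsQuasi.sub {Φ Φ' : ℝ × ℝ → ℂ} (h : IsQuasi β Φ) (h' : IsQuasi β Φ') : IsQuasi β (Φ - Φ') := by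
  have hd := h.smooth.differentiable (by simp)
  have hd' := h'.smooth.differentiable (by simp)
  refine ⟨h.smooth.sub h'.smooth, fun x => ?_, fun x => ?_⟩
  · simp only [Pi.sub_apply]; rw [h.quasi, h'.quasi]; ring
  · have e : ∀ p, dY (Φ - Φ') p = dY Φ p - dY Φ' p := fun p => by
      unfold dY; rw [fderiv_sub (hd p) (hd' p)]; rfl
    rw [e, e, h.quasi_dY, h'.quasi_dY]; ring

lemma IsTest.sub {Φ Φ' : ℝ × ℝ → ℂ} (h : IsTest β Φ) (h' : IsTest β Φ') : IsTest β (Φ - Φ') := by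
  obtain ⟨M, hM⟩ := h.vanish
  obtain ⟨M', hM'⟩ := h'.vanish
  refine (h.isQuasi.sub h'.isQuasi).isTest_of_vanish ⟨max M M', fun x y hx => ?_⟩
  rw [Pi.sub_apply, hM x y ((le_max_left _ _).trans_lt hx), hM' x y ((le_max_right _ _).trans_lt hx),
    sub_zero]

lemma dX_sub {Φ Φ' : ℝ × ℝ → ℂ} (h : ContDiff ℝ ∞ Φ) (h' : ContDiff ℝ ∞ Φ') :
    dX (Φ - Φ') = dX Φ - dX Φ' := by
  ext p
  unfold dX
  rw [fderiv_sub (h.differentiable (by simp) p) (h'.differentiable (by simp) p)]; rfl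

lemma dY_sub {Φ Φ' : ℝ × ℝ → ℂ} (h : ContDiff ℝ ∞ Φ) (h' : ContDiff ℝ ∞ Φ') :
    dY (Φ - Φ') = dY Φ - dY Φ' := by
  ext p
  unfold dY
  rw [fderiv_sub (h.differentiable (by simp) p) (h'.differentiable (by simp) p)]; rfl

lemma tendsto_eLpNorm_sub_sub {α E : Type*} {mα : MeasurableSpace α} [NormedAddCommGroup E] {ν : Measure α}
    {a a' : ℕ → α → E} {c c' : α → E} (ha : ∀ n, AEStronglyMeasurable (a n) ν)
    (ha' : ∀ n, AEStronglyMeasurable (a' n) ν) (hc : AEStronglyMeasurable c ν)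
    (hc' : AEStronglyMeasurable c' ν) (h : Tendsto (fun n => eLpNorm (a n - c) 2 ν) atTop (𝓝 0))
    (h' : Tendsto (fun n => eLpNorm (a' n - c') 2 ν) atTop (𝓝 0)) :
    Tendsto (fun n => eLpNorm ((a n - a' n) - (c - c')) 2 ν) atTop (𝓝 0) := by
  refine tendsto_of_tendsto_of_tendsto_of_le_of_le tendsto_const_nhds (by simpa using h.add h')
    (fun _ => zero_le) fun n => ?_
  rw [show a n - a' n - (c - c') = (a n - c) - (a' n - c') by abel]
  exact eLpNorm_sub_le ((ha n).sub hc) ((ha' n).sub hc') one_le_two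

lemma HasGradH.sub {u ux uy u' ux' uy' : ℝ × ℝ → ℂ} (h : HasGradH β u ux uy)
    (h' : HasGradH β u' ux' uy') : HasGradH β (u - u') (ux - ux') (uy - uy') := by
  obtain ⟨φ, hφ, l0, lx, ly⟩ := h.approx
  obtain ⟨φ', hφ', l0', lx', ly'⟩ := h'.approx
  refine ⟨h.memLp.sub h'.memLp, h.memLp_x.sub h'.memLp_x, h.memLp_y.sub h'.memLp_y,
    fun n => φ n - φ' n, fun n => (hφ n).sub (hφ' n), ?_, ?_, ?_⟩
  · exact tendsto_eLpNorm_sub_sub (fun n => (hφ n).smooth.continuous.aestronglyMeasurable)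
      (fun n => (hφ' n).smooth.continuous.aestronglyMeasurable) h.memLp.1 h'.memLp.1 l0 l0'
  · simp only [fun n => dX_sub (hφ n).smooth (hφ' n).smooth]
    exact tendsto_eLpNorm_sub_sub (fun n => (continuous_dX (hφ n).smooth).aestronglyMeasurable)
      (fun n => (continuous_dX (hφ' n).smooth).aestronglyMeasurable) h.memLp_x.1 h'.memLp_x.1 lx lx'
  · simp only [fun n => dY_sub (hφ n).smooth (hφ' n).smooth]
    exact tendsto_eLpNorm_sub_sub (fun n => (continuous_dY (hφ n).smooth).aestronglyMeasurable)
      (fun n => (continuous_dY (hφ' n).smooth).aestronglyMeasurable) h.memLp_y.1 h'.memLp_y.1 ly ly'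

lemma integrable_add_mul_conj {u w Φ : ℝ × ℝ → ℂ} (hu : MemLp u 2 (volume.restrict strip))
    (hw : Continuous w) (hΦ : Continuous Φ) {M : ℝ} (hM : ∀ x y : ℝ, M < |x| → Φ (x, y) = 0) :
    Integrable (fun p => (u p + w p) * conj (Φ p)) (volume.restrict strip) := by
  have h1 : Integrable (fun p => w p * conj (Φ p)) (volume.restrict strip) :=
    integrable_of_vanish (M := M) (by fun_prop) fun x y hx => by simp [hM x y hx]
  have h2 := (integrable_mul_conj hu (memLp_of_vanish hΦ hM 2)).add h1
  refine h2.congr (ae_of_all _ fun p => ?_)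
  simp only [Pi.add_apply]; ring

/-- The scattering coefficients are determined by the problem. -/
lemma SolvesScattering.unique (hf : IsPert f R) {μ : ℝ} (hk : 0 < waveNumber μ β) {Ψ Ψ' : ℝ × ℝ → ℂ}
    {ρ' t' : ℂ} (h : SolvesScattering f ε μ β Ψ ρ t) (h' : SolvesScattering f ε μ β Ψ' ρ' t') :
    ρ = ρ' ∧ t = t' := by
  obtain ⟨vx, vy, hv, hw⟩ := h
  obtain ⟨vx', vy', hv', hw'⟩ := h'
  obtain ⟨F, hF⟩ : ∃ F, F = farField β (waveNumber μ β) ρ t := ⟨_, rfl⟩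
  obtain ⟨F', hF'⟩ : ∃ F', F' = farField β (waveNumber μ β) ρ' t' := ⟨_, rfl⟩
  have sF : ContDiff ℝ ∞ F := by rw [hF]; exact (isQuasi_farField _ _ _ _).smooth
  have sF' : ContDiff ℝ ∞ F' := by rw [hF']; exact (isQuasi_farField _ _ _ _).smooth
  have hg := farField_sub β (waveNumber μ β) ρ t ρ' t'
  rw [← hF, ← hF'] at hg
  rw [← hF] at hv hw
  rw [← hF'] at hv' hw'
  -- In the difference of the two solutions the incident waves cancel, so its far field is purely
  -- outgoing.
  obtain ⟨h1, h2⟩ := HasGradH.outgoing_eq_zero (c := omegaSq μ β) (ε := ε) (ρ := ρ - ρ') (t := t - t') hf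
    (hv.sub hv') hk (fun Φ hΦ => by
    obtain ⟨M, hM⟩ := hΦ.vanish
    have cf : Continuous fun p => ((1 + ε * f p : ℝ) : ℂ) :=
      Complex.continuous_ofReal.comp (by have := hf.smooth.continuous; fun_prop)
    have cΦ := hΦ.smooth.continuous
    have jx : ∀ {u w : ℝ × ℝ → ℂ}, MemLp u 2 (volume.restrict strip) → Continuous w →
        Integrable (fun p => (u p + w p) * conj (dX Φ p)) (volume.restrict strip) := fun hu hw =>
      integrable_add_mul_conj hu hw (continuous_dX hΦ.smooth) (fun x y => dX_eq_zero_of_vanish hM)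
    have jy : ∀ {u w : ℝ × ℝ → ℂ}, MemLp u 2 (volume.restrict strip) → Continuous w →
        Integrable (fun p => (u p + w p) * conj (dY Φ p)) (volume.restrict strip) := fun hu hw =>
      integrable_add_mul_conj hu hw (continuous_dY hΦ.smooth) (fun x y => dY_eq_zero_of_vanish hM)
    have j0 : ∀ {u w : ℝ × ℝ → ℂ}, MemLp u 2 (volume.restrict strip) → Continuous w →
        Integrable (fun p => ((1 + ε * f p : ℝ) : ℂ) * (u p + w p) * conj (Φ p))
          (volume.restrict strip) := fun {u w} hu hw => by
      have := integrable_add_mul_conj hu hw (Φ := fun p => ((1 + ε * f p : ℝ) : ℂ) * Φ p) (by fun_prop)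
        (M := M) (fun x y hx => by simp [hM x y hx])
      refine this.congr (ae_of_all _ fun p => ?_)
      simp only [map_mul, Complex.conj_ofReal]; ring
    have k1 := hw Φ hΦ
    have k2 := hw' Φ hΦ
    have i1 := (jx hv.memLp_x (continuous_dX sF)).add (jy hv.memLp_y (continuous_dY sF))
    have i2 := (jx hv'.memLp_x (continuous_dX sF')).add (jy hv'.memLp_y (continuous_dY sF'))
    have i3 := j0 hv.memLp sF.continuous
    have i4 := j0 hv'.memLp sF'.continuous
    have e1 := integral_sub i1 i2
    have e2 := integral_sub i3 i4
    rw [← hg, dX_sub sF sF', dY_sub sF sF']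
    refine Eq.trans (integral_congr_ae (ae_of_all _ fun p => ?_)) (e1.trans (Eq.trans ?_
      (congrArg (fun z => (omegaSq μ β : ℂ) * z) (e2.symm.trans (integral_congr_ae
        (ae_of_all _ fun p => ?_))))))
    · simp only [Pi.sub_apply, Pi.add_apply]; ring
    · simp only [Pi.add_apply, Pi.sub_apply, sub_add_cancel] at k1 k2 ⊢
      rw [k1, k2]; ring
    · simp only [Pi.sub_apply]; ring)
  exact ⟨sub_eq_zero.1 h1, sub_eq_zero.1 h2⟩

end

/-! ### One-dimensional Green functions -/

/-- `∫_{-R}^x e^{-κ(x-ξ)} a(ξ) dξ`. -/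
def halfG (κ : ℂ) (R : ℝ) (a : ℝ → ℂ) (x : ℝ) : ℂ :=
  Complex.exp (-κ * x) * ∫ ξ in (-R)..x, Complex.exp (κ * ξ) * a ξ

/-- The solution `w` of `w'' = κ² w - a` with the kernel `e^{-κ|x|} / (2κ)`. -/
def greenW (κ : ℂ) (R : ℝ) (a : ℝ → ℂ) (x : ℝ) : ℂ :=
  (halfG κ R a x + halfG κ R (fun ξ => a (-ξ)) (-x)) / (2 * κ)

/-- Derivative of `greenW`. -/
def greenD (κ : ℂ) (R : ℝ) (a : ℝ → ℂ) (x : ℝ) : ℂ :=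
  (-halfG κ R a x + halfG κ R (fun ξ => a (-ξ)) (-x)) / 2

section
variable {κ : ℂ} {R : ℝ} {a : ℝ → ℂ} {x : ℝ}

lemma hasDerivAt_halfG (ha : Continuous a) (x : ℝ) :
    HasDerivAt (halfG κ R a) (-κ * halfG κ R a x + a x) x := by
  have hc : Continuous fun ξ : ℝ => Complex.exp (κ * ξ) * a ξ := by fun_prop
  have h1 := intervalIntegral.integral_hasDerivAt_right (hc.intervalIntegrable (-R) x)
    (hc.stronglyMeasurableAtFilter _ _) hc.continuousAt
  have h2 := (hasDerivAt_exp_linear (-κ) x).mul h1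
  refine h2.congr_deriv ?_
  have : Complex.exp (-κ * x) * Complex.exp (κ * x) = 1 := by
    rw [← Complex.exp_add]; simp
  unfold halfG
  linear_combination a x * this

lemma hasDerivAt_halfG_neg (ha : Continuous a) (x : ℝ) :
    HasDerivAt (fun x => halfG κ R (fun ξ => a (-ξ)) (-x))
      (κ * halfG κ R (fun ξ => a (-ξ)) (-x) - a x) x := by
  have h := (hasDerivAt_halfG (κ := κ) (R := R) (a := fun ξ => a (-ξ)) (by fun_prop) (-x)).scomp x
    (hasDerivAt_neg x)
  refine h.congr_deriv ?_
  simp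
  ring

lemma hasDerivAt_greenW (hκ : κ ≠ 0) (ha : Continuous a) (x : ℝ) :
    HasDerivAt (greenW κ R a) (greenD κ R a x) x := by
  refine (((hasDerivAt_halfG ha x).add (hasDerivAt_halfG_neg ha x)).div_const (2 * κ)).congr_deriv ?_
  unfold greenD
  field_simp
  ring

lemma hasDerivAt_greenD (ha : Continuous a) (x : ℝ) :
    HasDerivAt (greenD κ R a) (κ ^ 2 * greenW κ R a x - a x) x := by
  refine (((hasDerivAt_halfG ha x).neg.add (hasDerivAt_halfG_neg ha x)).div_const 2).congr_deriv ?_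
  unfold greenW
  field_simp
  ring

lemma halfG_of_le (h0 : ∀ ξ, R ≤ |ξ| → a ξ = 0) (hx : x ≤ -R) : halfG κ R a x = 0 := by
  unfold halfG
  rw [intervalIntegral.integral_zero_ae, mul_zero]
  refine ae_of_all _ fun ξ hξ => ?_
  rw [Set.uIoc_of_ge hx] at hξ
  rw [h0 ξ (by rw [le_abs]; right; linarith [hξ.2]), mul_zero]

lemma halfG_of_ge (ha : Continuous a) (h0 : ∀ ξ, R ≤ |ξ| → a ξ = 0) (hx : R ≤ x) :
    halfG κ R a x = Complex.exp (-κ * x) * ∫ ξ in (-R)..R, Complex.exp (κ * ξ) * a ξ := by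
  have hc : Continuous fun ξ : ℝ => Complex.exp (κ * ξ) * a ξ := by fun_prop
  unfold halfG
  rw [← intervalIntegral.integral_add_adjacent_intervals (hc.intervalIntegrable (-R) R)
    (hc.intervalIntegrable R x), intervalIntegral.integral_zero_ae (a := R), add_zero]
  refine ae_of_all _ fun ξ hξ => ?_
  rw [Set.uIoc_of_le hx] at hξ
  rw [h0 ξ (by rw [le_abs]; left; linarith [hξ.1]), mul_zero]

/-- Inside `[-R, R]` the factor `e^{sR}` compensates the weight; beyond the support the decay is
exact with rate `k ≥ s`. A common rate `s` for all modes is used, while the gain `1/k` is kept. -/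
lemma norm_halfG_le {k s N : ℝ} (ha : Continuous a) (h0 : ∀ ξ, R ≤ |ξ| → a ξ = 0) (hR : 0 ≤ R)
    (hs : 0 < s) (hk : s ≤ k) (hN : ∀ ξ, ‖a ξ‖ ≤ N) (x : ℝ) :
    ‖halfG k R a x‖ ≤ N / k * Real.exp (s * R) * Real.exp (-(s * |x|)) := by
  have hN0 : 0 ≤ N := (norm_nonneg _).trans (hN 0)
  have hk0 : 0 < k := hs.trans_le hk
  rcases le_or_gt x (-R) with hx | hx
  · rw [halfG_of_le h0 hx, norm_zero]; positivity
  have hnorm : ∀ c : ℝ, ‖Complex.exp ((k : ℂ) * c)‖ = Real.exp (k * c) := fun c => by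
    rw [Complex.norm_exp, ← Complex.ofReal_mul, Complex.ofReal_re]
  have hint : ∀ y, -R ≤ y → ‖∫ ξ in (-R)..y, Complex.exp (k * ξ) * a ξ‖ ≤ N / k * Real.exp (k * y) := by
    intro y hy
    have h1 : ‖∫ ξ in (-R)..y, Complex.exp (k * ξ) * a ξ‖ ≤ ∫ ξ in (-R)..y, N * Real.exp (k * ξ) := by
      refine intervalIntegral.norm_integral_le_of_norm_le hy (ae_of_all _ fun ξ _ => ?_)
        (Continuous.intervalIntegrable (by fun_prop) _ _)
      rw [norm_mul, hnorm, mul_comm]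
      gcongr
      exact hN ξ
    refine h1.trans ?_
    have h2 : ∫ ξ in (-R)..y, N * Real.exp (k * ξ) = N / k * Real.exp (k * y) - N / k * Real.exp (k * (-R)) := by
      refine intervalIntegral.integral_eq_sub_of_hasDerivAt (f := fun ξ => N / k * Real.exp (k * ξ))
        (fun ξ _ => ?_) (Continuous.intervalIntegrable (by fun_prop) _ _)
      have := (((hasDerivAt_id ξ).const_mul k).exp).const_mul (N / k)
      refine this.congr_deriv ?_
      simp only [id, mul_one]
      field_simp
    rw [h2]
    have : 0 ≤ N / k * Real.exp (k * (-R)) := by positivity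
    linarith
  have hmain : ∀ y, -R ≤ y → halfG k R a x = Complex.exp (-k * x) * (∫ ξ in (-R)..y, Complex.exp (k * ξ) * a ξ) →
      ‖halfG k R a x‖ ≤ N / k * Real.exp (-(k * (x - y))) := by
    intro y hy h
    rw [h, norm_mul, show -(k : ℂ) * x = (k : ℂ) * ((-x : ℝ) : ℂ) by push_cast; ring, hnorm]
    calc _ ≤ Real.exp (k * -x) * (N / k * Real.exp (k * y)) := by gcongr; exact hint y hy
      _ = N / k * (Real.exp (k * -x) * Real.exp (k * y)) := by ring
      _ = _ := by rw [← Real.exp_add]; congr 2; ring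
  rw [mul_assoc, ← Real.exp_add]
  rcases le_or_gt x R with hxR | hxR
  · refine (hmain x hx.le rfl).trans ?_
    gcongr
    have : |x| ≤ R := abs_le.2 ⟨hx.le, hxR⟩
    have : s * |x| ≤ s * R := by gcongr
    simp only [sub_self, mul_zero, neg_zero]
    linarith
  · refine (hmain R (by linarith) (halfG_of_ge ha h0 hxR.le)).trans ?_
    gcongr
    rw [abs_of_nonneg (by linarith)]
    have : s * (x - R) ≤ k * (x - R) := mul_le_mul_of_nonneg_right hk (by linarith)
    linarith

lemma norm_greenW_le {k s N : ℝ} (ha : Continuous a) (h0 : ∀ ξ, R ≤ |ξ| → a ξ = 0) (hR : 0 ≤ R)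
    (hs : 0 < s) (hk : s ≤ k) (hN : ∀ ξ, ‖a ξ‖ ≤ N) (x : ℝ) :
    ‖greenW k R a x‖ ≤ N / k ^ 2 * Real.exp (s * R) * Real.exp (-(s * |x|)) ∧
    ‖greenD k R a x‖ ≤ N / k * Real.exp (s * R) * Real.exp (-(s * |x|)) := by
  have hk0 : 0 < k := hs.trans_le hk
  have h1 := norm_halfG_le ha h0 hR hs hk hN x
  have h2 := norm_halfG_le (a := fun ξ => a (-ξ)) (by fun_prop) (fun ξ h => h0 _ (by rwa [abs_neg])) hR hs
    hk (fun ξ => hN _) (-x)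
  rw [abs_neg] at h2
  constructor
  · unfold greenW
    rw [norm_div, norm_mul, Complex.norm_real, Real.norm_of_nonneg hk0.le, Complex.norm_ofNat,
      div_le_iff₀ (by positivity)]
    refine (norm_add_le _ _).trans ((add_le_add h1 h2).trans (le_of_eq ?_))
    field_simp
    ring
  · unfold greenD
    rw [norm_div, Complex.norm_ofNat, div_le_iff₀ (by positivity)]
    refine (norm_add_le _ _).trans ?_
    rw [norm_neg]
    refine (add_le_add h1 h2).trans (le_of_eq ?_)
    ring

/-- Extension by zero from `[-R, R]`. -/
def extC (A : CIcc R) (x : ℝ) : ℂ := if h : x ∈ Set.Icc (-R) R then A ⟨x, h⟩ else 0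

lemma extC_apply (A : CIcc R) (x : Set.Icc (-R) R) : extC A x = A x := dif_pos x.2

lemma norm_extC_le (A : CIcc R) (x : ℝ) : ‖extC A x‖ ≤ ‖A‖ := by
  unfold extC
  split_ifs with h
  · exact A.norm_coe_le_norm _
  · rw [norm_zero]; exact norm_nonneg _

lemma extC_eq_zero {A : CIcc R} (hA : ∀ x : Set.Icc (-R) R, R ≤ |(x : ℝ)| → A x = 0) (hx : R ≤ |x|) :
    extC A x = 0 := by
  unfold extC
  split_ifs with h
  · exact hA _ hx
  · rfl

lemma continuous_extC (hR : 0 ≤ R) {A : CIcc R} (hA : ∀ x : Set.Icc (-R) R, R ≤ |(x : ℝ)| → A x = 0) :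
    Continuous (extC A) := by
  have hRR : -R ≤ R := by linarith
  have e : extC A = Set.IccExtend hRR A := by
    ext x
    rcases le_or_gt R |x| with h | h
    · rw [extC_eq_zero hA h]
      rcases le_abs.1 h with h' | h'
      · rw [Set.IccExtend_of_right_le _ _ h']
        exact (hA _ (le_abs_self R)).symm
      · rw [Set.IccExtend_of_le_left _ _ (by linarith)]
        exact (hA _ (by simpa using le_abs_self R)).symm
    · have hx : x ∈ Set.Icc (-R) R := ⟨(abs_lt.1 h).1.le, (abs_lt.1 h).2.le⟩
      rw [Set.IccExtend_of_mem _ _ hx]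
      exact dif_pos hx
  rw [e]
  exact A.continuous.Icc_extend'

/-- Split the integral at `ξ = x` and reflect the right part. The exponent is any complex number: `κ
= -ik_0` gives the outgoing kernel, because `1/(2κ) = i/(2k_0)`. -/
lemma integral_conv_eq_greenW {A : CIcc R} (ha : Continuous (extC A)) (x : Set.Icc (-R) R) :
    ∫ ξ : Set.Icc (-R) R, 1 / (2 * κ) * Complex.exp (-(κ * (|(x : ℝ) - ξ| : ℝ))) * A ξ ∂(lebIcc R) =
      greenW κ R (extC A) x := by
  have hxR := x.2
  have hR : -R ≤ R := hxR.1.trans hxR.2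
  have e0 : ∀ ξ : Set.Icc (-R) R, 1 / (2 * κ) * Complex.exp (-(κ * (|(x : ℝ) - ξ| : ℝ))) * A ξ =
      (fun ξ : ℝ => 1 / (2 * κ) * Complex.exp (-(κ * (|(x : ℝ) - ξ| : ℝ))) * extC A ξ) ξ := fun ξ => by
    beta_reduce; rw [extC_apply]
  rw [integral_congr_ae (ae_of_all _ e0), integral_lebIcc R
    (fun ξ : ℝ => 1 / (2 * κ) * Complex.exp (-(κ * (|(x : ℝ) - ξ| : ℝ))) * extC A ξ),
    integral_Icc_eq_integral_Ioc, ← intervalIntegral.integral_of_le hR]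
  have hc : Continuous fun ξ : ℝ =>
      1 / (2 * κ) * Complex.exp (-(κ * (|(x : ℝ) - ξ| : ℝ))) * extC A ξ := by fun_prop
  rw [← intervalIntegral.integral_add_adjacent_intervals (hc.intervalIntegrable (-R) x)
    (hc.intervalIntegrable x R)]
  have e1 : ∫ ξ in (-R)..(x : ℝ), 1 / (2 * κ) * Complex.exp (-(κ * (|(x : ℝ) - ξ| : ℝ))) * extC A ξ =
      halfG κ R (extC A) x / (2 * κ) := by
    unfold halfG
    rw [mul_div_right_comm, ← intervalIntegral.integral_const_mul]
    refine intervalIntegral.integral_congr fun ξ hξ => ?_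
    rw [Set.uIcc_of_le hxR.1] at hξ
    rw [abs_of_nonneg (by linarith [hξ.2]), show -(κ * (((x : ℝ) - ξ : ℝ) : ℂ)) =
      -κ * (x : ℝ) + κ * ξ by push_cast; ring, Complex.exp_add]
    ring
  have e2 : ∫ ξ in (x : ℝ)..R, 1 / (2 * κ) * Complex.exp (-(κ * (|(x : ℝ) - ξ| : ℝ))) * extC A ξ =
      halfG κ R (fun ξ => extC A (-ξ)) (-(x : ℝ)) / (2 * κ) := by
    unfold halfG
    rw [mul_div_right_comm, ← intervalIntegral.integral_const_mul]
    have := intervalIntegral.integral_comp_neg (a := -R) (b := -(x : ℝ)) (fun ξ : ℝ =>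
      1 / (2 * κ) * Complex.exp (-(κ * (|(x : ℝ) - ξ| : ℝ))) * extC A ξ)
    rw [neg_neg, neg_neg] at this
    rw [← this]
    refine intervalIntegral.integral_congr fun ξ hξ => ?_
    rw [Set.uIcc_of_le (by linarith [hxR.2])] at hξ
    beta_reduce
    rw [abs_of_nonpos (by linarith [hξ.2]), show -(κ * ((-((x : ℝ) - -ξ) : ℝ) : ℂ)) =
      -κ * ((-(x : ℝ) : ℝ) : ℂ) + κ * ξ by push_cast; ring, Complex.exp_add]
    ring
  rw [e1, e2]
  unfold greenW
  ring

end

/-! ### Exponentially decaying functions in `H_1^β` -/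

lemma tendsto_exp_neg_nat {s : ℝ} (hs : 0 < s) :
    Tendsto (fun n : ℕ => Real.exp (-(s * n))) atTop (𝓝 0) :=
  Real.tendsto_exp_neg_atTop_nhds_zero.comp (tendsto_natCast_atTop_atTop.const_mul_atTop hs)

/-- A decaying `C¹` function is approximated, together with its derivative, by smooth functions of
compact support in a weighted uniform norm. -/
lemma exists_smooth_approx {w w' : ℝ → ℂ} {s B η : ℝ} (hs : 0 < s) (hB : 0 ≤ B) (hη : 0 < η)
    (hd : ∀ x, HasDerivAt w (w' x) x) (hc : Continuous w')
    (h0 : ∀ x, ‖w x‖ ≤ B * Real.exp (-(s * |x|))) (h1 : ∀ x, ‖w' x‖ ≤ B * Real.exp (-(s * |x|))) :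
    ∃ g : ℝ → ℂ, ContDiff ℝ ∞ g ∧ (∃ M, ∀ x, M < |x| → g x = 0) ∧
      (∀ x, ‖g x - w x‖ ≤ η * Real.exp (-(s / 2 * |x|))) ∧
      ∀ x, ‖deriv g x - w' x‖ ≤ η * Real.exp (-(s / 2 * |x|)) := by
  obtain ⟨D, hD, hDb⟩ := exists_deriv_cutS_bound
  -- A continuous function with limit zero at infinity is uniformly continuous, which makes uniform
  -- smoothing available.
  have huc : UniformContinuous w' := by
    refine hc.uniformContinuous_of_tendsto_cocompact (x := 0) ?_
    refine squeeze_zero_norm h1 ?_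
    have : Tendsto (fun x : ℝ => |x|) (cocompact ℝ) atTop := tendsto_norm_cocompact_atTop
    simpa using ((Real.tendsto_exp_neg_atTop_nhds_zero.comp (this.const_mul_atTop hs)).const_mul B)
  -- Cut off at `n`: beyond it half of the decay rate makes the discarded tails small, and the other
  -- half remains as the weight.
  obtain ⟨n, hn1, hn⟩ : ∃ n : ℕ, 1 ≤ n ∧ (2 * B + D * B) * Real.exp (-(s / 2 * n)) ≤ η / 2 := by
    have := (tendsto_exp_neg_nat (half_pos hs)).const_mul (2 * B + D * B)
    rw [mul_zero] at this
    exact ((eventually_ge_atTop 1).and (this.eventually_le_const (by positivity))).exists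
  have hn1' : (1 : ℝ) ≤ n := by exact_mod_cast hn1
  have hn0 : (0 : ℝ) < n := by linarith
  -- The smoothing error `τ` is chosen after `n`, small against the weight on the support of the
  -- cut-off and against the length `2n` over which it is integrated.
  obtain ⟨τ, hτ, hτb⟩ : ∃ τ, 0 < τ ∧ (1 + (1 + D) * (2 * n)) * τ ≤ η / 2 * Real.exp (-(s * n)) :=
    ⟨η / 2 * Real.exp (-(s * n)) / (1 + (1 + D) * (2 * n)), by positivity,
      (mul_div_cancel₀ _ (by positivity)).le⟩
  obtain ⟨g, hg, hgw⟩ := huc.exists_contDiff_dist_le hτ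
  have hgc := hg.continuous
  -- The derivative is smoothed and then integrated, so function and derivative are approximated
  -- together.
  obtain ⟨W, hW⟩ : ∃ W : ℝ → ℂ, W = fun x => w 0 + ∫ t in (0 : ℝ)..x, g t := ⟨_, rfl⟩
  have hWd : ∀ x, HasDerivAt W (g x) x := fun x => by
    rw [hW]
    exact (intervalIntegral.integral_hasDerivAt_right (hgc.intervalIntegrable 0 x)
      (hgc.stronglyMeasurableAtFilter _ _) hgc.continuousAt).const_add _
  have hWs : ContDiff ℝ ∞ W := by
    rw [contDiff_infty_iff_deriv]
    exact ⟨fun x => (hWd x).differentiableAt, by rwa [show deriv W = g from funext fun x => (hWd x).deriv]⟩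
  have hWw : ∀ x, ‖W x - w x‖ ≤ τ * |x| := by
    intro x
    have := Convex.norm_image_sub_le_of_norm_hasDerivWithin_le (f := fun x => W x - w x)
      (f' := fun x => g x - w' x) (C := τ) (s := Set.univ) (x := 0) (y := x)
      (fun t _ => ((hWd t).sub (hd t)).hasDerivWithinAt)
      (fun t _ => by rw [← dist_eq_norm]; exact (hgw t).le) convex_univ trivial trivial
    simpa [hW] using this
  have hcs := contDiff_cutS n
  have hcd : ∀ x, HasDerivAt (fun x => (cutS n x : ℂ)) ((deriv (cutS n) x : ℝ) : ℂ) x := fun x =>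
    ((hcs.differentiable (by simp) x).hasDerivAt).ofReal_comp
  have hexp : ∀ x : ℝ, |x| ≤ 2 * n → Real.exp (-(s * n)) ≤ Real.exp (-(s / 2 * |x|)) := fun x hx =>
    Real.exp_le_exp.2 (by nlinarith)
  have hexp' : ∀ x : ℝ, n ≤ |x| → Real.exp (-(s * |x|)) ≤
      Real.exp (-(s / 2 * n)) * Real.exp (-(s / 2 * |x|)) := fun x hx => by
    rw [← Real.exp_add]; exact Real.exp_le_exp.2 (by nlinarith)
  have hcn : ∀ x, ‖(cutS n x : ℂ)‖ ≤ 1 := fun x => by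
    rw [Complex.norm_real]; exact cutS_mem n x
  have hfar : ∀ (v : ℝ → ℂ), (∀ x, ‖v x‖ ≤ B * Real.exp (-(s * |x|))) → ∀ x,
      ‖((cutS n x : ℂ) - 1) * v x‖ ≤ 2 * B * Real.exp (-(s / 2 * n)) * Real.exp (-(s / 2 * |x|)) := by
    intro v hv x
    rcases le_or_gt |x| n with hx | hx
    · rw [cutS_eq_one hn0 hx]; simp; positivity
    · rw [norm_mul]
      have : ‖(cutS n x : ℂ) - 1‖ ≤ 2 := (norm_sub_le _ _).trans (by rw [norm_one]; linarith [hcn x])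
      calc _ ≤ 2 * (B * (Real.exp (-(s / 2 * n)) * Real.exp (-(s / 2 * |x|)))) := by
            gcongr
            exact (hv x).trans (by gcongr; exact hexp' x hx.le)
        _ = _ := by ring
  have hprod : ContDiff ℝ ∞ fun x => (cutS n x : ℂ) * W x :=
    (Complex.ofRealCLM.contDiff.comp hcs).mul hWs
  refine ⟨fun x => (cutS n x : ℂ) * W x, hprod, ⟨2 * n, fun x hx => by
    beta_reduce; rw [cutS_eq_zero hn0 hx.le]; simp⟩, fun x => ?_, fun x => ?_⟩
  · have e : (cutS n x : ℂ) * W x - w x = cutS n x * (W x - w x) + ((cutS n x : ℂ) - 1) * w x := by ring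
    rw [e]
    have a1 : ‖(cutS n x : ℂ) * (W x - w x)‖ ≤ η / 2 * Real.exp (-(s / 2 * |x|)) := by
      rcases le_or_gt |x| (2 * n) with hx | hx
      · rw [norm_mul]
        calc _ ≤ 1 * (τ * |x|) := by gcongr; exacts [hcn x, hWw x]
          _ ≤ (1 + (1 + D) * (2 * n)) * τ := by
            have : τ * |x| ≤ τ * (2 * n) := by gcongr
            have : 0 ≤ τ + D * (2 * n) * τ := by positivity
            linarith
          _ ≤ η / 2 * Real.exp (-(s * n)) := hτb
          _ ≤ _ := mul_le_mul_of_nonneg_left (hexp x hx) (by positivity)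
      · rw [cutS_eq_zero hn0 hx.le]; simp; positivity
    have a2 := hfar w h0 x
    have a3 : (2 * B * Real.exp (-(s / 2 * n))) * Real.exp (-(s / 2 * |x|)) ≤
        η / 2 * Real.exp (-(s / 2 * |x|)) := by
      gcongr
      have : 0 ≤ D * B * Real.exp (-(s / 2 * n)) := by positivity
      linarith
    have := norm_add_le ((cutS n x : ℂ) * (W x - w x)) (((cutS n x : ℂ) - 1) * w x)
    linarith
  · rw [show deriv (fun x => (cutS n x : ℂ) * W x) x = _ from ((hcd x).mul (hWd x)).deriv]
    have e : ((deriv (cutS n) x : ℝ) : ℂ) * W x + cutS n x * g x - w' x =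
        (((deriv (cutS n) x : ℝ) : ℂ) * (W x - w x) + cutS n x * (g x - w' x)) +
        (((deriv (cutS n) x : ℝ) : ℂ) * w x + ((cutS n x : ℂ) - 1) * w' x) := by ring
    rw [e]
    have hdn : ‖((deriv (cutS n) x : ℝ) : ℂ)‖ ≤ D := by
      rw [Complex.norm_real, Real.norm_eq_abs]
      exact (hDb n hn0 x).trans (div_le_self hD hn1')
    have a1 : ‖((deriv (cutS n) x : ℝ) : ℂ) * (W x - w x) + cutS n x * (g x - w' x)‖ ≤
        η / 2 * Real.exp (-(s / 2 * |x|)) := by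
      rcases le_or_gt |x| (2 * n) with hx | hx
      · have hgx : ‖g x - w' x‖ ≤ τ := by rw [← dist_eq_norm]; exact (hgw x).le
        calc _ ≤ D * (τ * |x|) + 1 * τ := by
              refine (norm_add_le _ _).trans ?_
              rw [norm_mul, norm_mul]
              gcongr
              exacts [hWw x, hcn x]
          _ ≤ (1 + (1 + D) * (2 * n)) * τ := by
            have : D * (τ * |x|) ≤ D * (τ * (2 * n)) := by gcongr
            have : 0 ≤ 2 * n * τ := by positivity
            linarith
          _ ≤ η / 2 * Real.exp (-(s * n)) := hτb
          _ ≤ _ := mul_le_mul_of_nonneg_left (hexp x hx) (by positivity)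
      · rw [cutS_eq_zero hn0 hx.le, deriv_cutS_eq_zero hn0 (Or.inr hx)]; simp; positivity
    have a2 : ‖((deriv (cutS n) x : ℝ) : ℂ) * w x‖ ≤
        D * B * Real.exp (-(s / 2 * n)) * Real.exp (-(s / 2 * |x|)) := by
      rcases lt_or_ge |x| n with hx | hx
      · rw [deriv_cutS_eq_zero hn0 (Or.inl hx)]; simp; positivity
      · rw [norm_mul]
        calc _ ≤ D * (B * (Real.exp (-(s / 2 * n)) * Real.exp (-(s / 2 * |x|)))) := by
              gcongr
              exact (h0 x).trans (by gcongr; exact hexp' x hx)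
          _ = _ := by ring
    have a3 := hfar w' h1 x
    have a4 : (2 * B * Real.exp (-(s / 2 * n)) + D * B * Real.exp (-(s / 2 * n))) * Real.exp (-(s / 2 * |x|)) ≤
        η / 2 * Real.exp (-(s / 2 * |x|)) := by
      gcongr
      linarith
    refine (norm_add_le _ _).trans ((add_le_add a1 (norm_add_le _ _)).trans ?_)
    linarith

section
variable {β s : ℝ}

lemma memLp_exp_neg_abs (hs : 0 < s) :
    MemLp (fun p : ℝ × ℝ => Real.exp (-(s * |p.1|))) 2 (volume.restrict strip) := by
  rw [memLp_two_iff_integrable_sq (by fun_prop), volume_strip]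
  have h := (integrable_exp_neg_abs (s := 2 * s) (by positivity)).mul_prod
    (integrable_const (μ := volume.restrict (Set.Ioo 0 (2 * Real.pi))) (1 : ℝ))
  refine h.congr (ae_of_all _ fun p => ?_)
  simp only [mul_one]
  rw [← Real.exp_nat_mul]
  congr 1
  push_cast; ring

lemma tendsto_eLpNorm_of_le {v : ℕ → ℝ × ℝ → ℂ} {η : ℕ → ℝ} (hs : 0 < s) 
    (hη : Tendsto η atTop (𝓝 0)) (h : ∀ n p, ‖v n p‖ ≤ η n * Real.exp (-(s * |p.1|))) :
    Tendsto (fun n => eLpNorm (v n) 2 (volume.restrict strip)) atTop (𝓝 0) := by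
  have hN := (memLp_exp_neg_abs hs).2.ne
  have h1 : ∀ n, eLpNorm (v n) 2 (volume.restrict strip) ≤
      ENNReal.ofReal (η n) * eLpNorm (fun p : ℝ × ℝ => Real.exp (-(s * |p.1|))) 2 (volume.restrict strip) := by
    intro n
    refine eLpNorm_le_mul_eLpNorm_of_ae_le_mul (ae_of_all _ fun p => ?_) 2
    rw [Real.norm_of_nonneg (Real.exp_nonneg _)]
    exact h n p
  refine tendsto_of_tendsto_of_tendsto_of_le_of_le tendsto_const_nhds ?_ (fun _ => zero_le) h1
  have := ENNReal.Tendsto.mul_const (ENNReal.tendsto_ofReal hη) (b := eLpNorm (fun p : ℝ × ℝ =>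
    Real.exp (-(s * |p.1|))) 2 (volume.restrict strip)) (Or.inr hN)
  simpa using this

/-- `(u, ux, uy)` is approximated by test functions and their gradients in a weighted uniform norm. -/
def ApproxBy (β s : ℝ) (u ux uy : ℝ × ℝ → ℂ) : Prop :=
  ∀ η : ℝ, 0 < η → ∃ φ, IsTest β φ ∧ ∀ p : ℝ × ℝ, ‖φ p - u p‖ ≤ η * Real.exp (-(s * |p.1|)) ∧
    ‖dX φ p - ux p‖ ≤ η * Real.exp (-(s * |p.1|)) ∧ ‖dY φ p - uy p‖ ≤ η * Real.exp (-(s * |p.1|))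

lemma ApproxBy.hasGradH {u ux uy : ℝ × ℝ → ℂ} (h : ApproxBy β s u ux uy) (hs : 0 < s)
    (hu : Continuous u) (hx : Continuous ux) (hy : Continuous uy) : HasGradH β u ux uy := by
  have mem : ∀ {v φ : ℝ × ℝ → ℂ}, Continuous v → MemLp φ 2 (volume.restrict strip) →
      (∀ p : ℝ × ℝ, ‖φ p - v p‖ ≤ 1 * Real.exp (-(s * |p.1|))) → Continuous φ →
      MemLp v 2 (volume.restrict strip) := by
    intro v φ hv hφ hb hφc
    have h1 : MemLp (fun p => φ p - v p) 2 (volume.restrict strip) :=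
      (memLp_exp_neg_abs hs).of_le (hφc.sub hv).aestronglyMeasurable (ae_of_all _ fun p => by
        rw [Real.norm_of_nonneg (Real.exp_nonneg _)]; simpa using hb p)
    have h2 := hφ.sub h1
    have : v = φ - fun p => φ p - v p := by ext p; simp
    rwa [this]
  obtain ⟨φ, hφ, hb⟩ := h 1 one_pos
  obtain ⟨M, hM⟩ := hφ.vanish
  have hcx := continuous_dX hφ.smooth
  have hcy := continuous_dY hφ.smooth
  choose! Φ hΦ hΦb using h
  have hpos : ∀ n : ℕ, (0 : ℝ) < 1 / ((n : ℝ) + 1) := fun n => by positivity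
  refine ⟨mem hu (memLp_of_vanish hφ.smooth.continuous hM 2) (fun p => (hb p).1) hφ.smooth.continuous,
    mem hx (memLp_of_vanish hcx (fun _ _ => dX_eq_zero_of_vanish hM) 2) (fun p => (hb p).2.1) hcx,
    mem hy (memLp_of_vanish hcy (fun _ _ => dY_eq_zero_of_vanish hM) 2) (fun p => (hb p).2.2) hcy,
    fun n => Φ (1 / ((n : ℝ) + 1)), fun n => hΦ _ (hpos n),
    tendsto_eLpNorm_of_le hs tendsto_one_div_add_atTop_nhds_zero_nat fun n p =>
      (hΦb _ (hpos n) p).1,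
    tendsto_eLpNorm_of_le hs tendsto_one_div_add_atTop_nhds_zero_nat fun n p =>
      (hΦb _ (hpos n) p).2.1,
    tendsto_eLpNorm_of_le hs tendsto_one_div_add_atTop_nhds_zero_nat fun n p =>
      (hΦb _ (hpos n) p).2.2⟩

lemma dX_add {Φ Φ' : ℝ × ℝ → ℂ} (h : ContDiff ℝ ∞ Φ) (h' : ContDiff ℝ ∞ Φ') (p : ℝ × ℝ) :
    dX (Φ + Φ') p = dX Φ p + dX Φ' p := by
  unfold dX
  rw [fderiv_add (h.differentiable (by simp) p) (h'.differentiable (by simp) p)]; rfl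

lemma dY_add {Φ Φ' : ℝ × ℝ → ℂ} (h : ContDiff ℝ ∞ Φ) (h' : ContDiff ℝ ∞ Φ') (p : ℝ × ℝ) :
    dY (Φ + Φ') p = dY Φ p + dY Φ' p := by
  unfold dY
  rw [fderiv_add (h.differentiable (by simp) p) (h'.differentiable (by simp) p)]; rfl

lemma IsTest.add {Φ Φ' : ℝ × ℝ → ℂ} (h : IsTest β Φ) (h' : IsTest β Φ') : IsTest β (Φ + Φ') := by
  obtain ⟨M, hM⟩ := h.vanish
  obtain ⟨M', hM'⟩ := h'.vanish
  refine (h.isQuasi.add h'.isQuasi).isTest_of_vanish ⟨max M M', fun x y hx => ?_⟩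
  rw [Pi.add_apply, hM x y ((le_max_left _ _).trans_lt hx), hM' x y ((le_max_right _ _).trans_lt hx),
    add_zero]

lemma ApproxBy.add {u ux uy v vx vy : ℝ × ℝ → ℂ} (h : ApproxBy β s u ux uy) (h' : ApproxBy β s v vx vy) :
    ApproxBy β s (u + v) (ux + vx) (uy + vy) := by
  intro η hη
  obtain ⟨φ, hφ, hb⟩ := h (η / 2) (half_pos hη)
  obtain ⟨φ', hφ', hb'⟩ := h' (η / 2) (half_pos hη)
  have key : ∀ {a b c d : ℂ} {e : ℝ}, ‖a - b‖ ≤ η / 2 * e → ‖c - d‖ ≤ η / 2 * e →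
      ‖a + c - (b + d)‖ ≤ η * e := fun {a b c d e} h1 h2 => by
    rw [add_sub_add_comm]
    exact (norm_add_le _ _).trans (by linarith)
  refine ⟨φ + φ', hφ.add hφ', fun p => ⟨key (hb p).1 (hb' p).1, ?_, ?_⟩⟩
  · rw [dX_add hφ.smooth hφ'.smooth]; exact key (hb p).2.1 (hb' p).2.1
  · rw [dY_add hφ.smooth hφ'.smooth]; exact key (hb p).2.2 (hb' p).2.2

lemma ApproxBy.zero : ApproxBy β s 0 0 0 := fun η hη =>
  ⟨0, IsQuasi.zero.isTest_of_vanish ⟨0, fun _ _ _ => rfl⟩, fun p => by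
    simp [dX, dY]; positivity⟩

lemma approxBy_modal {w w' : ℝ → ℂ} {B : ℝ} (hs : 0 < s) (m : ℤ)
    (hd : ∀ x, HasDerivAt w (w' x) x) (hc : Continuous w')
    (h0 : ∀ x, ‖w x‖ ≤ B * Real.exp (-(s * |x|))) (h1 : ∀ x, ‖w' x‖ ≤ B * Real.exp (-(s * |x|))) :
    ApproxBy β (s / 2) (modal β m w) (modal β m w') (fun p => Complex.I * (β + m) * modal β m w p) := by
  intro η hη
  have hB : 0 ≤ B := by simpa using (norm_nonneg _).trans (h0 0)
  -- The tolerance is divided by `1 + |β + m|` because differentiation in `y` multiplies the error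
  -- by `|β + m|`.
  obtain ⟨g, hg, ⟨M, hM⟩, hg0, hg1⟩ := exists_smooth_approx (η := η / (1 + ‖(β + m : ℂ)‖)) hs hB
    (by positivity) hd hc h0 h1
  have hq : η / (1 + ‖(β + m : ℂ)‖) ≤ η := div_le_self hη.le (by linarith [norm_nonneg (β + m : ℂ)])
  have hgd : ∀ x, HasDerivAt g (deriv g x) x := fun x => (hg.differentiable (by simp) x).hasDerivAt
  refine ⟨modal β m g, (isQuasi_modal hg).isTest_of_vanish ⟨M, fun x y hx => by simp [modal, hM x hx]⟩,
    fun p => ⟨?_, ?_, ?_⟩⟩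
  · have : modal β m g p - modal β m w p = modal β m (fun x => g x - w x) p := by unfold modal; ring
    rw [this, norm_modal]
    exact (hg0 p.1).trans (by gcongr)
  · rw [dX_modal (hgd p.1)]
    unfold modal
    rw [← sub_mul, norm_mul, norm_exp_modal, mul_one]
    exact (hg1 p.1).trans (by gcongr)
  · rw [dY_modal (hgd p.1)]
    have : Complex.I * (β + m) * modal β m g p - Complex.I * (β + m) * modal β m w p =
      Complex.I * (β + m) * modal β m (fun x => g x - w x) p := by unfold modal; ring
    rw [this, norm_mul, norm_modal, norm_mul, Complex.norm_I, one_mul]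
    calc _ ≤ ‖(β + m : ℂ)‖ * (η / (1 + ‖(β + m : ℂ)‖) * Real.exp (-(s / 2 * |p.1|))) := by
          gcongr; exact hg0 p.1
      _ ≤ (1 + ‖(β + m : ℂ)‖) * (η / (1 + ‖(β + m : ℂ)‖) * Real.exp (-(s / 2 * |p.1|))) := by
          gcongr; linarith
      _ = _ := by field_simp

/-- Bounds under which `∑ m, ψ_m(x) e^{i(β+m)y}` converges in `H_1^β`. -/
structure ModeBounds (β s : ℝ) (ψ ψ' : ℤ → ℝ → ℂ) (B : ℤ → ℝ) : Prop where
  pos : 0 < s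
  summable : Summable B
  hasDerivAt : ∀ m x, HasDerivAt (ψ m) (ψ' m x) x
  continuous : ∀ m, Continuous (ψ' m)
  bound : ∀ m x, ‖ψ m x‖ ≤ B m * Real.exp (-(s * |x|))
  bound_deriv : ∀ m x, ‖ψ' m x‖ ≤ B m * Real.exp (-(s * |x|))
  bound_mul : ∀ (m : ℤ) (x : ℝ), ‖(β + m : ℂ) * ψ m x‖ ≤ B m * Real.exp (-(s * |x|))

lemma continuous_modal {u : ℝ → ℂ} (hu : Continuous u) (m : ℤ) : Continuous (modal β m u) := by
  unfold modal; fun_prop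

/-- Summation of modes. -/
def modeSum (β : ℝ) (ψ : ℤ → ℝ → ℂ) (p : ℝ × ℝ) : ℂ := ∑' m, modal β m (ψ m) p

/-- Derivative in `y` of `modeSum`. -/
def modeSumY (β : ℝ) (ψ : ℤ → ℝ → ℂ) (p : ℝ × ℝ) : ℂ :=
  ∑' m : ℤ, Complex.I * (β + m) * modal β m (ψ m) p

namespace ModeBounds
variable {ψ ψ' : ℤ → ℝ → ℂ} {B : ℤ → ℝ} (H : ModeBounds β s ψ ψ' B)
include H

lemma nonneg (m : ℤ) : 0 ≤ B m := by
  simpa using (norm_nonneg _).trans (H.bound m 0)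

lemma continuous_mode (m : ℤ) : Continuous (ψ m) :=
  continuous_iff_continuousAt.2 fun x => (H.hasDerivAt m x).continuousAt

lemma norm_term (m : ℤ) (p : ℝ × ℝ) :
    ‖modal β m (ψ m) p‖ ≤ B m * Real.exp (-(s * |p.1|)) ∧
    ‖modal β m (ψ' m) p‖ ≤ B m * Real.exp (-(s * |p.1|)) ∧
    ‖Complex.I * (β + m) * modal β m (ψ m) p‖ ≤ B m * Real.exp (-(s * |p.1|)) := by
  refine ⟨by rw [norm_modal]; exact H.bound m _, by rw [norm_modal]; exact H.bound_deriv m _, ?_⟩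
  rw [norm_mul, norm_mul, Complex.norm_I, one_mul, norm_modal, ← norm_mul]
  exact H.bound_mul m _

lemma hasSum (p : ℝ × ℝ) : HasSum (fun m => modal β m (ψ m) p) (modeSum β ψ p) ∧
    HasSum (fun m => modal β m (ψ' m) p) (modeSum β ψ' p) ∧
    HasSum (fun m : ℤ => Complex.I * (β + m) * modal β m (ψ m) p) (modeSumY β ψ p) := by
  have hs := H.summable.mul_right (Real.exp (-(s * |p.1|)))
  exact ⟨(Summable.of_norm_bounded hs fun m => (H.norm_term m p).1).hasSum,
    (Summable.of_norm_bounded hs fun m => (H.norm_term m p).2.1).hasSum,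
    (Summable.of_norm_bounded hs fun m => (H.norm_term m p).2.2).hasSum⟩

lemma continuous_sum : Continuous (modeSum β ψ) ∧ Continuous (modeSum β ψ') ∧
    Continuous (modeSumY β ψ) := by
  have h1 : ∀ m (p : ℝ × ℝ), B m * Real.exp (-(s * |p.1|)) ≤ B m := fun m p =>
    mul_le_of_le_one_right (H.nonneg m) (Real.exp_le_one_iff.2 (by have := H.pos; simp; positivity))
  have hc := H.continuous_mode
  refine ⟨continuous_tsum (fun m => continuous_modal (hc m) m) H.summable fun m p =>
      (H.norm_term m p).1.trans (h1 m p),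
    continuous_tsum (fun m => continuous_modal (H.continuous m) m) H.summable fun m p =>
      (H.norm_term m p).2.1.trans (h1 m p),
    continuous_tsum (fun m => continuous_const.mul (continuous_modal (hc m) m)) H.summable fun m p =>
      (H.norm_term m p).2.2.trans (h1 m p)⟩

lemma approxBy_sum (F : Finset ℤ) : ApproxBy β (s / 2) (fun p => ∑ m ∈ F, modal β m (ψ m) p)
    (fun p => ∑ m ∈ F, modal β m (ψ' m) p)
    (fun p => ∑ m ∈ F, Complex.I * (β + m) * modal β m (ψ m) p) := by
  classical
  induction F using Finset.induction_on with
  | empty => simp only [Finset.sum_empty]; exact ApproxBy.zero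
  | insert m F hm ih =>
    have := (approxBy_modal (β := β) H.pos m (H.hasDerivAt m) (H.continuous m) (H.bound m)
      (H.bound_deriv m)).add ih
    simp only [Finset.sum_insert hm]
    exact this

lemma hasGradH : HasGradH β (modeSum β ψ) (modeSum β ψ') (modeSumY β ψ) := by
  obtain ⟨c1, c2, c3⟩ := H.continuous_sum
  refine ApproxBy.hasGradH (s := s / 2) (fun η hη => ?_) (half_pos H.pos) c1 c2 c3
  -- Half of the tolerance is for the tail of the mode sum, half for approximating the finite part
  -- by test functions.
  obtain ⟨F, hF⟩ := ((tendsto_order.1 (tendsto_tsum_compl_atTop_zero B)).2 (η / 2)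
    (half_pos hη)).exists
  obtain ⟨φ, hφ, hb⟩ := H.approxBy_sum F (η / 2) (half_pos hη)
  have key : ∀ {t : ℤ → ℂ} {v S : ℂ} {x : ℝ}, HasSum t S → (∀ m, ‖t m‖ ≤ B m * Real.exp (-(s * |x|))) →
      ‖v - ∑ m ∈ F, t m‖ ≤ η / 2 * Real.exp (-(s / 2 * |x|)) →
      ‖v - S‖ ≤ η * Real.exp (-(s / 2 * |x|)) := by
    intro t v S x ht hB hv
    have e : S - ∑ m ∈ F, t m = ∑' m : { m // m ∉ F }, t m := by
      rw [← ht.tsum_eq, ← ht.summable.sum_add_tsum_subtype_compl F]; ring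
    have hsB : Summable fun m : { m // m ∉ F } => B m * Real.exp (-(s * |x|)) :=
      (H.summable.subtype _).mul_right _
    have h2 : ‖S - ∑ m ∈ F, t m‖ ≤ η / 2 * Real.exp (-(s / 2 * |x|)) := by
      rw [e]
      calc _ ≤ ∑' m : { m // m ∉ F }, B m * Real.exp (-(s * |x|)) :=
            tsum_of_norm_bounded hsB.hasSum fun m => hB m
        _ = (∑' m : { m // m ∉ F }, B m) * Real.exp (-(s * |x|)) := tsum_mul_right
        _ ≤ _ := by
          have := H.pos
          gcongr
          linarith
    calc ‖v - S‖ = ‖(v - ∑ m ∈ F, t m) - (S - ∑ m ∈ F, t m)‖ := by congr 1; ring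
      _ ≤ _ := (norm_sub_le _ _).trans (by linarith)
  refine ⟨φ, hφ, fun p => ?_⟩
  obtain ⟨s1, s2, s3⟩ := H.hasSum p
  exact ⟨key s1 (fun m => (H.norm_term m p).1) (hb p).1, key s2 (fun m => (H.norm_term m p).2.1) (hb p).2.1,
    key s3 (fun m => (H.norm_term m p).2.2) (hb p).2.2⟩

end ModeBounds

end

/-! ### Weak form of the equation for a sum of modes -/

lemma integral_strip_dX_eq_zero {F F' : ℝ × ℝ → ℂ} {M : ℝ} (hF : Continuous F) (hF' : Continuous F')
    (hM : ∀ x y : ℝ, M < |x| → F (x, y) = 0) (hM' : ∀ x y : ℝ, M < |x| → F' (x, y) = 0)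
    (hd : ∀ x y : ℝ, HasDerivAt (fun x => F (x, y)) (F' (x, y)) x) : ∫ p in strip, F' p = 0 := by
  have hi : Integrable F' (volume.restrict strip) := integrable_of_vanish hF' hM'
  rw [volume_strip] at hi ⊢
  rw [integral_prod_symm _ hi]
  have hcs : ∀ {u : ℝ → ℂ}, Continuous u → (∀ x, M < |x| → u x = 0) → Integrable u := fun hu hz =>
    hu.integrable_of_hasCompactSupport (HasCompactSupport.intro (isCompact_Icc (a := -M) (b := M))
      fun x hx => hz x (by by_contra hc; exact hx (abs_le.1 (not_lt.1 hc))))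
  have h0 : ∀ y, ∫ x, F' (x, y) = 0 := fun y =>
    integral_eq_zero_of_hasDerivAt_of_integrable (fun x => hd x y)
      (hcs (by fun_prop) fun x hx => hM' x y hx) (hcs (by fun_prop) fun x hx => hM x y hx)
  simp [h0]

lemma integral_strip_dY_eq_zero {F F' : ℝ × ℝ → ℂ} {M : ℝ} (hF' : Continuous F')
    (hM' : ∀ x y : ℝ, M < |x| → F' (x, y) = 0) (hper : ∀ x, F (x, 2 * Real.pi) = F (x, 0))
    (hd : ∀ x y : ℝ, HasDerivAt (fun y => F (x, y)) (F' (x, y)) y) : ∫ p in strip, F' p = 0 := by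
  have hi : Integrable F' (volume.restrict strip) := integrable_of_vanish hF' hM'
  rw [volume_strip] at hi ⊢
  rw [integral_prod _ hi]
  have h0 : ∀ x, ∫ y in Set.Ioo 0 (2 * Real.pi), F' (x, y) = 0 := fun x => by
    rw [← integral_Ioc_eq_integral_Ioo, ← intervalIntegral.integral_of_le (by positivity),
      intervalIntegral.integral_eq_sub_of_hasDerivAt (fun y _ => hd x y)
        (Continuous.intervalIntegrable (by fun_prop) _ _), hper, sub_self]
  simp [h0]

lemma hasDerivAt_dX {Φ : ℝ × ℝ → ℂ} (h : ContDiff ℝ ∞ Φ) (x y : ℝ) :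
    HasDerivAt (fun x => Φ (x, y)) (dX Φ (x, y)) x := by
  have h1 := (h.differentiable (by simp) (x, y)).hasFDerivAt
  have h2 : HasDerivAt (fun x : ℝ => (x, y)) ((1 : ℝ), (0 : ℝ)) x :=
    (hasDerivAt_id x).prodMk (hasDerivAt_const x y)
  exact h1.comp_hasDerivAt x h2

lemma hasDerivAt_dY {Φ : ℝ × ℝ → ℂ} (h : ContDiff ℝ ∞ Φ) (x y : ℝ) :
    HasDerivAt (fun y => Φ (x, y)) (dY Φ (x, y)) y := by
  have h1 := (h.differentiable (by simp) (x, y)).hasFDerivAt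
  have h2 : HasDerivAt (fun y : ℝ => (x, y)) ((0 : ℝ), (1 : ℝ)) y :=
    (hasDerivAt_const y x).prodMk (hasDerivAt_id y)
  exact h1.comp_hasDerivAt y h2

lemma hasDerivAt_conj_comp {u : ℝ → ℂ} {u' : ℂ} {x : ℝ} (h : HasDerivAt u u' x) :
    HasDerivAt (fun x => conj (u x)) (conj u') x := h.star

section
variable {β : ℝ} {Φ : ℝ × ℝ → ℂ}

/-- Weak form of the equation for a single mode. -/
lemma integral_modal_weak {ψ ψ' ψ'' : ℝ → ℂ} (hΦ : IsTest β Φ) (m : ℤ)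
    (h1 : ∀ x, HasDerivAt ψ (ψ' x) x) (h2 : ∀ x, HasDerivAt ψ' (ψ'' x) x) (hc : Continuous ψ'') :
    ∫ p in strip, (modal β m ψ' p * conj (dX Φ p) +
        Complex.I * (β + m) * modal β m ψ p * conj (dY Φ p)) =
      ∫ p in strip, modal β m (fun x => (β + m) ^ 2 * ψ x - ψ'' x) p * conj (Φ p) := by
  obtain ⟨M, hM⟩ := hΦ.vanish
  have hψ : Continuous ψ := continuous_iff_continuousAt.2 fun x => (h1 x).continuousAt
  have hψ' : Continuous ψ' := continuous_iff_continuousAt.2 fun x => (h2 x).continuousAt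
  have c0 := hΦ.smooth.continuous
  have cx := continuous_dX hΦ.smooth
  have cy := continuous_dY hΦ.smooth
  have cm : ∀ {u : ℝ → ℂ}, Continuous u → Continuous (modal β m u) := fun hu => continuous_modal hu m
  have m0 := cm hψ
  have m1 := cm hψ'
  have m2 := cm hc
  have zx : ∀ x y : ℝ, M < |x| → dX Φ (x, y) = 0 := fun _ _ => dX_eq_zero_of_vanish hM
  have zy : ∀ x y : ℝ, M < |x| → dY Φ (x, y) = 0 := fun _ _ => dY_eq_zero_of_vanish hM
  have hEx : ∀ x y : ℝ, HasDerivAt (fun x => modal β m ψ' (x, y)) (modal β m ψ'' (x, y)) x := fun x y =>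
    by exact (h2 x).mul_const (Complex.exp (Complex.I * (β + m) * y))
  have hX := integral_strip_dX_eq_zero (M := M) (F := fun p => modal β m ψ' p * conj (Φ p))
    (F' := fun p => modal β m ψ'' p * conj (Φ p) + modal β m ψ' p * conj (dX Φ p)) (by fun_prop)
    (by fun_prop) (fun x y hx => by simp [hM x y hx]) (fun x y hx => by simp [hM x y hx, zx x y hx])
    fun x y => (hEx x y).mul (hasDerivAt_conj_comp (hasDerivAt_dX hΦ.smooth x y))
  have hE : ∀ x y : ℝ, HasDerivAt (fun y => modal β m ψ (x, y))
      (Complex.I * (β + m) * modal β m ψ (x, y)) y := fun x y => by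
    have := (hasDerivAt_exp_linear (Complex.I * (β + m)) y).const_mul (ψ x)
    refine this.congr_deriv ?_
    unfold modal; ring
  have hY := integral_strip_dY_eq_zero (M := M)
    (F := fun p => Complex.I * (β + m) * (modal β m ψ p * conj (Φ p)))
    (F' := fun p => Complex.I * (β + m) * (Complex.I * (β + m) * modal β m ψ p * conj (Φ p) +
      modal β m ψ p * conj (dY Φ p))) (by fun_prop)
    (fun x y hx => by simp [hM x y hx, zy x y hx])
    (fun x => by
      -- The quasiperiodic phase of the mode is cancelled by that of the conjugated test function,
      -- so no boundary terms arise in `y`.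
      have e1 : Complex.exp (Complex.I * (β + m) * ((2 * Real.pi : ℝ) : ℂ)) *
          conj (Complex.exp (2 * Real.pi * Complex.I * β)) = 1 := by
        rw [← Complex.exp_conj, ← Complex.exp_add, Complex.exp_eq_one_iff]
        refine ⟨m, ?_⟩
        simp [Complex.conj_ofNat]
        ring
      simp only [modal]
      rw [hΦ.quasi, map_mul]
      simp only [Complex.ofReal_zero, mul_zero, Complex.exp_zero]
      linear_combination Complex.I * (β + m) * ψ x * conj (Φ (x, 0)) * e1)
    fun x y => ((hE x y).mul (hasDerivAt_conj_comp (hasDerivAt_dY hΦ.smooth x y))).const_mul _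
  have hi1 : Integrable (fun p => modal β m ψ'' p * conj (Φ p) + modal β m ψ' p * conj (dX Φ p))
      (volume.restrict strip) :=
    integrable_of_vanish (M := M) (by fun_prop) fun x y hx => by simp [hM x y hx, zx x y hx]
  have hi2 : Integrable (fun p => Complex.I * (β + m) * (Complex.I * (β + m) * modal β m ψ p * conj (Φ p) +
      modal β m ψ p * conj (dY Φ p))) (volume.restrict strip) :=
    integrable_of_vanish (M := M) (by fun_prop) fun x y hx => by simp [hM x y hx, zy x y hx]
  have hi3 : Integrable (fun p => modal β m (fun x => (β + m) ^ 2 * ψ x - ψ'' x) p * conj (Φ p))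
      (volume.restrict strip) :=
    integrable_of_vanish (M := M) (by have := cm (u := fun x => (β + m) ^ 2 * ψ x - ψ'' x) (by fun_prop)
                                      fun_prop) fun x y hx => by simp [hM x y hx]
  have s1 := integral_add hi1 hi2
  have s2 := integral_add (hi1.add hi2) hi3
  rw [hX, hY, add_zero] at s1
  simp only [Pi.add_apply] at s1 s2
  rw [s1, zero_add] at s2
  rw [← s2]
  refine integral_congr_ae (ae_of_all _ fun p => ?_)
  simp only [modal]
  linear_combination -((β + m : ℂ) ^ 2 * ψ p.1 * Complex.exp (Complex.I * (β + m) * p.2) * conj (Φ p)) *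
    Complex.I_sq

lemma hasSum_integral_strip {G : ℤ → ℝ × ℝ → ℂ} {S : ℝ × ℝ → ℂ} {b : ℤ → ℝ} {g : ℝ × ℝ → ℝ}
    (hG : ∀ m, Continuous (G m)) (hb : Summable b) (hg : IntegrableOn g strip)
    (hbd : ∀ m p, ‖G m p‖ ≤ b m * g p) (hS : ∀ p, HasSum (fun m => G m p) (S p)) :
    HasSum (fun m => ∫ p in strip, G m p) (∫ p in strip, S p) :=
  hasSum_integral_of_dominated_convergence (fun m p => b m * g p)
    (fun m => (hG m).aestronglyMeasurable) (fun m => ae_of_all _ (hbd m))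
    (ae_of_all _ fun p => hb.mul_right _)
    (by simp only [tsum_mul_right]; exact hg.const_mul _) (ae_of_all _ hS)

/-- Multiplication of `∑ ψ_n e^{i(β+n)y}` by `f`. -/
lemma IsPert.hasSum_mul_modes {f : ℝ × ℝ → ℝ} {R : ℝ} (hf : IsPert f R) {ψ a : ℤ → ℝ → ℂ} {P : ℤ → ℝ}
    (hP : Summable P) (hb : ∀ n x, ‖ψ n x‖ ≤ P n)
    (ha : ∀ m x, HasSum (fun n => fourierY f (m - n) x * ψ n x) (a m x)) :
    (∃ c : ℤ → ℝ, Summable c ∧ ∀ m x, ‖a m x‖ ≤ c m) ∧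
    ∀ p, HasSum (fun m => modal β m (a m) p) (2 * Real.pi * f p * modeSum β ψ p) := by
  have hF := hf.summable_coefC
  have hP0 : ∀ n, 0 ≤ P n := fun n => (norm_nonneg _).trans (hb n 0)
  have hFb : ∀ j x, ‖fourierY f j x‖ ≤ ‖coefC f R j‖ := fun j x => by
    rcases le_or_gt R |x| with hx | hx
    · rw [hf.fourierY_zero j hx, norm_zero]; exact norm_nonneg _
    · have := (coefC f R j).norm_coe_le_norm ⟨x, (abs_lt.1 hx).1.le, (abs_lt.1 hx).2.le⟩
      rwa [hf.coefC_apply] at this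
  obtain ⟨e, he⟩ : ∃ e : ℤ × ℤ ≃ ℤ × ℤ, ∀ p, e p = (p.1 - p.2, p.2) :=
    ⟨⟨fun p => (p.1 - p.2, p.2), fun p => (p.1 + p.2, p.2), fun p => by simp, fun p => by simp⟩,
      fun _ => rfl⟩
  have hprod : Summable fun p : ℤ × ℤ => ‖coefC f R (p.1 - p.2)‖ * P p.2 := by
    have := (e.summable_iff).2 (hF.mul_of_nonneg hP (fun _ => norm_nonneg _) hP0)
    refine this.congr fun p => ?_
    simp [he]
  refine ⟨⟨fun m => ∑' n, ‖coefC f R (m - n)‖ * P n, hprod.prod, fun m x => ?_⟩, fun p => ?_⟩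
  · rw [← (ha m x).tsum_eq]
    refine tsum_of_norm_bounded (hprod.prod_factor m).hasSum fun n => ?_
    rw [norm_mul]
    exact mul_le_mul (hFb _ _) (hb _ _) (norm_nonneg _) (norm_nonneg _)
  · have h1 := hf.hasSum_fourierY p.1 p.2
    have hn1 : Summable fun j : ℤ => ‖fourierY f j p.1 * Complex.exp (Complex.I * j * p.2)‖ := by
      refine hF.of_nonneg_of_le (fun _ => norm_nonneg _) fun j => ?_
      have := norm_exp_modal 0 j p.2
      rw [Complex.ofReal_zero, zero_add] at this
      rw [norm_mul, this, mul_one]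
      exact hFb j _
    have hn2 : Summable fun n => ‖modal β n (ψ n) p‖ := by
      refine hP.of_nonneg_of_le (fun _ => norm_nonneg _) fun n => ?_
      rw [norm_modal]; exact hb n _
    have h2 : HasSum (fun n => modal β n (ψ n) p) (modeSum β ψ p) := hn2.of_norm.hasSum
    have h12 := summable_mul_of_summable_norm hn1 hn2
    have h3 := h1.mul h2 h12
    -- The product of the two absolutely convergent series is regrouped by the shear, and each
    -- output mode collects a convolution.
    have h4 : HasSum (fun q : ℤ × ℤ => fourierY f (q.1 - q.2) p.1 * ψ q.2 p.1 *
        Complex.exp (Complex.I * (β + q.1) * p.2)) (2 * Real.pi * f p * modeSum β ψ p) := by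
      refine ((e.hasSum_iff).2 h3).congr_fun fun q => ?_
      simp only [Function.comp, he, modal]
      rw [show Complex.I * (β + q.1) * p.2 = Complex.I * ((q.1 - q.2 : ℤ) : ℂ) * p.2 +
        Complex.I * (β + q.2) * p.2 by push_cast; ring, Complex.exp_add]
      ring
    exact h4.prod_fiberwise fun m => (ha m p.1).mul_right (Complex.exp (Complex.I * (β + m) * p.2))

lemma norm_farU_le (k : ℝ) (ρ t : ℂ) (x : ℝ) : ‖farU k ρ t x‖ ≤ ‖t‖ + ‖ρ‖ + 1 := by
  have hs : ∀ y, ‖(Real.smoothTransition y : ℂ)‖ ≤ 1 := fun y => by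
    rw [Complex.norm_real, Real.norm_of_nonneg (Real.smoothTransition.nonneg y)]
    exact Real.smoothTransition.le_one y
  unfold farU outU
  refine (norm_add_le _ _).trans (add_le_add ((norm_add_le _ _).trans (add_le_add ?_ ?_)) ?_)
  · rw [norm_mul, norm_mul, norm_exp_I_mul, mul_one]
    exact mul_le_of_le_one_left (norm_nonneg _) (hs x)
  · rw [norm_mul, norm_mul, norm_exp_neg_I_mul, mul_one]
    exact mul_le_of_le_one_left (norm_nonneg _) (hs _)
  · rw [norm_mul, norm_exp_I_mul, mul_one]
    exact hs _

/-- A family of modes solving the coupled equations yields a solution of the scattering problem. -/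
theorem solvesScattering_of_modes {f : ℝ × ℝ → ℝ} {R ε μ s : ℝ} (hf : IsPert f R) {ρ t : ℂ}
    {ψ ψ' v v' a : ℤ → ℝ → ℂ} {B : ℤ → ℝ}
    (hψ : ∀ m x, HasDerivAt (ψ m) (ψ' m x) x) (hac : ∀ m, Continuous (a m))
    (hψ' : ∀ (m : ℤ) x, HasDerivAt (ψ' m)
      (((β + m : ℂ) ^ 2 - omegaSq μ β) * ψ m x - ε * omegaSq μ β / (2 * Real.pi) * a m x) x)
    (ha : ∀ m x, HasSum (fun n => fourierY f (m - n) x * ψ n x) (a m x))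
    (hv0 : ∀ x, v 0 x = ψ 0 x - farU (waveNumber μ β) ρ t x)
    (hv0' : ∀ x, v' 0 x = ψ' 0 x - deriv (farU (waveNumber μ β) ρ t) x)
    (hv : ∀ m ≠ 0, v m = ψ m ∧ v' m = ψ' m) (H : ModeBounds β s v v' B) :
    SolvesScattering f ε μ β (modeSum β ψ) ρ t := by
  obtain ⟨U, hU⟩ : ∃ U, U = farU (waveNumber μ β) ρ t := ⟨_, rfl⟩
  have hUs : ContDiff ℝ ∞ U := hU ▸ contDiff_farU _ _ _
  have hUd : ∀ x, HasDerivAt U (deriv U x) x := fun x => (hUs.differentiable (by simp) x).hasDerivAt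
  have hUc := hUs.continuous
  have hUc' := hUs.continuous_deriv (by simp)
  have hUb : ∀ x, ‖U x‖ ≤ ‖t‖ + ‖ρ‖ + 1 := fun x => by rw [hU]; exact norm_farU_le _ _ _ _
  rw [← hU] at hv0 hv0'
  -- The propagating mode is bounded but does not decay, so it needs an additional constant.
  have hP : Summable fun m : ℤ => B m + if m = 0 then ‖t‖ + ‖ρ‖ + 1 else 0 :=
    H.summable.add (hasSum_ite_eq 0 _).summable
  have hψb : ∀ m x, ‖ψ m x‖ ≤ B m + if m = 0 then ‖t‖ + ‖ρ‖ + 1 else 0 := by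
    intro m x
    have hvb : ‖v m x‖ ≤ B m := (H.bound m x).trans (mul_le_of_le_one_right (H.nonneg m)
      (Real.exp_le_one_iff.2 (by have := H.pos; simp; positivity)))
    by_cases hm : m = 0
    · subst hm
      rw [if_pos rfl, show ψ 0 x = v 0 x + U x by rw [hv0]; ring]
      exact (norm_add_le _ _).trans (add_le_add hvb (hUb x))
    · rw [if_neg hm, add_zero, ← (hv m hm).1]; exact hvb
  obtain ⟨⟨c, hc, hca⟩, haS⟩ := hf.hasSum_mul_modes (β := β) hP hψb ha
  have hΨ : ∀ p, HasSum (fun m => modal β m (ψ m) p) (modeSum β ψ p) := fun p =>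
    (Summable.of_norm_bounded hP fun m => by rw [norm_modal]; exact hψb m _).hasSum
  -- The families `v` and `ψ` differ in the mode `0` only; this transfers sums from one to the
  -- other.
  have hfar : ∀ (g g' : ℤ → ℂ) (z : ℂ), g 0 = g' 0 - z → (∀ m ≠ 0, g m = g' m) → ∀ S, HasSum g S →
      HasSum g' (S + z) := by
    intro g g' z h0 hne S hS
    refine (hS.add (hasSum_ite_eq 0 z)).congr_fun fun m => ?_
    by_cases hm : m = 0
    · subst hm; simp [h0]
    · simp [hm, hne m hm]
  have hdiff : modeSum β ψ - farField β (waveNumber μ β) ρ t = modeSum β v := by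
    ext p
    rw [Pi.sub_apply, farField_eq, ← hU]
    have := hfar (fun m => modal β m (v m) p) (fun m => modal β m (ψ m) p) (modal β 0 U p)
      (by simp only [modal, hv0]; ring) (fun m hm => by rw [(hv m hm).1]) _ (H.hasSum p).1
    rw [(hΨ p).unique this]; ring
  refine ⟨modeSum β v', modeSumY β v, hdiff ▸ H.hasGradH, fun Φ hΦ => ?_⟩
  obtain ⟨M, hM⟩ := hΦ.vanish
  have c0 := hΦ.smooth.continuous
  have cx := continuous_dX hΦ.smooth
  have cy := continuous_dY hΦ.smooth
  have zx : ∀ x y : ℝ, M < |x| → dX Φ (x, y) = 0 := fun _ _ => dX_eq_zero_of_vanish hM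
  have zy : ∀ x y : ℝ, M < |x| → dY Φ (x, y) = 0 := fun _ _ => dY_eq_zero_of_vanish hM
  have hcv := H.continuous_mode
  have hcv' := H.continuous
  have hcψ : ∀ m, Continuous (ψ m) := fun m => continuous_iff_continuousAt.2 fun x => (hψ m x).continuousAt
  rw [farField_eq, ← hU]
  simp only [fun p : ℝ × ℝ => dX_modal (β := β) (m := 0) (hUd p.1),
    fun p : ℝ × ℝ => dY_modal (β := β) (m := 0) (hUd p.1)]
  -- the left-hand side as a sum over modes
  have hL1 : HasSum (fun m : ℤ => ∫ p in strip, (modal β m (v' m) p * conj (dX Φ p) +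
      Complex.I * (β + m) * modal β m (v m) p * conj (dY Φ p)))
      (∫ p in strip, (modeSum β v' p * conj (dX Φ p) + modeSumY β v p * conj (dY Φ p))) := by
    refine hasSum_integral_strip (b := B) (g := fun p => ‖dX Φ p‖ + ‖dY Φ p‖) (fun m => ?_) H.summable
      ((integrable_of_vanish cx zx).norm.add (integrable_of_vanish cy zy).norm) (fun m p => ?_) fun p => ?_
    · have := continuous_modal (β := β) (hcv m) m
      have := continuous_modal (β := β) (hcv' m) m
      fun_prop
    · have hle : B m * Real.exp (-(s * |p.1|)) ≤ B m := mul_le_of_le_one_right (H.nonneg m)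
        (Real.exp_le_one_iff.2 (by have := H.pos; simp; positivity))
      obtain ⟨_, b1, b2⟩ := H.norm_term m p
      refine (norm_add_le _ _).trans ?_
      rw [norm_mul, norm_mul _ (conj (dY Φ p)), RCLike.norm_conj, RCLike.norm_conj]
      exact (add_le_add (mul_le_mul_of_nonneg_right (b1.trans hle) (norm_nonneg (dX Φ p)))
        (mul_le_mul_of_nonneg_right (b2.trans hle) (norm_nonneg (dY Φ p)))).trans_eq (mul_add _ _ _).symm
    · exact ((H.hasSum p).2.1.mul_right _).add ((H.hasSum p).2.2.mul_right _)
  have hL2 := hfar _ (fun m : ℤ => ∫ p in strip, (modal β m (ψ' m) p * conj (dX Φ p) +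
      Complex.I * (β + m) * modal β m (ψ m) p * conj (dY Φ p)))
      (∫ p in strip, (modal β 0 (deriv U) p * conj (dX Φ p) +
        Complex.I * (β + (0 : ℤ)) * modal β 0 U p * conj (dY Φ p))) (by
    rw [← integral_sub]
    · refine integral_congr_ae (ae_of_all _ fun p => ?_)
      simp only [modal, hv0, hv0']
      ring
    · have := continuous_modal (β := β) (hcψ 0) 0
      have hc1 : Continuous (ψ' 0) := continuous_iff_continuousAt.2 fun x => (hψ' 0 x).continuousAt
      have := continuous_modal (β := β) hc1 0
      exact integrable_of_vanish (M := M) (by fun_prop) fun x y hx => by simp [zx x y hx, zy x y hx]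
    · have := continuous_modal (β := β) hUc 0
      have := continuous_modal (β := β) hUc' 0
      exact integrable_of_vanish (M := M) (by fun_prop) fun x y hx => by simp [zx x y hx, zy x y hx])
    (fun m hm => by rw [(hv m hm).1, (hv m hm).2]) _ hL1
  have hR : HasSum (fun m : ℤ => ∫ p in strip, modal β m (fun x => omegaSq μ β * ψ m x +
      ε * omegaSq μ β / (2 * Real.pi) * a m x) p * conj (Φ p))
      (∫ p in strip, (omegaSq μ β : ℂ) * (((1 + ε * f p : ℝ) : ℂ) * modeSum β ψ p * conj (Φ p))) := by
    refine hasSum_integral_strip (b := fun m => ‖(omegaSq μ β : ℂ)‖ * (B m + if m = 0 then ‖t‖ + ‖ρ‖ + 1 else 0)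
      + ‖(ε * omegaSq μ β / (2 * Real.pi) : ℂ)‖ * c m) (g := fun p => ‖Φ p‖) (fun m => ?_)
      ((hP.mul_left _).add (hc.mul_left _)) (integrable_of_vanish c0 hM).norm (fun m p => ?_) fun p => ?_
    · have h1 := hcψ m
      have h2 := hac m
      have := continuous_modal (β := β) (u := fun x => omegaSq μ β * ψ m x +
        ε * omegaSq μ β / (2 * Real.pi) * a m x) (by fun_prop) m
      fun_prop
    · rw [norm_mul, RCLike.norm_conj, norm_modal]
      refine mul_le_mul_of_nonneg_right ?_ (norm_nonneg _)
      refine (norm_add_le _ _).trans ?_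
      rw [norm_mul, norm_mul _ (a m p.1)]
      gcongr
      exacts [hψb _ _, hca _ _]
    · have h1 := (((hΨ p).mul_left (omegaSq μ β : ℂ)).add
        ((haS p).mul_left (ε * omegaSq μ β / (2 * Real.pi) : ℂ))).mul_right (conj (Φ p))
      have hpi : (Real.pi : ℂ) ≠ 0 := Complex.ofReal_ne_zero.2 Real.pi_ne_zero
      have e : (omegaSq μ β : ℂ) * (((1 + ε * f p : ℝ) : ℂ) * modeSum β ψ p * conj (Φ p)) =
          ((omegaSq μ β : ℂ) * modeSum β ψ p + ε * omegaSq μ β / (2 * Real.pi) *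
            (2 * Real.pi * f p * modeSum β ψ p)) * conj (Φ p) := by
        push_cast
        field_simp
      rw [e]
      refine h1.congr_fun fun m => ?_
      simp only [modal]; ring
  rw [← integral_const_mul]
  have hmode : ∀ m : ℤ, ∫ p in strip, (modal β m (ψ' m) p * conj (dX Φ p) +
      Complex.I * (β + m) * modal β m (ψ m) p * conj (dY Φ p)) =
      ∫ p in strip, modal β m (fun x => omegaSq μ β * ψ m x +
      ε * omegaSq μ β / (2 * Real.pi) * a m x) p * conj (Φ p) := by
    intro m
    have h1 := hcψ m
    have h2 := hac m
    rw [integral_modal_weak hΦ m (hψ m) (hψ' m) (by fun_prop)]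
    refine integral_congr_ae (ae_of_all _ fun p => ?_)
    simp only [modal]; ring
  simp only [hmode] at hL2
  rw [hR.unique hL2, ← integral_add]
  · refine integral_congr_ae (ae_of_all _ fun p => ?_)
    simp only [modal]; ring
  · obtain ⟨_, k2, k3⟩ := H.continuous_sum
    exact integrable_of_vanish (M := M) (by fun_prop) fun x y hx => by simp [zx x y hx, zy x y hx]
  · have := continuous_modal (β := β) hUc 0
    have := continuous_modal (β := β) hUc' 0
    exact integrable_of_vanish (M := M) (by fun_prop) fun x y hx => by simp [zx x y hx, zy x y hx]

end

/-! ### Solution of the scattering problem -/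

section
variable {f : ℝ × ℝ → ℝ} {R b K ε m β ν : ℝ}

/-- Combination of the reduced solutions that solves the system for the incident wave. -/
lemma Adm.exists_system (h : Adm f R b K ε (m : ℂ) β)
    (hD : denS ε (ν - qR f R ε m β) (sr f R ε m β).re (sz f R ε m β).re (cA₁ m β) (cA₂ m β) ≠ 0) :
    ∃ (A : SpaceA R) (c : ℂ),
      A - ((ε : ℂ) • kerSys f R kerT m β) A = srcOp (coefC f R) 0 (cosC R (kZero m β)) +
        Complex.I • srcOp (coefC f R) 0 (sinC R (kZero m β)) + c • srcOp (coefC f R) (-1) 1 ∧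
      ν * c = gam m β * intC R (A (-1)) ∧
      1 + Complex.I * sa ε m β * (intC R (A 0 * cosC R (kZero m β)) -
          Complex.I * intC R (A 0 * sinC R (kZero m β))) =
        transS ε (ν - qR f R ε m β) (sr f R ε m β).re (sz f R ε m β).re (sw f R ε m β).re
          (cA₁ m β) (cA₂ m β) ∧
      Complex.I * sa ε m β * (intC R (A 0 * cosC R (kZero m β)) +
          Complex.I * intC R (A 0 * sinC R (kZero m β))) =
        reflS ε (ν - qR f R ε m β) (sr f R ε m β).re (sz f R ε m β).re (sw f R ε m β).re
          (cA₁ m β) (cA₂ m β) := by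
  have hw := h.one_sub_ne h.sw_ofReal
  have hkT := h.kerT_apply
  have eZ := h.redSol_spec 0 (cosC R (kZero m β))
  have eW := h.redSol_spec 0 (sinC R (kZero m β))
  have eY := h.redSol_spec (-1) 1
  have iZs := h.intC_even_mul_sin 0 (cosC_even (kZero m β)) (kZero m β)
  have iYs := h.intC_even_mul_sin (-1) one_even (kZero m β)
  have iWc := h.intC_odd_mul_even 0 0 (sinC_odd (kZero m β)) (cosC_even (kZero m β))
  have iW1 := h.intC_odd_mul_even 0 (-1) (sinC_odd (kZero m β)) one_even
  have iZ1 := h.sr_eq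
  have hqR := h.ofReal_qR
  have hsa := h.sa_eq
  have hr := h.sr_ofReal
  have hz := h.sz_ofReal
  have hwr := h.sw_ofReal
  have hγ := ofReal_gamR m β
  have hA₁ : (cA₁ m β : ℂ) = gam m β * cA₂ m β := by unfold cA₁; push_cast; rw [hγ]
  unfold denS at hD
  unfold transS reflS denS
  have iYF : intC R (redSol f R ε m β (-1) 1 (-1)) = sF f R ε m β := rfl
  have iYr : intC R (redSol f R ε m β (-1) 1 0 * cosC R (kZero m β)) = sr f R ε m β := rfl
  have iZz : intC R (redSol f R ε m β 0 (cosC R (kZero m β)) 0 * cosC R (kZero m β)) = sz f R ε m β := rfl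
  have iWw : intC R (redSol f R ε m β 0 (sinC R (kZero m β)) 0 * sinC R (kZero m β)) = sw f R ε m β := rfl
  simp only [Complex.ofReal_sub, Complex.ofReal_mul] at hD ⊢
  rw [hr, hz, hqR, hA₁] at hD
  rw [hr, hz, hwr, hqR, hA₁]
  rw [mul_one] at iW1
  rw [hsa] at hw hkT ⊢
  generalize hC : cosC R (kZero m β) = C at *
  generalize hS : sinC R (kZero m β) = S at *
  generalize sr f R ε m β = r at *
  generalize sz f R ε m β = z at *
  generalize sw f R ε m β = w at *
  generalize sF f R ε m β = F at *
  generalize gam m β = γ at *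
  generalize (cA₂ m β : ℂ) = a₂ at *
  generalize redSol f R ε m β 0 C = Z at *
  generalize redSol f R ε m β 0 S = W at *
  generalize redSol f R ε m β (-1) 1 = Y at *
  obtain ⟨D, hDe⟩ : ∃ D, D = ((ν : ℂ) - γ * F) * (1 - Complex.I * (ε * a₂) * z) - Complex.I * ε * (γ * a₂) * r ^ 2 :=
    ⟨_, rfl⟩
  rw [← hDe] at hD ⊢
  obtain ⟨w', hw'⟩ : ∃ w', w' = 1 - Complex.I * (ε * a₂) * w := ⟨_, rfl⟩
  rw [← hw'] at hw ⊢
  have hIs := Complex.I_sq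
  -- The solution is sought as `c₁Z + c₂W + c₃Y` with source `cos + i sin` and threshold amplitude
  -- `c₃`. The conditions are `c₁ - ia(c₁z + c₃r) = 1`, `c₂(1 - iaw) = i` and `νc₃ = γ(c₁r + c₃F)`.
  -- They give `c₁ = (ν - γF)/D`, `c₂ = i/w'`, `c₃ = γr/D`.
  have hc1 : ((ν : ℂ) - γ * F) / D * (1 - Complex.I * (ε * a₂) * z) -
      Complex.I * (ε * a₂) * (γ * r / D) * r = 1 := by
    rw [div_mul_eq_mul_div, mul_div_assoc', div_mul_eq_mul_div, ← sub_div, div_eq_one_iff_eq hD, hDe]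
    ring
  have hc2 : Complex.I / w' * (1 - Complex.I * (ε * a₂) * w) = Complex.I := by
    rw [← hw', div_mul_cancel₀ _ hw]
  have hc3 : (γ * r / D) * ((ν : ℂ) - γ * F) = γ * r * (((ν : ℂ) - γ * F) / D) := by ring
  -- By the conditions above, `ia` times the cosine and sine pairings are `c₁ - 1` and `c₂ - i`.
  -- Hence `𝒯 = c₁ - ic₂ - 1` and `ℛ = c₁ + ic₂`.
  have hT : ((ν : ℂ) - γ * F) / D - Complex.I * (Complex.I / w') - 1 =
      (((ν : ℂ) - γ * F) + (ε * a₂) ^ 2 * w * z * ((ν : ℂ) - γ * F) + ε * a₂ * w * ε * (γ * a₂) * r ^ 2) /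
        (D * w') := by
    rw [eq_div_iff (mul_ne_zero hD hw)]
    have e1 : (((ν : ℂ) - γ * F) / D - Complex.I * (Complex.I / w') - 1) * (D * w') =
        ((ν : ℂ) - γ * F) * w' - Complex.I ^ 2 * D - D * w' := by field_simp
    rw [e1, hw', hDe]
    linear_combination (-((ν : ℂ) - γ * F) * (1 - Complex.I * (ε * a₂) * z) + Complex.I * ε * (γ * a₂) * r ^ 2
      - (ε * a₂) ^ 2 * w * z * ((ν : ℂ) - γ * F) - ε * a₂ * w * ε * (γ * a₂) * r ^ 2) * hIs
  have hR' : ((ν : ℂ) - γ * F) / D + Complex.I * (Complex.I / w') =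
      Complex.I * ε * (a₂ * (z - w) * ((ν : ℂ) - γ * F) + γ * a₂ * r ^ 2) / (D * w') := by
    rw [eq_div_iff (mul_ne_zero hD hw)]
    have e1 : (((ν : ℂ) - γ * F) / D + Complex.I * (Complex.I / w')) * (D * w') =
        ((ν : ℂ) - γ * F) * w' + Complex.I ^ 2 * D := by field_simp
    rw [e1, hw', hDe]
    linear_combination (((ν : ℂ) - γ * F) * (1 - Complex.I * (ε * a₂) * z) - Complex.I * ε * (γ * a₂) * r ^ 2) * hIs
  generalize ((ν : ℂ) - γ * F) / D = c1 at *
  generalize Complex.I / w' = c2 at *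
  generalize γ * r / D = c3 at *
  have i0 : ∀ χ : CIcc R, intC R ((c1 • Z + c2 • W + c3 • Y : SpaceA R) 0 * χ) =
      c1 * intC R (Z 0 * χ) + c2 * intC R (W 0 * χ) + c3 * intC R (Y 0 * χ) := by
    intro χ
    have : (c1 • Z + c2 • W + c3 • Y : SpaceA R) 0 * χ = c1 • (Z 0 * χ) + c2 • (W 0 * χ) + c3 • (Y 0 * χ) := by
      simp only [← smul_mul_assoc, ← add_mul]; rfl
    rw [this]
    simp only [map_add, map_smul, smul_eq_mul]
  have i1 : intC R ((c1 • Z + c2 • W + c3 • Y : SpaceA R) (-1)) =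
      c1 * intC R (Z (-1)) + c2 * intC R (W (-1)) + c3 * intC R (Y (-1)) := by
    have : (c1 • Z + c2 • W + c3 • Y : SpaceA R) (-1) = c1 • Z (-1) + c2 • W (-1) + c3 • Y (-1) := rfl
    rw [this]
    simp only [map_add, map_smul, smul_eq_mul]
  have j1 := i0 C
  have j2 := i0 S
  rw [iZz, iWc, iYr] at j1
  rw [iZs, iWw, iYs] at j2
  rw [iZ1, iW1, iYF] at i1
  refine ⟨c1 • Z + c2 • W + c3 • Y, c3, ?_, ?_, ?_, ?_⟩
  · rw [hkT, j1, j2, map_add, map_add, map_smul, map_smul, map_smul]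
    have k1 : c1 - Complex.I * (ε * a₂) * (c1 * z + c2 * 0 + c3 * r) = 1 := by linear_combination hc1
    have k2 : c2 - Complex.I * (ε * a₂) * (c1 * 0 + c2 * w + c3 * 0) = Complex.I := by linear_combination hc2
    generalize c1 * z + c2 * 0 + c3 * r = u1 at *
    generalize c1 * 0 + c2 * w + c3 * 0 = u2 at *
    generalize srcOp (coefC f R) 0 C = gC at *
    generalize srcOp (coefC f R) 0 S = gS at *
    generalize srcOp (coefC f R) (-1) 1 = g1 at *
    linear_combination (norm := module) c1 • eZ + c2 • eW + c3 • eY + k1 • gC + k2 • gS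
  · rw [i1]; linear_combination hc3
  · rw [j1, j2, ← hT]; linear_combination -hc1 + Complex.I * hc2 + hIs
  · rw [j1, j2, ← hR']; linear_combination -hc1 - Complex.I * hc2 - hIs

end

/-! ### Modes of the solution -/

/-- Decay exponents of the evanescent modes. -/
def kapR (m β : ℝ) (n : ℤ) : ℝ := if n = -1 then m else (kEvan m β n).re

/-- Exponents of all modes; the mode `n = 0` propagates. -/
def kapM (m β : ℝ) (n : ℤ) : ℂ := if n = 0 then -(Complex.I * waveNumber m β) else kapR m β n

/-- Modes of the solution. -/
def psiM (R ε m β : ℝ) (A : SpaceA R) (n : ℤ) (x : ℝ) : ℂ :=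
  (if n = 0 then Complex.exp (Complex.I * waveNumber m β * x) else 0) +
    2 * gam m β * ε * greenW (kapM m β n) R (extC (A n)) x

/-- Derivatives of the modes. -/
def psiD (R ε m β : ℝ) (A : SpaceA R) (n : ℤ) (x : ℝ) : ℂ :=
  (if n = 0 then Complex.I * waveNumber m β * Complex.exp (Complex.I * waveNumber m β * x) else 0) +
    2 * gam m β * ε * greenD (kapM m β n) R (extC (A n)) x

section
variable {f : ℝ × ℝ → ℝ} {R b K ε m β ν : ℝ} {A : SpaceA R} {c : ℂ}

lemma Dom.waveNumber_pos (h : Dom b (m : ℂ) β) : 0 < waveNumber m β :=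
  (Real.sqrt_pos.2 h.pos).trans_le h.le_waveNumber

lemma Dom.kapR_eq (h : Dom b (m : ℂ) β) {n : ℤ} (hn : n ≠ 0) (hn1 : n ≠ -1) :
    (kapR m β n : ℂ) = kEvan m β n := by
  unfold kapR
  rw [if_neg hn1]
  exact Complex.conj_eq_iff_re.1 (h.conj_kEvan hn hn1)

/-- The mode `-1` decays only at the rate `m = εν`. A rate depending on `ε` is harmless: existence
of the solution requires no uniformity. -/
lemma Dom.le_kapR (h : Dom b (m : ℂ) β) {n : ℤ} (hn : n ≠ 0) :
    min (Real.sqrt b) m * |(n : ℝ)| ≤ kapR m β n := by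
  unfold kapR
  split_ifs with hn1
  · subst hn1; simp
  · exact (mul_le_mul_of_nonneg_right (min_le_left _ _) (abs_nonneg _)).trans (h.kEvan_re hn hn1)

/-- Propagating, threshold and evanescent modes all satisfy the same type of equation; for `n = -1`
the right side is `(1 - β)² - ω² = m²`. -/
lemma Dom.kapM_sq (h : Dom b (m : ℂ) β) (n : ℤ) :
    kapM m β n ^ 2 = (β + n : ℂ) ^ 2 - omegaSq m β := by
  unfold kapM
  split_ifs with h0
  · subst h0
    have h1 : (waveNumber m β : ℂ) ^ 2 = 1 - 2 * β - m ^ 2 := by exact_mod_cast h.waveNumber_sq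
    rw [neg_sq, mul_pow, Complex.I_sq, h1]
    unfold omegaSq; push_cast; ring
  · by_cases h1 : n = -1
    · subst h1
      unfold kapR omegaSq
      simp
      ring
    · rw [h.kapR_eq h0 h1, kEvan_sq]
      unfold omegaSq; push_cast; ring

lemma Dom.kapM_ne (h : Dom b (m : ℂ) β) (hm : 0 < m) (n : ℤ) : kapM m β n ≠ 0 := by
  unfold kapM
  split_ifs with h0
  · have : (waveNumber m β : ℂ) ≠ 0 := Complex.ofReal_ne_zero.2 h.waveNumber_pos.ne'
    simpa using this
  · refine Complex.ofReal_ne_zero.2 (lt_of_lt_of_le ?_ (h.le_kapR h0)).ne'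
    have := one_le_abs_int h0
    exact mul_pos (lt_min (Real.sqrt_pos.2 h.pos) hm) (by linarith)

/-- The system in terms of the values on `[-R, R]`. -/
lemma Adm.hasSum_system (h : Adm f R b K ε (m : ℂ) β)
    (hA : A - ((ε : ℂ) • kerSys f R kerT m β) A = srcOp (coefC f R) 0 (cosC R (kZero m β)) +
        Complex.I • srcOp (coefC f R) 0 (sinC R (kZero m β)) + c • srcOp (coefC f R) (-1) 1)
    (n : ℤ) (x : Set.Icc (-R) R) :
    HasSum (fun j => fourierY f (n - j) x * ((if j = 0 then Complex.exp (Complex.I * waveNumber m β * (x : ℝ))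
      else 0) + (if j = -1 then c else 0) +
        2 * gam m β * ε * ∫ ξ : Set.Icc (-R) R, kernelH m β j ((x : ℝ) - ξ) * A j ξ ∂(lebIcc R))) (A n x) := by
  have h1 := (hasSum_sysOp_apply h.pert.summable_coefC (h.dom.summable_kerT h.pert.pos.le) A n).mapL
    (ContinuousMap.evalCLM ℂ x)
  have h2 := h1.mul_left (2 * gam m β * ε)
  have h3 := hasSum_single (f := fun j : ℤ => if j = 0 then fourierY f n x *
    Complex.exp (Complex.I * waveNumber m β * (x : ℝ)) else 0) 0 (fun j hj => if_neg hj)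
  have h4 := hasSum_single (f := fun j : ℤ => if j = -1 then fourierY f (n + 1) x * c else 0) (-1)
    (fun j hj => if_neg hj)
  rw [if_pos rfl] at h3 h4
  have h5 := (h3.add h4).add h2
  have e : A n x = fourierY f n x * Complex.exp (Complex.I * waveNumber m β * (x : ℝ)) +
      fourierY f (n + 1) x * c + 2 * gam m β * ε *
        sysOp (coefC f R) (fun n => convOp R (kerT m β n)) A n x := by
    have e1 : A n x - ((ε : ℂ) • kerSys f R kerT m β) A n x = srcOp (coefC f R) 0 (cosC R (kZero m β)) n x +
        Complex.I * srcOp (coefC f R) 0 (sinC R (kZero m β)) n x + c * srcOp (coefC f R) (-1) 1 n x := by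
      have := congrArg (fun B : SpaceA R => B n x) hA
      exact this
    rw [smul_kerSys_apply, h.src_apply, h.src_apply, h.src_apply, mul_one, ContinuousMap.mul_apply,
      ContinuousMap.mul_apply, h.pert.coefC_apply, h.pert.coefC_apply, sub_zero, sub_neg_eq_add, cosC_apply,
      sinC_apply, h.dom.kZero_eq] at e1
    rw [show Complex.I * waveNumber m β * ((x : ℝ) : ℂ) = (waveNumber m β * ((x : ℝ) : ℂ)) * Complex.I by ring,
      Complex.exp_mul_I]
    linear_combination e1
  rw [e]
  refine h5.congr_fun fun j => ?_
  change _ = (_ + _) + 2 * gam m β * ε * (coefC f R (n - j) x * convOp R (kerT m β j) (A j) x)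
  rw [h.pert.coefC_apply, convOp_apply]
  simp only [RayleighBloch.kerT_apply]
  by_cases h0 : j = 0
  · subst h0; simp; ring
  · by_cases h1 : j = -1
    · subst h1; simp; ring
    · simp [h0, h1]; ring

/-- Each `A_n` is a combination of the coefficients `f_j`, all of which vanish at `±R`; the
extension of `A_n` by zero is therefore continuous. -/
lemma Adm.system_vanish (h : Adm f R b K ε (m : ℂ) β)
    (hA : A - ((ε : ℂ) • kerSys f R kerT m β) A = srcOp (coefC f R) 0 (cosC R (kZero m β)) +
        Complex.I • srcOp (coefC f R) 0 (sinC R (kZero m β)) + c • srcOp (coefC f R) (-1) 1)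
    (n : ℤ) (x : Set.Icc (-R) R) (hx : R ≤ |(x : ℝ)|) : A n x = 0 := by
  have := h.hasSum_system hA n x
  simp only [h.pert.fourierY_zero _ hx, zero_mul] at this
  exact this.unique hasSum_zero

/-- Self-consistency `A_n = ∑ f_{n-j} ψ_j` of the reconstructed modes. For `j = -1` the true Green
function is the regularized one plus `1/(2m)`, and the condition on `c` says that this constant
contributes exactly `c`. -/
lemma Adm.hasSum_psiM (h : Adm f R b K ε (m : ℂ) β) (hm : m = ε * ν) (hm0 : 0 < m)
    (hA : A - ((ε : ℂ) • kerSys f R kerT m β) A = srcOp (coefC f R) 0 (cosC R (kZero m β)) +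
        Complex.I • srcOp (coefC f R) 0 (sinC R (kZero m β)) + c • srcOp (coefC f R) (-1) 1)
    (hc : ν * c = gam m β * intC R (A (-1))) (n : ℤ) (x : ℝ) :
    HasSum (fun j => fourierY f (n - j) x * psiM R ε m β A j x) (extC (A n) x) := by
  have hR := h.pert.pos.le
  have hcont := fun j => continuous_extC hR (h.system_vanish hA j)
  rcases le_or_gt R |x| with hx | hx
  · rw [extC_eq_zero (h.system_vanish hA n) hx]
    simp only [h.pert.fourierY_zero _ hx, zero_mul]
    exact hasSum_zero
  have hxI : x ∈ Set.Icc (-R) R := ⟨(abs_lt.1 hx).1.le, (abs_lt.1 hx).2.le⟩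
  obtain ⟨y, hy⟩ : ∃ y : Set.Icc (-R) R, (y : ℝ) = x := ⟨⟨x, hxI⟩, rfl⟩
  rw [← hy, extC_apply]
  refine (h.hasSum_system hA n y).congr_fun fun j => ?_
  congr 1
  unfold psiM
  rw [add_assoc]
  congr 1
  rw [← integral_conv_eq_greenW (hcont j) y]
  have hmne : (m : ℂ) ≠ 0 := Complex.ofReal_ne_zero.2 hm0.ne'
  unfold kapM
  by_cases h0 : j = 0
  · subst h0
    have hk : (waveNumber m β : ℂ) ≠ 0 := Complex.ofReal_ne_zero.2 h.dom.waveNumber_pos.ne'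
    rw [if_pos rfl, if_neg (by norm_num), zero_add]
    congr 2
    ext ξ
    unfold kernelH
    rw [if_pos rfl, h.dom.kZero_eq]
    congr 2
    · field_simp
      rw [Complex.I_sq]
    · congr 1; ring
  · rw [if_neg h0]
    by_cases h1 : j = -1
    · subst h1
      rw [if_pos rfl]
      have e1 : ∫ ξ : Set.Icc (-R) R, kernelH m β (-1) ((y : ℝ) - ξ) * A (-1) ξ ∂(lebIcc R) =
          (∫ ξ : Set.Icc (-R) R, 1 / (2 * (kapR m β (-1) : ℂ)) *
            Complex.exp (-((kapR m β (-1) : ℂ) * (|(y : ℝ) - ξ| : ℝ))) * A (-1) ξ ∂(lebIcc R)) -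
          1 / (2 * m) * intC R (A (-1)) := by
        rw [intC_apply, ← integral_const_mul, ← integral_sub (integrable_lebIcc (by fun_prop))
          (integrable_lebIcc (by fun_prop))]
        congr 1; ext ξ
        unfold kernelH kapR
        rw [if_neg (by norm_num), if_pos rfl, if_neg hmne, if_pos rfl]
        ring
      rw [e1]
      have e2 : (m : ℂ) = ε * ν := by rw [hm]; push_cast; rfl
      have hne : (ε : ℂ) ≠ 0 ∧ (ν : ℂ) ≠ 0 := by rw [e2] at hmne; exact mul_ne_zero_iff.1 hmne
      -- With `m = εν` the factor `2γε/(2m)` is `γ/ν`.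
      have e3 : c = 2 * gam m β * ε * (1 / (2 * m) * intC R (A (-1))) := by
        have : c = gam m β * intC R (A (-1)) / ν := by rw [← hc, mul_div_cancel_left₀ _ hne.2]
        rw [this, e2]
        have := hne.1; have := hne.2
        field_simp
      rw [mul_sub, ← e3]; ring
    · rw [if_neg h1, zero_add, h.dom.kapR_eq h0 h1]
      congr 2
      ext ξ
      unfold kernelH
      rw [if_neg h0, if_neg h1]

lemma hasDerivAt_psiM (hA : Continuous (extC (A n))) (hne : kapM m β n ≠ 0) (x : ℝ) :
    HasDerivAt (psiM R ε m β A n) (psiD R ε m β A n x) x := by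
  unfold psiM psiD
  refine HasDerivAt.add ?_ ((hasDerivAt_greenW hne hA x).const_mul _)
  split_ifs
  · exact hasDerivAt_exp_linear _ x
  · exact hasDerivAt_const x 0

lemma hasDerivAt_psiD (h : Dom b (m : ℂ) β) (hA : Continuous (extC (A n))) (x : ℝ) :
    HasDerivAt (psiD R ε m β A n) (((β + n : ℂ) ^ 2 - omegaSq m β) * psiM R ε m β A n x -
      ε * omegaSq m β / (2 * Real.pi) * extC (A n) x) x := by
  have h1 := (hasDerivAt_greenD (κ := kapM m β n) (R := R) hA x).const_mul (2 * gam m β * ε)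
  have hg : 2 * gam m β * ε = ε * omegaSq m β / (2 * Real.pi) := by
    have hpi : (Real.pi : ℂ) ≠ 0 := Complex.ofReal_ne_zero.2 Real.pi_ne_zero
    unfold gam omegaSq; push_cast; field_simp; ring
  have h2 : HasDerivAt (fun x : ℝ => if n = 0 then Complex.I * waveNumber m β *
      Complex.exp (Complex.I * waveNumber m β * x) else 0) (kapM m β n ^ 2 *
      if n = 0 then Complex.exp (Complex.I * waveNumber m β * x) else 0) x := by
    split_ifs with h0
    · refine ((hasDerivAt_exp_linear (Complex.I * waveNumber m β) x).const_mul _).congr_deriv ?_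
      unfold kapM
      rw [if_pos h0]; ring
    · simpa using hasDerivAt_const x (0 : ℂ)
  refine (h2.add h1).congr_deriv ?_
  unfold psiM
  rw [← h.kapM_sq, ← hg]
  ring

end

/-! ### Decay of the modes and the far field of the propagating mode -/

section
variable {f : ℝ × ℝ → ℝ} {R b K ε m β ν : ℝ} {A : SpaceA R}

lemma summable_norm_sq (A : SpaceA R) : Summable fun n => ‖A n‖ ^ 2 := by
  have := (lp.memℓp A).summable (by norm_num)
  simpa using this

/-- `A` is only square summable, but every quantity here is `O(‖A_n‖/|n|)`, and this is dominated by
`‖A_n‖² + n⁻²`. The two powers of `1/|n|` gained by the Green function leave one after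
multiplication by `β + n`. -/
lemma norm_psiM_le (h : Dom b (m : ℂ) β) (hm : 0 < m) (hR : 0 ≤ R) {n : ℤ} (hn : n ≠ 0)
    (hA : Continuous (extC (A n))) (h0 : ∀ x : Set.Icc (-R) R, R ≤ |(x : ℝ)| → A n x = 0) :
    ∀ s, s = min (Real.sqrt b) m → ∀ B : ℝ, B = ‖(2 * gam m β * ε : ℂ)‖ * Real.exp (s * R) / s ^ 2 *
      (‖A n‖ ^ 2 + 2 * wt n) → ∀ x : ℝ,
    ‖psiM R ε m β A n x‖ ≤ B * Real.exp (-(s * |x|)) ∧ ‖psiD R ε m β A n x‖ ≤ B * Real.exp (-(s * |x|)) ∧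
    ‖(β + n : ℂ) * psiM R ε m β A n x‖ ≤ B * Real.exp (-(s * |x|)) := by
  intro s hs B hB x
  have hs0 : 0 < s := by rw [hs]; exact lt_min (Real.sqrt_pos.2 h.pos) hm
  have hβ0 := h.pos.trans_le h.le
  have hs1 : s ≤ 1 := by
    rw [hs]
    refine (min_le_left _ _).trans ?_
    exact Real.sqrt_le_iff.2 ⟨zero_le_one, by linarith [h.le, h.ge, h.pos]⟩
  have ht := one_le_abs_int hn
  obtain ⟨t, ht'⟩ : ∃ t, t = |(n : ℝ)| := ⟨_, rfl⟩
  have hk := h.le_kapR hn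
  rw [← hs, ← ht'] at hk
  rw [← ht'] at ht
  have hsk : s ≤ kapR m β n := le_trans (by nlinarith) hk
  have hk0 : 0 < kapR m β n := hs0.trans_le hsk
  obtain ⟨g1, g2⟩ := norm_greenW_le (R := R) hA (fun ξ hξ => extC_eq_zero h0 hξ) hR hs0 hsk
    (norm_extC_le (A n)) x
  obtain ⟨N, hN⟩ : ∃ N, N = ‖A n‖ := ⟨_, rfl⟩
  have hN0 : 0 ≤ N := hN ▸ norm_nonneg _
  obtain ⟨G, hG⟩ : ∃ G, G = ‖(2 * gam m β * ε : ℂ)‖ := ⟨_, rfl⟩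
  have hG0 : 0 ≤ G := hG ▸ norm_nonneg _
  have hwt : 1 / t ^ 2 ≤ 2 * wt n := ht' ▸ inv_sq_le_wt hn
  rw [← hN] at g1 g2 hB
  rw [← hG] at hB
  have a1 : N / kapR m β n ≤ N / (s * t) := by gcongr
  have a2 : N / kapR m β n ^ 2 ≤ N / (s * t) ^ 2 := by gcongr
  have key : 2 * N / t ≤ N ^ 2 + 2 * wt n := by
    have : 0 ≤ (N - 1 / t) ^ 2 := sq_nonneg _
    have e : (N - 1 / t) ^ 2 = N ^ 2 - 2 * N / t + 1 / t ^ 2 := by field_simp; ring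
    linarith
  have b1 : N / (s * t) ^ 2 ≤ (2 * N / t) / (2 * t) / s ^ 2 := le_of_eq (by field_simp)
  have b2 : N / (s * t) ≤ (2 * N / t) / s ^ 2 := by
    rw [div_div, div_le_div_iff₀ (by positivity) (by positivity)]
    have hts : 0 ≤ t * s * (2 - s) := mul_nonneg (by positivity) (by linarith)
    have : N * (t * s ^ 2) ≤ N * (t * s * 2) := mul_le_mul_of_nonneg_left (by linarith) hN0
    linarith
  obtain ⟨E, hE⟩ : ∃ E, E = Real.exp (s * R) := ⟨_, rfl⟩
  obtain ⟨X, hX⟩ : ∃ X, X = Real.exp (-(s * |x|)) := ⟨_, rfl⟩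
  have hE0 : 0 ≤ E := hE ▸ Real.exp_nonneg _
  have hX0 : 0 ≤ X := hX ▸ Real.exp_nonneg _
  rw [← hE, ← hX] at g1 g2
  rw [← hE] at hB
  rw [← hX]
  have hψ : ‖psiM R ε m β A n x‖ ≤ G * ((2 * N / t) / (2 * t) / s ^ 2 * E * X) := by
    unfold psiM kapM
    rw [if_neg hn, if_neg hn, zero_add, norm_mul, ← hG]
    gcongr
    exact g1.trans (mul_le_mul_of_nonneg_right (mul_le_mul_of_nonneg_right (a2.trans b1) hE0) hX0)
  have hψ' : ‖psiD R ε m β A n x‖ ≤ G * ((2 * N / t) / s ^ 2 * E * X) := by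
    unfold psiD kapM
    rw [if_neg hn, if_neg hn, zero_add, norm_mul, ← hG]
    gcongr
    exact g2.trans (mul_le_mul_of_nonneg_right (mul_le_mul_of_nonneg_right (a1.trans b2) hE0) hX0)
  have hfin : G * ((2 * N / t) / s ^ 2 * E * X) ≤ B * X := by
    rw [hB]
    calc _ = G * E / s ^ 2 * (2 * N / t) * X := by ring
      _ ≤ _ := by gcongr
  refine ⟨hψ.trans (le_trans ?_ hfin), hψ'.trans hfin, ?_⟩
  · have b3 : 2 * N / t / (2 * t) / s ^ 2 ≤ 2 * N / t / s ^ 2 :=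
      div_le_div_of_nonneg_right (div_le_self (by positivity) (by linarith)) (by positivity)
    gcongr
  · rw [norm_mul]
    have hn2 : ‖(β + n : ℂ)‖ ≤ 2 * t := by
      rw [show (β + n : ℂ) = ((β + n : ℝ) : ℂ) by push_cast; rfl, Complex.norm_real, Real.norm_eq_abs]
      have : |β| ≤ 1 / 2 := by rw [abs_of_pos hβ0]; linarith [h.ge, h.pos]
      have := abs_add_le β (n : ℝ)
      rw [← ht'] at this
      linarith
    calc _ ≤ 2 * t * (G * ((2 * N / t) / (2 * t) / s ^ 2 * E * X)) := by gcongr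
      _ = G * ((2 * N / t) / s ^ 2 * E * X) := by field_simp
      _ ≤ _ := hfin

/-- The propagating mode agrees with its far field away from the perturbation. -/
lemma psiM_zero_eq_farU (h : Dom b (m : ℂ) β) (hR : 0 ≤ R)
    (hA : Continuous (extC (A 0))) (h0 : ∀ x : Set.Icc (-R) R, R ≤ |(x : ℝ)| → A 0 x = 0) {x : ℝ}
    (hx : max R 1 < |x|) :
    psiM R ε m β A 0 x = farU (waveNumber m β)
      (Complex.I * sa ε m β * (intC R (A 0 * cosC R (kZero m β)) +
        Complex.I * intC R (A 0 * sinC R (kZero m β))))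
      (1 + Complex.I * sa ε m β * (intC R (A 0 * cosC R (kZero m β)) -
        Complex.I * intC R (A 0 * sinC R (kZero m β)))) x := by
  have hz : ∀ ξ, R ≤ |ξ| → extC (A 0) ξ = 0 := fun ξ hξ => extC_eq_zero h0 hξ
  have hz' : ∀ ξ, R ≤ |ξ| → extC (A 0) (-ξ) = 0 := fun ξ hξ => hz _ (by rwa [abs_neg])
  have hA' : Continuous fun ξ => extC (A 0) (-ξ) := by fun_prop
  have hkne : (waveNumber m β : ℂ) ≠ 0 := Complex.ofReal_ne_zero.2 h.waveNumber_pos.ne'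
  obtain ⟨k, hk⟩ : ∃ k, k = waveNumber m β := ⟨_, rfl⟩
  rw [← hk] at hkne
  have hRR : -R ≤ R := by linarith
  -- `σ = 1` and `σ = -1` give the amplitudes of the waves leaving to the right and to the left.
  have hint : ∀ σ : ℂ, (∀ z : ℂ, Complex.exp (-(σ * Complex.I * k) * z) = Complex.cos (k * z) - σ * Complex.I * Complex.sin (k * z)) →
      ∫ ξ in (-R)..R, Complex.exp (-(σ * Complex.I * k) * ξ) * extC (A 0) ξ =
      intC R (A 0 * cosC R k) - σ * Complex.I * intC R (A 0 * sinC R k) := by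
    intro σ hσ
    have e1 := integral_lebIcc R fun ξ : ℝ => Complex.exp (-(σ * Complex.I * k) * ξ) * extC (A 0) ξ
    rw [integral_Icc_eq_integral_Ioc, ← intervalIntegral.integral_of_le hRR] at e1
    rw [← e1, intC_apply, intC_apply, ← integral_const_mul, ← integral_sub (integrable_lebIcc (by fun_prop))
      (integrable_lebIcc (by fun_prop))]
    congr 1; ext ξ
    rw [extC_apply, hσ]
    simp only [ContinuousMap.mul_apply, cosC_apply, sinC_apply]
    ring
  have hpos := hint 1 fun z => by
    rw [show -(1 * Complex.I * k) * z = -(k * z) * Complex.I by ring, Complex.exp_mul_I, Complex.cos_neg,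
      Complex.sin_neg]; ring
  have hneg := hint (-1) fun z => by
    rw [show -(-1 * Complex.I * k) * z = (k * z) * Complex.I by ring, Complex.exp_mul_I]; ring
  have hsa : sa ε m β = ε * gam m β / k := by unfold sa; rw [h.kZero_eq, hk]
  unfold psiM farU
  rw [if_pos rfl, hsa, h.kZero_eq, ← hk]
  have hκ : kapM m β 0 = -(1 * Complex.I * k) := by unfold kapM; rw [if_pos rfl, hk]; ring
  unfold greenW
  rw [hκ]
  rcases lt_abs.1 hx with hx | hx
  · have hx1 := (le_max_left R 1).trans hx.le
    have hx2 := (le_max_right R 1).trans hx.le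
    rw [halfG_of_ge hA hz hx1, halfG_of_le hz' (by linarith), hpos, outU_of_one_le hx2,
      Real.smoothTransition.zero_of_nonpos (by linarith),
      show -(-(1 * Complex.I * (k : ℂ))) * (x : ℂ) = Complex.I * (k * x) by ring, mul_assoc Complex.I, Complex.ofReal_zero]
    generalize Complex.exp (Complex.I * (k * x)) = e
    generalize intC R (A 0 * cosC R k) = Cc
    generalize intC R (A 0 * sinC R k) = Cs
    field_simp
    linear_combination e * gam m β * ε * (Complex.I * Cs - Cc) * Complex.I_sq
  · have hx1 := (le_max_left R 1).trans hx.le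
    have hx2 := (le_max_right R 1).trans hx.le
    have hrefl : ∫ ξ in (-R)..R, Complex.exp (-(1 * Complex.I * k) * ξ) * extC (A 0) (-ξ) =
        ∫ ξ in (-R)..R, Complex.exp (-(-1 * Complex.I * k) * ξ) * extC (A 0) ξ := by
      have := intervalIntegral.integral_comp_neg (a := -R) (b := R) (fun ξ : ℝ =>
        Complex.exp (-(-1 * Complex.I * k) * ξ) * extC (A 0) ξ)
      rw [neg_neg] at this
      rw [← this]
      congr 1; ext ξ
      congr 2
      push_cast; ring
    rw [halfG_of_le hz (by linarith), halfG_of_ge hA' hz' hx1, hrefl, hneg, outU_of_le_neg_one (by linarith),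
      Real.smoothTransition.one_of_one_le hx2,
      show -(-(1 * Complex.I * (k : ℂ))) * ((-x : ℝ) : ℂ) = -(Complex.I * (k * x)) by push_cast; ring,
      mul_assoc Complex.I, Complex.ofReal_one]
    generalize Complex.exp (Complex.I * (k * x)) = e
    generalize Complex.exp (-(Complex.I * (k * x))) = e'
    generalize intC R (A 0 * cosC R k) = Cc
    generalize intC R (A 0 * sinC R k) = Cs
    field_simp
    linear_combination -(e' * gam m β * ε * (Complex.I * Cs + Cc)) * Complex.I_sq

/-- Existence of a solution of the scattering problem, with explicit coefficients. -/
theorem Adm.exists_solvesScattering (h : Adm f R b K ε (m : ℂ) β) (hm : m = ε * ν) (hm0 : 0 < m)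
    (hD : denS ε (ν - qR f R ε m β) (sr f R ε m β).re (sz f R ε m β).re (cA₁ m β) (cA₂ m β) ≠ 0) :
    ∃ Ψ, SolvesScattering f ε m β Ψ
      (reflS ε (ν - qR f R ε m β) (sr f R ε m β).re (sz f R ε m β).re (sw f R ε m β).re
          (cA₁ m β) (cA₂ m β))
      (transS ε (ν - qR f R ε m β) (sr f R ε m β).re (sz f R ε m β).re (sw f R ε m β).re
          (cA₁ m β) (cA₂ m β)) := by
  obtain ⟨A, c, hA, hc, hT, hRf⟩ := h.exists_system hD
  rw [← hT, ← hRf]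
  have hR := h.pert.pos.le
  have hv := h.system_vanish hA
  have hcont := fun j => continuous_extC hR (hv j)
  have hfar := fun x (hx : max R 1 < |x|) => psiM_zero_eq_farU (ε := ε) h.dom hR (hcont 0) (hv 0) hx
  generalize Complex.I * sa ε m β * (intC R (A 0 * cosC R (kZero m β)) +
    Complex.I * intC R (A 0 * sinC R (kZero m β))) = ρ at *
  generalize 1 + Complex.I * sa ε m β * (intC R (A 0 * cosC R (kZero m β)) -
    Complex.I * intC R (A 0 * sinC R (kZero m β))) = t at *
  have hd := fun n x => hasDerivAt_psiM (R := R) (ε := ε) (hcont n) (h.dom.kapM_ne hm0 n) x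
  have hd' := fun n x => hasDerivAt_psiD (R := R) (ε := ε) h.dom (hcont n) x
  obtain ⟨U, hU⟩ : ∃ U, U = farU (waveNumber m β) ρ t := ⟨_, rfl⟩
  have hUs : ContDiff ℝ ∞ U := hU ▸ contDiff_farU _ _ _
  have hUd : ∀ x, HasDerivAt U (deriv U x) x := fun x => (hUs.differentiable (by simp) x).hasDerivAt
  have hcψ' : ∀ n, Continuous (psiD R ε m β A n) := fun n =>
    continuous_iff_continuousAt.2 fun x => (hd' n x).continuousAt
  have hvd := fun x => (hd 0 x).sub (hUd x)
  have hv0 : ∀ x, max R 1 < |x| → psiM R ε m β A 0 x - U x = 0 := fun x hx => by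
    rw [hU, hfar x hx, sub_self]
  have hv0' : ∀ x, max R 1 < |x| → psiD R ε m β A 0 x - deriv U x = 0 := fun x hx => by
    rw [← (hvd x).deriv]
    exact deriv_eq_zero_of_vanish hv0 hx
  have hvc : Continuous fun x => psiM R ε m β A 0 x - U x :=
    continuous_iff_continuousAt.2 fun x => (hvd x).continuousAt
  have hvc' : Continuous fun x => psiD R ε m β A 0 x - deriv U x :=
    (hcψ' 0).sub (hUs.continuous_deriv (by simp))
  obtain ⟨Q, hQ, hQb⟩ := exists_bound_of_vanish hvc.norm fun x hx => by rw [hv0 x hx, norm_zero]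
  obtain ⟨Q', hQ', hQb'⟩ := exists_bound_of_vanish hvc'.norm fun x hx => by rw [hv0' x hx, norm_zero]
  simp only [abs_norm] at hQb hQb'
  obtain ⟨s, hs⟩ : ∃ s, s = min (Real.sqrt b) m := ⟨_, rfl⟩
  have hs0 : 0 < s := by rw [hs]; exact lt_min (Real.sqrt_pos.2 h.dom.pos) hm0
  have hψb := fun n (hn : n ≠ 0) => norm_psiM_le (ε := ε) h.dom hm0 hR hn (hcont n) (hv n) s hs _ rfl
  obtain ⟨G, hG⟩ : ∃ G, G = ‖(2 * gam m β * ε : ℂ)‖ * Real.exp (s * R) / s ^ 2 := ⟨_, rfl⟩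
  have hG0 : 0 ≤ G := by rw [hG]; positivity
  simp only [← hG] at hψb
  have hB0 : ∀ n, 0 ≤ G * (‖A n‖ ^ 2 + 2 * wt n) := fun n => by have := wt_pos n; positivity
  -- The propagating mode minus its far field has compact support; the factor `e^{s max(R,1)}` fits
  -- it under the exponential weight.
  have hzero : ∀ (u : ℝ → ℂ) (q : ℝ), (∀ x, max R 1 < |x| → u x = 0) → (∀ x, ‖u x‖ ≤ q) → q ≤ Q + Q' →
      ∀ x, ‖u x‖ ≤ (G * (‖A 0‖ ^ 2 + 2 * wt 0) + (Q + Q') * Real.exp (s * max R 1)) * Real.exp (-(s * |x|)) := by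
    intro u q hu0 hub hq x
    have hQQ : 0 ≤ Q + Q' := by positivity
    rcases lt_or_ge (max R 1) |x| with hx | hx
    · rw [hu0 x hx, norm_zero]
      have := hB0 0
      positivity
    · rw [add_mul, mul_assoc (Q + Q'), ← Real.exp_add]
      have h1 : 1 ≤ Real.exp (s * max R 1 + -(s * |x|)) := Real.one_le_exp (by nlinarith)
      have h2 : 0 ≤ G * (‖A 0‖ ^ 2 + 2 * wt 0) * Real.exp (-(s * |x|)) := mul_nonneg (hB0 0) (Real.exp_nonneg _)
      have := hub x
      nlinarith
  refine ⟨_, solvesScattering_of_modes (s := s) (v := fun n x => psiM R ε m β A n x - if n = 0 then U x else 0)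
    (v' := fun n x => psiD R ε m β A n x - if n = 0 then deriv U x else 0)
    (B := fun n => G * (‖A n‖ ^ 2 + 2 * wt n) + if n = 0 then (Q + Q') * Real.exp (s * max R 1) else 0)
    h.pert hd hcont hd' (h.hasSum_psiM hm hm0 hA hc)
    (fun x => by simp [hU]) (fun x => by simp [hU]) (fun n hn => by simp [hn]) ?_⟩
  refine ⟨hs0, (((summable_norm_sq A).add (summable_wt.mul_left 2)).mul_left G).add
    (hasSum_ite_eq 0 _).summable, fun n x => ?_, fun n => ?_, fun n x => ?_, fun n x => ?_, fun n x => ?_⟩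
  · by_cases hn : n = 0
    · subst hn; simp only [↓reduceIte]; exact hvd x
    · simpa [hn] using hd n x
  · by_cases hn : n = 0
    · subst hn; simpa using hvc'
    · simpa [hn] using hcψ' n
  · by_cases hn : n = 0
    · subst hn; simpa using hzero _ Q hv0 hQb (by linarith) x
    · simpa [hn] using (hψb n hn x).1
  · by_cases hn : n = 0
    · subst hn; simpa using hzero _ Q' hv0' hQb' (by linarith) x
    · simpa [hn] using (hψb n hn x).2.1
  · by_cases hn : n = 0
    · subst hn
      have hβ : ‖(β : ℂ)‖ ≤ 1 := by
        rw [Complex.norm_real, Real.norm_of_nonneg (h.dom.pos.le.trans h.dom.le)]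
        linarith [h.dom.ge, h.dom.pos]
      have := hzero (fun x => (β + (0 : ℤ) : ℂ) * (psiM R ε m β A 0 x - U x)) Q
        (fun x hx => by simp [hv0 x hx]) (fun x => by
          simp only [Int.cast_zero, add_zero]
          rw [norm_mul]
          exact (mul_le_of_le_one_left (norm_nonneg _) hβ).trans (hQb x)) (by linarith) x
      simpa using this
    · simpa [hn] using (hψb n hn x).2.2

end

/-! ### Constants of the theorem in terms of the reduced quantities -/

section
variable {f : ℝ × ℝ → ℝ} {R b K ε β : ℝ}

lemma Adm.orthR_eq_zero_iff {m : ℝ} (h : Adm f R b K ε (m : ℂ) β) :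
    orthR f R ε m β = 0 ↔ (sr f R ε m β).re = 0 := by
  have hne := h.one_sub_ne h.sz_ofReal
  rw [h.orthR_eq hne, div_eq_zero_iff, or_iff_left hne, ← h.sr_ofReal, Complex.ofReal_eq_zero]
  simp

lemma kap_pos (h : β < 1 / 2) : 0 < kap β := Real.sqrt_pos.2 (by linarith)

lemma gamZero_pos (h : β < 1 / 2) : 0 < gamZero β := by
  have : 0 < 1 - β := by linarith
  unfold gamZero; positivity

lemma IsPert.deriv_fourierXY (hf : IsPert f R) (k : ℝ) :
    deriv (fourierXY f 1) k = (cosT' f 1 k : ℂ) := (hf.hasDerivAt_fourierXY 1 k).deriv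

/-- Since `κ'(β) = -1/κ(β)`, the number being squared is `∂_β f̃_1(κ(β))`, the slope of `sr` at
leading order. -/
lemma IsPert.alphaC_eq (hf : IsPert f R) (h : β < 1 / 2) :
    alphaC f β = gamR 0 β * cA₂ 0 β * (-cosT' f 1 (waveNumber 0 β) / waveNumber 0 β) ^ 2 := by
  have hk := (kap_pos h).ne'
  unfold alphaC cA₂
  rw [gamR_zero, waveNumber_zero, hf.deriv_fourierXY, Complex.norm_real, Real.norm_eq_abs, sq_abs]
  field_simp

lemma IsPert.qC_eq (hf : IsPert f R) :
    qC f β = ((cA₂ 0 β * cosT f 0 (2 * waveNumber 0 β) : ℝ) : ℂ) := by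
  unfold qC cA₂
  rw [gamR_zero, waveNumber_zero, hf.fourierXY_eq, div_eq_mul_inv, ← Complex.ofReal_mul]

end

end RayleighBloch

end

/-! ### Choice of the constants and conclusion -/

theorem mainTheorem5
    (f : ℝ × ℝ → ℝ) (R : ℝ) (hR : 0 < R)
    (hf_smooth : ContDiff ℝ ∞ f)
    (hf_per : ∀ x y : ℝ, f (x, y + 2 * Real.pi) = f (x, y))
    (hf_supp : ∀ x y : ℝ, R < |x| → f (x, y) = 0)
    (hf_even_x : ∀ x y : ℝ, f (-x, y) = f (x, y))
    (hf_even_y : ∀ x y : ℝ, f (x, -y) = f (x, y))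
    (hf_pos : 0 < ∫ p in RayleighBloch.strip, f p)
    (β₀₀ : ℝ) (hβ_pos : 0 < β₀₀) (hβ_lt : β₀₀ < 1 / 2)
    (h_zero : RayleighBloch.fourierXY f 1 (RayleighBloch.kap β₀₀) = 0)
    (h_deriv : deriv (RayleighBloch.fourierXY f 1) (RayleighBloch.kap β₀₀) ≠ 0) :
    ∃ ρ₁ ρ₂ ε₀ C : ℝ, 0 < ρ₁ ∧ 0 < ρ₂ ∧ 0 < ε₀ ∧ 0 < C ∧
    ∃ (ν₀ : ℝ → ℝ → ℂ) (β₀ : ℝ → ℝ → ℝ) (ν_tr β_tr : ℝ → ℝ),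
    ∀ ε : ℝ, 0 < ε → ε < ε₀ →
      -- `ν₀ ε β` is the unique root of the dispersion relation near `ν₀₀`
      (∀ β : ℝ, |β - β₀₀| < ρ₁ →
        ‖ν₀ ε β - RayleighBloch.nuCenter f β₀₀‖ < ρ₂ ∧
        RayleighBloch.IsResonance f R ε β (ν₀ ε β) ∧
        ∀ ν : ℂ, ‖ν - RayleighBloch.nuCenter f β₀₀‖ < ρ₂ →
          RayleighBloch.IsResonance f R ε β ν → ν = ν₀ ε β) ∧
      -- `β₀ ε (ε ν)` is the unique root of the orthogonality condition near `β₀₀`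
      (∀ ν : ℝ, |ν - RayleighBloch.nuCenter f β₀₀| < ρ₂ →
        |β₀ ε (ε * ν) - β₀₀| < ρ₁ ∧
        RayleighBloch.orthR f R ε ((ε * ν : ℝ) : ℂ) (β₀ ε (ε * ν)) = 0 ∧
        ∀ β : ℝ, |β - β₀₀| < ρ₁ →
          RayleighBloch.orthR f R ε ((ε * ν : ℝ) : ℂ) β = 0 → β = β₀ ε (ε * ν)) ∧
      -- the point `(β_tr, ν_tr)` lies on both curves and is `O(ε)`-close to `(β₀₀, ν₀₀)`
      (|β_tr ε - β₀₀| < ρ₁ ∧ |β_tr ε - β₀₀| ≤ C * ε ∧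
        |ν_tr ε - RayleighBloch.nuCenter f β₀₀| < ρ₂ ∧
        |ν_tr ε - RayleighBloch.nuCenter f β₀₀| ≤ C * ε ∧
        β_tr ε = β₀ ε (ε * ν_tr ε) ∧
        RayleighBloch.IsResonance f R ε (β_tr ε) (ν_tr ε : ℂ)) ∧
      -- the asymptotics, uniformly in a fixed neighbourhood
      ∀ β ν : ℝ, |β - β₀₀| < ρ₁ → |ν - RayleighBloch.nuCenter f β₀₀| < ρ₂ →
        (0 < β ∧ β < 1 / 2 ∧ 0 < ν ∧ β ^ 2 < RayleighBloch.omegaSq (ε * ν) β) ∧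
        ∀ δ Δ : ℝ, δ = ν - (ν₀ ε β).re → Δ = β - β₀ ε (ε * ν) → (δ ≠ 0 ∨ Δ ≠ 0) →
          (∃ (Ψ : ℝ × ℝ → ℂ) (ℛ 𝒯 : ℂ),
            RayleighBloch.SolvesScattering f ε (ε * ν) β Ψ ℛ 𝒯) ∧
          ∀ (Ψ : ℝ × ℝ → ℂ) (ℛ 𝒯 : ℂ),
            RayleighBloch.SolvesScattering f ε (ε * ν) β Ψ ℛ 𝒯 →
            (∃ E₁ E₂ : ℂ, ‖E₁‖ ≤ C * (ε + |Δ|) ∧ ‖E₂‖ ≤ C * (ε + |Δ|) ∧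
              ℛ = Complex.I * ε *
                  (δ * RayleighBloch.qC f β₀₀ + RayleighBloch.alphaC f β₀₀ * Δ ^ 2 +
                    (|δ| + Δ ^ 2 : ℝ) * E₁) * (1 + E₂) /
                (δ - Complex.I * ε * RayleighBloch.alphaC f β₀₀ * Δ ^ 2)) ∧
            (∃ E₁ E₂ : ℂ, ‖E₁‖ ≤ C * (ε + |Δ|) ∧ ‖E₂‖ ≤ C * (ε + |Δ|) ∧
              𝒯 = (δ + (|δ| + Δ ^ 2 : ℝ) * E₁) * (1 + E₂) /
                (δ - Complex.I * ε * RayleighBloch.alphaC f β₀₀ * Δ ^ 2)) := by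
  have hf : RayleighBloch.IsPert f R := ⟨hR, hf_smooth, hf_per, hf_supp, hf_even_x, hf_even_y⟩
  obtain ⟨b, hb⟩ : ∃ b, b = min β₀₀ (1 / 2 - β₀₀) / 2 := ⟨_, rfl⟩
  have hb0 : 0 < b := by rw [hb]; exact half_pos (lt_min hβ_pos (by linarith))
  obtain ⟨K, hK⟩ := hf.exists_opBound hb0
  obtain ⟨C₁, H⟩ := RayleighBloch.exists_redBounds hf hb0 hK
  have hk := RayleighBloch.kap_pos hβ_lt
  have hg := RayleighBloch.gamZero_pos hβ_lt
  have hz : RayleighBloch.cosT f 1 (RayleighBloch.waveNumber 0 β₀₀) = 0 := by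
    rw [hf.fourierXY_eq] at h_zero
    rw [RayleighBloch.waveNumber_zero]
    exact_mod_cast h_zero
  obtain ⟨L, hL, hS⟩ := H.exists_scatData hf hK hβ_pos hβ_lt hb hz
  have hαC := hf.alphaC_eq hβ_lt
  have hqC := hf.qC_eq (β := β₀₀)
  have hα₀ : 0 < RayleighBloch.gamR 0 β₀₀ * RayleighBloch.cA₂ 0 β₀₀ := by
    unfold RayleighBloch.cA₂
    rw [RayleighBloch.gamR_zero, RayleighBloch.waveNumber_zero]
    positivity
  have hc : -RayleighBloch.cosT' f 1 (RayleighBloch.waveNumber 0 β₀₀) /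
      RayleighBloch.waveNumber 0 β₀₀ ≠ 0 := by
    rw [RayleighBloch.waveNumber_zero]
    rw [hf.deriv_fourierXY] at h_deriv
    exact div_ne_zero (neg_ne_zero.2 fun h => h_deriv (by rw [h, Complex.ofReal_zero])) hk.ne'
  have hν : 0 < RayleighBloch.nuCenter f β₀₀ := mul_pos hg hf_pos
  generalize RayleighBloch.nuCenter f β₀₀ = ν₀₀ at *
  generalize -RayleighBloch.cosT' f 1 (RayleighBloch.waveNumber 0 β₀₀) /
      RayleighBloch.waveNumber 0 β₀₀ = c at *
  generalize RayleighBloch.gamR 0 β₀₀ * RayleighBloch.cA₂ 0 β₀₀ = α₀ at *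
  generalize RayleighBloch.cA₂ 0 β₀₀ *
    RayleighBloch.cosT f 0 (2 * RayleighBloch.waveNumber 0 β₀₀) = q at *
  rw [hαC, hqC]
  obtain ⟨ρmax, ρ₂, B, hρm, hρmb, hρ₂, hρ₂e, hB, hroots⟩ :=
    RayleighBloch.ScatData.exists_roots (β₀ := β₀₀) (α₀ := α₀) (q := q) hL hb0 hb0 hν hc
  -- A single constant for all hypotheses of `exists_asymptotic_form`. The factor `1 + 2B` accounts
  -- for rewriting `ε + εν + |β - β₀₀|` in terms of `ε + |Δ|`.
  obtain ⟨L', hL'⟩ : ∃ L', L' = L * (1 + 2 * B) + B + |α₀| + |c| + |q| := ⟨_, rfl⟩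
  have hLB : 0 ≤ L * B := by positivity
  have hLL : L * (1 + 2 * B) ≤ L' := by
    rw [hL']; linarith [abs_nonneg α₀, abs_nonneg c, abs_nonneg q]
  have hLL' : L ≤ L' := by linarith
  have hBL : B ≤ L' := by
    rw [hL']; linarith [abs_nonneg α₀, abs_nonneg c, abs_nonneg q]
  obtain ⟨C, hC1, hC⟩ := RayleighBloch.exists_asymptotic_form (L := L') (α₀ := α₀) (c := c) (q := q)
    (hL.trans hLL') (by positivity)
    (by rw [hL']; linarith [abs_nonneg α₀, abs_nonneg c, abs_nonneg q])
    (by rw [hL']; linarith [abs_nonneg α₀, abs_nonneg c, abs_nonneg q])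
    (by rw [hL']; linarith [abs_nonneg α₀, abs_nonneg c, abs_nonneg q])
  have hC0 : 0 < C := by linarith
  -- Since `|Δ| ≤ 2ρ₁`, the second bound gives `C|Δ| ≤ 1/2`; with `Cε ≤ 1/2` the smallness condition
  -- of the asymptotic form holds on the whole rectangle.
  obtain ⟨ρ₁, hρ₁⟩ : ∃ ρ₁, ρ₁ = min ρmax (1 / (4 * C)) := ⟨_, rfl⟩
  have hρ₁0 : 0 < ρ₁ := by rw [hρ₁]; positivity
  have hρ₁m : ρ₁ ≤ ρmax := by rw [hρ₁]; exact min_le_left _ _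
  have hρ₁C : C * (2 * ρ₁) ≤ 1 / 2 := by
    have : ρ₁ ≤ 1 / (4 * C) := by rw [hρ₁]; exact min_le_right _ _
    rw [le_div_iff₀ (by positivity)] at this; linarith
  have hρ₁b : ρ₁ ≤ b := hρ₁m.trans hρmb
  obtain ⟨ε₁, hε₁, hε₁1, hε₁r⟩ := hroots ρ₁ hρ₁0 hρ₁m
  have hK0 : 0 ≤ K := hK.1
  obtain ⟨ε₀, hε₀⟩ : ∃ ε₀, ε₀ = min ε₁ (min (1 / (2 * C)) (1 / (2 * (K + 1)))) := ⟨_, rfl⟩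
  have hε₀0 : 0 < ε₀ := by rw [hε₀]; positivity
  have hεC : ∀ ε, ε < ε₀ → C * ε ≤ 1 / 2 := fun ε h => by
    have : ε ≤ 1 / (2 * C) := h.le.trans (by
      rw [hε₀]; exact (min_le_right _ _).trans (min_le_left _ _))
    rw [le_div_iff₀ (by positivity)] at this; linarith
  have hεK : ∀ ε, 0 < ε → ε < ε₀ → ε * K ≤ 1 / 2 := fun ε h0 h => by
    have : ε ≤ 1 / (2 * (K + 1)) := h.le.trans (by
      rw [hε₀]; exact (min_le_right _ _).trans (min_le_right _ _))
    rw [le_div_iff₀ (by positivity)] at this; linarith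
  have hε1 : ∀ ε, ε < ε₀ → ε < ε₁ := fun ε h => h.trans_le (by rw [hε₀]; exact min_le_left _ _)
  -- The roots must be functions of all real `ε`; outside `(0, ε₀)` they are set to `0`, where
  -- nothing is claimed.
  have key : ∀ ε : ℝ, ∃ (νs : ℝ → ℂ) (βs : ℝ → ℝ) (νt βt : ℝ), ∀ (_ : 0 < ε) (_ : ε < ε₀), _ :=
    fun ε => if h : 0 < ε ∧ ε < ε₀ then by
      obtain ⟨νs, βs, νt, βt, hh⟩ := (hε₁r ε h.1 (hε1 ε h.2)).2 _ _ _ _ _ _ _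
        (hS ε h.1.le ((hε1 ε h.2).le.trans hε₁1) (hεK ε h.1 h.2))
      exact ⟨νs, βs, νt, βt, fun _ _ => hh⟩
    else ⟨0, 0, 0, 0, fun h1 h2 => (h ⟨h1, h2⟩).elim⟩
  choose νs βs νt βt hroot using key
  have hνr : ∀ ν : ℝ, |ν - ν₀₀| < ρ₂ → 0 < ν ∧ ν < 2 * ν₀₀ := fun ν h => by
    rw [abs_lt] at h; constructor <;> linarith
  have hmr : ∀ ε ν : ℝ, 0 < ε → ε < ε₀ → |ν - ν₀₀| < ρ₂ → 0 < ε * ν ∧ ε * ν ≤ b :=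
    fun ε ν h0 h1 h => by
      obtain ⟨h2, h3⟩ := hνr ν h
      exact ⟨mul_pos h0 h2,
        (mul_le_mul_of_nonneg_left h3.le h0.le).trans (hε₁r ε h0 (hε1 ε h1)).1⟩
  have hadm : ∀ ε β ν : ℝ, 0 < ε → ε < ε₀ → |β - β₀₀| < ρ₁ → |ν - ν₀₀| < ρ₂ →
      RayleighBloch.Adm f R b K ε ((ε * ν : ℝ) : ℂ) β := fun ε β ν h0 h1 hβ hν' => by
    obtain ⟨hm0, hmb⟩ := hmr ε ν h0 h1 hν'
    refine ⟨hf, hK, h0.le, hεK ε h0 h1, RayleighBloch.dom_of_le hβ_pos hβ_lt hb ?_ ?_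
      (hβ.le.trans hρ₁b)⟩
    · rw [Complex.ofReal_re]; exact hm0.le
    · rwa [Complex.norm_real, Real.norm_of_nonneg hm0.le]
  refine ⟨ρ₁, ρ₂, ε₀, max C B, hρ₁0, hρ₂, hε₀0, by positivity, νs, fun ε => βs ε, νt, βt,
    fun ε hε0 hε => ?_⟩
  have hsc := hS ε hε0.le ((hε1 ε hε).le.trans hε₁1) (hεK ε hε0 hε)
  obtain ⟨r1, r2, r3, r4⟩ := hroot ε hε0 hε
  have hBmax : B * ε ≤ max C B * ε := mul_le_mul_of_nonneg_right (le_max_right _ _) hε0.le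
  refine ⟨r1, fun ν hνν => ?_, ⟨r3.1, r3.2.1.trans hBmax, r3.2.2.1, r3.2.2.2.1.trans hBmax,
    r3.2.2.2.2⟩, fun β ν hβ hνν => ?_⟩
  · obtain ⟨s1, s2, s3⟩ := r2 ν hνν
    exact ⟨s1, (hadm ε _ ν hε0 hε s1 hνν).orthR_eq_zero_iff.2 s2,
      fun β hβ h => s3 β hβ ((hadm ε β ν hε0 hε hβ hνν).orthR_eq_zero_iff.1 h)⟩
  have A := hadm ε β ν hε0 hε hβ hνν
  obtain ⟨hm0, hmb⟩ := hmr ε ν hε0 hε hνν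
  have hβb : |β - β₀₀| ≤ b := hβ.le.trans hρ₁b
  refine ⟨⟨hb0.trans_le A.dom.le, A.dom.ge.trans_lt (by linarith), (hνr ν hνν).1,
    sub_pos.1 A.dom.waveNumber_arg⟩, fun δ Δ hδ hΔ hne => ?_⟩
  obtain ⟨t1, t2, t3, t4⟩ := r4 β ν hβ hνν δ Δ hδ hΔ
  have hΔ' : |Δ| ≤ 2 * ρ₁ := by
    have h1 := (r2 ν hνν).1
    rw [abs_lt] at h1 hβ
    rw [hΔ, abs_le]; constructor <;> linarith
  have hsmall : C * (ε + |Δ|) ≤ 1 := by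
    have := mul_le_mul_of_nonneg_left hΔ' hC0.le
    linarith [hεC ε hε]
  have hsum : 0 ≤ ε + |Δ| := by positivity
  -- Distances to the base point become distances to the curve, using `|β - β₀₀| ≤ |Δ| + Bε` and `εν
  -- ≤ Bε`.
  have hLΔ : L * (ε + ε * ν + |β - β₀₀|) ≤ L' * (ε + |Δ|) :=
    calc L * (ε + ε * ν + |β - β₀₀|) ≤ L * ((1 + 2 * B) * (ε + |Δ|)) := by
          refine mul_le_mul_of_nonneg_left ?_ (by linarith)
          linarith [mul_nonneg hB.le (abs_nonneg Δ)]
      _ = L * (1 + 2 * B) * (ε + |Δ|) := by ring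
      _ ≤ L' * (ε + |Δ|) := mul_le_mul_of_nonneg_right hLL hsum
  obtain ⟨hD, ⟨E₁, E₂, e1, e2, e3⟩, E₃, E₄, e4, e5, e6⟩ := hC ε δ Δ _ _ _ _ _ _ hε0 hsmall hne
    ((hsc.A₁_center _ β hm0.le hmb hβb).trans
      ((mul_le_mul_of_nonneg_left (by linarith) (by linarith)).trans hLΔ))
    ((hsc.A₁_le _ β hm0.le hmb hβb).trans hLL') ((hsc.A₂_le _ β hm0.le hmb hβb).trans hLL')
    ((hsc.z_le _ β hm0.le hmb hβb).trans hLL') ((hsc.w_le _ β hm0.le hmb hβb).trans hLL')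
    ((hsc.q_center _ β hm0.le hmb hβb).trans hLΔ)
    (t1.trans (mul_le_mul_of_nonneg_right hBL (by positivity)))
    (t2.trans (mul_le_mul_of_nonneg_right (mul_le_mul_of_nonneg_right hBL hsum) (abs_nonneg _)))
  obtain ⟨Ψ₀, hΨ₀⟩ := A.exists_solvesScattering rfl hm0 hD
  have hmax : C * (ε + |Δ|) ≤ max C B * (ε + |Δ|) :=
    mul_le_mul_of_nonneg_right (le_max_left _ _) hsum
  refine ⟨⟨Ψ₀, _, _, hΨ₀⟩, fun Ψ ℛ 𝒯 hΨ => ?_⟩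
  -- An arbitrary solution shares its coefficients with the constructed one, for which the closed
  -- form is available.
  obtain ⟨hr, ht⟩ := hΨ.unique hf A.dom.waveNumber_pos hΨ₀
  exact ⟨⟨E₁, E₂, e1.trans hmax, e2.trans hmax, hr.trans e3⟩,
    E₃, E₄, e4.trans hmax, e5.trans hmax, ht.trans e6⟩
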